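/- Let $n\ge 4$, let $k$ be a (commutative) field with $|k|\ge 5$ (possibly infinite), and put $\mathsf A=k[t,t^{-1}]$. Let $V$ be the $k(t)$-vector space with basis $e_1,\dots,e_n,f_1,\dots,f_n$ and let $\mathsf M$ be the free $\mathsf A$-lattice spanned by this basis. Let $\sigma$ be the automorphism of $k(t)$ that fixes $k$ pointwise and interchanges $t$ and $t^{-1}$, and let $\beta$ be the $\sigma$-sesquilinear form on $V$ ($\beta(\lambda u,\mu v)=\lambda\,\beta(u,v)\,\mu^\sigma$) whose Gram matrix with respect to this basis is $\begin{pmatrix}0&I_n\\ tI_n&0\end{pmatrix}$. For $\varepsilon=\pm$ let $\mathcal O_\varepsilon\subseteq k(t)$ be the valuation ring of the discrete valuation $v_\varepsilon$ over $k$ with $v_\varepsilon(t^{\varepsilon 1})=1$. Let $\Delta=(\Delta_+,\Delta_-,\delta_*)$ be the affine twin building of type $\widetilde A_{2n-1}$ over $I=\mathbb Z/2n$ associated with $\mathrm{SL}(\mathsf M)\cong\mathrm{SL}_{2n}(\mathsf A)$. The objects of $\Delta_\varepsilon$ are the classes $[\Lambda]=\{t^j\Lambda : j\in\mathbb Z\}$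 of full $\mathcal O_\varepsilon$-lattices $\Lambda=g\langle e_1,\dots,f_n\rangle_{\mathcal O_\varepsilon}$, $g\in\mathrm{GL}(V)$; the type of $[\Lambda]$ is $\varepsilon v_\varepsilon(\det g)\bmod 2n$; two objects are incident if the union of their classes is a chain. Chambers are the flags containing an object of every type. Two chambers are $i$-adjacent if they have the same object of type $j$ for every $j\neq i$; the $J$-residue of a chamber $c$ ($J\subseteq I$) is the set of chambers having the same objects as $c$ of all types outside $J$, and its rank is $|J|$. For an $\mathsf A$-basis $a=(a_0,\dots,a_{2n-1})$ of $\mathsf M$, extended by $a_{m+2n}=ta_m$ to all $m\in\mathbb Z$, let $c_\varepsilon(a)$ consist of the classes of the lattices $\langle a_l,a_{l+1},\dots,a_{l+2n-1}\rangle_{\mathcal O_\varepsilon}$, $l\in \mathbb Z$ (with $a$ indexed so that the class of this lattice has type $l\bmod 2n$). Let $(W,\{s_i\}_{i\in I})$ be the Coxeter system of type $\widetilde A_{2n-1}$, realized as the affine symmetric group of permutations of $\mathbb Z$, where $s_i$ interchanges $m-1$ and $m$ for all $m\equiv i \pmod{2n}$, and let $l$ be its word length. For chambers $c\in\Delta_\varepsilon$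 and $d\in\Delta_{-\varepsilon}$ the codistance $\delta_*(c,d)\in W$ is the element $w$ such that, for some $\mathsf A$-basis $a$ of $\mathsf M$, $c=c_\varepsilon(a)$ and $d=c_{-\varepsilon}\big((a_{w(m)})_m\big)$. For an $\mathcal O_\varepsilon$-lattice $\Lambda$ put $\Lambda^\theta=\{v\in V: \beta(u,v)\in\mathcal O_\varepsilon\text{ for all }u\in\Lambda\}$, an $\mathcal O_{-\varepsilon}$-lattice. This induces bijections $\theta\colon\Delta_\varepsilon\to\Delta_{-\varepsilon}$, $c\mapsto c^\theta$, acting on types by $i\mapsto i+n \pmod{2n}$. For a residue $R$ of $\Delta_\varepsilon$ put $$A_\theta(R)=\{c\in R : l(\delta_*(c,c^\theta))\text{ is minimal among all } l(\delta_*(d,d^\theta)),\ d\in R\}.$$ **Theorem.** For $\varepsilon=\pm$ and every $J\subseteq I$ with $|J|=3$, for every $J$-residue $R$ of $\Delta_\varepsilon$ the set $A_\theta(R)$, regarded as a chamber system over $J$ with the adjacency relations of $\Delta_\varepsilon$, is connected and simply ($2$-)connected. That is, $A_\theta(R)$ is non-empty, any two of its chambers are joined by a gallery inside $A_\theta(R)$,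 and every closed gallery inside $A_\theta(R)$ can be transformed into the trivial gallery at its base chamber by finitely many elementary $2$-homotopies, each of which replaces a subgallery lying in a rank $2$ residue of $A_\theta(R)$ by another gallery in this residue with the same first and last chambers. -/

import Mathlib

open scoped Matrix

noncomputable section

/-! ## Chamber systems: galleries, connectedness, simple 2-connectedness -/

namespace ChamberSystem

variable {C I : Type*}

/-- A gallery of the chamber system on the set `A` of chambers, with types in `K`: a finite
sequence of chambers of `A` in which consecutive chambers are `i`-adjacent for some `i ∈ K`. -/
def IsGallery (adj : I → C → C → Prop) (A : Set C) (K : Set I) (γ : List C) : Prop :=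
  (∀ c ∈ γ, c ∈ A) ∧ γ.IsChain (fun c d => ∃ i ∈ K, adj i c d)

/-- The gallery `γ` starts at `c` and ends at `d`. -/
def Joins (γ : List C) (c d : C) : Prop :=
  γ.head? = some c ∧ γ.getLast? = some d

/-- A chamber system over `J` on the set `A` is connected: it is non-empty and any two chambers
are joined by a gallery inside `A`. -/
def IsConnected (adj : I → C → C → Prop) (A : Set C) (J : Set I) : Prop :=
  A.Nonempty ∧ ∀ c ∈ A, ∀ d ∈ A, ∃ γ, IsGallery adj A J γ ∧ Joins γ c d

/-- Elementary 2-homotopy: a subgallery inside a rank 2 residue (of type `{i, j}`) of `A` is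
replaced by another gallery inside that residue with the same first and last chamber. -/
def ElementaryHomotopy (adj : I → C → C → Prop) (A : Set C) (J : Set I)
    (γ γ' : List C) : Prop :=
  ∃ i ∈ J, ∃ j ∈ J, i ≠ j ∧ ∃ (c d : C) (γ₁ γ₀ γ₀' γ₂ : List C),
    IsGallery adj A {i, j} γ₀ ∧ IsGallery adj A {i, j} γ₀' ∧
    Joins γ₀ c d ∧ Joins γ₀' c d ∧
    γ = γ₁ ++ γ₀ ++ γ₂ ∧ γ' = γ₁ ++ γ₀' ++ γ₂

/-- 2-homotopy of galleries: the equivalence relation generated by elementary 2-homotopies. -/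
def Homotopic (adj : I → C → C → Prop) (A : Set C) (J : Set I) : List C → List C → Prop :=
  Relation.EqvGen (ElementaryHomotopy adj A J)

/-- Triviality of all fundamental groups of the chamber system on `A` over `J`: every closed
gallery is 2-homotopic to the trivial gallery at its base chamber. -/
def IsSimplyConnected (adj : I → C → C → Prop) (A : Set C) (J : Set I) : Prop :=
  ∀ (c : C) (γ : List C), IsGallery adj A J γ → Joins γ c c → Homotopic adj A J γ [c]

end ChamberSystem

/-! ## The affine twin building of `SL_{2n}(k[t, t⁻¹])` and the map `θ` -/

namespace AffineTwin

/-- The two halves of a twin building. -/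
inductive Side
  | plus
  | minus

/-- The other half. -/
def Side.flip : Side → Side
  | .plus => .minus
  | .minus => .plus

variable (k : Type*) [Field k] (n : ℕ)

/-- The indeterminate `t` of the field `k(t)`. -/
abbrev t : RatFunc k := RatFunc.X

/-- The automorphism `σ` of `k(t)` that fixes `k` pointwise and sends `t` to `t⁻¹`. -/
def sigma : RatFunc k →ₐ[k] RatFunc k :=
  RatFunc.liftAlgHom (Polynomial.aeval (RatFunc.X : RatFunc k)⁻¹) (by
    have h : Transcendental k (RatFunc.X : RatFunc k)⁻¹ := by
      rw [Transcendental, IsAlgebraic.inv_iff]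
      exact RatFunc.transcendental_X
    intro p hp
    refine mem_nonZeroDivisors_of_ne_zero fun h0 => nonZeroDivisors.ne_zero hp ?_
    exact (transcendental_iff.mp h) p h0)

theorem sigma_X : sigma k (RatFunc.X : RatFunc k) = (RatFunc.X : RatFunc k)⁻¹ := by
  have h := RatFunc.liftAlgHom_apply_div (L := RatFunc k) (S := k)
    (Polynomial.aeval (RatFunc.X : RatFunc k)⁻¹) (by
      intro p hp
      refine mem_nonZeroDivisors_of_ne_zero fun h0 => nonZeroDivisors.ne_zero hp ?_
      have h : Transcendental k (RatFunc.X : RatFunc k)⁻¹ := by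
        rw [Transcendental, IsAlgebraic.inv_iff]
        exact RatFunc.transcendental_X
      exact (transcendental_iff.mp h) p h0) Polynomial.X 1
  simpa [sigma] using h

theorem sigma_sigma (x : RatFunc k) : sigma k (sigma k x) = x := by
  have key : ∀ p : Polynomial k,
      sigma k (sigma k (algebraMap _ (RatFunc k) p)) = algebraMap _ (RatFunc k) p := by
    intro p
    have h : ((sigma k).comp (sigma k)).comp
        (Polynomial.aeval (RatFunc.X : RatFunc k)) = Polynomial.aeval (RatFunc.X : RatFunc k) := by
      apply Polynomial.algHom_ext
      simp [sigma_X]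
    have h2 := DFunLike.congr_fun h p
    simpa [RatFunc.aeval_X_left_eq_algebraMap] using h2
  induction x using RatFunc.induction_on with
  | f p q hq => rw [map_div₀, map_div₀, key, key]

/-- The valuations `v_ε` of `k(t)` over `k` (written multiplicatively) with uniformizer `t` for
`ε = +` and `t⁻¹` for `ε = -`. -/
def val : Side → Valuation (RatFunc k) (WithZero (Multiplicative ℤ))
  | .plus => (Polynomial.idealX k).valuation (RatFunc k)
  | .minus => ((Polynomial.idealX k).valuation (RatFunc k)).comap (sigma k).toRingHom

theorem val_sigma (ε : Side) (x : RatFunc k) : val k ε (sigma k x) = val k ε.flip x := by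
  cases ε
  · rfl
  · exact congrArg ((Polynomial.idealX k).valuation (RatFunc k)) (sigma_sigma k x)

/-- The valuation ring `O_ε` of `v_ε` in `k(t)`. -/
abbrev O (ε : Side) : Subring (RatFunc k) := (val k ε).integer

/-- The ring `k[t, t⁻¹]` of Laurent polynomials, as a subring of `k(t)`. -/
abbrev Laurent : Subalgebra k (RatFunc k) := Algebra.adjoin k {t k, (t k)⁻¹}

/-- The `2n`-dimensional space `V` over `k(t)`. The first `n` coordinates belong to the basis
vectors `e₁, …, eₙ` and the last `n` coordinates to `f₁, …, fₙ`. -/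
abbrev V : Type _ := Fin n ⊕ Fin n → RatFunc k

/-- The Gram matrix of `β` with respect to `e₁, …, eₙ, f₁, …, fₙ`. -/
def gram : Matrix (Fin n ⊕ Fin n) (Fin n ⊕ Fin n) (RatFunc k) :=
  Matrix.fromBlocks 0 1 (t k • 1) 0

variable {k n}

/-- The `σ`-sesquilinear form `β`, linear in the first and `σ`-linear in the second argument. -/
def beta (u v : V k n) : RatFunc k :=
  u ⬝ᵥ (gram k n *ᵥ fun i => sigma k (v i))

theorem beta_add (u v w : V k n) : beta u (v + w) = beta u v + beta u w := by
  have : (fun i => sigma k ((v + w) i)) = (fun i => sigma k (v i)) + fun i => sigma k (w i) := by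
    funext i; simp
  rw [beta, this, Matrix.mulVec_add, dotProduct_add]; rfl

theorem beta_smul (x : RatFunc k) (u v : V k n) : beta u (x • v) = sigma k x * beta u v := by
  have : (fun i => sigma k ((x • v) i)) = sigma k x • fun i => sigma k (v i) := by
    funext i; simp
  rw [beta, this, Matrix.mulVec_smul, dotProduct_smul]; rfl

variable (k n)

/-- The free `k[t, t⁻¹]`-lattice `M` spanned by the standard basis of `V`. -/
def M : Submodule (Laurent k) (V k n) :=
  Submodule.span (Laurent k) (Set.range fun i => (Pi.single i 1 : V k n))

variable {k n}

/-- `a` is a `k[t, t⁻¹]`-basis `a 0, …, a (2n - 1)` of `M`, extended to all integer indices by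
`a (m + 2n) = t • a m`. -/
def IsFrame (a : ℤ → V k n) : Prop :=
  (∀ m, a (m + 2 * n) = t k • a m) ∧
  LinearIndependent (Laurent k) (fun i : Fin (2 * n) => a i) ∧
  Submodule.span (Laurent k) (Set.range fun i : Fin (2 * n) => a i) = M k n

/-- `Λ` is an `O_ε`-lattice of full rank in `V` of degree `l`: it is spanned over `O_ε` by the
vectors of a `k(t)`-basis of `V` whose determinant has the same `v_ε`-value as `t ^ l`. The type
of the homothety class `[Λ]` is the residue class of `l` modulo `2n`. -/
def HasDegree (ε : Side) (Λ : Submodule (O k ε) (V k n)) (l : ℤ) : Prop :=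
  ∃ b : Fin n ⊕ Fin n → V k n,
    Λ = Submodule.span (O k ε) (Set.range b) ∧
    val k ε (Matrix.of b).det = val k ε (t k ^ l)

/-- A family of `O_ε`-modules indexed by the integers. -/
abbrev Chain (k : Type*) [Field k] (n : ℕ) (ε : Side) : Type _ := ℤ → Submodule (O k ε) (V k n)

/-- The chambers of `Δ_ε`, i.e. the maximal flags of homothety classes of lattices. A chamber
consists of one class `[Λ]` of each type in `ℤ/2n`, and all the lattices in these classes form
a chain; we index this chain by the degree of the lattices. -/
def IsChamber {ε : Side} (c : Chain k n ε) : Prop :=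
  (∀ l, HasDegree ε (c l) l) ∧
  (∀ l v, v ∈ c l ↔ t k • v ∈ c (l + 2 * n)) ∧
  (match ε with
    | .plus => ∀ l, c (l + 1) ≤ c l
    | .minus => ∀ l, c l ≤ c (l + 1))

/-- `i`-adjacency of chambers: the objects of every type different from `i` are the same. -/
def Adj {ε : Side} (i : ZMod (2 * n)) (c d : Chain k n ε) : Prop :=
  ∀ l : ℤ, (l : ZMod (2 * n)) ≠ i → c l = d l

/-- The `J`-residue of the chamber `c`: all chambers that have the same objects as `c` of every
type outside `J`. -/
def residue {ε : Side} (J : Set (ZMod (2 * n))) (c : Chain k n ε) : Set (Chain k n ε) :=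
  {d | IsChamber d ∧ ∀ l : ℤ, (l : ZMod (2 * n)) ∉ J → d l = c l}

/-- The chamber `c_ε(a)` given by a `k[t, t⁻¹]`-basis `a`; its `l`-th lattice is
`⟨t a_0, …, t a_{l-1}, a_l, …, a_{2n-1}⟩` over `O_ε` for `0 ≤ l < 2n`. -/
def frameChamber (ε : Side) (a : ℤ → V k n) : Chain k n ε :=
  fun l => Submodule.span (O k ε) (a '' Set.Ico l (l + 2 * n))

/-! ### The Weyl group and the codistance -/

variable (n) in
/-- The underlying function of the affine reflection `s_i`: it interchanges `m - 1` and `m` for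
all `m ≡ i` modulo `2n`. -/
def reflectionFun (i : ZMod (2 * n)) (m : ℤ) : ℤ :=
  if (m : ZMod (2 * n)) = i then m - 1
  else if ((m + 1 : ℤ) : ZMod (2 * n)) = i then m + 1 else m

variable (n) in
theorem reflectionFun_involutive (i : ZMod (2 * n)) :
    Function.Involutive (reflectionFun n i) := by
  have h1 : (1 : ZMod (2 * n)) ≠ 0 := by
    intro h
    have h2 : ((1 : ℕ) : ZMod (2 * n)) = 0 := by simpa using h
    have h3 := (ZMod.natCast_eq_zero_iff 1 (2 * n)).mp h2
    have h4 := Nat.dvd_one.mp h3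
    omega
  intro m
  unfold reflectionFun
  by_cases ha : (m : ZMod (2 * n)) = i
  · have hb : ¬ (((m - 1 : ℤ) : ZMod (2 * n)) = i) := by
      intro hb
      apply h1
      push_cast at hb
      rw [ha] at hb
      simpa using hb
    simp only [if_pos ha, if_neg hb]
    simp [ha]
  · by_cases hb : ((m + 1 : ℤ) : ZMod (2 * n)) = i
    · simp only [if_neg ha, if_pos hb]
      simp
    · simp only [if_neg ha, if_neg hb]

variable (n) in
/-- The generators `s_i` of the Weyl group. -/
def s (i : ZMod (2 * n)) : Equiv.Perm ℤ := (reflectionFun_involutive n i).toPerm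

variable (n) in
/-- The Weyl group `W`: the Coxeter group of type affine `A_{2n-1}`, realized as the affine
symmetric group. -/
def W : Subgroup (Equiv.Perm ℤ) := Subgroup.closure (Set.range (s n))

/-- The length of `w ∈ W`: the minimal number of generators in a word for `w`. -/
def length (w : W n) : ℕ :=
  sInf {r | ∃ L : List (ZMod (2 * n)), L.length = r ∧ (L.map (s n)).prod = (w : Equiv.Perm ℤ)}

/-- The relation `δ_*(c, d) = w` for chambers `c` and `d` in different halves of the twin
building: in a twin apartment, given by a basis `a`, that contains `c` and `d`, the chamber `c`
is `c_ε(a)` and `d` is the translate by `w` of the chamber `c_{-ε}(a)`, which is opposite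
to `c`. -/
def Codistance {ε : Side} (c : Chain k n ε) (d : Chain k n ε.flip) (w : W n) : Prop :=
  ∃ a : ℤ → V k n, IsFrame a ∧ c = frameChamber ε a ∧
    d = frameChamber ε.flip (fun m => a ((w : Equiv.Perm ℤ) m))

/-! ### The map `θ` and the geometries `A_θ(R)` -/

/-- The dual lattice `Λ^θ = {v | β(u, v) ∈ O_ε for all u ∈ Λ}` of an `O_ε`-lattice `Λ`. -/
def dual {ε : Side} (Λ : Submodule (O k ε) (V k n)) : Submodule (O k ε.flip) (V k n) where
  carrier := {v | ∀ u ∈ Λ, beta u v ∈ O k ε}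
  zero_mem' := by
    intro u _
    have : beta u (0 : V k n) = 0 := by simpa using beta_smul (0 : RatFunc k) u 0
    rw [this]
    exact zero_mem _
  add_mem' := by
    intro v w hv hw u hu
    rw [beta_add]
    exact add_mem (hv u hu) (hw u hu)
  smul_mem' := by
    intro x v hv u hu
    have h : beta u (x • v) = sigma k (x : RatFunc k) * beta u v := beta_smul _ u v
    rw [h]
    refine mul_mem ?_ (hv u hu)
    rw [Valuation.mem_integer_iff, val_sigma]
    exact x.2

/-- The image `c^θ` of a chamber: the chain of the lattices dual to those of `c`. Dualizing
raises degrees by `n`. -/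
def theta {ε : Side} (c : Chain k n ε) : Chain k n ε.flip :=
  fun l => dual (c (l - n))

/-- `A_θ(R)`: the chambers `c` of `R` for which the length of `δ_*(c, c^θ)` is minimal among
all chambers of `R`. -/
def A {ε : Side} (R : Set (Chain k n ε)) : Set (Chain k n ε) :=
  {c | c ∈ R ∧ ∃ w, Codistance c (theta c) w ∧
    ∀ d ∈ R, ∀ w', Codistance d (theta d) w' → length w ≤ length w'}

end AffineTwin

end

/-! Intersecting the lattices of a chamber c of Δ_ε with the vectors of Laurent polynomials gives a
complete decreasing filtration F over k of E = k[t,t⁻¹]^{2n}, periodic under multiplication T by a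
power t^{±1} (`chamberFilt`). One coefficient of β is a k-bilinear form b with b(u,v) = b(v,Tu), and
c^θ becomes the orthogonal filtration (`IsChamber.mem_perp`). A basis of E adapted to both
filtrations (`TwistedForm.Filt.exists_frame`) yields a permutation j of ℤ, their relative position.
It satisfies j(j(m)) = m - 2n (`TwistedForm.Frame.isTwist`), and the length of δ_*(c,c^θ) is the
number of its inversions modulo translation by 2n.

If j has a descent at i, some i-neighbour has position s_i j s_i, with fewer inversions
(`TwistedForm.Frame.descent`, `IsTwist.inv_conj_lt`). A position without descents at the types of J
is determined by the dimensions of F_f ∩ (F_g)^⊥ for f, g outside J, and these are constant on a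
J-residue. So A_θ(R) consists of the chambers whose position has no descents in J, and all of them
have the same j (`TwistedForm.Frame.minimal_iff`, `TwistedForm.Agree.position_eq`).

A type t in J is linked if j maps the pair t-1, t to a consecutive pair whose type again lies in J.
Linked types come in nonadjacent pairs. Hence J = {h, i, i'} with h not linked, i and i' not
adjacent, and i, i' either both not linked or linked to each other. With respect to a frame of one
member, the chambers of A_θ(R) have coordinates (S,x,y): a matrix S with at most two rows and
columns for the object of type h, and points x, y of the projective line for those of types i, i'.
The only condition is B(x,y) ≠ 0 for a certain nonzero bilinear form B on k²
(`TwistedForm.exists_isCoord`). Type i changes x, type i' changes y, and type h adds to S a matrix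
whose columns are proportional to x (if there are two rows) and whose rows are orthogonal to y (if
there are two columns).

Connectedness holds because these matrices generate the whole group (`generates_colSub_rowSub`). For
simple connectedness it is enough that every cocycle which is a coboundary on the rank 2 residues is
a coboundary (`isSimplyConnected_of_cocycles`). In coordinates this becomes a gluing problem for
homomorphisms on groups of matrices (`extends_colSub_rowSub`). It is easy if S has a single row or
column. For two by two matrices one has to show that the images of x₁⊗z and x₂⊗z' commute; this
comes from expanding (x₁+x₂)⊗(z₁+z₂) in two orders, and |k| ≥ 5 provides enough admissible vectors.
-/

namespace ChamberSystem

-- Galleries up to homotopy, and cocycles.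

universe u v
variable {C : Type u} {I : Type v} {adj : I → C → C → Prop} {A : Set C} {J K : Set I}

/-- `γ` is a gallery with types in `K` from `c` to `d`. -/
def IsPath (adj : I → C → C → Prop) (A : Set C) (K : Set I) (c d : C) (γ : List C) : Prop :=
  IsGallery adj A K γ ∧ Joins γ c d

theorem IsPath.append {c d d' f : C} {γ γ' : List C} (h : IsPath adj A K c d γ)
    (h' : IsPath adj A K d' f γ') (hd : ∃ i ∈ K, adj i d d') : IsPath adj A K c f (γ ++ γ') := by
  obtain ⟨⟨h1, h2⟩, h3, h4⟩ := h
  obtain ⟨⟨h1', h2'⟩, h3', h4'⟩ := h'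
  refine ⟨⟨?_, ?_⟩, ?_, ?_⟩
  · intro x hx
    rcases List.mem_append.1 hx with hx | hx
    exacts [h1 x hx, h1' x hx]
  · rw [List.isChain_append]
    refine ⟨h2, h2', ?_⟩
    intro x hx y hy
    rw [h4] at hx
    rw [h3'] at hy
    simp only [Option.mem_def, Option.some.injEq] at hx hy
    subst hx; subst hy; exact hd
  · simp [List.head?_append, h3]
  · simp [List.getLast?_append, h4']

theorem IsPath.reverse (hsymm : ∀ i c d, adj i c d → adj i d c) {c d : C} {γ : List C}
    (h : IsPath adj A K c d γ) : IsPath adj A K d c γ.reverse := by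
  obtain ⟨⟨h1, h2⟩, h3, h4⟩ := h
  refine ⟨⟨fun x hx => h1 x (List.mem_reverse.1 hx), ?_⟩, ?_, ?_⟩
  · rw [List.isChain_reverse]
    exact h2.imp fun a b ⟨i, hi, hab⟩ => ⟨i, hi, hsymm _ _ _ hab⟩
  · simp [List.head?_reverse, h4]
  · simp [List.getLast?_reverse, h3]

theorem IsPath.mono {K' : Set I} (hK : K ⊆ K') {c d : C} {γ : List C}
    (h : IsPath adj A K c d γ) : IsPath adj A K' c d γ :=
  ⟨⟨h.1.1, h.1.2.imp fun _ _ ⟨i, hi, hab⟩ => ⟨i, hK hi, hab⟩⟩, h.2⟩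

theorem isPath_singleton {c : C} (hc : c ∈ A) : IsPath adj A K c c [c] := by
  refine ⟨⟨by simpa using hc, List.isChain_singleton _⟩, by simp [Joins]⟩

theorem isPath_pair {c d : C} (hc : c ∈ A) (hd : d ∈ A) (h : ∃ i ∈ K, adj i c d) :
    IsPath adj A K c d [c, d] := (isPath_singleton hc).append (isPath_singleton hd) h

theorem IsPath.left_mem {c d : C} {γ : List C} (h : IsPath adj A K c d γ) : c ∈ A :=
  h.1.1 _ (List.mem_of_head? h.2.1)

theorem IsPath.right_mem {c d : C} {γ : List C} (h : IsPath adj A K c d γ) : d ∈ A :=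
  h.1.1 _ (List.mem_of_getLast? h.2.2)

theorem IsPath.exists_cons {c d : C} {γ : List C} (h : IsPath adj A K c d γ) :
    ∃ t, γ = c :: t := by
  obtain ⟨-, h3, -⟩ := h
  cases γ with
  | nil => simp at h3
  | cons x t => simp at h3; exact ⟨t, by rw [h3]⟩

theorem IsPath.exists_concat {c d : C} {γ : List C} (h : IsPath adj A K c d γ) :
    ∃ t, γ = t ++ [d] := by
  obtain ⟨-, -, h4⟩ := h
  exact (List.getLast?_eq_some_iff).1 h4

theorem Homotopic.context {γ γ' : List C} (h : Homotopic adj A J γ γ') (l r : List C) :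
    Homotopic adj A J (l ++ γ ++ r) (l ++ γ' ++ r) := by
  induction h with
  | rel x y h =>
    obtain ⟨i, hi, j, hj, hij, c, d, g1, g0, g0', g2, h1, h2, h3, h4, rfl, rfl⟩ := h
    exact .rel _ _ ⟨i, hi, j, hj, hij, c, d, l ++ g1, g0, g0', g2 ++ r, h1, h2, h3, h4,
      by simp, by simp⟩
  | refl x => exact .refl _
  | symm x y _ ih => exact .symm _ _ ih
  | trans x y z _ _ ih1 ih2 => exact .trans _ _ _ ih1 ih2

theorem Homotopic.trans {γ₁ γ₂ γ₃ : List C} (h : Homotopic adj A J γ₁ γ₂)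
    (h' : Homotopic adj A J γ₂ γ₃) : Homotopic adj A J γ₁ γ₃ := Relation.EqvGen.trans _ _ _ h h'

theorem Homotopic.symm {γ₁ γ₂ : List C} (h : Homotopic adj A J γ₁ γ₂) :
    Homotopic adj A J γ₂ γ₁ := Relation.EqvGen.symm _ _ h

theorem Homotopic.left {γ γ' : List C} (h : Homotopic adj A J γ γ') (l : List C) :
    Homotopic adj A J (l ++ γ) (l ++ γ') := by simpa using h.context l []

theorem Homotopic.right {γ γ' : List C} (h : Homotopic adj A J γ γ') (r : List C) :
    Homotopic adj A J (γ ++ r) (γ' ++ r) := by simpa using h.context [] r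

theorem homotopic_of_isPath {i j : I} (hi : i ∈ J) (hj : j ∈ J) (hij : i ≠ j) {c d : C}
    {γ γ' : List C} (h : IsPath adj A {i, j} c d γ) (h' : IsPath adj A {i, j} c d γ') :
    Homotopic adj A J γ γ' :=
  .rel _ _ ⟨i, hi, j, hj, hij, c, d, [], γ, γ', [], h.1, h'.1, h.2, h'.2, by simp, by simp⟩

section Loops

variable (hrefl : ∀ i c, adj i c c) (hsymm : ∀ i c d, adj i c d → adj i d c)
  (hJ : ∀ i ∈ J, ∃ j ∈ J, i ≠ j) (hne : J.Nonempty)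
include hrefl hsymm hJ hne

omit hsymm in
theorem homotopic_dup {c : C} (hc : c ∈ A) : Homotopic adj A J [c, c] [c] := by
  obtain ⟨i, hi⟩ := hne
  obtain ⟨j, hj, hij⟩ := hJ i hi
  exact homotopic_of_isPath hi hj hij (isPath_pair hc hc ⟨i, by simp, hrefl _ _⟩)
    (isPath_singleton hc)

omit hsymm in
theorem IsPath.homotopic_cons {c d : C} {γ : List C} (h : IsPath adj A K c d γ) :
    Homotopic adj A J (c :: γ) γ := by
  obtain ⟨t, rfl⟩ := h.exists_cons
  exact (homotopic_dup hrefl hJ hne h.left_mem).right t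

omit hsymm in
theorem IsPath.homotopic_concat {c d : C} {γ : List C} (h : IsPath adj A K c d γ) :
    Homotopic adj A J (γ ++ [d]) γ := by
  obtain ⟨t, rfl⟩ := h.exists_concat
  simpa using (homotopic_dup hrefl hJ hne h.right_mem).left t

/-- Cancellation starts in the middle: the gallery y, x, x, y formed by the first chamber x and its
neighbour y lies in one rank 2 residue and shrinks to y, y. Since an elementary homotopy needs two
different types, `hJ` supplies a second one. -/
theorem IsPath.homotopic_reverse_append {c d : C} {γ : List C} (h : IsPath adj A J c d γ) :
    Homotopic adj A J (γ.reverse ++ γ) [d] := by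
  induction γ generalizing c with
  | nil => simp [IsPath, Joins] at h
  | cons x t ih =>
    obtain ⟨t', ht'⟩ := h.exists_cons
    obtain rfl : x = c := by simp at ht'; exact ht'.1
    cases t with
    | nil =>
      have : d = x := by have := h.2.2; simpa using this.symm
      subst this
      simpa using homotopic_dup hrefl hJ hne h.left_mem
    | cons y s =>
      have hp : IsPath adj A J y d (y :: s) := by
        obtain ⟨⟨h1, h2⟩, h3, h4⟩ := h
        refine ⟨⟨fun z hz => h1 z (List.mem_cons_of_mem _ hz), ?_⟩, rfl, ?_⟩
        · exact (List.isChain_cons_cons.1 h2).2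
        · simpa [List.getLast?_cons_cons] using h4
      have hxy := (List.isChain_cons_cons.1 h.1.2).1
      obtain ⟨i, hi, hxy⟩ := hxy
      obtain ⟨j, hj, hij⟩ := hJ i hi
      have hx := h.left_mem
      have hy := hp.left_mem
      have e : Homotopic adj A J [y, x, x, y] [y, y] := by
        apply homotopic_of_isPath hi hj hij (c := y) (d := y)
        · exact (isPath_pair hy hx ⟨i, by simp, hsymm _ _ _ hxy⟩).append
            (isPath_pair hx hy ⟨i, by simp, hxy⟩) ⟨i, by simp, hrefl _ _⟩
        · exact isPath_pair hy hy ⟨i, by simp, hrefl _ _⟩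
      have e2 := e.context s.reverse s
      refine Homotopic.trans ?_ (ih hp)
      simpa using e2

theorem IsPath.homotopic_append_reverse {c d : C} {γ : List C} (h : IsPath adj A J c d γ) :
    Homotopic adj A J (γ ++ γ.reverse) [c] := by
  simpa using (h.reverse hsymm).homotopic_reverse_append hrefl hsymm hJ hne

end Loops

/-- Closed galleries at `c`. -/
abbrev Loop (adj : I → C → C → Prop) (A : Set C) (J : Set I) (c : C) : Type u :=
  {γ : List C // IsPath adj A J c c γ}

/-- Closed galleries up to homotopy. -/
def loopSetoid (adj : I → C → C → Prop) (A : Set C) (J : Set I) (c : C) :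
    Setoid (Loop adj A J c) where
  r γ γ' := Homotopic adj A J γ γ'
  iseqv := ⟨fun _ => .refl _, fun h => h.symm, fun h h' => h.trans h'⟩

/-- The fundamental group. -/
def FundamentalGroup (adj : I → C → C → Prop) (A : Set C) (J : Set I) (c : C) : Type u :=
  Quotient (loopSetoid adj A J c)

/-- The group structure on the homotopy classes of closed galleries. -/
@[reducible]
noncomputable def fundamentalGroupGroup (hrefl : ∀ i c, adj i c c)
    (hsymm : ∀ i c d, adj i c d → adj i d c)
    (hJ : ∀ i ∈ J, ∃ j ∈ J, i ≠ j) (hne : J.Nonempty) (c : C) (hc : c ∈ A) :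
    Group (FundamentalGroup adj A J c) :=
  letI : Mul (FundamentalGroup adj A J c) :=
    ⟨Quotient.map₂ (fun γ γ' => ⟨γ.1 ++ γ'.1, γ.2.append γ'.2
      ⟨hne.some, hne.some_mem, hrefl _ _⟩⟩) (fun γ₁ γ₂ h γ₁' γ₂' h' =>
 Homotopic.trans (Homotopic.right h _) (Homotopic.left h' _))⟩
  letI : Inv (FundamentalGroup adj A J c) :=
    ⟨Quotient.map (fun γ => ⟨γ.1.reverse, γ.2.reverse hsymm⟩) (fun γ γ' h => by
      have h1 := γ.2.homotopic_reverse_append hrefl hsymm hJ hne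
      have h2 := γ'.2.homotopic_append_reverse hrefl hsymm hJ hne
      have h3 := (γ.2.reverse hsymm).homotopic_concat hrefl hJ hne
      have h4 := (γ'.2.reverse hsymm).homotopic_cons hrefl hJ hne
      change Homotopic adj A J γ.1.reverse γ'.1.reverse
      change Homotopic adj A J γ.1 γ'.1 at h
      -- The chain is γ⁻¹ ~ γ⁻¹γ'γ'⁻¹ ~ γ⁻¹γγ'⁻¹ ~ γ'⁻¹.
      refine Homotopic.trans (Homotopic.symm h3) (Homotopic.trans (Homotopic.symm (h2.left _)) ?_)
      rw [← List.append_assoc]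
      refine  Homotopic.trans ((Homotopic.symm h |>.left _).right _) ?_
      exact  Homotopic.trans (h1.right _) h4)⟩
  letI : One (FundamentalGroup adj A J c) := ⟨⟦⟨[c], isPath_singleton hc⟩⟧⟩
  Group.ofLeftAxioms
    (by
      rintro ⟨a⟩ ⟨b⟩ ⟨d⟩
      apply Quotient.sound
      change Homotopic adj A J _ _
      simp only [List.append_assoc]
      exact .refl _)
    (by
      rintro ⟨a⟩
      apply Quotient.sound
      exact a.2.homotopic_cons hrefl hJ hne)
    (by
      rintro ⟨a⟩
      apply Quotient.sound
      exact a.2.homotopic_reverse_append hrefl hsymm hJ hne)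

open Classical in
/-- If every cocycle that is trivial on the rank 2 residues is trivial, the chamber system is
simply connected. -/
theorem isSimplyConnected_of_cocycles (hrefl : ∀ i c, adj i c c)
    (hsymm : ∀ i c d, adj i c d → adj i d c)
    (hJ : ∀ i ∈ J, ∃ j ∈ J, i ≠ j) (hne : J.Nonempty) (hconn : IsConnected adj A J)
    (h : ∀ (Γ : Type u) [Group Γ] (e : C → C → Γ),
      (∀ i ∈ J, ∀ j ∈ J, i ≠ j → ∃ f : C → Γ, ∀ c ∈ A, ∀ d ∈ A, (adj i c d ∨ adj j c d) →
        e c d = (f c)⁻¹ * f d) →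
      ∃ f : C → Γ, ∀ i ∈ J, ∀ c ∈ A, ∀ d ∈ A, adj i c d → e c d = (f c)⁻¹ * f d) :
    IsSimplyConnected adj A J := by
  obtain ⟨⟨c₀, hc₀⟩, hconn⟩ := hconn
  let _ : Group (FundamentalGroup adj A J c₀) :=
    fundamentalGroupGroup hrefl hsymm hJ hne c₀ hc₀
  have hJr : ∀ c, ∃ i ∈ J, adj i c c := fun c => ⟨hne.some, hne.some_mem, hrefl _ _⟩
  -- The value 1 on lists that are not closed galleries at `c₀` only makes `cls` total.
  let cls : List C → FundamentalGroup adj A J c₀ := fun γ =>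
    if hγ : IsPath adj A J c₀ c₀ γ then ⟦⟨γ, hγ⟩⟧ else 1
  have cls_eq : ∀ {γ} (hγ : IsPath adj A J c₀ c₀ γ), cls γ = ⟦⟨γ, hγ⟩⟧ := fun hγ => dif_pos hγ
  have cls_mul : ∀ {γ γ'}, IsPath adj A J c₀ c₀ γ → IsPath adj A J c₀ c₀ γ' →
      cls γ * cls γ' = cls (γ ++ γ') := by
    intro γ γ' h h'
    rw [cls_eq h, cls_eq h', cls_eq (h.append h' (hJr _))]
    rfl
  have cls_of : ∀ {γ γ'}, IsPath adj A J c₀ c₀ γ → IsPath adj A J c₀ c₀ γ' →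
      Homotopic adj A J γ γ' → cls γ = cls γ' := by
    intro γ γ' h h' hh
    rw [cls_eq h, cls_eq h']
    exact Quotient.sound hh
  have cls_one : cls [c₀] = 1 := cls_eq (isPath_singleton hc₀)
  have hP : ∀ c : C, ∃ γ, c ∈ A → IsPath adj A J c₀ c γ := by
    intro c
    by_cases hc : c ∈ A
    · obtain ⟨γ, h1, h2⟩ := hconn c₀ hc₀ c hc
      exact ⟨γ, fun _ => ⟨h1, h2⟩⟩
    · exact ⟨[], fun h => absurd h hc⟩
  choose P hP using hP
  have hPr : ∀ c ∈ A, IsPath adj A J c c₀ (P c).reverse := fun c hc => (hP c hc).reverse hsymm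
  -- loops through the chosen paths
  have L : ∀ {c d γ}, IsPath adj A J c d γ →
      IsPath adj A J c₀ c₀ (P c ++ γ ++ (P d).reverse) := fun {c d γ} h =>
    ((hP c h.left_mem).append h (hJr _)).append (hPr d h.right_mem) (hJr _)
  have cancel : ∀ (c) (_ : c ∈ A) (l r : List C),
      Homotopic adj A J (l ++ ((P c).reverse ++ P c) ++ r) (l ++ [c] ++ r) := fun c hc l r =>
    ((hP c hc).homotopic_reverse_append hrefl hsymm hJ hne).context l r
  have cls_comp : ∀ {c d f γ γ'}, IsPath adj A J c d γ → IsPath adj A J d f γ' →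
      cls (P c ++ γ ++ (P d).reverse) * cls (P d ++ γ' ++ (P f).reverse) =
        cls (P c ++ (γ ++ γ') ++ (P f).reverse) := by
    intro c d f γ γ' h h'
    rw [cls_mul (L h) (L h')]
    refine cls_of ((L h).append (L h') (hJr _)) (L (h.append h' (hJr _))) ?_
    have e1 := cancel d h.right_mem (P c ++ γ) (γ' ++ (P f).reverse)
    have e2 := ((h'.homotopic_cons hrefl hJ hne).context (P c ++ γ) (P f).reverse)
    refine Homotopic.trans (γ₂ := (P c ++ γ ++ [d] ++ (γ' ++ (P f).reverse))) ?_ ?_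
    · simpa using e1
    · simpa using e2
  have cls_triv : ∀ c ∈ A, cls (P c ++ [c] ++ (P c).reverse) = 1 := by
    intro c hc
    rw [← cls_one]
    refine cls_of (L (isPath_singleton hc)) (isPath_singleton hc₀) ?_
    have e1 := ((hP c hc).homotopic_concat hrefl hJ hne).right (P c).reverse
    exact Homotopic.trans e1 ((hP c hc).homotopic_append_reverse hrefl hsymm hJ hne)
  have cls_hom : ∀ {c d γ γ'}, IsPath adj A J c d γ → IsPath adj A J c d γ' →
      Homotopic adj A J γ γ' →
      cls (P c ++ γ ++ (P d).reverse) = cls (P c ++ γ' ++ (P d).reverse) := fun h h' hh =>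
    cls_of (L h) (L h') (hh.context _ _)
  -- The tautological cocycle: an adjacent pair is closed up by the chosen paths. If it is a
  -- coboundary, all closed galleries are trivial.
  let e : C → C → FundamentalGroup adj A J c₀ := fun c d => cls (P c ++ [c, d] ++ (P d).reverse)
  obtain ⟨f, hf⟩ := h _ e (by
    intro i hi j hj hij
    have hsub : ({i, j} : Set I) ⊆ J := by
      rintro x (rfl | rfl)
      exacts [hi, hj]
    -- connected components of type `{i, j}`
    let S : Setoid C := ⟨fun c d => c = d ∨ ∃ γ, IsPath adj A {i, j} c d γ, by
      refine ⟨fun _ => .inl rfl, ?_, ?_⟩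
      · rintro x y (rfl | ⟨γ, h⟩)
        exacts [.inl rfl, .inr ⟨_, h.reverse hsymm⟩]
      · rintro x y z (rfl | ⟨γ, h⟩) (rfl | ⟨γ', h'⟩)
        exacts [.inl rfl, .inr ⟨_, h'⟩, .inr ⟨_, h⟩,
          .inr ⟨_, h.append h' ⟨i, by simp, hrefl _ _⟩⟩]⟩
    let rep : C → C := fun c => (Quotient.mk S c).out
    have hQ : ∀ c, ∃ γ, c ∈ A → IsPath adj A {i, j} (rep c) c γ := by
      intro c
      by_cases hc : c ∈ A
      · rcases (Quotient.exact (Quotient.out_eq (Quotient.mk S c)) : S.r _ _) with h | ⟨γ, h⟩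
        · refine ⟨[c], fun _ => ?_⟩
          have : rep c = c := h
          rw [this]; exact isPath_singleton hc
        · exact ⟨γ, fun _ => h⟩
      · exact ⟨[], fun h => absurd h hc⟩
    choose Q hQ using hQ
    -- The potential on a rank 2 residue: walk to `c` from the representative of its component,
    -- inside the component. Two such galleries with the same ends are homotopic.
    refine ⟨fun c => cls (P (rep c) ++ Q c ++ (P c).reverse), ?_⟩
    intro c hc d hd hcd
    have hcd' : IsPath adj A {i, j} c d [c, d] := isPath_pair hc hd (by
      rcases hcd with h | h
      exacts [⟨i, by simp, h⟩, ⟨j, by simp, h⟩])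
    have hrep : rep c = rep d := by
      have : Quotient.mk S c = Quotient.mk S d := Quotient.sound (.inr ⟨_, hcd'⟩)
      simp only [rep, this]
    rw [eq_inv_mul_iff_mul_eq]
    simp only [e]
    rw [cls_comp ((hQ c hc).mono hsub) (hcd'.mono hsub)]
    have hh := hQ d hd
    rw [← hrep] at hh
    have := cls_hom (((hQ c hc).append hcd' ⟨i, by simp, hrefl _ _⟩).mono hsub) (hh.mono hsub)
      (homotopic_of_isPath hi hj hij ((hQ c hc).append hcd' ⟨i, by simp, hrefl _ _⟩) hh)
    rw [this, hrep])
  -- Along a gallery the coboundary telescopes.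
  have key : ∀ (γ : List C) (c d : C), IsPath adj A J c d γ →
      cls (P c ++ γ ++ (P d).reverse) = (f c)⁻¹ * f d := by
    intro γ
    induction γ with
    | nil => intro c d h; simp [IsPath, Joins] at h
    | cons x t ih =>
      intro c d h
      obtain ⟨t', ht'⟩ := h.exists_cons
      obtain rfl : x = c := by simp at ht'; exact ht'.1
      cases t with
      | nil =>
        have : d = x := by have := h.2.2; simpa using this.symm
        subst this
        rw [cls_triv d h.left_mem]; simp
      | cons y s =>
        have hp : IsPath adj A J y d (y :: s) := by
          obtain ⟨⟨h1, h2⟩, h3, h4⟩ := h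
          refine ⟨⟨fun z hz => h1 z (List.mem_cons_of_mem _ hz), ?_⟩, rfl, ?_⟩
          · exact (List.isChain_cons_cons.1 h2).2
          · simpa [List.getLast?_cons_cons] using h4
        obtain ⟨i, hi, hxy⟩ := (List.isChain_cons_cons.1 h.1.2).1
        have hx := h.left_mem
        have hy := hp.left_mem
        have hpair : IsPath adj A J x y [x, y] := isPath_pair hx hy ⟨i, hi, hxy⟩
        have e1 := cls_comp hpair hp
        rw [ih y d hp, show cls (P x ++ [x, y] ++ (P y).reverse) = _ from hf i hi x hx y hy hxy]
          at e1
        have e2 := cls_hom (hpair.append hp (hJr _)) h (by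
          have := (hp.homotopic_cons hrefl hJ hne).left [x]
          simpa using this)
        rw [← e2, ← e1]; group
  intro c γ hγ hj
  have hp : IsPath adj A J c c γ := ⟨hγ, hj⟩
  have hc := hp.left_mem
  have h1 : cls (P c ++ γ ++ (P c).reverse) = cls (P c ++ [c] ++ (P c).reverse) := by
    rw [key γ c c hp, cls_triv c hc]; group
  rw [cls_eq (L hp), cls_eq (L (isPath_singleton hc))] at h1
  have h2 : Homotopic adj A J (P c ++ γ ++ (P c).reverse) (P c ++ [c] ++ (P c).reverse) :=
    Quotient.exact h1
  -- Conjugation by the chosen path moves the homotopy from loops at `c₀` back to loops at `c`.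
  have h3 := h2.context (P c).reverse (P c)
  have red : ∀ γ, IsPath adj A J c c γ →
      Homotopic adj A J ((P c).reverse ++ (P c ++ γ ++ (P c).reverse) ++ P c) γ := by
    intro γ hγ
    have e1 := cancel c hc [] (γ ++ ((P c).reverse ++ P c))
    have e2 := cancel c hc ([c] ++ γ) []
    refine Homotopic.trans (γ₂ := ([] ++ [c] ++ (γ ++ ((P c).reverse ++ P c)))) (by simpa using e1) ?_
    refine Homotopic.trans (γ₂ := ([c] ++ γ ++ [c] ++ [])) (by simpa using e2) ?_
    refine Homotopic.trans (γ₂ := (γ ++ [c])) ?_ (hγ.homotopic_concat hrefl hJ hne)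
    have := (hγ.homotopic_cons hrefl hJ hne).right [c]
    simpa using this
  exact ((red γ hp).symm.trans h3).trans (red _ (isPath_singleton hc))

/-- The hypothesis is applied to the property of being reachable from a fixed chamber. -/
theorem isConnected_of_locallyConstant (hA : A.Nonempty)
    (h : ∀ f : C → Prop, (∀ i ∈ J, ∀ c ∈ A, ∀ d ∈ A, adj i c d → f c → f d) →
      ∀ c ∈ A, ∀ d ∈ A, f c → f d) : IsConnected adj A J := by
  refine ⟨hA, fun c hc d hd => ?_⟩
  refine h (fun d => ∃ γ, IsPath adj A J c d γ) ?_ c hc d hd ⟨[c], isPath_singleton hc⟩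
  rintro i hi d hd d' hd' hdd ⟨γ, hγ⟩
  exact ⟨_, hγ.append (isPath_singleton hd') ⟨i, hi, hdd⟩⟩

end ChamberSystem

namespace AffineTwin

universe u

variable {k : Type u} [Field k]

/-! ### Points of the projective line -/

/-- Two vectors of `k²` are parallel. -/
def Par (x x' : k × k) : Prop := x.1 * x'.2 = x.2 * x'.1

theorem Par.symm {x x' : k × k} (h : Par x x') : Par x' x := by
  unfold Par at *; linear_combination -h

theorem Par.exists_smul {x x' : k × k} (h : Par x x') (hx : x ≠ 0) (hx' : x' ≠ 0) :
    ∃ r : k, r ≠ 0 ∧ x' = r • x := by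
  unfold Par at h
  by_cases h1 : x.1 = 0
  · have h2 : x.2 ≠ 0 := fun h2 => hx (Prod.ext h1 h2)
    have h3 : x'.1 = 0 := by
      rw [h1] at h
      have : x.2 * x'.1 = 0 := by rw [← h]; ring
      exact (mul_eq_zero.1 this).resolve_left h2
    have h4 : x'.2 ≠ 0 := fun h4 => hx' (Prod.ext h3 h4)
    refine ⟨x'.2 / x.2, div_ne_zero h4 h2, Prod.ext ?_ ?_⟩
    · simp [h1, h3]
    · simp [h2]
  · have h3 : x'.1 ≠ 0 := by
      intro h3
      rw [h3] at h
      have : x.1 * x'.2 = 0 := by rw [h]; ring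
      exact hx' (Prod.ext h3 ((mul_eq_zero.1 this).resolve_left h1))
    refine ⟨x'.1 / x.1, div_ne_zero h3 h1, Prod.ext ?_ ?_⟩
    · simp [h1]
    · simp only [Prod.smul_snd, smul_eq_mul]
      field_simp
      linear_combination h

theorem Par.trans {x y z : k × k} (h : Par x y) (h' : Par y z) (hy : y ≠ 0) : Par x z := by
  unfold Par at *
  by_cases h1 : y.1 = 0
  · have h2 : y.2 ≠ 0 := fun h2 => hy (Prod.ext h1 h2)
    apply mul_left_cancel₀ h2
    linear_combination z.2 * h + x.2 * h'
  · apply mul_left_cancel₀ h1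
    linear_combination z.1 * h + x.1 * h'

/-- A form on `k²`. -/
abbrev Form (k : Type u) [Field k] := (k × k) →ₗ[k] (k × k) →ₗ[k] k

/-- Two proper subspaces, here the kernels, cannot cover k²; this is true over every field. -/
theorem exists_apply_ne {f g : (k × k) →ₗ[k] k} (hf : f ≠ 0) (hg : g ≠ 0) :
    ∃ x, f x ≠ 0 ∧ g x ≠ 0 := by
  obtain ⟨x, hx⟩ : ∃ x, f x ≠ 0 := by
    by_contra! h; exact hf (LinearMap.ext h)
  obtain ⟨y, hy⟩ : ∃ x, g x ≠ 0 := by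
    by_contra! h; exact hg (LinearMap.ext h)
  by_cases h1 : g x = 0
  · by_cases h2 : f y = 0
    · exact ⟨x + y, by simpa [h2] using hx, by simpa [h1] using hy⟩
    · exact ⟨y, h2, hy⟩
  · exact ⟨x, hx, h1⟩

theorem Form.left_ne_zero {B : Form k} {x y : k × k} (h : B x y ≠ 0) : B x ≠ 0 := by
  rintro h0; simp [h0] at h

theorem Form.right_ne_zero {B : Form k} {x y : k × k} (h : B x y ≠ 0) : B.flip y ≠ 0 := by
  rintro h0
  have : B.flip y x = 0 := by rw [h0]; rfl
  exact h this

theorem ne_zero_of_left {B : Form k} {x y : k × k} (h : B x y ≠ 0) : x ≠ 0 := by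
  rintro rfl; simp at h

theorem ne_zero_of_right {B : Form k} {x y : k × k} (h : B x y ≠ 0) : y ≠ 0 := by
  rintro rfl; simp at h

/-! ### Coordinates for the chamber systems `A_θ(R)` -/

section Coordinates

variable {C : Type u} {I : Type*} {U : Type u} [AddCommGroup U]

/-- Coordinates `(u, x, y)`, with `u` in an abelian group `U` and `x`, `y` points of the projective
line that do not annihilate each other under the form `B`, on a chamber system of rank 3 with types
`h`, `i`, `i'`. -/
structure IsCoord {C I : Type*} {U : Type*} [AddCommGroup U]
    (adj : I → C → C → Prop) (A : Set C) (h i i' : I) (B : Form k)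
    (L R : k × k → AddSubgroup U) (pu : C → U) (px py : C → k × k) : Prop where
  form_ne : B ≠ 0
  good : ∀ c ∈ A, B (px c) (py c) ≠ 0
  surj : ∀ u x y, B x y ≠ 0 → ∃ c ∈ A, pu c = u ∧ Par (px c) x ∧ Par (py c) y
  adj_h : ∀ c ∈ A, ∀ d ∈ A, adj h c d ↔
    Par (px c) (px d) ∧ Par (py c) (py d) ∧ pu d - pu c ∈ L (px c) ∧ pu d - pu c ∈ R (py c)
  adj_i : ∀ c ∈ A, ∀ d ∈ A, adj i c d ↔ pu c = pu d ∧ Par (py c) (py d)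
  adj_i' : ∀ c ∈ A, ∀ d ∈ A, adj i' c d ↔ pu c = pu d ∧ Par (px c) (px d)
  left_par : ∀ x x', Par x x' → x ≠ 0 → x' ≠ 0 → L x = L x'
  right_par : ∀ x x', Par x x' → x ≠ 0 → x' ≠ 0 → R x = R x'

/-- `U` is generated by the intersections `L x ⊓ R y` for the pairs `(x, y)` with `B x y ≠ 0`. -/
def Generates (B : Form k) (L R : k × k → AddSubgroup U) : Prop :=
  ∀ H : AddSubgroup U, (∀ x y, B x y ≠ 0 → L x ⊓ R y ≤ H) → H = ⊤

/-- Homomorphisms of `U` that agree on the intersections `L x ⊓ R y` with `B x y ≠ 0` can be glued. -/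
def Extends (B : Form k) (L R : k × k → AddSubgroup U) : Prop :=
  ∀ (G : Type u) [Group G] (eL eR : k × k → Multiplicative U →* G),
    (∀ x y, B x y ≠ 0 → ∀ τ, τ ∈ L x → τ ∈ R y → eL x (.ofAdd τ) = eR y (.ofAdd τ)) →
    ∃ Φ : Multiplicative U →* G,
      ∀ x y, B x y ≠ 0 → ∀ τ, τ ∈ L x → τ ∈ R y → Φ (.ofAdd τ) = eL x (.ofAdd τ)

/-- The translations of `U × Γ` twisted by a function `g : U → Γ`. -/
def twistedTranslation {U Γ : Type*} [AddCommGroup U] [Group Γ] (g : U → Γ) :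
    Multiplicative U →* Equiv.Perm (U × Γ) where
  toFun τ := {
    toFun := fun p => (p.1 + τ.toAdd, p.2 * (g p.1)⁻¹ * g (p.1 + τ.toAdd))
    invFun := fun p => (p.1 - τ.toAdd, p.2 * (g p.1)⁻¹ * g (p.1 - τ.toAdd))
    left_inv := fun p => by ext <;> simp
    right_inv := fun p => by ext <;> simp }
  map_one' := by ext <;> simp
  map_mul' a b := by
    ext p
    · simp [add_comm, add_left_comm]
    · simp [add_comm, add_left_comm, mul_assoc]

theorem twistedTranslation_apply {U Γ : Type*} [AddCommGroup U] [Group Γ] (g : U → Γ) (τ : U)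
    (p : U × Γ) : twistedTranslation g (.ofAdd τ) p = (p.1 + τ, p.2 * (g p.1)⁻¹ * g (p.1 + τ)) :=
  rfl

/-- Gluing of local potentials. -/
theorem exists_potential {B : Form k} {L R : k × k → AddSubgroup U} (hG : Generates B L R)
    (hE : Extends B L R) {Γ : Type u} [Group Γ] (gL gR : k × k → U → Γ)
    (hg : ∀ x y, B x y ≠ 0 → ∀ u u', u' - u ∈ L x → u' - u ∈ R y →
      (gL x u)⁻¹ * gL x u' = (gR y u)⁻¹ * gR y u') :
    ∃ f : U → Γ, ∀ x y, B x y ≠ 0 → ∀ u u', u' - u ∈ L x → u' - u ∈ R y →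
      (f u)⁻¹ * f u' = (gL x u)⁻¹ * gL x u' := by
  -- The functions `gL x` and `gR y` are not homomorphisms, but the translations of `U × Γ` twisted
  -- by them are. Only the quotients `(g p)⁻¹ * g (p + τ)` enter, and for τ in `L x ⊓ R y` they
  -- coincide by `hg`.
  obtain ⟨Φ, hΦ⟩ := hE (Equiv.Perm (U × Γ)) (fun x => twistedTranslation (gL x))
    (fun y => twistedTranslation (gR y)) (by
      intro x y hxy τ h1 h2
      refine Equiv.ext fun p => ?_
      simp only [twistedTranslation_apply]
      rw [mul_assoc, mul_assoc, hg x y hxy p.1 (p.1 + τ) (by simpa using h1) (by simpa using h2)])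
  -- `Φ` is prescribed on the intersections only. That it lies over the translations of `U`
  -- everywhere follows because the intersections generate.
  have h1 : ∀ τ : U, ∀ p, (Φ (.ofAdd τ) p).1 = p.1 + τ := by
    let H : AddSubgroup U :=
      { carrier := {τ | ∀ p, (Φ (.ofAdd τ) p).1 = p.1 + τ}
        zero_mem' := by intro p; simp
        add_mem' := by
          intro a b ha hb p
          rw [ofAdd_add, map_mul, Equiv.Perm.mul_apply, ha, hb]; abel
        neg_mem' := by
          intro a ha p
          have := ha (Φ (.ofAdd (-a)) p)
          rw [← Equiv.Perm.mul_apply, ← map_mul, ← ofAdd_add] at this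
          simp only [add_neg_cancel, ofAdd_zero, map_one, Equiv.Perm.coe_one, id_eq] at this
          rw [this]; abel }
    have hH : H = ⊤ := hG H (by
      rintro x y hxy τ ⟨h1, h2⟩ p
      rw [hΦ x y hxy τ h1 h2]; rfl)
    intro τ
    have : τ ∈ H := by rw [hH]; trivial
    exact this
  -- The orbit of `(0, 1)` meets each fibre over `U` once and is the graph of the potential.
  refine ⟨fun u => (Φ (.ofAdd u) (0, 1)).2, ?_⟩
  intro x y hxy u u' hL hR
  have h2 : Φ (.ofAdd u') = Φ (.ofAdd (u' - u)) * Φ (.ofAdd u) := by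
    rw [← map_mul, ← ofAdd_add, sub_add_cancel]
  have h3 : Φ (.ofAdd u) (0, 1) = (u, (Φ (.ofAdd u) (0, 1)).2) :=
    Prod.ext (by simp [h1]) rfl
  have h4 : (Φ (.ofAdd u') (0, 1)).2 =
      (Φ (.ofAdd u) (0, 1)).2 * (gL x u)⁻¹ * gL x u' := by
    rw [h2, Equiv.Perm.mul_apply, h3, hΦ x y hxy _ hL hR, twistedTranslation_apply]
    simp
  change ((Φ (.ofAdd u) (0, 1)).2)⁻¹ * (Φ (.ofAdd u') (0, 1)).2 = _
  rw [h4]; group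

variable {adj : I → C → C → Prop} {A : Set C} {h i i' : I} {B : Form k}
  {L R : k × k → AddSubgroup U} {pu : C → U} {px py : C → k × k}

/-- For fixed `u` any two points x have a common partner y with `B x y ≠ 0`, so three steps of types
`i'`, `i`, `i'` suffice. The differences of `u` along which `f` is transported form a subgroup, and
`h`-adjacency puts every `L x ⊓ R y` into it. -/
theorem IsCoord.connected (hc : IsCoord adj A h i i' B L R pu px py) (hG : Generates B L R)
    (f : C → Prop) (hf : ∀ j ∈ ({h, i, i'} : Set I), ∀ c ∈ A, ∀ d ∈ A, adj j c d → f c → f d) :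
    ∀ c ∈ A, ∀ d ∈ A, f c → f d := by
  -- chambers with the same `u`
  have h1 : ∀ c ∈ A, ∀ d ∈ A, pu c = pu d → f c → f d := by
    intro c hcA d hdA hu hfc
    have hgc := hc.good c hcA
    have hgd := hc.good d hdA
    obtain ⟨y, hy1, hy2⟩ := exists_apply_ne (Form.left_ne_zero hgc) (Form.left_ne_zero hgd)
    obtain ⟨c1, hc1, hu1, hx1, hy1'⟩ := hc.surj (pu c) _ _ hy1
    obtain ⟨c2, hc2, hu2, hx2, hy2'⟩ := hc.surj (pu c) _ _ hy2
    have e1 : f c1 := hf i' (by simp) c hcA c1 hc1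
      ((hc.adj_i' c hcA c1 hc1).2 ⟨hu1.symm, hx1.symm⟩) hfc
    have e2 : f c2 := hf i (by simp) c1 hc1 c2 hc2
      ((hc.adj_i c1 hc1 c2 hc2).2 ⟨hu1.trans hu2.symm,
        hy1'.trans hy2'.symm (ne_zero_of_right hy1)⟩) e1
    exact hf i' (by simp) c2 hc2 d hdA
      ((hc.adj_i' c2 hc2 d hdA).2 ⟨hu2.trans hu, hx2⟩) e2
  let H : AddSubgroup U :=
    { carrier := {τ | (∀ c ∈ A, ∀ d ∈ A, pu d = pu c + τ → f c → f d) ∧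
        (∀ c ∈ A, ∀ d ∈ A, pu d = pu c - τ → f c → f d)}
      zero_mem' := ⟨fun c hc d hd h => h1 c hc d hd (by simp [h]),
        fun c hc d hd h => h1 c hc d hd (by simp [h])⟩
      add_mem' := by
        obtain ⟨x, hx⟩ : ∃ x, B x ≠ 0 := by
          by_contra! h; exact hc.form_ne (LinearMap.ext h)
        obtain ⟨y, hy, -⟩ := exists_apply_ne hx hx
        rintro a b ⟨ha, ha'⟩ ⟨hb, hb'⟩
        refine ⟨fun c hcA d hdA hu hfc => ?_, fun c hcA d hdA hu hfc => ?_⟩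
        · obtain ⟨c1, hc1, hu1, -⟩ := hc.surj (pu c + a) x y hy
          exact hb c1 hc1 d hdA (by rw [hu, hu1]; abel) (ha c hcA c1 hc1 hu1 hfc)
        · obtain ⟨c1, hc1, hu1, -⟩ := hc.surj (pu c - a) x y hy
          exact hb' c1 hc1 d hdA (by rw [hu, hu1]; abel) (ha' c hcA c1 hc1 hu1 hfc)
      neg_mem' := by
        rintro a ⟨ha, ha'⟩
        exact ⟨fun c hc d hd h => ha' c hc d hd (by rw [h]; abel),
          fun c hc d hd h => ha c hc d hd (by rw [h]; abel)⟩ }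
  have key : ∀ x y, B x y ≠ 0 → ∀ τ, τ ∈ L x → τ ∈ R y →
      ∀ c ∈ A, ∀ d ∈ A, pu d = pu c + τ → f c → f d := by
    intro x y hxy τ hτ hτ' c hcA d hdA hu hfc
    obtain ⟨c1, hc1, hu1, hx1, hy1⟩ := hc.surj (pu c) x y hxy
    obtain ⟨c2, hc2, hu2, hx2, hy2⟩ := hc.surj (pu d) x y hxy
    have e1 := h1 c hcA c1 hc1 hu1.symm hfc
    have hg1 := hc.good c1 hc1
    have hd : pu c2 - pu c1 = τ := by rw [hu2, hu1, hu]; abel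
    have e2 : f c2 := hf h (by simp) c1 hc1 c2 hc2 ((hc.adj_h c1 hc1 c2 hc2).2
      ⟨hx1.trans hx2.symm (ne_zero_of_left hxy), hy1.trans hy2.symm (ne_zero_of_right hxy), by
        rw [hd, hc.left_par _ _ hx1 (ne_zero_of_left hg1) (ne_zero_of_left hxy)]; exact hτ, by
        rw [hd, hc.right_par _ _ hy1 (ne_zero_of_right hg1) (ne_zero_of_right hxy)]
        exact hτ'⟩) e1
    exact h1 c2 hc2 d hdA hu2 e2
  have hH : H = ⊤ := hG H (by
    rintro x y hxy τ ⟨hτ, hτ'⟩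
    refine ⟨key x y hxy τ hτ hτ', fun c hcA d hdA hu => key x y hxy (-τ) (neg_mem hτ) (neg_mem hτ')
      c hcA d hdA (by rw [hu]; abel)⟩)
  intro c hcA d hdA
  have : pu d - pu c ∈ H := by rw [hH]; trivial
  exact this.1 c hcA d hdA (by abel)

-- There are potentials `f0` for the types `i`, `i'`, `fR` for `h`, `i` and `fL` for `h`, `i'`. The
-- quotient `fR c * (f0 c)⁻¹` is constant along `i`, hence a function of `(u, y)`; likewise `fL c *
-- (f0 c)⁻¹` is a function of `(u, x)`. Gluing them to one function of `u` corrects `f0` to a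
-- potential for all three types.
open Classical in
theorem IsCoord.exists_potential (hc : IsCoord adj A h i i' B L R pu px py)
    (hhi : h ≠ i) (hhi' : h ≠ i') (hii' : i ≠ i')
    (hG : Generates B L R) (hE : Extends B L R) {Γ : Type u} [Group Γ] (e : C → C → Γ)
    (he : ∀ j ∈ ({h, i, i'} : Set I), ∀ j' ∈ ({h, i, i'} : Set I), j ≠ j' →
      ∃ f : C → Γ, ∀ c ∈ A, ∀ d ∈ A, (adj j c d ∨ adj j' c d) → e c d = (f c)⁻¹ * f d) :
    ∃ f : C → Γ, ∀ j ∈ ({h, i, i'} : Set I), ∀ c ∈ A, ∀ d ∈ A, adj j c d →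
      e c d = (f c)⁻¹ * f d := by
  obtain ⟨f0, hf0⟩ := he i (by simp) i' (by simp) hii'
  obtain ⟨fR, hfR⟩ := he h (by simp) i (by simp) hhi
  obtain ⟨fL, hfL⟩ := he h (by simp) i' (by simp) hhi'
  have hR : ∀ c ∈ A, ∀ d ∈ A, pu c = pu d → Par (py c) (py d) →
      fR c * (f0 c)⁻¹ = fR d * (f0 d)⁻¹ := by
    intro c hcA d hdA h1 h2
    have ha := (hc.adj_i c hcA d hdA).2 ⟨h1, h2⟩
    have e1 := (hfR c hcA d hdA (.inr ha)).symm.trans (hf0 c hcA d hdA (.inl ha))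
    rw [inv_mul_eq_iff_eq_mul] at e1
    rw [e1]; group
  have hL : ∀ c ∈ A, ∀ d ∈ A, pu c = pu d → Par (px c) (px d) →
      fL c * (f0 c)⁻¹ = fL d * (f0 d)⁻¹ := by
    intro c hcA d hdA h1 h2
    have ha := (hc.adj_i' c hcA d hdA).2 ⟨h1, h2⟩
    have e1 := (hfL c hcA d hdA (.inr ha)).symm.trans (hf0 c hcA d hdA (.inr ha))
    rw [inv_mul_eq_iff_eq_mul] at e1
    rw [e1]; group
  -- The value 1 stands where no chamber has the given coordinates.
  let gR : k × k → U → Γ := fun y u =>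
    if hh : ∃ c ∈ A, pu c = u ∧ Par (py c) y then fR hh.choose * (f0 hh.choose)⁻¹ else 1
  let gL : k × k → U → Γ := fun x u =>
    if hh : ∃ c ∈ A, pu c = u ∧ Par (px c) x then fL hh.choose * (f0 hh.choose)⁻¹ else 1
  have hgR : ∀ c ∈ A, ∀ y, y ≠ 0 → Par (py c) y → gR y (pu c) = fR c * (f0 c)⁻¹ := by
    intro c hcA y hy hp
    have hh : ∃ d ∈ A, pu d = pu c ∧ Par (py d) y := ⟨c, hcA, rfl, hp⟩
    simp only [gR, dif_pos hh]
    obtain ⟨h1, h2, h3⟩ := hh.choose_spec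
    exact hR _ h1 _ hcA h2 (h3.trans hp.symm hy)
  have hgL : ∀ c ∈ A, ∀ x, x ≠ 0 → Par (px c) x → gL x (pu c) = fL c * (f0 c)⁻¹ := by
    intro c hcA y hy hp
    have hh : ∃ d ∈ A, pu d = pu c ∧ Par (px d) y := ⟨c, hcA, rfl, hp⟩
    simp only [gL, dif_pos hh]
    obtain ⟨h1, h2, h3⟩ := hh.choose_spec
    exact hL _ h1 _ hcA h2 (h3.trans hp.symm hy)
  obtain ⟨f, hf⟩ := AffineTwin.exists_potential hG hE gL gR (by
    intro x y hxy u u' h1 h2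
    have hx0 := ne_zero_of_left hxy
    have hy0 := ne_zero_of_right hxy
    obtain ⟨c, hcA, rfl, hx, hy⟩ := hc.surj u x y hxy
    obtain ⟨d, hdA, rfl, hx', hy'⟩ := hc.surj u' x y hxy
    have hgc := hc.good c hcA
    have ha : adj h c d := (hc.adj_h c hcA d hdA).2 ⟨hx.trans hx'.symm hx0, hy.trans hy'.symm hy0,
      by rwa [hc.left_par _ _ hx (ne_zero_of_left hgc) hx0],
      by rwa [hc.right_par _ _ hy (ne_zero_of_right hgc) hy0]⟩
    rw [hgL c hcA x hx0 hx, hgL d hdA x hx0 hx', hgR c hcA y hy0 hy, hgR d hdA y hy0 hy']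
    have e1 := (hfR c hcA d hdA (.inl ha)).symm.trans (hfL c hcA d hdA (.inl ha))
    rw [inv_mul_eq_iff_eq_mul] at e1
    rw [e1]; group)
  refine ⟨fun c => f (pu c) * f0 c, ?_⟩
  rintro j (rfl | rfl | rfl) c hcA d hdA ha
  · obtain ⟨h1, h2, h3, h4⟩ := (hc.adj_h c hcA d hdA).1 ha
    have hgc := hc.good c hcA
    have e1 := hf _ _ hgc _ _ h3 h4
    rw [hgL c hcA _ (ne_zero_of_left hgc) (mul_comm _ _), hgL d hdA _ (ne_zero_of_left hgc) h1.symm] at e1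
    rw [inv_mul_eq_iff_eq_mul] at e1
    rw [hfL c hcA d hdA (.inl ha)]
    simp only [e1]; group
  · obtain ⟨h1, -⟩ := (hc.adj_i c hcA d hdA).1 ha
    rw [hf0 c hcA d hdA (.inl ha)]; simp only [h1]; group
  · obtain ⟨h1, -⟩ := (hc.adj_i' c hcA d hdA).1 ha
    rw [hf0 c hcA d hdA (.inr ha)]; simp only [h1]; group

end Coordinates

end AffineTwin

namespace AffineTwin

universe u

variable {k : Type u} [Field k]

/-! ### The groups of matrices attached to the coordinates -/

/-- Coordinates of a vector of `k²`. -/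
def co {m : ℕ} (x : k × k) (s : Fin m) : k := if (s : ℕ) = 0 then x.1 else x.2

@[simp] theorem co_zero {m : ℕ} (x : k × k) : co x (0 : Fin (m + 1)) = x.1 := rfl

@[simp] theorem co_one {m : ℕ} (x : k × k) : co x (1 : Fin (m + 2)) = x.2 := rfl

theorem co_smul {m : ℕ} (r : k) (x : k × k) (s : Fin m) : co (r • x) s = r * co x s := by
  unfold co; split_ifs <;> rfl

theorem co_add {m : ℕ} (x y : k × k) (s : Fin m) : co (x + y) s = co x s + co y s := by
  unfold co; split_ifs <;> rfl

/-- The vector orthogonal to `y`. -/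
def rot (y : k × k) : k × k := (-y.2, y.1)

theorem rot_smul (r : k) (y : k × k) : rot (r • y) = r • rot y := by
  simp [rot]

variable {α β : ℕ}

/-- The matrices all of whose columns are multiples of `x`. -/
def colSub (α β : ℕ) (x : k × k) : AddSubgroup (Matrix (Fin α) (Fin β) k) where
  carrier := {S | ∀ s s' t, S s t * co x s' = S s' t * co x s}
  zero_mem' := by intro s s' t; simp
  add_mem' := by
    intro a b ha hb s s' t
    simp only [Matrix.add_apply, add_mul, ha s s' t, hb s s' t]
  neg_mem' := by
    intro a ha s s' t
    simp only [Matrix.neg_apply, neg_mul, ha s s' t]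

/-- The matrices all of whose rows are orthogonal to `y`. -/
def rowSub (α β : ℕ) (y : k × k) : AddSubgroup (Matrix (Fin α) (Fin β) k) where
  carrier := {S | ∀ s t t', S s t * co (rot y) t' = S s t' * co (rot y) t}
  zero_mem' := by intro s s' t; simp
  add_mem' := by
    intro a b ha hb s s' t
    simp only [Matrix.add_apply, add_mul, ha s s' t, hb s s' t]
  neg_mem' := by
    intro a ha s s' t
    simp only [Matrix.neg_apply, neg_mul, ha s s' t]

theorem colSub_par {x x' : k × k} (h : Par x x') (hx : x ≠ 0) (hx' : x' ≠ 0) :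
    colSub α β x = colSub α β x' := by
  obtain ⟨r, hr, rfl⟩ := h.exists_smul hx hx'
  ext S
  refine forall_congr' fun s => forall_congr' fun s' => forall_congr' fun t => ?_
  rw [co_smul, co_smul, mul_left_comm, mul_left_comm (S s' t)]
  exact (mul_right_inj' hr).symm

theorem rowSub_par {x x' : k × k} (h : Par x x') (hx : x ≠ 0) (hx' : x' ≠ 0) :
    rowSub α β x = rowSub α β x' := by
  obtain ⟨r, hr, rfl⟩ := h.exists_smul hx hx'
  ext S
  refine forall_congr' fun s => forall_congr' fun s' => forall_congr' fun t => ?_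
  rw [rot_smul, co_smul, co_smul, mul_left_comm, mul_left_comm (S s t)]
  exact (mul_right_inj' hr).symm

theorem colSub_one (β : ℕ) (x : k × k) : colSub 1 β x = ⊤ := by
  refine eq_top_iff.2 fun S _ s s' t => ?_
  rw [Subsingleton.elim s s']

theorem rowSub_one (α : ℕ) (x : k × k) : rowSub α 1 x = ⊤ := by
  refine eq_top_iff.2 fun S _ s t t' => ?_
  rw [Subsingleton.elim t t']

theorem exists_notMem_of_card_le {m : ℕ} (hk : (m : ℕ∞) + 1 ≤ ENat.card k) (S : Finset k)
    (hS : S.card ≤ m) : ∃ x, x ∉ S := by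
  by_contra! h
  have : ENat.card k ≤ S.card := by
    have h1 : (S : Set k) = Set.univ := Set.eq_univ_of_forall (by simpa using h)
    rw [← Set.encard_univ, ← h1, Set.encard_coe_eq_coe_finsetCard]
  have h2 : ((m + 1 : ℕ) : ℕ∞) ≤ (S.card : ℕ∞) := by push_cast; exact hk.trans this
  have := Nat.cast_le.1 h2
  omega

/-- A subgroup of `k²` containing two different lines is everything. -/
theorem eq_top_of_lines (H : AddSubgroup (k × k)) {x y : k × k} (hxy : ¬ Par x y)
    (hx : ∀ a : k, a • x ∈ H) (hy : ∀ a : k, a • y ∈ H) : H = ⊤ := by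
  refine eq_top_iff.2 fun z _ => ?_
  have hd : x.1 * y.2 - x.2 * y.1 ≠ 0 := sub_ne_zero.2 hxy
  obtain ⟨d, hd'⟩ : ∃ d, d = x.1 * y.2 - x.2 * y.1 := ⟨_, rfl⟩
  rw [← hd'] at hd
  have : z = ((z.1 * y.2 - z.2 * y.1) / d) • x + ((x.1 * z.2 - x.2 * z.1) / d) • y := by
    ext
    · simp only [Prod.fst_add, Prod.smul_fst, smul_eq_mul]; field_simp; rw [hd']; ring
    · simp only [Prod.snd_add, Prod.smul_snd, smul_eq_mul]; field_simp; rw [hd']; ring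
  rw [this]
  exact add_mem (hx _) (hy _)

theorem apply_one_add (f : (k × k) →ₗ[k] k) (m : k) : f (1, m) = f (1, 0) + m * f (0, 1) := by
  have : ((1, m) : k × k) = (1, 0) + m • (0, 1) := by ext <;> simp
  rw [this, map_add, map_smul, smul_eq_mul]

-- On the affine points (1, m) each functional has at most one zero. Three values are avoided for
-- the first point and a fourth for the second, which is possible as |k| ≥ 5.
open Classical in
theorem exists_notPar (hk : 5 ≤ ENat.card k) {f g l : (k × k) →ₗ[k] k} (hf : f ≠ 0) (hg : g ≠ 0)
    (hl : l ≠ 0) : ∃ x y, ¬ Par x y ∧ f x ≠ 0 ∧ f y ≠ 0 ∧ g x ≠ 0 ∧ g y ≠ 0 ∧ l x ≠ 0 ∧ l y ≠ 0 := by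
  -- If `f (0, 1) = 0`, the excluded value is 0 by the convention on division by zero; this is
  -- harmless, as `f (1, m)` is then the nonzero constant `f (1, 0)`.
  have key : ∀ f : (k × k) →ₗ[k] k, f ≠ 0 → ∀ m, m ≠ - (f (1, 0) / f (0, 1)) → f (1, m) ≠ 0 := by
    intro f hf m hm h0
    rw [apply_one_add] at h0
    by_cases h1 : f (0, 1) = 0
    · have h2 : f (1, 0) = 0 := by simpa [h1] using h0
      apply hf
      refine LinearMap.ext fun x => ?_
      have : x = x.1 • ((1, 0) : k × k) + x.2 • (0, 1) := by ext <;> simp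
      rw [this, map_add, map_smul, map_smul, h1, h2]; simp
    · apply hm
      field_simp
      linear_combination h0
  have hk' : ((4 : ℕ) : ℕ∞) + 1 ≤ ENat.card k := by norm_num; exact hk
  let S : Finset k := {-(f (1, 0) / f (0, 1)), -(g (1, 0) / g (0, 1)), -(l (1, 0) / l (0, 1))}
  have hS : S.card ≤ 3 := Finset.card_le_three
  obtain ⟨m, hm⟩ := exists_notMem_of_card_le hk' S (by omega)
  obtain ⟨m', hm'⟩ := exists_notMem_of_card_le hk' (insert m S)
    ((Finset.card_insert_le _ _).trans (by omega))
  simp only [S, Finset.mem_insert, Finset.mem_singleton, not_or] at hm hm'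
  refine ⟨(1, m), (1, m'), ?_, key f hf _ hm.1, key f hf _ hm'.2.1, key g hg _ hm.2.1,
    key g hg _ hm'.2.2.1, key l hl _ hm.2.2, key l hl _ hm'.2.2.2⟩
  simp only [Par, mul_one, one_mul]
  exact fun h => hm'.1 h

theorem Form.exists_left {B : Form k} (hB : B ≠ 0) : ∃ x y, B x y ≠ 0 := by
  by_contra! h
  exact hB (LinearMap.ext fun x => LinearMap.ext fun y => h x y)

/-- The matrix with columns proportional to `x` and rows proportional to `z`. -/
def outer (α β : ℕ) (x z : k × k) : Matrix (Fin α) (Fin β) k := Matrix.of fun s t => co x s * co z t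

theorem outer_add_right (x z z' : k × k) : outer α β x (z + z') = outer α β x z + outer α β x z' := by
  ext s t; simp [outer, co_add, mul_add]

theorem outer_add_left (x x' z : k × k) : outer α β (x + x') z = outer α β x z + outer α β x' z := by
  ext s t; simp [outer, co_add, add_mul]

theorem outer_smul_left (r : k) (x z : k × k) : outer α β (r • x) z = outer α β x (r • z) := by
  ext s t; simp [outer, co_smul]; ring

theorem outer_zero_right (x : k × k) : outer α β x 0 = 0 := by
  ext s t; simp [outer, co]

theorem outer_mem_colSub (x z : k × k) : outer α β x z ∈ colSub α β x := by
  intro s s' t; simp [outer]; ring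

theorem outer_mem_rowSub (x y : k × k) : outer α β x (rot y) ∈ rowSub α β y := by
  intro s t t'; simp [outer]; ring

/-- `z ↦ x ⊗ z` as a homomorphism. -/
def outerHom (α β : ℕ) (x : k × k) : (k × k) →+ Matrix (Fin α) (Fin β) k :=
  AddMonoidHom.mk' (outer α β x) (outer_add_right x)

theorem exists_outer_of_mem_colSub {x : k × k} (hx : x ≠ 0) {S : Matrix (Fin 2) (Fin 2) k}
    (hS : S ∈ colSub 2 2 x) : ∃ z, S = outer 2 2 x z := by
  by_cases h1 : x.1 = 0
  · have h2 : x.2 ≠ 0 := fun h2 => hx (Prod.ext h1 h2)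
    refine ⟨(S 1 0 / x.2, S 1 1 / x.2), ?_⟩
    have h3 : ∀ t, S 0 t = 0 := fun t => by
      have := hS 0 1 t
      simpa [h1, h2] using this
    ext s t
    fin_cases s <;> fin_cases t <;> simp [outer, h1, h3] <;> field_simp
  · refine ⟨(S 0 0 / x.1, S 0 1 / x.1), ?_⟩
    have h3 : ∀ t, S 1 t = S 0 t * x.2 / x.1 := fun t => by
      have := hS 0 1 t
      simp only [co_zero, co_one] at this
      rw [this]; field_simp
    ext s t
    fin_cases s <;> fin_cases t <;> simp [outer, h3] <;> field_simp

end AffineTwin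

/-! ### Generation and commutation for two by two matrices. -/

namespace AffineTwin

universe u

variable {k : Type u} [Field k] {B : Form k}

/-- The intersections contain the rank one matrices x ⊗ rot y. For `B x ≠ 0` two independent y give
all of x ⊗ k², and two independent such x then give everything. -/
theorem generates_two_two (hk : 5 ≤ ENat.card k) (hB : B ≠ 0) :
    Generates B (colSub (k := k) 2 2) (rowSub 2 2) := by
  intro H hH
  have h1 : ∀ x, B x ≠ 0 → ∀ z, outer 2 2 x z ∈ H := by
    intro x hx
    obtain ⟨y, y', hy, h1, h2, -⟩ := exists_notPar hk hx hx hx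
    have e : H.comap (outerHom 2 2 x) = ⊤ := by
      refine eq_top_of_lines _ (x := rot y) (y := rot y') ?_ ?_ ?_
      · intro hp; apply hy; simp only [Par, rot] at *; linear_combination hp
      all_goals
        intro a
        rw [← rot_smul]
        rcases eq_or_ne a 0 with rfl | ha
        · change outer 2 2 x (rot (0 • _)) ∈ H
          rw [rot_smul, zero_smul, outer_zero_right]; exact zero_mem H
        · refine hH x (a • _) (by simpa [ha]) ⟨outer_mem_colSub _ _, outer_mem_rowSub _ _⟩
    intro z
    have : z ∈ H.comap (outerHom 2 2 x) := by rw [e]; trivial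
    exact this
  obtain ⟨x0, y0, h0⟩ := Form.exists_left hB
  obtain ⟨x, x', hx, hx1, hx2, -⟩ := exists_notPar hk (Form.right_ne_zero h0)
    (Form.right_ne_zero h0) (Form.right_ne_zero h0)
  have hx1 : B x ≠ 0 := Form.left_ne_zero (y := y0) hx1
  have hx2 : B x' ≠ 0 := Form.left_ne_zero (y := y0) hx2
  have h2 : ∀ z, ∀ v, outer 2 2 v z ∈ H := by
    intro z
    have e : H.comap (AddMonoidHom.mk' (fun v => outer 2 2 v z)
        (fun v v' => outer_add_left v v' z)) = ⊤ := by
      refine eq_top_of_lines _ hx ?_ ?_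
      all_goals
        intro a
        change outer 2 2 _ z ∈ H
        rw [outer_smul_left]
        exact h1 _ (by assumption) _
    intro v
    have : v ∈ H.comap (AddMonoidHom.mk' (fun v => outer 2 2 v z)
        (fun v v' => outer_add_left v v' z)) := by rw [e]; trivial
    exact this
  refine eq_top_iff.2 fun S _ => ?_
  have : S = outer 2 2 (1, 0) (S 0 0, S 0 1) + outer 2 2 (0, 1) (S 1 0, S 1 1) := by
    ext s t; fin_cases s <;> fin_cases t <;> simp [outer]
  rw [this]
  exact add_mem (h2 _ _) (h2 _ _)

section Commute

variable {G : Type u} [Group G] {eL eR : k × k → Multiplicative (Matrix (Fin 2) (Fin 2) k) →* G}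

/-- `z` as a function of `y`, with the rows of the matrices in `rowSub y` proportional to `z`. -/
def unrot (z : k × k) : k × k := (z.2, -z.1)

theorem rot_unrot (z : k × k) : rot (unrot z) = z := by simp [rot, unrot]

/-- The form `B` in terms of the vectors of the rows. -/
def rotForm (B : Form k) : Form k :=
  LinearMap.compl₂ B ((LinearMap.snd k k k).prod (-LinearMap.fst k k k))

theorem rotForm_apply (x z : k × k) : rotForm B x z = B x (unrot z) := rfl

theorem rotForm_rot (x y : k × k) : rotForm B x (rot y) = B x y := by
  rw [rotForm_apply]; simp [rot, unrot]

theorem rotForm_left {x : k × k} (h : B x ≠ 0) : rotForm B x ≠ 0 := by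
  intro h0
  apply h
  refine LinearMap.ext fun y => ?_
  rw [← rotForm_rot, h0]; rfl

variable (hag : ∀ x y, B x y ≠ 0 → ∀ τ, τ ∈ colSub 2 2 x → τ ∈ rowSub 2 2 y →
  eL x (.ofAdd τ) = eR y (.ofAdd τ))
include hag

/-- In terms of z = rot y, both homomorphisms are given on the line of x ⊗ z. The multiples x' and
z' may be zero; only membership of the matrix in both subgroups matters. -/
theorem eL_eq_eR {x z : k × k} (h : rotForm B x z ≠ 0) (x' : k × k) (z' : k × k)
    (hx : ∃ r : k, x' = r • x) (hz : ∃ r : k, z' = r • z) :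
    eL x (.ofAdd (outer 2 2 x' z')) = eR (unrot z) (.ofAdd (outer 2 2 x' z')) := by
  obtain ⟨r, rfl⟩ := hx
  obtain ⟨s, rfl⟩ := hz
  refine hag x _ h _ ?_ ?_
  · rw [outer_smul_left]; exact outer_mem_colSub _ _
  · have := outer_mem_rowSub (α := 2) (β := 2) (r • x) (s • unrot z)
    rw [rot_smul, rot_unrot] at this
    intro a b c
    have h1 := this a b c
    rw [rot_smul, rot_unrot, co_smul, co_smul] at h1
    change _ * co (rot (unrot z)) _ = _ * co (rot (unrot z)) _
    rw [rot_unrot]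
    rcases eq_or_ne s 0 with rfl | hs
    · simp [outer, co]
    · apply mul_left_cancel₀ hs
      linear_combination h1

/-- Expand (x₁ + x₂) ⊗ (z₁ + z₂), once splitting z before x and once x before z. Splitting along z
uses `eL`, splitting along x uses `eR`, and the nine conditions allow every product to be read in
both ways. The two results differ in the order of the two middle factors. -/
theorem commute_of_nine {x₁ x₂ z₁ z₂ : k × k}
    (h11 : rotForm B x₁ z₁ ≠ 0) (h12 : rotForm B x₁ z₂ ≠ 0)
    (h21 : rotForm B x₂ z₁ ≠ 0) (h22 : rotForm B x₂ z₂ ≠ 0)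
    (hs1 : rotForm B (x₁ + x₂) z₁ ≠ 0) (hs2 : rotForm B (x₁ + x₂) z₂ ≠ 0)
    (h1s : rotForm B x₁ (z₁ + z₂) ≠ 0) (h2s : rotForm B x₂ (z₁ + z₂) ≠ 0)
    (hss : rotForm B (x₁ + x₂) (z₁ + z₂) ≠ 0) :
    Commute (eL x₁ (.ofAdd (outer 2 2 x₁ z₂))) (eL x₂ (.ofAdd (outer 2 2 x₂ z₁))) := by
  have o : ∀ x : k × k, ∃ r : k, x = r • x := fun x => ⟨1, by simp⟩
  have e1 : eL (x₁ + x₂) (.ofAdd (outer 2 2 (x₁ + x₂) (z₁ + z₂))) =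
      eL x₁ (.ofAdd (outer 2 2 x₁ z₁)) * eL x₂ (.ofAdd (outer 2 2 x₂ z₁)) *
      (eL x₁ (.ofAdd (outer 2 2 x₁ z₂)) * eL x₂ (.ofAdd (outer 2 2 x₂ z₂))) := by
    rw [outer_add_right, ofAdd_add, map_mul, eL_eq_eR hag hs1 _ _ (o _) (o _),
      eL_eq_eR hag hs2 _ _ (o _) (o _), outer_add_left, outer_add_left, ofAdd_add, ofAdd_add,
      map_mul, map_mul, eL_eq_eR hag h11 _ _ (o _) (o _), eL_eq_eR hag h12 _ _ (o _) (o _),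
      eL_eq_eR hag h21 _ _ (o _) (o _), eL_eq_eR hag h22 _ _ (o _) (o _)]
  have e2 : eL (x₁ + x₂) (.ofAdd (outer 2 2 (x₁ + x₂) (z₁ + z₂))) =
      eL x₁ (.ofAdd (outer 2 2 x₁ z₁)) * eL x₁ (.ofAdd (outer 2 2 x₁ z₂)) *
      (eL x₂ (.ofAdd (outer 2 2 x₂ z₁)) * eL x₂ (.ofAdd (outer 2 2 x₂ z₂))) := by
    rw [eL_eq_eR hag hss _ _ (o _) (o _), outer_add_left, ofAdd_add, map_mul,
      ← eL_eq_eR hag h1s _ _ (o _) (o _), ← eL_eq_eR hag h2s _ _ (o _) (o _), outer_add_right,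
      outer_add_right, ofAdd_add, ofAdd_add, map_mul, map_mul]
  have e3 := e1.symm.trans e2
  simp only [mul_assoc] at e3
  have e4 := mul_left_cancel e3
  simp only [← mul_assoc] at e4
  exact (mul_right_cancel e4).symm

/-- The subgroup of the `z` such that `eL x₁ (x₁ ⊗ z)` commutes with `g`. -/
def commSub (x : k × k) (e : Multiplicative (Matrix (Fin 2) (Fin 2) k) →* G) (g : G) :
    AddSubgroup (k × k) where
  carrier := {z | Commute (e (.ofAdd (outer 2 2 x z))) g}
  zero_mem' := by simp [outer_zero_right]
  add_mem' := by
    intro a b ha hb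
    simp only [Set.mem_ofPred_eq, outer_add_right, ofAdd_add, map_mul] at *
    exact ha.mul_left hb
  neg_mem' := by
    intro a ha
    have : outer 2 2 x (-a) = - outer 2 2 x a := (outerHom 2 2 x).map_neg a
    simp only [Set.mem_ofPred_eq, this, ofAdd_neg, map_inv] at *
    exact ha.inv_left

/-- For a common z both elements are values of the one homomorphism `eR (unrot z)` on an abelian
group. -/
theorem smul_mem_commSub {x₁ x₂ z : k × k} (h1 : rotForm B x₁ z ≠ 0) (h2 : rotForm B x₂ z ≠ 0)
    (a : k) : a • z ∈ commSub x₁ (eL x₁) (eL x₂ (.ofAdd (outer 2 2 x₂ z))) := by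
  have o : ∀ x : k × k, ∃ r : k, x = r • x := fun x => ⟨1, by simp⟩
  change Commute _ _
  rw [eL_eq_eR hag h1 _ _ (o _) ⟨a, rfl⟩, eL_eq_eR hag h2 _ _ (o _) (o _)]
  change _ * _ = _ * _
  rw [← map_mul (eR _), ← map_mul (eR _), mul_comm]

/-- The commutation relation with a rescaled pair of vectors. -/
theorem mem_commSub_of_ne {x₁ x₂ z₁ z₂ : k × k} {ρ : k} (hρ : ρ ≠ 0)
    (h11 : rotForm B x₁ z₁ ≠ 0) (h12 : rotForm B x₁ z₂ ≠ 0)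
    (h21 : rotForm B x₂ z₁ ≠ 0) (h22 : rotForm B x₂ z₂ ≠ 0)
    (hs1 : rotForm B x₁ z₁ + ρ * rotForm B x₂ z₁ ≠ 0)
    (hs2 : rotForm B x₁ z₂ + ρ * rotForm B x₂ z₂ ≠ 0)
    (h1s : rotForm B x₁ z₁ + ρ * rotForm B x₁ z₂ ≠ 0)
    (h2s : rotForm B x₂ z₁ + ρ * rotForm B x₂ z₂ ≠ 0)
    (hss : rotForm B x₁ z₁ + ρ * rotForm B x₂ z₁ + ρ * (rotForm B x₁ z₂ + ρ * rotForm B x₂ z₂) ≠ 0) :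
    z₂ ∈ commSub x₁ (eL x₁) (eL x₂ (.ofAdd (outer 2 2 x₂ z₁))) := by
  have o : ∀ x : k × k, ∃ r : k, x = r • x := fun x => ⟨1, by simp⟩
  have hi : ρ⁻¹ ≠ 0 := inv_ne_zero hρ
  -- Replacing x₂, z₁ by ρ x₂, ρ⁻¹ z₁ leaves x₂ ⊗ z₁ and x₁ ⊗ z₂ alone but changes the five
  -- conditions that involve a sum.
  have h := commute_of_nine hag (x₁ := x₁) (x₂ := ρ • x₂) (z₁ := ρ⁻¹ • z₁) (z₂ := z₂)
    (by simp [hi, h11]) h12 (by simp [hρ, h21]) (by simp [hρ, h22])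
    (by simp only [map_add, map_smul, LinearMap.add_apply, LinearMap.smul_apply, smul_eq_mul]
        exact mul_ne_zero hi hs1)
    (by simpa using hs2)
    (by simp only [map_add, map_smul, smul_eq_mul]
        intro h0; apply h1s
        have := congrArg (ρ * ·) h0
        simpa [mul_add, ← mul_assoc, hρ] using this)
    (by simp only [map_add, map_smul, LinearMap.smul_apply, smul_eq_mul]
        intro h0; apply h2s
        simpa [mul_add, ← mul_assoc, hρ] using h0)
    (by simp only [map_add, map_smul, LinearMap.add_apply, LinearMap.smul_apply, smul_eq_mul]
        intro h0; apply hss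
        have := congrArg (ρ * ·) h0
        simp only [mul_zero] at this
        rw [← this]
        field_simp)
  have e : outer 2 2 (ρ • x₂) (ρ⁻¹ • z₁) = outer 2 2 x₂ z₁ := by
    rw [outer_smul_left, smul_smul, mul_inv_cancel₀ hρ, one_smul]
  have e2 : eL (ρ • x₂) (.ofAdd (outer 2 2 x₂ z₁)) = eL x₂ (.ofAdd (outer 2 2 x₂ z₁)) := by
    rw [eL_eq_eR hag (x := ρ • x₂) (z := z₁) (by simp [hρ, h21]) x₂ z₁
      ⟨ρ⁻¹, by rw [smul_smul, inv_mul_cancel₀ hρ, one_smul]⟩ (o _),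
      eL_eq_eR hag h21 _ _ (o _) (o _)]
  rw [e, e2] at h
  exact h

-- The subgroup contains the line of z, so a vector ν may be replaced by ν + μ z. If |k| ≥ 7, a ρ
-- avoiding two values and a μ avoiding six make all nine products admissible. For |k| = 5 this
-- count fails, but there every scalar is an integer, so one vector off the line of z suffices. No
-- field has six elements.
open Classical in
theorem commSub_eq_top (hk : 5 ≤ ENat.card k) {x₁ x₂ z : k × k} (h1 : rotForm B x₁ z ≠ 0)
    (h2 : rotForm B x₂ z ≠ 0) :
    commSub x₁ (eL x₁) (eL x₂ (.ofAdd (outer 2 2 x₂ z))) = ⊤ := by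
  obtain ⟨s, hs⟩ : ∃ s, s = rotForm B x₁ z := ⟨_, rfl⟩
  obtain ⟨t, ht⟩ : ∃ t, t = rotForm B x₂ z := ⟨_, rfl⟩
  have hs0 : s ≠ 0 := hs ▸ h1
  have ht0 : t ≠ 0 := ht ▸ h2
  have hmem : ∀ a : k, a • z ∈ commSub x₁ (eL x₁) (eL x₂ (.ofAdd (outer 2 2 x₂ z))) :=
    smul_mem_commSub hag h1 h2
  by_cases hc : ENat.card k = 5
  · have hcard : Nat.card k = 5 := by
      have hf : Finite k := by
        by_contra h
        rw [not_finite_iff_infinite] at h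
        rw [ENat.card_eq_top_of_infinite] at hc
        exact absurd hc (by decide)
      rw [ENat.card_eq_coe_natCard] at hc
      exact_mod_cast hc
    -- The additive group of a field with five elements is generated by 1, so its subgroups of
    -- vectors are subspaces.
    have hint : ∀ a : k, ∃ m : ℤ, (m : k) = a := by
      intro a
      have : Fact (Nat.Prime 5) := ⟨by norm_num⟩
      have h3 := zmultiples_eq_top_of_prime_card (G := k) (p := 5) hcard (g := 1) one_ne_zero
      have : a ∈ AddSubgroup.zmultiples (1 : k) := by rw [h3]; trivial
      obtain ⟨m, hm⟩ := AddSubgroup.mem_zmultiples_iff.1 this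
      exact ⟨m, by simpa using hm⟩
    have h5 : (5 : k) = 0 := by
      have : Nat.card k • (1 : k) = 0 := card_nsmul_eq_zero'
      rw [hcard] at this
      simpa using this
    have htwo : (2 : k) ≠ 0 := by
      intro h
      apply one_ne_zero (α := k)
      linear_combination h5 - 2 * h
    obtain ⟨ρ, hρ⟩ : ∃ ρ, ρ = s / t := ⟨_, rfl⟩
    have hρ0 : ρ ≠ 0 := hρ ▸ div_ne_zero hs0 ht0
    have hst : s = ρ * t := by rw [hρ]; field_simp
    obtain ⟨f, hf⟩ : ∃ f, f = rotForm B x₁ := ⟨_, rfl⟩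
    have hfapp : ∀ v : k × k, f v = v.1 * f (1, 0) + v.2 * f (0, 1) := by
      intro v
      have : v = v.1 • ((1, 0) : k × k) + v.2 • (0, 1) := by ext <;> simp
      conv_lhs => rw [this]
      rw [map_add, map_smul, map_smul, smul_eq_mul, smul_eq_mul]
    -- ν spans the kernel of `rotForm B x₁`. If possible it is scaled to the value `2 * t`; then the
    -- nine products for ν + ρ⁻¹ z are multiples of t by 1, 2, 3, 4 or 6, up to powers of ρ, and
    -- none of these vanishes in characteristic 5.
    obtain ⟨ν, hν, hν0, hν2⟩ : ∃ ν : k × k, f ν = 0 ∧ ν ≠ 0 ∧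
        (rotForm B x₂ ν = 0 ∨ ρ * rotForm B x₂ ν = 2 * t) := by
      have h0 : ((f (0, 1), -f (1, 0)) : k × k) ≠ 0 := by
        intro h0
        simp only [Prod.mk_eq_zero, neg_eq_zero] at h0
        apply hs0
        rw [hs, ← hf, hfapp, h0.1, h0.2]; simp
      have h3 : f (f (0, 1), -f (1, 0)) = 0 := by rw [hfapp]; simp; ring
      by_cases h4 : rotForm B x₂ (f (0, 1), -f (1, 0)) = 0
      · exact ⟨_, h3, h0, .inl h4⟩
      · refine ⟨(2 * t / (ρ * rotForm B x₂ (f (0, 1), -f (1, 0)))) • (f (0, 1), -f (1, 0)), ?_,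
          ?_, .inr ?_⟩
        · rw [map_smul, h3, smul_zero]
        · exact smul_ne_zero (div_ne_zero (mul_ne_zero htwo ht0) (mul_ne_zero hρ0 h4)) h0
        · rw [map_smul, smul_eq_mul]; field_simp
    have hnp : ¬ Par ν z := by
      intro hp
      have hz : z ≠ 0 := ne_zero_of_right h1
      obtain ⟨r, hr, rfl⟩ := hp.exists_smul hν0 hz
      apply h1
      rw [map_smul, ← hf, hν, smul_zero]
    obtain ⟨τ, hτ⟩ : ∃ τ, τ = rotForm B x₂ ν := ⟨_, rfl⟩
    have hin : ν + ρ⁻¹ • z ∈ commSub x₁ (eL x₁) (eL x₂ (.ofAdd (outer 2 2 x₂ z))) := by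
      have e1 : rotForm B x₁ (ν + ρ⁻¹ • z) = t := by
        rw [map_add, map_smul, ← hs, ← hf, hν, hst, smul_eq_mul]; field_simp; ring
      have e2 : rotForm B x₂ (ν + ρ⁻¹ • z) = τ + ρ⁻¹ * t := by
        rw [map_add, map_smul, ← ht, ← hτ, smul_eq_mul]
      have e3 : ρ * (τ + ρ⁻¹ * t) = t ∨ ρ * (τ + ρ⁻¹ * t) = 3 * t := by
        rw [← hτ] at hν2
        rcases hν2 with h | h
        · left; rw [h]; field_simp; ring
        · right; rw [mul_add, h]; field_simp; ring
      have hne : ∀ m : k, m = 1 ∨ m = 2 ∨ m = 3 ∨ m = 4 → m * t ≠ 0 := by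
        rintro m (rfl | rfl | rfl | rfl)
        · simpa using ht0
        · exact mul_ne_zero htwo ht0
        · refine mul_ne_zero (fun h => htwo ?_) ht0
          linear_combination h5 - h
        · refine mul_ne_zero (fun h => htwo ?_) ht0
          linear_combination -2 * h5 + 3 * h
      obtain ⟨w, hw⟩ : ∃ w, w = τ + ρ⁻¹ * t := ⟨_, rfl⟩
      rw [← hw] at e2 e3
      refine mem_commSub_of_ne hag hρ0 h1 ?_ h2 ?_ ?_ ?_ ?_ ?_ ?_
      all_goals simp only [e1, e2, ← hs, ← ht, hst]
      · exact ht0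
      · intro h0
        rw [h0] at e3
        rcases e3 with h | h
        · exact ht0 (by rw [← h]; ring)
        · exact hne 3 (by simp) (by rw [← h]; ring)
      · convert mul_ne_zero hρ0 (hne 2 (by simp)) using 1; ring
      · rcases e3 with h | h
        · rw [h]; convert hne 2 (by simp) using 1; ring
        · rw [h]; convert hne 4 (by simp) using 1; ring
      · convert mul_ne_zero hρ0 (hne 2 (by simp)) using 1; ring
      · rcases e3 with h | h
        · rw [h]; convert hne 2 (by simp) using 1; ring
        · rw [h]; convert hne 4 (by simp) using 1; ring
      · rcases e3 with h | h
        · rw [h]; convert mul_ne_zero hρ0 (hne 4 (by simp)) using 1; ring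
        · rw [h]; convert mul_ne_zero hρ0 (hne 1 (by simp)) using 1
          linear_combination (ρ * t) * h5
    have hin2 : ν ∈ commSub x₁ (eL x₁) (eL x₂ (.ofAdd (outer 2 2 x₂ z))) := by
      have := sub_mem hin (hmem ρ⁻¹)
      simpa using this
    refine eq_top_of_lines _ hnp ?_ hmem
    intro a
    obtain ⟨m, rfl⟩ := hint a
    rw [Int.cast_smul_eq_zsmul]
    exact zsmul_mem hin2 m
  · have hk7 : ((6 : ℕ) : ℕ∞) + 1 ≤ ENat.card k := by
      rcases finite_or_infinite k with hfin | hinf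
      · have e1 : ENat.card k = (Nat.card k : ℕ∞) := ENat.card_eq_coe_natCard k
        rw [e1] at hk hc ⊢
        have h3 : 5 ≤ Nat.card k := by exact_mod_cast hk
        have h4 : Nat.card k ≠ 5 := by exact_mod_cast hc
        have h6 : Nat.card k ≠ 6 := by
          intro h6
          have := Fintype.ofFinite k
          have hp : IsPrimePow (Fintype.card k) := Fintype.isPrimePow_card_of_field
          rw [← Nat.card_eq_fintype_card, h6] at hp
          obtain ⟨p, m, hp, -, hpm⟩ := hp
          have hp' := hp.nat_prime
          have a1 : 2 ∣ p := Nat.prime_two.dvd_of_dvd_pow (n := m) (by rw [hpm]; norm_num)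
          have a2 : 3 ∣ p := Nat.prime_three.dvd_of_dvd_pow (n := m) (by rw [hpm]; norm_num)
          have b1 := (Nat.prime_dvd_prime_iff_eq Nat.prime_two hp').1 a1
          have b2 := (Nat.prime_dvd_prime_iff_eq Nat.prime_three hp').1 a2
          omega
        have : 7 ≤ Nat.card k := by omega
        exact_mod_cast this
      · simp
    have hk4 : ((4 : ℕ) : ℕ∞) + 1 ≤ ENat.card k := by norm_num; exact hk
    obtain ⟨ρ, hρ⟩ := exists_notMem_of_card_le hk4 {0, -(s / t)} (Finset.card_le_two.trans (by omega))
    simp only [Finset.mem_insert, Finset.mem_singleton, not_or] at hρ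
    obtain ⟨hρ0, hρ1⟩ := hρ
    have hlin : ∀ c d m : k, d ≠ 0 → m ≠ -(c / d) → c + m * d ≠ 0 := by
      intro c d m hd hm h0
      apply hm
      field_simp
      linear_combination h0
    have hst : s + ρ * t ≠ 0 := hlin _ _ _ ht0 hρ1
    refine eq_top_iff.2 fun ν _ => ?_
    obtain ⟨σ, hσ⟩ : ∃ σ, σ = rotForm B x₁ ν := ⟨_, rfl⟩
    obtain ⟨θ, hθ⟩ : ∃ θ, θ = rotForm B x₂ ν := ⟨_, rfl⟩
    -- Each remaining condition is linear in μ with leading coefficient s, t, s + ρ t, ρ s, ρ t or ρ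
    -- (s + ρ t), all nonzero, and so excludes one value.
    obtain ⟨μ, hμ⟩ := exists_notMem_of_card_le hk7 {-(σ / s), -(θ / t), -((σ + ρ * θ) / (s + ρ * t)),
      -((s + ρ * σ) / (ρ * s)), -((t + ρ * θ) / (ρ * t)),
      -((s + ρ * t + ρ * (σ + ρ * θ)) / (ρ * (s + ρ * t)))} Finset.card_le_six
    simp only [Finset.mem_insert, Finset.mem_singleton, not_or] at hμ
    obtain ⟨m1, m2, m3, m4, m5, m6⟩ := hμ
    have hin : ν + μ • z ∈ commSub x₁ (eL x₁) (eL x₂ (.ofAdd (outer 2 2 x₂ z))) := by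
      refine mem_commSub_of_ne hag hρ0 h1 ?_ h2 ?_ ?_ ?_ ?_ ?_ ?_
      all_goals simp only [map_add, map_smul, smul_eq_mul, ← hs, ← ht, ← hσ, ← hθ]
      · exact hlin _ _ _ hs0 m1
      · exact hlin _ _ _ ht0 m2
      · exact hst
      · convert hlin _ _ _ hst m3 using 1; ring
      · convert hlin _ _ _ (mul_ne_zero hρ0 hs0) m4 using 1; ring
      · convert hlin _ _ _ (mul_ne_zero hρ0 ht0) m5 using 1; ring
      · convert hlin _ _ _ (mul_ne_zero hρ0 hst) m6 using 1; ring
    have := sub_mem hin (hmem μ)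
    simpa using this

/-- `commSub_eq_top` needs a vector admissible for both x₁ and x₂. Such vectors span k², so
exchanging the roles of the two factors removes the condition. -/
theorem commute_eL (hk : 5 ≤ ENat.card k) {x₁ x₂ : k × k} (h1 : B x₁ ≠ 0) (h2 : B x₂ ≠ 0)
    (z z' : k × k) :
    Commute (eL x₁ (.ofAdd (outer 2 2 x₁ z))) (eL x₂ (.ofAdd (outer 2 2 x₂ z'))) := by
  obtain ⟨w, w', hw, a1, a2, b1, b2, -⟩ :=
    exists_notPar hk (rotForm_left h1) (rotForm_left h2) (rotForm_left h2)
  have key : ∀ w, rotForm B x₁ w ≠ 0 → rotForm B x₂ w ≠ 0 →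
      w ∈ commSub x₂ (eL x₂) (eL x₁ (.ofAdd (outer 2 2 x₁ z))) := by
    intro w e1 e2
    have h3 := commSub_eq_top hag hk e1 e2
    have : z ∈ commSub x₁ (eL x₁) (eL x₂ (.ofAdd (outer 2 2 x₂ w))) := by rw [h3]; trivial
    exact Commute.symm this
  have h3 : commSub x₂ (eL x₂) (eL x₁ (.ofAdd (outer 2 2 x₁ z))) = ⊤ := by
    refine eq_top_of_lines _ hw (fun a => ?_) (fun a => ?_)
    · rcases eq_or_ne a 0 with rfl | ha
      · rw [zero_smul]; exact zero_mem _
      · exact key _ (by simp [ha, a1]) (by simp [ha, b1])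
    · rcases eq_or_ne a 0 with rfl | ha
      · rw [zero_smul]; exact zero_mem _
      · exact key _ (by simp [ha, a2]) (by simp [ha, b2])
  have : z' ∈ commSub x₂ (eL x₂) (eL x₁ (.ofAdd (outer 2 2 x₁ z))) := by rw [h3]; trivial
  exact Commute.symm this

end Commute

end AffineTwin

/-! ### Gluing homomorphisms on groups of matrices. -/

namespace AffineTwin

universe u

variable {k : Type u} [Field k] {B : Form k}

/-- Cramer's rule in every column. -/
theorem colSub_sup {β : ℕ} {x x' : k × k} (h : ¬ Par x x') :
    colSub (k := k) 2 β x ⊔ colSub 2 β x' = ⊤ := by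
  refine eq_top_iff.2 fun S _ => ?_
  obtain ⟨d, hd'⟩ : ∃ d, d = x.1 * x'.2 - x.2 * x'.1 := ⟨_, rfl⟩
  have hd : d ≠ 0 := hd' ▸ sub_ne_zero.2 h
  refine AddSubgroup.mem_sup.2
    ⟨Matrix.of fun s t => co x s * ((S 0 t * x'.2 - S 1 t * x'.1) / d), ?_,
      Matrix.of fun s t => co x' s * ((x.1 * S 1 t - x.2 * S 0 t) / d), ?_, ?_⟩
  · intro s s' t; simp; ring
  · intro s s' t; simp; ring
  · ext s t
    fin_cases s <;> simp <;> field_simp <;> rw [hd'] <;> ring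

theorem rowSub_sup {α : ℕ} {x x' : k × k} (h : ¬ Par x x') :
    rowSub (k := k) α 2 x ⊔ rowSub α 2 x' = ⊤ := by
  refine eq_top_iff.2 fun S _ => ?_
  obtain ⟨d, hd'⟩ : ∃ d, d = x.1 * x'.2 - x.2 * x'.1 := ⟨_, rfl⟩
  have hd : d ≠ 0 := hd' ▸ sub_ne_zero.2 h
  refine AddSubgroup.mem_sup.2
    ⟨Matrix.of fun s t => co (rot x) t * ((S s 0 * x'.1 + S s 1 * x'.2) / d), ?_,
      Matrix.of fun s t => co (rot x') t * (-(x.1 * S s 0 + x.2 * S s 1) / d), ?_, ?_⟩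
  · intro s s' t; simp; ring
  · intro s s' t; simp; ring
  · ext s t
    fin_cases t <;> simp [rot] <;> field_simp <;> rw [hd'] <;> ring

section Top

variable {U : Type u} [AddCommGroup U] {L R : k × k → AddSubgroup U}

/-- Here each relevant `eR y` is governed by the gluing condition on all of `L v`. Two of them
coincide, since both agree with `eL v` and `eL w` for independent v, w that are good for both, and
`L v`, `L w` generate. So any one of them is the glued homomorphism. -/
theorem extends_of_right_top (hk : 5 ≤ ENat.card k) (hB : B ≠ 0) (hR : ∀ y, R y = ⊤)
    (hL : ∀ x x', ¬ Par x x' → L x ⊔ L x' = ⊤) : Extends B L R := by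
  intro G _ eL eR hag
  obtain ⟨x0, y0, h0⟩ := Form.exists_left hB
  refine ⟨eR y0, fun x y hxy τ hτ hτ' => ?_⟩
  rw [hag x y hxy τ hτ hτ']
  have hf := Form.right_ne_zero hxy
  obtain ⟨v, w, hvw, a1, a2, b1, b2, -⟩ := exists_notPar hk hf (Form.right_ne_zero h0) hf
  have h1 : L v ⊔ L w ≤ ((eR y0).eqLocus (eR y)).toAddSubgroup' := by
    refine sup_le (fun σ hσ => ?_) (fun σ hσ => ?_)
    · exact (hag v y0 b1 σ hσ (by rw [hR]; trivial)).symm.trans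
        (hag v y a1 σ hσ (by rw [hR]; trivial))
    · exact (hag w y0 b2 σ hσ (by rw [hR]; trivial)).symm.trans
        (hag w y a2 σ hσ (by rw [hR]; trivial))
  rw [hL v w hvw] at h1
  exact h1 (AddSubgroup.mem_top τ)

theorem extends_of_left_top (hk : 5 ≤ ENat.card k) (hB : B ≠ 0) (hL : ∀ y, L y = ⊤)
    (hR : ∀ x x', ¬ Par x x' → R x ⊔ R x' = ⊤) : Extends B L R := by
  intro G _ eL eR hag
  obtain ⟨x0, y0, h0⟩ := Form.exists_left hB
  refine ⟨eL x0, fun x y hxy τ hτ hτ' => ?_⟩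
  have hf := Form.left_ne_zero hxy
  obtain ⟨v, w, hvw, a1, a2, b1, b2, -⟩ := exists_notPar hk hf (Form.left_ne_zero h0) hf
  have h1 : R v ⊔ R w ≤ ((eL x0).eqLocus (eL x)).toAddSubgroup' := by
    refine sup_le (fun σ hσ => ?_) (fun σ hσ => ?_)
    · exact (hag x0 v b1 σ (by rw [hL]; trivial) hσ).trans
        (hag x v a1 σ (by rw [hL]; trivial) hσ).symm
    · exact (hag x0 w b2 σ (by rw [hL]; trivial) hσ).trans
        (hag x w a2 σ (by rw [hL]; trivial) hσ).symm
  rw [hR v w hvw] at h1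
  exact h1 (AddSubgroup.mem_top τ)

theorem generates_of_right_top (hk : 5 ≤ ENat.card k) (hB : B ≠ 0) (hR : ∀ y, R y = ⊤)
    (hL : ∀ x x', ¬ Par x x' → L x ⊔ L x' = ⊤) : Generates B L R := by
  intro H hH
  obtain ⟨x0, y0, h0⟩ := Form.exists_left hB
  have hf := Form.right_ne_zero h0
  obtain ⟨v, w, hvw, a1, a2, -⟩ := exists_notPar hk hf hf hf
  rw [eq_top_iff, ← hL v w hvw]
  refine sup_le (fun σ hσ => ?_) (fun σ hσ => ?_)
  · exact hH v y0 a1 ⟨hσ, by rw [hR]; trivial⟩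
  · exact hH w y0 a2 ⟨hσ, by rw [hR]; trivial⟩

theorem generates_of_left_top (hk : 5 ≤ ENat.card k) (hB : B ≠ 0) (hL : ∀ y, L y = ⊤)
    (hR : ∀ x x', ¬ Par x x' → R x ⊔ R x' = ⊤) : Generates B L R := by
  intro H hH
  obtain ⟨x0, y0, h0⟩ := Form.exists_left hB
  have hf := Form.left_ne_zero h0
  obtain ⟨v, w, hvw, a1, a2, -⟩ := exists_notPar hk hf hf hf
  rw [eq_top_iff, ← hR v w hvw]
  refine sup_le (fun σ hσ => ?_) (fun σ hσ => ?_)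
  · exact hH x0 v a1 ⟨by rw [hL]; trivial, hσ⟩
  · exact hH x0 w a2 ⟨by rw [hL]; trivial, hσ⟩

end Top

/-- The coordinates of the columns of a matrix with respect to `x₁`, `x₂`. -/
def colCoord (x₁ x₂ : k × k) : Matrix (Fin 2) (Fin 2) k →+ (k × k) × (k × k) :=
  AddMonoidHom.mk' (fun S =>
    (((S 0 0 * x₂.2 - S 1 0 * x₂.1) / (x₁.1 * x₂.2 - x₁.2 * x₂.1),
      (S 0 1 * x₂.2 - S 1 1 * x₂.1) / (x₁.1 * x₂.2 - x₁.2 * x₂.1)),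
     ((x₁.1 * S 1 0 - x₁.2 * S 0 0) / (x₁.1 * x₂.2 - x₁.2 * x₂.1),
      (x₁.1 * S 1 1 - x₁.2 * S 0 1) / (x₁.1 * x₂.2 - x₁.2 * x₂.1)))) (by
    intro S S'
    ext <;> simp <;> ring)

theorem colCoord_outer {x₁ x₂ : k × k} (h : ¬ Par x₁ x₂) (a b : k) (z : k × k) :
    colCoord x₁ x₂ (outer 2 2 (a • x₁ + b • x₂) z) = (a • z, b • z) := by
  have hd : x₁.1 * x₂.2 - x₁.2 * x₂.1 ≠ 0 := sub_ne_zero.2 h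
  ext <;> simp only [colCoord, outer, AddMonoidHom.mk'_apply, Matrix.of_apply, co_zero, co_one,
    Prod.fst_add, Prod.snd_add, Prod.smul_fst, Prod.smul_snd, smul_eq_mul] <;>
    rw [div_eq_iff hd] <;> ring

/-- Splitting the columns along two good vectors x₁, x₂ defines the glued map, a homomorphism
because the two parts commute by `commute_eL`. It agrees with `eL x` on x ⊗ w whenever w is
admissible for x, x₁ and x₂ at once, and such w span k². -/
theorem extends_two_two (hk : 5 ≤ ENat.card k) (hB : B ≠ 0) :
    Extends B (colSub (k := k) 2 2) (rowSub 2 2) := by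
  intro G _ eL eR hag
  obtain ⟨x0, y0, h0⟩ := Form.exists_left hB
  obtain ⟨x₁, x₂, hx, hx1, hx2, -⟩ := exists_notPar hk (Form.right_ne_zero h0)
    (Form.right_ne_zero h0) (Form.right_ne_zero h0)
  have hx1 : B x₁ ≠ 0 := Form.left_ne_zero (y := y0) hx1
  have hx2 : B x₂ ≠ 0 := Form.left_ne_zero (y := y0) hx2
  have o : ∀ x : k × k, ∃ r : k, x = r • x := fun x => ⟨1, by simp⟩
  let Φ : Multiplicative (Matrix (Fin 2) (Fin 2) k) →* G := MonoidHom.mk'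
    (fun S => eL x₁ (.ofAdd (outer 2 2 x₁ (colCoord x₁ x₂ S.toAdd).1)) *
      eL x₂ (.ofAdd (outer 2 2 x₂ (colCoord x₁ x₂ S.toAdd).2))) (by
    intro S S'
    rw [toAdd_mul, map_add, Prod.fst_add, Prod.snd_add, outer_add_right, outer_add_right,
      ofAdd_add, ofAdd_add, map_mul, map_mul, mul_assoc, mul_assoc]
    congr 1
    rw [← mul_assoc, ← mul_assoc]
    congr 1
    exact commute_eL hag hk hx1 hx2 _ _)
  refine ⟨Φ, fun x y hxy τ hτ hτ' => ?_⟩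
  obtain ⟨z, rfl⟩ := exists_outer_of_mem_colSub (ne_zero_of_left hxy) hτ
  have hxB := Form.left_ne_zero hxy
  obtain ⟨d, hd'⟩ : ∃ d, d = x₁.1 * x₂.2 - x₁.2 * x₂.1 := ⟨_, rfl⟩
  have hd : d ≠ 0 := hd' ▸ sub_ne_zero.2 hx
  obtain ⟨a, b, hab⟩ : ∃ a b : k, x = a • x₁ + b • x₂ := by
    refine ⟨(x.1 * x₂.2 - x.2 * x₂.1) / d, (x₁.1 * x.2 - x₁.2 * x.1) / d, ?_⟩
    ext <;> simp <;> field_simp <;> rw [hd'] <;> ring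
  have key : ∀ w, rotForm B x₁ w ≠ 0 → rotForm B x₂ w ≠ 0 → rotForm B x w ≠ 0 →
      Φ (.ofAdd (outer 2 2 x w)) = eL x (.ofAdd (outer 2 2 x w)) := by
    intro w h1 h2 h3
    have e1 : Φ (.ofAdd (outer 2 2 x w)) =
      eL x₁ (.ofAdd (outer 2 2 x₁ (a • w))) * eL x₂ (.ofAdd (outer 2 2 x₂ (b • w))) := by
      change eL x₁ (.ofAdd (outer 2 2 x₁ (colCoord x₁ x₂ (outer 2 2 x w)).1)) *
        eL x₂ (.ofAdd (outer 2 2 x₂ (colCoord x₁ x₂ (outer 2 2 x w)).2)) = _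
      rw [hab, colCoord_outer hx]
    rw [e1, eL_eq_eR hag h3 _ _ (o _) (o _), eL_eq_eR hag h1 _ _ (o _) ⟨a, rfl⟩,
      eL_eq_eR hag h2 _ _ (o _) ⟨b, rfl⟩, ← map_mul, ← ofAdd_add, hab, outer_add_left,
      outer_smul_left, outer_smul_left]
  obtain ⟨w, w', hw, a1, a2, b1, b2, c1, c2⟩ :=
    exists_notPar hk (rotForm_left hx1) (rotForm_left hx2) (rotForm_left hxB)
  have h3 : ((Φ.eqLocus (eL x)).toAddSubgroup').comap (outerHom 2 2 x) = ⊤ := by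
    refine eq_top_of_lines _ hw (fun r => ?_) (fun r => ?_)
    all_goals
      rcases eq_or_ne r 0 with rfl | hr
      · rw [zero_smul]; exact zero_mem _
      · refine key _ ?_ ?_ ?_ <;> rw [map_smul] <;> exact smul_ne_zero hr (by assumption)
  have : z ∈ ((Φ.eqLocus (eL x)).toAddSubgroup').comap (outerHom 2 2 x) := by rw [h3]; trivial
  exact this

theorem generates_colSub_rowSub (hk : 5 ≤ ENat.card k) (hB : B ≠ 0) {α β : ℕ}
    (hα : α = 1 ∨ α = 2) (hβ : β = 1 ∨ β = 2) :
    Generates B (colSub (k := k) α β) (rowSub α β) := by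
  rcases hα with rfl | rfl
  · refine generates_of_left_top hk hB (colSub_one β) fun x x' h => ?_
    rcases hβ with rfl | rfl
    · rw [rowSub_one, rowSub_one, sup_idem]
    · exact rowSub_sup h
  · rcases hβ with rfl | rfl
    · exact generates_of_right_top hk hB (rowSub_one 2) fun x x' h => colSub_sup h
    · exact generates_two_two hk hB

theorem extends_colSub_rowSub (hk : 5 ≤ ENat.card k) (hB : B ≠ 0) {α β : ℕ}
    (hα : α = 1 ∨ α = 2) (hβ : β = 1 ∨ β = 2) :
    Extends B (colSub (k := k) α β) (rowSub α β) := by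
  rcases hα with rfl | rfl
  · refine extends_of_left_top hk hB (colSub_one β) fun x x' h => ?_
    rcases hβ with rfl | rfl
    · rw [rowSub_one, rowSub_one, sup_idem]
    · exact rowSub_sup h
  · rcases hβ with rfl | rfl
    · exact extends_of_right_top hk hB (rowSub_one 2) fun x x' h => colSub_sup h
    · exact extends_two_two hk hB

end AffineTwin

namespace AffineTwin

/-! ### Periodic permutations of the integers and their inversions -/

variable {n : ℕ}

theorem intCast_eq_iff {a b : ℤ} : (a : ZMod (2 * n)) = b ↔ ∃ z : ℤ, b = a + 2 * n * z := by
  rw [ZMod.intCast_eq_intCast_iff_dvd_sub]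
  constructor
  · rintro ⟨z, hz⟩
    exact ⟨z, by push_cast at hz; linarith⟩
  · rintro ⟨z, rfl⟩
    exact ⟨z, by push_cast; ring⟩

/-- Functions that commute with the translation by `2n`. -/
def Periodic (n : ℕ) (f : ℤ → ℤ) : Prop := ∀ m, f (m + 2 * n) = f m + 2 * n

theorem Periodic.add_mul {f : ℤ → ℤ} (hf : Periodic n f) (m z : ℤ) :
    f (m + 2 * n * z) = f m + 2 * n * z := by
  induction z using Int.induction_on with
  | zero => simp
  | succ z ih =>
    have := hf (m + 2 * n * z)
    rw [ih] at this
    rw [show m + 2 * n * ((z : ℤ) + 1) = m + 2 * n * z + 2 * n by ring, this]; ring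
  | pred z ih =>
    have := hf (m + 2 * n * (-(z : ℤ) - 1))
    rw [show m + 2 * n * (-(z : ℤ) - 1) + 2 * n = m + 2 * n * (-z) by ring, ih] at this
    linarith

theorem Periodic.symm {f : Equiv.Perm ℤ} (hf : Periodic n f) : Periodic n f.symm := by
  intro m
  apply f.injective
  rw [Equiv.apply_symm_apply, hf, Equiv.apply_symm_apply]

theorem Periodic.comp {f g : ℤ → ℤ} (hf : Periodic n f) (hg : Periodic n g) :
    Periodic n (fun m => f (g m)) := by
  intro m
  change f (g _) = f (g m) + _
  rw [hg, hf]

theorem periodic_add (c : ℤ) : Periodic n (fun m => m + c) := fun m => by ring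

theorem Periodic.bounded [NeZero n] {f : ℤ → ℤ} (hf : Periodic n f) : ∃ C : ℤ, ∀ m, |f m - m| ≤ C := by
  have hn : (0 : ℤ) < 2 * n := by have := NeZero.pos n; positivity
  obtain ⟨C, hC⟩ := ((Set.finite_Ico (0 : ℤ) (2 * n)).image (fun m => |f m - m|)).bddAbove
  refine ⟨C, fun m => ?_⟩
  have h1 : f m = f (m % (2 * n)) + 2 * n * (m / (2 * n)) := by
    rw [← hf.add_mul, Int.emod_add_mul_ediv]
  have h2 := hC ⟨m % (2 * n), ⟨Int.emod_nonneg _ hn.ne', Int.emod_lt_of_pos _ hn⟩, rfl⟩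
  have h3 : m = m % (2 * n) + 2 * n * (m / (2 * n)) := (Int.emod_add_mul_ediv _ _).symm
  have h4 : f m - m = f (m % (2 * n)) - m % (2 * n) := by linarith
  rw [h4]
  exact h2

/-- The projection of `ℤ²` to the orbits of the diagonal translation by `2n`. -/
def orbit (n : ℕ) (p : ℤ × ℤ) : ZMod (2 * n) × ℤ := (p.1, p.2 - p.1)

theorem orbit_eq_iff {p q : ℤ × ℤ} :
    orbit n p = orbit n q ↔ ∃ z : ℤ, q = (p.1 + 2 * n * z, p.2 + 2 * n * z) := by
  rw [orbit, orbit, Prod.mk.injEq, intCast_eq_iff]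
  constructor
  · rintro ⟨⟨z, hz⟩, h⟩
    exact ⟨z, Prod.ext hz (by simp; linarith)⟩
  · rintro ⟨z, rfl⟩
    exact ⟨⟨z, rfl⟩, by simp⟩

/-- After a choice of representatives it is enough that `h` separates orbits; it need not commute
with the translation. -/
theorem ncard_orbit_le {S S' : Set (ℤ × ℤ)} (hS' : (orbit n '' S').Finite) (h : ℤ × ℤ → ℤ × ℤ)
    (hm : Set.MapsTo h S S')
    (hi : ∀ p q, orbit n (h p) = orbit n (h q) → orbit n p = orbit n q) :
    (orbit n '' S).ncard ≤ (orbit n '' S').ncard := by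
  classical
  choose! r hr hr' using fun (x : ZMod (2 * n) × ℤ) (hx : x ∈ orbit n '' S) => hx
  refine Set.ncard_le_ncard_of_injOn (fun x => orbit n (h (r x)))
    (fun x hx => ⟨_, hm (hr x hx), rfl⟩) ?_ hS'
  intro x hx y hy hxy
  rw [← hr' x hx, ← hr' y hy]
  exact hi _ _ hxy

/-- The inversions of a function on the integers. -/
def inversions (f : ℤ → ℤ) : Set (ℤ × ℤ) := {p | p.1 < p.2 ∧ f p.2 < f p.1}

/-- The number of inversions of a periodic function, up to translation. -/
noncomputable def inv (n : ℕ) (f : ℤ → ℤ) : ℕ := (orbit n '' inversions f).ncard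

/-- A periodic function moves integers by at most some C, so the entries of an inversion are at most
2C apart. -/
theorem finite_inversions [NeZero n] {f : ℤ → ℤ} (hf : Periodic n f) :
    (orbit n '' inversions f).Finite := by
  obtain ⟨C, hC⟩ := hf.bounded
  refine ((Set.finite_univ (α := ZMod (2 * n))).prod (Set.finite_Icc (0 : ℤ) (2 * C))).subset ?_
  rintro _ ⟨p, ⟨h1, h2⟩, rfl⟩
  refine ⟨trivial, ?_, ?_⟩
  · change 0 ≤ p.2 - p.1; linarith
  · have a1 := abs_le.1 (hC p.1)
    have a2 := abs_le.1 (hC p.2)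
    change p.2 - p.1 ≤ _
    linarith [a1.1, a1.2, a2.1, a2.2]

theorem inv_add_const (f : ℤ → ℤ) (c : ℤ) : inv n (fun m => f m + c) = inv n f := by
  simp [inv, inversions]

/-- An inversion (a, b) of f⁻¹ corresponds to the inversion (f⁻¹ b, f⁻¹ a) of f. -/
theorem inv_symm_le [NeZero n] {f : Equiv.Perm ℤ} (hf : Periodic n f) : inv n f.symm ≤ inv n f := by
  refine ncard_orbit_le (finite_inversions hf) (fun p => (f.symm p.2, f.symm p.1)) ?_ ?_
  · rintro p ⟨h1, h2⟩
    exact ⟨h2, by simpa using h1⟩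
  · intro p q h
    obtain ⟨z, hz⟩ := orbit_eq_iff.1 h
    refine orbit_eq_iff.2 ⟨z, ?_⟩
    simp only [Prod.mk.injEq, ← hf.symm.add_mul, EmbeddingLike.apply_eq_iff_eq] at hz
    exact Prod.ext hz.2 hz.1

theorem inv_symm [NeZero n] {f : Equiv.Perm ℤ} (hf : Periodic n f) : inv n f.symm = inv n f :=
  le_antisymm (inv_symm_le hf) (by simpa using inv_symm_le hf.symm)

/-- Reversing the order in both source and target preserves inversions. This is needed for ε = -,
where the indices run backwards. -/
theorem inv_reflect_le [NeZero n] {f : ℤ → ℤ} (hf : Periodic n f) (b c : ℤ) :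
    inv n (fun m => b - f (c - m)) ≤ inv n f := by
  refine ncard_orbit_le (S := inversions (fun m => b - f (c - m))) (finite_inversions hf)
    (fun p => (c - p.2, c - p.1)) ?_ ?_
  · rintro p ⟨h1, h2⟩
    refine ⟨by change c - p.2 < c - p.1; linarith, by simp at h2 ⊢; linarith⟩
  · intro p q h
    obtain ⟨z, hz⟩ := orbit_eq_iff.1 h
    refine orbit_eq_iff.2 ⟨-z, ?_⟩
    simp only [Prod.mk.injEq] at hz
    exact Prod.ext (by simp; linarith [hz.2]) (by simp; linarith [hz.1])

theorem inv_reflect [NeZero n] {f : ℤ → ℤ} (hf : Periodic n f) (b c : ℤ) :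
    inv n (fun m => b - f (c - m)) = inv n f := by
  refine le_antisymm (inv_reflect_le hf b c) ?_
  have hf' : Periodic n (fun m => b - f (c - m)) := by
    intro m
    have := hf (c - (m + 2 * n))
    rw [show c - (m + 2 * n) + 2 * n = c - m by ring] at this
    simp only [this]; ring
  have := inv_reflect_le hf' b c
  simpa using this

/-! ### The reflections -/

theorem two_n_one [NeZero n] : (1 : ZMod (2 * n)) ≠ 0 := by
  intro h
  have h2 : ((1 : ℕ) : ZMod (2 * n)) = 0 := by simpa using h
  have h3 := (ZMod.natCast_eq_zero_iff 1 (2 * n)).mp h2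
  have h4 := Nat.dvd_one.mp h3
  omega

theorem s_apply (i : ZMod (2 * n)) (m : ℤ) : s n i m = reflectionFun n i m := rfl

theorem s_s (i : ZMod (2 * n)) (m : ℤ) : s n i (s n i m) = m := reflectionFun_involutive n i m

theorem s_mul_self (i : ZMod (2 * n)) : s n i * s n i = 1 := Equiv.ext (s_s i)

theorem s_of_eq {i : ZMod (2 * n)} {m : ℤ} (h : (m : ZMod (2 * n)) = i) : s n i m = m - 1 := by
  rw [s_apply, reflectionFun, if_pos h]

theorem s_of_add_one_eq {i : ZMod (2 * n)} {m : ℤ} (h : ((m + 1 : ℤ) : ZMod (2 * n)) = i) :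
    s n i m = m + 1 := by
  have := s_s i (m + 1)
  rwa [s_of_eq h, add_sub_cancel_right] at this

theorem s_of_ne {i : ZMod (2 * n)} {m : ℤ} (h : (m : ZMod (2 * n)) ≠ i)
    (h' : ((m + 1 : ℤ) : ZMod (2 * n)) ≠ i) : s n i m = m := by
  rw [s_apply, reflectionFun, if_neg h, if_neg h']

theorem periodic_s (i : ZMod (2 * n)) : Periodic n (s n i) := by
  intro m
  have h : ∀ m : ℤ, ((m + 2 * n : ℤ) : ZMod (2 * n)) = m := fun m =>
    (intCast_eq_iff.2 ⟨1, by ring⟩).symm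
  simp only [s_apply, reflectionFun, h, show m + 2 * (n : ℤ) + 1 = (m + 1) + 2 * n by ring]
  split_ifs <;> ring

/-- Every integer moves by at most one, so the order of a and b is reversed only if they are
neighbours that are interchanged. -/
theorem s_lt_s [NeZero n] {i : ZMod (2 * n)} {a b : ℤ} (hab : a < b)
    (h : ¬ ((b : ZMod (2 * n)) = i ∧ a = b - 1)) : s n i a < s n i b := by
  have hle : ∀ m, s n i m ≤ m + 1 ∧ m - 1 ≤ s n i m := by
    intro m
    rw [s_apply, reflectionFun]
    split_ifs <;> omega
  have h1 := hle a
  have h2 := hle b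
  have hne : s n i a ≠ s n i b := fun h => hab.ne ((s n i).injective h)
  by_contra hcon
  push Not at hcon
  have hlt : s n i b < s n i a := lt_of_le_of_ne hcon (Ne.symm hne)
  -- only `b = a + 1` is possible
  by_cases hb : (b : ZMod (2 * n)) = i
  · rw [s_of_eq hb] at hlt
    have : a = b - 1 := by omega
    exact h ⟨hb, this⟩
  · have h3 : b ≤ s n i b := by
      rw [s_apply, reflectionFun, if_neg hb]
      split_ifs <;> omega
    omega

/-- Apart from the orbit of (i - 1, i), the reflection carries the inversions of f to those of f ∘
s; as it is an involution, the same map gives both inequalities. -/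
theorem inv_comp_s [NeZero n] {f : ℤ → ℤ} (hf : Periodic n f) {i : ℤ} (h : f i < f (i - 1)) :
    inv n (fun m => f (s n i m)) + 1 = inv n f := by
  have e1 : orbit n '' inversions f =
      insert (orbit n (i - 1, i)) (orbit n '' (inversions f \ {p | orbit n p = orbit n (i - 1, i)})) := by
    ext x
    simp only [Set.mem_image, Set.mem_insert_iff, Set.mem_sdiff, Set.mem_ofPred_eq]
    constructor
    · rintro ⟨p, hp, rfl⟩
      by_cases hpi : orbit n p = orbit n (i - 1, i)
      · exact .inl hpi
      · exact .inr ⟨p, ⟨hp, hpi⟩, rfl⟩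
    · rintro (rfl | ⟨p, ⟨hp, -⟩, rfl⟩)
      · exact ⟨_, ⟨by simp, h⟩, rfl⟩
      · exact ⟨p, hp, rfl⟩
  have hnot : ∀ p : ℤ × ℤ, p.1 < p.2 → orbit n p ≠ orbit n (i - 1, i) →
      s n i p.1 < s n i p.2 := by
    intro p hp hne
    refine s_lt_s hp ?_
    rintro ⟨h1, h2⟩
    apply hne
    rw [orbit, orbit, Prod.mk.injEq, h2]
    push_cast
    exact ⟨by rw [h1], by ring⟩
  have hor : ∀ p q : ℤ × ℤ, orbit n (s n i p.1, s n i p.2) = orbit n (s n i q.1, s n i q.2) →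
      orbit n p = orbit n q := by
    intro p q hpq
    obtain ⟨z, hz⟩ := orbit_eq_iff.1 hpq
    refine orbit_eq_iff.2 ⟨z, ?_⟩
    simp only [Prod.mk.injEq, ← (periodic_s _).add_mul, EmbeddingLike.apply_eq_iff_eq] at hz
    exact Prod.ext hz.1 hz.2
  have hper : Periodic n (fun m => f (s n i m)) := hf.comp (periodic_s _)
  have hpair : ∀ p : ℤ × ℤ, orbit n p = orbit n (i - 1, i) → f p.2 < f p.1 ∧
      s n i p.1 = p.1 + 1 ∧ s n i p.2 = p.2 - 1 ∧ p.2 = p.1 + 1 := by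
    intro p hp
    obtain ⟨z, rfl⟩ := orbit_eq_iff.1 hp.symm
    have hi : ((i + 2 * n * z : ℤ) : ZMod (2 * n)) = i := (intCast_eq_iff.2 ⟨z, rfl⟩).symm
    refine ⟨by simp only [hf.add_mul]; linarith, ?_, s_of_eq hi, by simp; ring⟩
    refine s_of_add_one_eq ?_
    rw [← hi]; congr 1; ring
  have e2 : (orbit n '' (inversions f \ {p | orbit n p = orbit n (i - 1, i)})).ncard =
      inv n (fun m => f (s n i m)) := by
    have hfin : (orbit n '' (inversions f \ {p | orbit n p = orbit n (i - 1, i)})).Finite :=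
      (finite_inversions hf).subset (Set.image_mono Set.sdiff_subset)
    refine le_antisymm (ncard_orbit_le (finite_inversions hper)
      (fun p => (s n i p.1, s n i p.2)) ?_ hor) (ncard_orbit_le hfin
      (fun p => (s n i p.1, s n i p.2)) ?_ hor)
    · rintro p ⟨⟨h1, h2⟩, h3⟩
      exact ⟨hnot p h1 h3, by simpa [s_s] using h2⟩
    · rintro p ⟨h1, h2⟩
      simp only at h2
      have hne : orbit n p ≠ orbit n (i - 1, i) := by
        intro hp
        obtain ⟨a1, a2, a3, a4⟩ := hpair p hp
        rw [a2, a3] at h2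
        rw [show p.1 + 1 = p.2 by omega, show p.2 - 1 = p.1 by omega] at h2
        omega
      refine ⟨⟨hnot p h1 hne, h2⟩, fun hp => ?_⟩
      obtain ⟨-, a2, a3, a4⟩ := hpair _ hp
      simp only [s_s] at a2 a3 a4
      omega
  rw [← e2, inv, e1, Set.ncard_insert_of_notMem _ ?_]
  · rintro ⟨p, ⟨-, hp⟩, hp'⟩
    exact hp hp'
  · exact (finite_inversions hf).subset (Set.image_mono Set.sdiff_subset)

theorem inv_comp_s_le [NeZero n] {f : Equiv.Perm ℤ} (hf : Periodic n f) (i : ℤ) :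
    inv n (fun m => f (s n i m)) ≤ inv n f + 1 := by
  rcases lt_trichotomy (f i) (f (i - 1)) with h | h | h
  · have := inv_comp_s hf h; omega
  · have := f.injective h; omega
  · have h2 := inv_comp_s (f := fun m => f (s n i m)) (i := i) (hf.comp (periodic_s _)) (by
      rw [s_of_eq rfl, s_of_add_one_eq (m := i - 1) (by simp)]
      simpa using h)
    simp only [s_s] at h2
    exact h2.ge

end AffineTwin

/-! ### The Weyl group as the periodic permutations of displacement zero. -/

namespace AffineTwin

set_option linter.unusedSectionVars false

variable {n : ℕ} [NeZero n]

/-- The total displacement of a periodic function on a period. -/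
def displacement (n : ℕ) [NeZero n] (f : ℤ → ℤ) : ℤ :=
  ∑ r : ZMod (2 * n), (f (r.val : ℤ) - (r.val : ℤ))

theorem Periodic.sub_eq {f : ℤ → ℤ} (hf : Periodic n f) {a b : ℤ}
    (h : (a : ZMod (2 * n)) = b) : f a - a = f b - b := by
  obtain ⟨z, rfl⟩ := intCast_eq_iff.1 h
  rw [hf.add_mul]; ring

theorem val_intCast (r : ZMod (2 * n)) : (((r.val : ℕ) : ℤ) : ZMod (2 * n)) = r := by simp

/-- The difference f m - m depends only on the residue of m, and g permutes the residues. -/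
theorem displacement_comp {f : ℤ → ℤ} {g : Equiv.Perm ℤ} (hf : Periodic n f) (hg : Periodic n g) :
    displacement n (fun m => f (g m)) = displacement n f + displacement n g := by
  let e : ZMod (2 * n) → ZMod (2 * n) := fun r => ((g (r.val : ℤ) : ℤ) : ZMod (2 * n))
  have he : Function.Bijective e := by
    rw [← Finite.injective_iff_bijective]
    intro a b hab
    obtain ⟨z, hz⟩ := intCast_eq_iff.1 hab
    rw [← hg.add_mul, EmbeddingLike.apply_eq_iff_eq] at hz
    rw [← val_intCast a, ← val_intCast b]
    exact intCast_eq_iff.2 ⟨z, hz⟩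
  unfold displacement
  rw [← he.sum_comp (fun r => f (r.val : ℤ) - (r.val : ℤ)), ← Finset.sum_add_distrib]
  refine Finset.sum_congr rfl fun r _ => ?_
  have h1 := hf.sub_eq (a := ((e r).val : ℤ)) (b := g (r.val : ℤ)) (val_intCast _)
  linarith

theorem displacement_add (c : ℤ) : displacement n (fun m => m + c) = 2 * n * c := by
  simp [displacement, ZMod.card]

theorem displacement_id : displacement n id = 0 := by simp [displacement]

theorem displacement_s (i : ZMod (2 * n)) : displacement n (s n i) = 0 := by
  have h := displacement_comp (periodic_s i) (periodic_s i)
  simp only [s_s] at h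
  have h2 : displacement n (fun m => m) = 0 := displacement_id
  rw [h2] at h
  omega

theorem inv_id : inv n id = 0 := by
  have : inversions id = ∅ := by
    ext p; simp [inversions]; exact fun h => h.le
  rw [inv, this]; simp

theorem inv_prod_le (L : List (ZMod (2 * n))) :
    Periodic n ((L.map (s n)).prod : Equiv.Perm ℤ) ∧
      displacement n ((L.map (s n)).prod : Equiv.Perm ℤ) = 0 ∧
      inv n ((L.map (s n)).prod : Equiv.Perm ℤ) ≤ L.length := by
  induction L using List.reverseRecOn with
  | nil => exact ⟨fun _ => rfl, displacement_id, (inv_id (n := n)).le⟩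
  | append_singleton L i ih =>
    obtain ⟨h1, h2, h3⟩ := ih
    have e : ⇑((List.map (s n) (L ++ [i])).prod) = fun m => (L.map (s n)).prod (s n i m) := by
      rw [List.map_append, List.prod_append]; simp
      rfl
    rw [e]
    refine ⟨h1.comp (periodic_s i), ?_, ?_⟩
    · rw [displacement_comp h1 (periodic_s i), h2, displacement_s]; rfl
    · obtain ⟨i, rfl⟩ := ZMod.intCast_surjective i
      have := inv_comp_s_le h1 i
      simp only [List.length_append, List.length_singleton]
      omega

/-- Without inversions f is an increasing bijection of ℤ, hence a translation, and displacement zero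
leaves only the identity. -/
theorem eq_one_of_inv_eq_zero {f : Equiv.Perm ℤ} (hf : Periodic n f) (hd : displacement n f = 0)
    (h : inv n f = 0) : f = 1 := by
  have h1 : ∀ i, f i < f (i + 1) := by
    intro i
    by_contra hcon
    rcases lt_or_eq_of_le (not_lt.1 hcon) with h2 | h2
    · have := inv_comp_s hf (i := i + 1) (by simpa using h2)
      omega
    · have := f.injective h2
      omega
  have hm : StrictMono f := strictMono_int_of_lt_succ h1
  have h2 : ∀ i, f (i + 1) = f i + 1 := by
    intro i
    obtain ⟨x, hx⟩ := f.surjective (f i + 1)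
    have h3 : i < x := hm.lt_iff_lt.1 (by omega)
    have h4 : f (i + 1) ≤ f x := hm.monotone (by omega)
    have := h1 i
    omega
  have h3 : ∀ i, f i = i + f 0 := by
    intro i
    induction i using Int.induction_on with
    | zero => simp
    | succ i ih => rw [h2, ih]; ring
    | pred i ih =>
      have := h2 (-(i : ℤ) - 1)
      rw [sub_add_cancel, ih] at this
      linarith
  have h4 : displacement n f = 2 * n * f 0 := by
    rw [← displacement_add]; congr 1; funext m; exact h3 m
  have h5 : f 0 = 0 := by
    have hn : (n : ℤ) ≠ 0 := by exact_mod_cast NeZero.ne n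
    rw [hd] at h4
    exact (mul_eq_zero.1 h4.symm).resolve_left (by simpa using hn)
  refine Equiv.ext fun i => ?_
  rw [h3, h5]; simp

/-- Sorting: composition with a reflection at a descent removes exactly one inversion and keeps the
displacement. -/
theorem exists_word (r : ℕ) : ∀ {f : Equiv.Perm ℤ}, Periodic n f → displacement n f = 0 →
    inv n f = r → ∃ L : List (ZMod (2 * n)), L.length = r ∧ (L.map (s n)).prod = f := by
  induction r with
  | zero =>
    intro f hf hd h
    exact ⟨[], rfl, (eq_one_of_inv_eq_zero hf hd h).symm⟩
  | succ r ih =>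
    intro f hf hd h
    obtain ⟨i, hi⟩ : ∃ i, f i < f (i - 1) := by
      by_contra! hcon
      have h1 : ∀ p : ℤ × ℤ, p ∉ inversions f := by
        have hm : Monotone f := monotone_int_of_le_succ fun i => by simpa using hcon (i + 1)
        rintro p ⟨h1, h2⟩
        exact absurd (hm h1.le) (not_le.2 h2)
      rw [inv, Set.eq_empty_of_forall_notMem h1] at h
      simp at h
    have h1 := inv_comp_s hf hi
    obtain ⟨L, hL, hL'⟩ := ih (f := f * s n i) (hf.comp (periodic_s _))
      ((displacement_comp hf (periodic_s _)).trans (by rw [hd, displacement_s]; rfl))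
      (by rw [h] at h1; exact Nat.succ_injective h1)
    refine ⟨L ++ [(i : ZMod (2 * n))], by simp [hL], ?_⟩
    rw [List.map_append, List.prod_append, hL']
    simp [mul_assoc, s_mul_self]

theorem mem_W_iff {f : Equiv.Perm ℤ} : f ∈ W n ↔ Periodic n f ∧ displacement n f = 0 := by
  constructor
  · intro h
    have : ∃ L : List (ZMod (2 * n)), (L.map (s n)).prod = f := by
      induction h using Subgroup.closure_induction with
      | mem x hx => obtain ⟨i, rfl⟩ := hx; exact ⟨[i], by simp⟩
      | one => exact ⟨[], rfl⟩
      | mul x y _ _ hx hy =>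
        obtain ⟨L, rfl⟩ := hx
        obtain ⟨L', rfl⟩ := hy
        exact ⟨L ++ L', by simp⟩
      | inv x _ hx =>
        obtain ⟨L, rfl⟩ := hx
        refine ⟨L.reverse, ?_⟩
        rw [List.prod_inv_reverse, List.map_map, List.map_reverse]
        congr 2
    obtain ⟨L, rfl⟩ := this
    exact ⟨(inv_prod_le L).1, (inv_prod_le L).2.1⟩
  · rintro ⟨h1, h2⟩
    obtain ⟨L, -, rfl⟩ := exists_word _ h1 h2 rfl
    refine list_prod_mem ?_
    intro x hx
    obtain ⟨i, -, rfl⟩ := List.mem_map.1 hx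
    exact Subgroup.subset_closure ⟨i, rfl⟩

/-- Sorting gives one inequality; the other holds because a generator adds at most one inversion.
From here on lengths are counted by inversions. -/
theorem length_eq (w : W n) : length w = inv n (w : Equiv.Perm ℤ) := by
  obtain ⟨h1, h2⟩ := mem_W_iff.1 w.2
  refine le_antisymm (Nat.sInf_le (exists_word _ h1 h2 rfl)) ?_
  refine le_csInf ⟨_, exists_word _ h1 h2 rfl⟩ ?_
  rintro r ⟨L, rfl, hL⟩
  rw [← hL]
  exact (inv_prod_le L).2.2

/-! ### Permutations with `j (j m) = m - 2n` -/

/-- The permutations `j` describing the position of a chamber relative to its image under `θ`. -/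
structure IsTwist (n : ℕ) (j : ℤ → ℤ) : Prop where
  per : Periodic n j
  twist : ∀ m, j (j m) = m - 2 * n

namespace IsTwist

variable {j : ℤ → ℤ}

theorem injective (hj : IsTwist n j) : Function.Injective j := by
  intro a b h
  have := congrArg j h
  rw [hj.twist, hj.twist] at this
  omega

/-- The permutation of the integers. -/
@[simps] def perm (hj : IsTwist n j) : Equiv.Perm ℤ where
  toFun := j
  invFun m := j m + 2 * n
  left_inv m := by simp [hj.twist]
  right_inv m := by simp [hj.per _, hj.twist]

/-- Twice the displacement is that of the translation by -2n, namely -4n². -/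
theorem displacement_eq (hj : IsTwist n j) : displacement n j = - (2 * n * n) := by
  have h := displacement_comp (f := j) (g := hj.perm) hj.per hj.per
  have h2 : (fun m => j (hj.perm m)) = fun m => m + - (2 * (n : ℤ)) := by
    funext m; simp [hj.twist]; ring
  rw [h2, displacement_add] at h
  change _ = displacement n j + displacement n j at h
  have : 2 * displacement n j = 2 * (- (2 * n * n)) := by rw [two_mul, ← h]; ring
  omega

/-- Conjugation removes two inversions: one on the right and, after passing to the inverse, one on
the left. The second descent could fail only if the reflection interchanged j i and j (i - 1). -/
theorem inv_conj_lt (hj : IsTwist n j) {i : ℤ} (h : j i < j (i - 1)) :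
    inv n (fun m => s n i (j (s n i m))) < inv n j := by
  have h1 := inv_comp_s hj.per h
  obtain ⟨g, hg⟩ : ∃ g : Equiv.Perm ℤ, g = hj.perm * s n (i : ZMod (2 * n)) := ⟨_, rfl⟩
  have hgp : Periodic n g := by rw [hg]; exact hj.per.comp (periodic_s _)
  have hgs : ∀ m, g.symm m = s n i (j m) + 2 * n := by
    intro m
    rw [Equiv.symm_apply_eq, hgp, hg]
    simp [s_s, hj.twist]
  have h3 : s n i (j i) < s n i (j (i - 1)) := by
    refine s_lt_s h ?_
    -- In this case j (j i) = i + 4nz for some z, which differs from i - 2n by parity.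
    rintro ⟨e1, e2⟩
    obtain ⟨z, hz⟩ := intCast_eq_iff.1 e1.symm
    have e3 : j i = i - 1 + 2 * n * z := by rw [e2, hz]; ring
    have e4 := hj.twist i
    rw [e3, hj.per.add_mul, hz] at e4
    have hn : (n : ℤ) ≠ 0 := by exact_mod_cast NeZero.ne n
    have : (2 * (n : ℤ)) * (2 * z) = 2 * n * (-1) := by linarith
    have := mul_left_cancel₀ (by positivity) this
    omega
  have h4 := inv_comp_s (f := g.symm) hgp.symm (i := i) (by rw [hgs, hgs]; linarith)
  have h5 : inv n (fun m => s n i (j (s n i m))) = inv n (fun m => g.symm (s n i m)) := by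
    obtain ⟨q, hq⟩ : ∃ q : Equiv.Perm ℤ, q = s n (i : ZMod (2 * n)) * g := ⟨_, rfl⟩
    have e : ⇑q = fun m => s n i (j (s n i m)) := by rw [hq, hg]; rfl
    have e2 : ⇑q.symm = fun m => g.symm (s n i m) := by
      funext m
      rw [Equiv.symm_apply_eq, hq, Equiv.Perm.mul_apply, Equiv.apply_symm_apply, s_s]
    rw [← e, ← e2, inv_symm (f := q)]
    rw [hq]
    exact (periodic_s _).comp hgp
  have h6 : inv n g.symm = inv n g := inv_symm hgp
  have h7 : inv n g = inv n (fun m => j (s n i m)) := by rw [hg]; rfl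
  omega

end IsTwist

end AffineTwin

/-! ### Positions without inversions inside blocks. -/

namespace AffineTwin

set_option linter.unusedSectionVars false

variable {n : ℕ} [NeZero n]

/-- `j` has no inversions inside the blocks of type `J`. -/
def NoInv (J : Set (ZMod (2 * n))) (j : ℤ → ℤ) : Prop :=
  ∀ i : ℤ, (i : ZMod (2 * n)) ∈ J → j (i - 1) < j i

variable {J : Set (ZMod (2 * n))} {j j' : ℤ → ℤ}

theorem NoInv.lt (h : NoInv J j) {f x y : ℤ} (hf : ∀ i : ℤ, f < i → i ≤ y → (i : ZMod (2 * n)) ∈ J)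
    (hx : f ≤ x) (hxy : x < y) : j x < j y := by
  obtain ⟨d, rfl⟩ : ∃ d : ℕ, y = x + 1 + d := ⟨(y - x - 1).toNat, by omega⟩
  clear hxy
  induction d with
  | zero => simpa using h (x + 1) (hf _ (by omega) (by simp))
  | succ d ih =>
    refine (ih fun i h1 h2 => hf i h1 (by push_cast; omega)).trans ?_
    have := h (x + 1 + (d + 1 : ℕ)) (hf _ (by omega) le_rfl)
    rwa [show x + 1 + ((d + 1 : ℕ) : ℤ) - 1 = x + 1 + d by push_cast; ring] at this

/-- The block of an integer. -/
theorem exists_block (hJ : ∃ r, r ∉ J) (x : ℤ) : ∃ f f' : ℤ, f ≤ x ∧ x < f' ∧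
    (f : ZMod (2 * n)) ∉ J ∧ (f' : ZMod (2 * n)) ∉ J ∧
    ∀ i : ℤ, f < i → i < f' → (i : ZMod (2 * n)) ∈ J := by
  obtain ⟨r, hr⟩ := hJ
  obtain ⟨r, rfl⟩ := ZMod.intCast_surjective r
  have hn : (0 : ℤ) < 2 * n := by have := NeZero.pos n; positivity
  have hmem : ∀ z : ℤ, ((r + 2 * n * z : ℤ) : ZMod (2 * n)) = r := fun z =>
    (intCast_eq_iff.2 ⟨z, rfl⟩).symm
  have hab : |r - x| ≤ 2 * n * |r - x| := by nlinarith [abs_nonneg (r - x)]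
  obtain ⟨f, ⟨hf1, hf2⟩, hf3⟩ := Int.exists_greatest_of_bdd
    (P := fun f => f ≤ x ∧ (f : ZMod (2 * n)) ∉ J) ⟨x, fun z hz => hz.1⟩
    ⟨r + 2 * n * (-|r - x|), by have := le_abs_self (r - x); linarith, by rwa [hmem]⟩
  obtain ⟨f', ⟨hf1', hf2'⟩, hf3'⟩ := Int.exists_least_of_bdd
    (P := fun f => x < f ∧ (f : ZMod (2 * n)) ∉ J) ⟨x, fun z hz => hz.1.le⟩
    ⟨r + 2 * n * (|r - x| + 1), by have := neg_abs_le (r - x); linarith, by rwa [hmem]⟩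
  refine ⟨f, f', hf1, hf1', hf2, hf2', fun i h1 h2 => ?_⟩
  by_contra hi
  rcases le_or_gt i x with h3 | h3
  · exact absurd (hf3 i ⟨h3, hi⟩) (not_le.2 h1)
  · exact absurd (hf3' i ⟨h3, hi⟩) (not_le.2 h2)

theorem finite_counts (hj : Periodic n j) (f g : ℤ) : {m | f ≤ m ∧ j m < g}.Finite := by
  obtain ⟨C, hC⟩ := hj.bounded
  refine (Set.finite_Icc f (g + C)).subset ?_
  rintro m ⟨h1, h2⟩
  have := (abs_le.1 (hC m)).1
  exact ⟨h1, by linarith⟩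

/-- On a block from f to f' both functions increase, so the indices sent below g form an initial
segment. Its size is the difference of the counts for f and f', and it determines the segment. -/
theorem lt_iff_of_counts (hJ : ∃ r, r ∉ J) (hj : IsTwist n j) (hj' : IsTwist n j')
    (h : NoInv J j) (h' : NoInv J j')
    (hc : ∀ f g : ℤ, (f : ZMod (2 * n)) ∉ J → (g : ZMod (2 * n)) ∉ J →
      {m | f ≤ m ∧ j m < g}.ncard = {m | f ≤ m ∧ j' m < g}.ncard)
    (x g : ℤ) (hg : (g : ZMod (2 * n)) ∉ J) : j x < g ↔ j' x < g := by
  obtain ⟨f, f', hfx, hxf, hf, hf', hb⟩ := exists_block hJ x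
  have hsplit : ∀ j, IsTwist n j → {m | f ≤ m ∧ j m < g}.ncard =
      {m | (f ≤ m ∧ m < f') ∧ j m < g}.ncard + {m | f' ≤ m ∧ j m < g}.ncard := by
    intro j hj
    rw [← Set.ncard_union_eq ?_ ?_ ?_]
    · congr 1
      ext m
      simp only [Set.mem_ofPred_eq, Set.mem_union]
      constructor
      · rintro ⟨h1, h2⟩
        rcases lt_or_ge m f' with h3 | h3
        · exact .inl ⟨⟨h1, h3⟩, h2⟩
        · exact .inr ⟨h3, h2⟩
      · rintro (⟨⟨h1, -⟩, h2⟩ | ⟨h1, h2⟩)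
        · exact ⟨h1, h2⟩
        · exact ⟨by omega, h2⟩
    · rw [Set.disjoint_left]
      rintro m ⟨⟨-, h1⟩, -⟩ ⟨h2, -⟩
      omega
    · exact (finite_counts hj.per f g).subset fun m hm => ⟨hm.1.1, hm.2⟩
    · exact finite_counts hj.per f' g
  have hcard : {m | (f ≤ m ∧ m < f') ∧ j m < g}.ncard =
      {m | (f ≤ m ∧ m < f') ∧ j' m < g}.ncard := by
    have h1 := hsplit j hj
    have h2 := hsplit j' hj'
    rw [hc f g hf hg, hc f' g hf' hg] at h1
    omega
  have hfin : ∀ j, IsTwist n j → {m | (f ≤ m ∧ m < f') ∧ j m < g}.Finite := fun j hj =>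
    (finite_counts hj.per f g).subset fun m hm => ⟨hm.1.1, hm.2⟩
  have hdown : ∀ j, NoInv J j → ∀ a b, f ≤ a → a < b → b < f' → j b < g → j a < g := by
    intro j h a b h1 h2 h3 h4
    exact (h.lt (f := f) (fun i hi hi' => hb i hi (by omega)) h1 h2).trans h4
  have heq : {m | (f ≤ m ∧ m < f') ∧ j m < g} = {m | (f ≤ m ∧ m < f') ∧ j' m < g} := by
    by_cases hsub : {m | (f ≤ m ∧ m < f') ∧ j m < g} ⊆ {m | (f ≤ m ∧ m < f') ∧ j' m < g}
    · exact Set.eq_of_subset_of_ncard_le hsub hcard.ge (hfin j' hj')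
    · obtain ⟨a, ⟨ha1, ha2⟩, ha3⟩ := Set.not_subset.1 hsub
      refine (Set.eq_of_subset_of_ncard_le ?_ hcard.le (hfin j hj)).symm
      rintro b ⟨hb1, hb2⟩
      refine ⟨hb1, ?_⟩
      rcases lt_trichotomy a b with h3 | rfl | h3
      · exact absurd ⟨ha1, hdown j' h' a b ha1.1 h3 hb1.2 hb2⟩ ha3
      · exact ha2
      · exact hdown j h b a hb1.1 h3 ha1.2 ha2
  have := Set.ext_iff.1 heq x
  simpa [hfx, hxf] using this

/-- A permutation without inversions inside the blocks is determined by the numbers of elements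
that it sends from one block to another. -/
theorem IsTwist.eq_of_counts (hJ : ∃ r, r ∉ J) (hj : IsTwist n j) (hj' : IsTwist n j')
    (h : NoInv J j) (h' : NoInv J j')
    (hc : ∀ f g : ℤ, (f : ZMod (2 * n)) ∉ J → (g : ZMod (2 * n)) ∉ J →
      {m | f ≤ m ∧ j m < g}.ncard = {m | f ≤ m ∧ j' m < g}.ncard) : j = j' := by
  have key := lt_iff_of_counts hJ hj hj' h h' hc
  funext x
  obtain ⟨g, g', hgx, hxg, hg, hg', hb⟩ := exists_block hJ (j x)
  -- On the block of j x the inverse of j, which is j + 2n, increases as well. So j x - g counts the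
  -- y < x that are sent into this block.
  have hcount : ∀ j, IsTwist n j → NoInv J j → g ≤ j x → j x < g' →
      (({y | (g ≤ j y ∧ j y < g') ∧ y < x}.ncard : ℕ) : ℤ) = j x - g := by
    intro j hj h h1 h2
    have e : j '' {y | (g ≤ j y ∧ j y < g') ∧ y < x} = Set.Ico g (j x) := by
      have hlt : ∀ a b, g ≤ a → a < b → b < g' → j a < j b := fun a b h3 h4 h5 =>
        h.lt (f := g) (fun i hi hi' => hb i hi (by omega)) h3 h4
      ext z
      constructor
      · rintro ⟨y, ⟨⟨h3, h4⟩, h5⟩, rfl⟩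
        refine ⟨h3, ?_⟩
        by_contra hcon
        rcases lt_or_eq_of_le (not_lt.1 hcon) with h6 | h6
        · have := hlt _ _ h1 h6 h4
          rw [hj.twist, hj.twist] at this
          omega
        · exact h5.ne (hj.injective h6).symm
      · rintro ⟨h3, h4⟩
        obtain ⟨y, rfl⟩ := hj.perm.surjective z
        simp only [IsTwist.perm_apply] at h3 h4 ⊢
        refine ⟨y, ⟨⟨h3, by omega⟩, ?_⟩, rfl⟩
        have := hlt _ _ h3 h4 h2
        rw [hj.twist, hj.twist] at this
        omega
    rw [← Set.ncard_image_of_injective _ hj.injective, e, Set.ncard_eq_toFinset_card']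
    simp
    omega
  have e1 := hcount j hj h hgx hxg
  have hgx' : g ≤ j' x := not_lt.1 fun h0 => absurd ((key x g hg).2 h0) (not_lt.2 hgx)
  have hxg' : j' x < g' := (key x g' hg').1 hxg
  have e2 := hcount j' hj' h' hgx' hxg'
  have e3 : {y | (g ≤ j y ∧ j y < g') ∧ y < x} = {y | (g ≤ j' y ∧ j' y < g') ∧ y < x} := by
    ext y
    simp only [Set.mem_ofPred_eq, key y g' hg', ← not_lt, key y g hg]
  rw [e3, e2] at e1
  omega

end AffineTwin

namespace AffineTwin

set_option linter.unusedSectionVars false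

/-! ### Periodic filtrations of a vector space with a twisted symmetric form -/

/-- A bilinear form `b` with `b u v = b v (T u)` for an automorphism `T`. -/
structure TwistedForm (k E : Type*) [Field k] [AddCommGroup E] [Module k E] where
  T : E ≃ₗ[k] E
  b : E →ₗ[k] E →ₗ[k] k
  twist : ∀ u v, b u v = b v (T u)

namespace TwistedForm

variable {k E : Type*} [Field k] [AddCommGroup E] [Module k E] (X : TwistedForm k E) (n : ℕ)
  {F F' : ℤ → Submodule k E} {a : ℤ → E} {j : ℤ → ℤ}

theorem b_T (u v : E) : X.b (X.T u) (X.T v) = X.b u v := by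
  rw [X.twist u v, X.twist v]

/-- The orthogonal space of `F g`. -/
def perp (F : ℤ → Submodule k E) (g : ℤ) : Submodule k E where
  carrier := {x | ∀ u ∈ F g, X.b u x = 0}
  zero_mem' := fun u _ => map_zero _
  add_mem' := fun {x y} hx hy u hu => by rw [map_add, hx u hu, hy u hu, add_zero]
  smul_mem' := fun r x hx u hu => by rw [map_smul, hx u hu, smul_zero]

variable {X}

theorem mem_perp {g : ℤ} {x : E} : x ∈ X.perp F g ↔ ∀ u ∈ F g, X.b u x = 0 := Iff.rfl

variable (X)

/-- The periodic complete filtrations for which the form is nondegenerate in a suitable sense. -/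
structure Filt (F : ℤ → Submodule k E) : Prop where
  anti : ∀ l, F (l + 1) ≤ F l
  per : ∀ l x, x ∈ F l ↔ X.T x ∈ F (l + 2 * n)
  ne : ∀ l, ∃ x ∈ F l, x ∉ F (l + 1)
  codim : ∀ l, ∀ x ∈ F l, x ∉ F (l + 1) → ∀ y ∈ F l, ∃ r : k, y - r • x ∈ F (l + 1)
  exhaust : ∀ x, ∃ l, x ∈ F l
  exhaust_perp : ∀ x, ∃ l, x ∈ X.perp F l
  separated : ∃ D : ℤ, ∀ l, ∀ x ∈ F (l + D), x ∈ X.perp F l → x = 0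
  represent : ∀ (φ : E →ₗ[k] k) (f g : ℤ), (∀ x ∈ F f, φ x = 0) → (∀ x ∈ X.perp F g, φ x = 0) →
    ∃ y, ∀ x, φ x = X.b x y

/-- A basis adapted to the filtration `F` and the orthogonal filtration, with relative position `j`. -/
structure Frame (F : ℤ → Submodule k E) (a : ℤ → E) (j : ℤ → ℤ) : Prop where
  aper : ∀ m, a (m + 2 * n) = X.T (a m)
  jper : Periodic n j
  inj : Function.Injective j
  mem : ∀ m, a m ∈ F m
  notMem : ∀ m, a m ∉ F (m + 1)
  mem_perp : ∀ m, a m ∈ X.perp F (j m + 1)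
  notMem_perp : ∀ m, a m ∉ X.perp F (j m)
  span : Submodule.span k (Set.range a) = ⊤

variable {X n}

section Filt

variable (hF : X.Filt n F)
include hF

theorem Filt.antitone : Antitone F := antitone_int_of_succ_le hF.anti

theorem Filt.perp_mono : Monotone (X.perp F) := fun _ _ hgh _ hx u hu =>
  hx u (hF.antitone hgh hu)

theorem Filt.perp_per (g : ℤ) (x : E) : x ∈ X.perp F g ↔ X.T x ∈ X.perp F (g + 2 * n) := by
  constructor
  · intro h u hu
    obtain ⟨v, rfl⟩ := X.T.surjective u
    rw [b_T]
    exact h v ((hF.per g v).2 hu)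
  · intro h u hu
    rw [← b_T]
    exact h _ ((hF.per g u).1 hu)

theorem Filt.per_zpow (z l : ℤ) (x : E) : x ∈ F l ↔ (X.T ^ z) x ∈ F (l + 2 * n * z) := by
  induction z using Int.induction_on with
  | zero => simp
  | succ z ih =>
    rw [ih, hF.per, show l + 2 * n * ((z : ℤ) + 1) = l + 2 * n * z + 2 * n by ring,
      ← LinearEquiv.mul_apply, ← zpow_one_add, add_comm 1]
  | pred z ih =>
    rw [ih, hF.per (l + 2 * n * (-(z : ℤ) - 1)),
      show l + 2 * n * (-(z : ℤ) - 1) + 2 * n = l + 2 * n * (-z) by ring,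
      ← LinearEquiv.mul_apply, ← zpow_one_add]
    simp

theorem Filt.perp_per_zpow (z l : ℤ) (x : E) :
    x ∈ X.perp F l ↔ (X.T ^ z) x ∈ X.perp F (l + 2 * n * z) := by
  induction z using Int.induction_on with
  | zero => simp
  | succ z ih =>
    rw [ih, hF.perp_per, show l + 2 * n * ((z : ℤ) + 1) = l + 2 * n * z + 2 * n by ring,
      ← LinearEquiv.mul_apply, ← zpow_one_add, add_comm 1]
  | pred z ih =>
    rw [ih, hF.perp_per (l + 2 * n * (-(z : ℤ) - 1)),
      show l + 2 * n * (-(z : ℤ) - 1) + 2 * n = l + 2 * n * (-z) by ring,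
      ← LinearEquiv.mul_apply, ← zpow_one_add]
    simp

/-- The orthogonal filtration has one-dimensional steps. -/
theorem Filt.perp_codim (g : ℤ) {x y : E} (hx : x ∈ X.perp F (g + 1)) (hx' : x ∉ X.perp F g)
    (hy : y ∈ X.perp F (g + 1)) : ∃ r : k, y - r • x ∈ X.perp F g := by
  obtain ⟨e, he, he'⟩ := hF.ne g
  have key : ∀ z ∈ X.perp F (g + 1), X.b e z = 0 → z ∈ X.perp F g := by
    intro z hz h0 u hu
    obtain ⟨r, hr⟩ := hF.codim g e he he' u hu
    have h1 := hz _ hr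
    rw [map_sub, map_smul, LinearMap.sub_apply, LinearMap.smul_apply, h0, smul_zero, sub_zero] at h1
    exact h1
  have h1 : X.b e x ≠ 0 := fun h0 => hx' (key x hx h0)
  refine ⟨X.b e y / X.b e x, key _ (sub_mem hy (Submodule.smul_mem _ _ hx)) ?_⟩
  rw [map_sub, map_smul, smul_eq_mul, div_mul_cancel₀ _ h1, sub_self]

/-- The least `g` such that `F f ⊓ perp g` is not contained in `F (f + 1)`. -/
theorem Filt.exists_position (f : ℤ) : ∃ g : ℤ, (∃ x ∈ F f, x ∈ X.perp F (g + 1) ∧ x ∉ F (f + 1)) ∧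
    ∀ x ∈ F f, x ∈ X.perp F g → x ∈ F (f + 1) := by
  obtain ⟨D, hD⟩ := hF.separated
  obtain ⟨x, hx, hx'⟩ := hF.ne f
  obtain ⟨g0, hg0⟩ := hF.exhaust_perp x
  -- A vector of F f orthogonal to F g with g < f - D is zero by `separated`, so the admissible g
  -- are bounded below.
  obtain ⟨g, ⟨y, hy, hy', hy''⟩, hmin⟩ := Int.exists_least_of_bdd
    (P := fun g => ∃ x ∈ F f, x ∈ X.perp F g ∧ x ∉ F (f + 1)) ⟨f - D, by
      rintro g ⟨y, hy, hy', hy''⟩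
      by_contra hcon
      apply hy''
      rw [hD (f - D) y (by simpa using hy) (hF.perp_mono (by omega) hy')]
      exact zero_mem _⟩ ⟨g0, x, hx, hg0, hx'⟩
  refine ⟨g - 1, ⟨y, hy, by simpa using hy', hy''⟩, fun z hz hz' => ?_⟩
  by_contra hcon
  have := hmin _ ⟨z, hz, hz', hcon⟩
  omega

/-- j f marks where the orthogonal filtration first meets F f outside F (f + 1), and a vector found
there enters the frame; one period is chosen and then translated by T. Minimality of j f makes j
injective, and separation makes the frame span. -/
theorem Filt.exists_frame [NeZero n] : ∃ a j, X.Frame n F a j := by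
  choose j hj hj' using hF.exists_position
  choose c hc hc' hc'' using hj
  have hn : (0 : ℤ) < 2 * n := by have := NeZero.pos n; positivity
  have hjper : Periodic n j := by
    intro m
    refine le_antisymm ?_ ?_
    · by_contra hcon
      have h1 := hj' (m + 2 * n) (X.T (c m)) ((hF.per _ _).1 (hc m))
        (hF.perp_mono (by omega) ((hF.perp_per (j m + 1) _).1 (hc' m)))
      rw [show m + 2 * (n : ℤ) + 1 = m + 1 + 2 * n by ring, ← hF.per] at h1
      exact hc'' m h1
    · by_contra hcon
      obtain ⟨v, hv⟩ := X.T.surjective (c (m + 2 * n))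
      have a1 := hc (m + 2 * n)
      have a2 := hc' (m + 2 * n)
      have a3 := hc'' (m + 2 * n)
      rw [← hv] at a1 a2 a3
      rw [← hF.per] at a1
      rw [show m + 2 * (n : ℤ) + 1 = m + 1 + 2 * n by ring, ← hF.per] at a3
      refine a3 (hj' m v a1 ?_)
      rw [hF.perp_per]
      exact hF.perp_mono (by omega) a2
  let a : ℤ → E := fun m => (X.T ^ (m / (2 * n))) (c (m % (2 * n)))
  have hmod : ∀ m : ℤ, m % (2 * n) + 2 * n * (m / (2 * n)) = m := fun m => Int.emod_add_mul_ediv _ _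
  have hmem : ∀ m, a m ∈ F m := by
    intro m
    have h1 := (hF.per_zpow (m / (2 * n)) _ _).1 (hc (m % (2 * n)))
    rwa [hmod] at h1
  have hnmem : ∀ m, a m ∉ F (m + 1) := by
    intro m h
    apply hc'' (m % (2 * n))
    rw [hF.per_zpow (m / (2 * n))]
    rwa [show m % (2 * (n : ℤ)) + 1 + 2 * n * (m / (2 * n)) = m + 1 by linarith [hmod m]]
  have hpmem : ∀ m, a m ∈ X.perp F (j m + 1) := by
    intro m
    have h1 := (hF.perp_per_zpow (m / (2 * n)) _ _).1 (hc' (m % (2 * n)))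
    rw [add_right_comm, ← hjper.add_mul, hmod] at h1
    exact h1
  -- If j f = j f' with f < f', subtracting a multiple of a f' from a f gives a vector orthogonal to
  -- F (j f) but still outside F (f + 1), against the choice of j f.
  have hinj : ∀ f f', f < f' → j f ≠ j f' := by
    intro f f' hff h
    have hp : a f' ∉ X.perp F (j f') := fun h0 => hnmem f' (hj' f' _ (hmem f') h0)
    obtain ⟨r, hr⟩ := hF.perp_codim (j f') (hpmem f') hp (h ▸ hpmem f)
    have h1 := hF.antitone (show f + 1 ≤ f' by omega) (hmem f')
    have h2 := hj' f _ (sub_mem (hmem f) (Submodule.smul_mem _ r (hF.antitone hff.le (hmem f'))))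
      (h ▸ hr)
    exact hnmem f ((Submodule.sub_mem_iff_left _ (Submodule.smul_mem _ r h1)).1 h2)
  refine ⟨a, j, ?_, hjper, ?_, hmem, hnmem, hpmem, fun m h0 => hnmem m (hj' m _ (hmem m) h0), ?_⟩
  · intro m
    simp only [a]
    rw [Int.add_emod_right, Int.add_ediv_of_dvd_right dvd_rfl, Int.ediv_self hn.ne',
      add_comm, zpow_one_add]
    rfl
  · intro f f' h
    rcases lt_trichotomy f f' with h1 | h1 | h1
    · exact absurd h (hinj _ _ h1)
    · exact h1
    · exact absurd h.symm (hinj _ _ h1)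
  · obtain ⟨D, hD⟩ := hF.separated
    refine eq_top_iff.2 fun x _ => ?_
    obtain ⟨f, hf⟩ := hF.exhaust x
    obtain ⟨g, hg⟩ := hF.exhaust_perp x
    -- Downward induction on f: from g + D on, F f ⊓ perp g is zero, and each step down costs at
    -- most one frame vector, itself in perp g because then j f < g.
    have key : ∀ d : ℕ, ∀ f, g + D - d ≤ f → ∀ x ∈ F f, x ∈ X.perp F g →
        x ∈ Submodule.span k (Set.range a) := by
      intro d
      induction d with
      | zero =>
        intro f hfd x hx hx'
        rw [hD g x (hF.antitone (by simpa using hfd) hx) hx']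
        exact zero_mem _
      | succ d ih =>
        intro f hfd x hx hx'
        by_cases h : x ∈ F (f + 1)
        · exact ih (f + 1) (by push_cast at hfd; omega) x h hx'
        · have h1 : j f < g := by
            by_contra hcon
            exact h (hj' f x hx (hF.perp_mono (not_lt.1 hcon) hx'))
          obtain ⟨r, hr⟩ := hF.codim f _ (hmem f) (hnmem f) x hx
          have h2 := ih (f + 1) (by push_cast at hfd; omega) _ hr
            (sub_mem hx' (Submodule.smul_mem _ r (hF.perp_mono (by omega) (hpmem f))))
          have h3 : a f ∈ Submodule.span k (Set.range a) := Submodule.subset_span ⟨f, rfl⟩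
          have := add_mem h2 (Submodule.smul_mem _ r h3)
          simpa using this
    exact key (g + D - f).toNat f (by omega) x hf hg

/-- A filtration that agrees with `F` on one residue class shares its properties. -/
theorem Filt.congr [NeZero n] (anti : ∀ l, F' (l + 1) ≤ F' l)
    (per : ∀ l x, x ∈ F' l ↔ X.T x ∈ F' (l + 2 * n)) (ne : ∀ l, ∃ x ∈ F' l, x ∉ F' (l + 1))
    (codim : ∀ l, ∀ x ∈ F' l, x ∉ F' (l + 1) → ∀ y ∈ F' l, ∃ r : k, y - r • x ∈ F' (l + 1))
    (r : ℤ) (hr : ∀ z : ℤ, F' (r + 2 * n * z) = F (r + 2 * n * z)) : X.Filt n F' := by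
  have hn : (0 : ℤ) < 2 * n := by have := NeZero.pos n; positivity
  have hant : Antitone F' := antitone_int_of_succ_le anti
  have hmono : ∀ g h : ℤ, g ≤ h → X.perp F' g ≤ X.perp F' h := fun g h hgh x hx u hu =>
    hx u (hant hgh hu)
  -- Within distance 2n of every index, on either side, there is one of the class of r, where F and
  -- F' coincide. This accounts for the summand 4n below.
  have hlow : ∀ l : ℤ, ∃ f, f ≤ l ∧ l - f ≤ 2 * n ∧ F' f = F f := by
    intro l
    refine ⟨r + 2 * n * ((l - r) / (2 * n)), ?_, ?_, hr _⟩
    · have := Int.mul_ediv_self_le (x := l - r) hn.ne'; linarith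
    · have := Int.lt_mul_ediv_self_add (x := l - r) hn; linarith
  have hhigh : ∀ l : ℤ, ∃ f, l ≤ f ∧ f - l ≤ 2 * n ∧ F' f = F f := by
    intro l
    obtain ⟨f, h1, h2, h3⟩ := hlow (l + 2 * n)
    exact ⟨f, by linarith, by linarith, h3⟩
  have hperp : ∀ f, F' f = F f → X.perp F' f = X.perp F f := by
    intro f h; ext x; rw [mem_perp, mem_perp, h]
  refine ⟨anti, per, ne, codim, ?_, ?_, ?_, ?_⟩
  · intro x
    obtain ⟨l, hl⟩ := hF.exhaust x
    obtain ⟨f, h1, -, h3⟩ := hlow l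
    exact ⟨f, h3 ▸ hF.antitone h1 hl⟩
  · intro x
    obtain ⟨l, hl⟩ := hF.exhaust_perp x
    obtain ⟨f, h1, -, h3⟩ := hhigh l
    exact ⟨f, hperp f h3 ▸ hF.perp_mono h1 hl⟩
  · obtain ⟨D, hD⟩ := hF.separated
    refine ⟨D + 4 * n, fun l x hx hx' => ?_⟩
    obtain ⟨f, h1, h2, h3⟩ := hhigh l
    obtain ⟨f', h1', h2', h3'⟩ := hlow (l + (D + 4 * n))
    have a1 := hmono _ _ h1 hx'
    have a2 := hant h1' hx
    rw [hperp f h3] at a1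
    rw [h3'] at a2
    exact hD f x (hF.antitone (by linarith) a2) a1
  · intro φ f g h1 h2
    obtain ⟨f', a1, -, a3⟩ := hhigh f
    obtain ⟨g', b1, -, b3⟩ := hlow g
    refine hF.represent φ f' g' (fun x hx => h1 x (hant a1 ?_)) (fun x hx => h2 x (hmono _ _ b1 ?_))
    · rwa [a3]
    · rwa [hperp g' b3]

end Filt

end TwistedForm

end AffineTwin

/-! ### Coordinates with respect to a frame, and the relation j (j m) = m - 2n. -/

namespace AffineTwin

namespace TwistedForm

set_option linter.unusedSectionVars false

variable {k E : Type*} [Field k] [AddCommGroup E] [Module k E] {X : TwistedForm k E} {n : ℕ}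
  {F F' : ℤ → Submodule k E} {a a' : ℤ → E} {j j' : ℤ → ℤ}

namespace Frame

variable (hf : X.Frame n F a j) (hF : X.Filt n F)
include hf hF

/-- The term of least index m lies in F m but not in F (m + 1), and the other terms cannot cancel
it. -/
theorem coeff_eq_zero (c : ℤ →₀ k) {f : ℤ} (hc : Finsupp.linearCombination k a c ∈ F f) :
    ∀ m < f, c m = 0 := by
  by_contra! hcon
  obtain ⟨m0, hm0, hm0'⟩ := hcon
  obtain ⟨m, hm, hmin⟩ := Finset.exists_min_image c.support id ⟨m0, by simpa using hm0'⟩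
  have hmf : m < f := lt_of_le_of_lt (hmin m0 (by simpa using hm0')) hm0
  rw [Finsupp.linearCombination_apply, Finsupp.sum, ← Finset.add_sum_erase _ _ hm] at hc
  have h1 : ∑ x ∈ c.support.erase m, c x • a x ∈ F (m + 1) := by
    refine sum_mem fun x hx => Submodule.smul_mem _ _ (hF.antitone ?_ (hf.mem x))
    have h2 := hmin x (Finset.mem_of_mem_erase hx)
    have h3 := Finset.ne_of_mem_erase hx
    simp only [id] at h2
    omega
  have h2 : c m • a m ∈ F (m + 1) :=
    (Submodule.add_mem_iff_left _ h1).1 (hF.antitone (by omega) hc)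
  rw [Submodule.smul_mem_iff _ (by simpa using hm)] at h2
  exact hf.notMem m h2

theorem linearIndependent : LinearIndependent k a := by
  rw [linearIndependent_iff]
  intro c hc
  ext m
  exact hf.coeff_eq_zero hF c (f := m + 1) (by rw [hc]; exact zero_mem _) m (by omega)

/-- The frame as a basis. -/
noncomputable def basis : Module.Basis ℤ k E :=
  Module.Basis.mk (hf.linearIndependent hF) hf.span.ge

theorem basis_apply (m : ℤ) : hf.basis hF m = a m := Module.Basis.mk_apply _ _ _

/-- The coordinates with respect to a frame. -/
noncomputable def coord (m : ℤ) : E →ₗ[k] k := (hf.basis hF).coord m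

theorem linearCombination_repr (x : E) :
    Finsupp.linearCombination k a ((hf.basis hF).repr x) = x := by
  conv_rhs => rw [← (hf.basis hF).linearCombination_repr x]
  congr 2
  funext m
  exact (hf.basis_apply hF m).symm

theorem coord_self (m : ℤ) : hf.coord hF m (a m) = 1 := by
  rw [coord, ← hf.basis_apply hF m]; simp

theorem coord_ne {m l : ℤ} (h : l ≠ m) : hf.coord hF m (a l) = 0 := by
  rw [coord, ← hf.basis_apply hF l]
  simp [h]

theorem mem_of_coord {S : Submodule k E} {x : E}
    (h : ∀ m, hf.coord hF m x ≠ 0 → a m ∈ S) : x ∈ S := by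
  rw [← hf.linearCombination_repr hF x, Finsupp.linearCombination_apply, Finsupp.sum]
  exact sum_mem fun m hm => Submodule.smul_mem _ _ (h m (by simpa [coord] using hm))

theorem mem_iff {f : ℤ} {x : E} : x ∈ F f ↔ ∀ m < f, hf.coord hF m x = 0 := by
  constructor
  · intro h
    refine hf.coeff_eq_zero hF ((hf.basis hF).repr x) ?_
    rwa [hf.linearCombination_repr]
  · intro h
    refine hf.mem_of_coord hF fun m hm => ?_
    refine hF.antitone ?_ (hf.mem m)
    by_contra hcon
    exact hm (h m (not_le.1 hcon))

theorem mem_perp_iff {g : ℤ} {x : E} : x ∈ X.perp F g ↔ ∀ m, g ≤ j m → hf.coord hF m x = 0 := by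
  constructor
  · intro h
    by_contra! hcon
    obtain ⟨m0, hm0, hm0'⟩ := hcon
    obtain ⟨m, hm, hmax⟩ := Finset.exists_max_image ((hf.basis hF).repr x).support j
      ⟨m0, by simpa [coord] using hm0'⟩
    have hmg : g ≤ j m := hm0.trans (hmax m0 (by simpa [coord] using hm0'))
    rw [← hf.linearCombination_repr hF x, Finsupp.linearCombination_apply, Finsupp.sum,
      ← Finset.add_sum_erase _ _ hm] at h
    have h1 : ∑ y ∈ ((hf.basis hF).repr x).support.erase m, ((hf.basis hF).repr x) y • a y ∈
        X.perp F (j m) := by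
      refine sum_mem fun y hy => Submodule.smul_mem _ _ (hF.perp_mono ?_ (hf.mem_perp y))
      have h2 := hmax y (Finset.mem_of_mem_erase hy)
      have h3 := hf.inj.ne (Finset.ne_of_mem_erase hy)
      omega
    have h2 := (Submodule.add_mem_iff_left _ h1).1 (hF.perp_mono hmg h)
    rw [Submodule.smul_mem_iff _ (by simpa using hm)] at h2
    exact hf.notMem_perp m h2
  · intro h
    refine hf.mem_of_coord hF fun m hm => ?_
    refine hF.perp_mono ?_ (hf.mem_perp m)
    by_contra hcon
    exact hm (h m (by omega))

theorem b_eq_zero {l m : ℤ} (h : j m < l) : X.b (a l) (a m) = 0 :=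
  hf.mem_perp m _ (hF.antitone (by omega) (hf.mem l))

/-- The twist gives b (a l) (a m) = b (a m) (a (l + 2n)), hence a second range where the Gram matrix
of a frame vanishes. -/
theorem b_eq_zero_of_add_lt {l m : ℤ} (h : j l + 2 * n < m) : X.b (a l) (a m) = 0 := by
  rw [X.twist, ← hf.aper]
  exact hf.b_eq_zero hF (by rw [hf.jper]; exact h)

/-- a m is orthogonal to F (j m + 1) but not to F (j m), and a (j m) spans the quotient. -/
theorem b_ne_zero (m : ℤ) : X.b (a (j m)) (a m) ≠ 0 := by
  intro h0
  apply hf.notMem_perp m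
  intro u hu
  obtain ⟨r, hr⟩ := hF.codim _ _ (hf.mem (j m)) (hf.notMem (j m)) u hu
  have h1 := hf.mem_perp m _ hr
  rwa [map_sub, map_smul, LinearMap.sub_apply, LinearMap.smul_apply, h0, smul_zero, sub_zero] at h1

theorem surjective [NeZero n] : Function.Surjective j := by
  have h : Function.Injective (fun r : ZMod (2 * n) => ((j (r.val : ℤ) : ℤ) : ZMod (2 * n))) := by
    intro r r' h
    obtain ⟨z, hz⟩ := intCast_eq_iff.1 h
    rw [← hf.jper.add_mul] at hz
    rw [← val_intCast r, ← val_intCast r']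
    exact intCast_eq_iff.2 ⟨z, hf.inj hz⟩
  intro x
  obtain ⟨r, hr⟩ := (Finite.injective_iff_surjective.1 h) (x : ZMod (2 * n))
  obtain ⟨z, hz⟩ := intCast_eq_iff.1 hr
  exact ⟨_, (hf.jper.add_mul _ z).trans hz.symm⟩

theorem le_twist (m : ℤ) : m - 2 * n ≤ j (j m) := by
  by_contra hcon
  exact hf.b_ne_zero hF m (hf.b_eq_zero_of_add_lt hF (by omega))

/-- One inequality is `le_twist`. For the other, `represent` writes the m-th coordinate as the
pairing with a vector y; let f be its leading index and j m' = f. Then y pairs nontrivially with a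
m', and the twist reads this pairing as the m-th coordinate of a (m' - 2n), so m' = m + 2n. But f is
at most the index x0 with j x0 = m, where y has a component. -/
theorem isTwist [NeZero n] : IsTwist n j := by
  refine ⟨hf.jper, fun m => ?_⟩
  obtain ⟨y, hy⟩ := hF.represent (hf.coord hF m) (m + 1) (j m)
    (fun x hx => (hf.mem_iff hF).1 hx m (by omega))
    (fun x hx => (hf.mem_perp_iff hF).1 hx m le_rfl)
  have hy1 : y ∈ X.perp F (m + 1) := fun u hu => by
    rw [← hy]; exact (hf.mem_iff hF).1 hu m (by omega)
  have hy2 : y ∉ X.perp F m := fun h => by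
    have := h _ (hf.mem m)
    rw [← hy, hf.coord_self] at this
    exact one_ne_zero this
  -- the coordinate at `j⁻¹ m` is nonzero
  obtain ⟨x0, hx0⟩ := hf.surjective hF m
  have hx0' : hf.coord hF x0 y ≠ 0 := by
    intro h0
    apply hy2
    rw [hf.mem_perp_iff hF] at hy1 ⊢
    intro l hl
    rcases eq_or_lt_of_le hl with h1 | h1
    · have : l = x0 := hf.inj (h1.symm.trans hx0.symm)
      rw [this, h0]
    · exact hy1 l (by omega)
  -- the least nonzero coordinate
  obtain ⟨f, hfm, hmin⟩ := Finset.exists_min_image ((hf.basis hF).repr y).support id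
    ⟨x0, by simpa [coord] using hx0'⟩
  have hyf : y ∈ F f := by
    rw [hf.mem_iff hF]
    intro l hl
    by_contra hcon
    exact absurd (hmin l (by simpa [coord] using hcon)) (not_le.2 hl)
  have hyf' : y ∉ F (f + 1) := by
    rw [hf.mem_iff hF]
    intro h
    exact absurd (h f (by omega)) (by simpa [coord] using hfm)
  obtain ⟨m', hm'⟩ := hf.surjective hF f
  have hne : X.b y (a m') ≠ 0 := by
    intro h0
    apply hf.notMem_perp m'
    rw [hm']
    intro u hu
    obtain ⟨r, hr⟩ := hF.codim f y hyf hyf' u hu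
    have h1 := hf.mem_perp m' _ (hm' ▸ hr)
    rwa [map_sub, map_smul, LinearMap.sub_apply, LinearMap.smul_apply, h0, smul_zero,
      sub_zero] at h1
  have hm'' : m' = m + 2 * n := by
    by_contra hcon
    apply hne
    have h1 : a m' = X.T (a (m' - 2 * n)) := by rw [← hf.aper]; congr 1; ring
    rw [h1, ← X.twist, ← hy]
    exact hf.coord_ne hF (by omega)
  have h1 : f ≤ x0 := hmin x0 (by simpa [coord] using hx0')
  have h2 := hf.le_twist hF x0
  rw [hm'', hf.jper] at hm'
  rw [hx0] at h2
  have h3 : x0 = j m + 2 * n := by omega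
  rw [h3, hf.jper] at hx0
  linarith

theorem lt_iff {f g : ℤ} : j f < g ↔ ∃ x ∈ F f, x ∈ X.perp F g ∧ x ∉ F (f + 1) := by
  constructor
  · intro h
    exact ⟨a f, hf.mem f, hF.perp_mono (by omega) (hf.mem_perp f), hf.notMem f⟩
  · rintro ⟨x, h1, h2, h3⟩
    by_contra hcon
    apply h3
    rw [hf.mem_iff hF] at h1 ⊢
    intro m hm
    rcases lt_or_eq_of_le (Int.lt_add_one_iff.1 hm) with h4 | rfl
    · exact h1 m h4
    · exact (hf.mem_perp_iff hF).1 h2 m (not_lt.1 hcon)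

/-- The frame vectors with f ≤ m and j m < g form a basis of the intersection. So these counts
depend on the filtration only. -/
theorem finrank_inf_perp (f g : ℤ) :
    Module.finrank k (F f ⊓ X.perp F g : Submodule k E) = {m | f ≤ m ∧ j m < g}.ncard := by
  have h : (F f ⊓ X.perp F g : Submodule k E) = Submodule.span k (a '' {m | f ≤ m ∧ j m < g}) := by
    refine le_antisymm ?_ ?_
    · rintro x ⟨h1, h2⟩
      refine hf.mem_of_coord hF fun m hm => Submodule.subset_span ⟨m, ⟨?_, ?_⟩, rfl⟩
      · by_contra hcon
        exact hm ((hf.mem_iff hF).1 h1 m (not_le.1 hcon))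
      · by_contra hcon
        exact hm ((hf.mem_perp_iff hF).1 h2 m (not_lt.1 hcon))
    · rw [Submodule.span_le]
      rintro _ ⟨m, ⟨h1, h2⟩, rfl⟩
      exact ⟨hF.antitone h1 (hf.mem m), hF.perp_mono (by omega) (hf.mem_perp m)⟩
  have hli : LinearIndepOn k id (a '' {m | f ≤ m ∧ j m < g}) :=
    ((hf.linearIndependent hF).linearIndepOn_id).mono (Set.image_subset_range _ _)
  rw [h, Module.finrank, rank_span_set hli, ← Set.ncard_image_of_injective _
    (hf.linearIndependent hF).injective]
  rfl

end Frame

/-- Two filtrations that agree outside the residue classes in `J`. -/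
def Agree (J : Set (ZMod (2 * n))) (F F' : ℤ → Submodule k E) : Prop :=
  ∀ l : ℤ, (l : ZMod (2 * n)) ∉ J → F l = F' l

theorem Agree.perp {J : Set (ZMod (2 * n))} (h : Agree J F F') {g : ℤ}
    (hg : (g : ZMod (2 * n)) ∉ J) : X.perp F g = X.perp F' g := by
  ext x; rw [TwistedForm.mem_perp, TwistedForm.mem_perp, h g hg]

theorem Agree.counts {J : Set (ZMod (2 * n))} (h : Agree J F F') (hF : X.Filt n F)
    (hF' : X.Filt n F') (hf : X.Frame n F a j) (hf' : X.Frame n F' a' j') (f g : ℤ)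
    (hfJ : (f : ZMod (2 * n)) ∉ J) (hg : (g : ZMod (2 * n)) ∉ J) :
    {m | f ≤ m ∧ j m < g}.ncard = {m | f ≤ m ∧ j' m < g}.ncard := by
  rw [← hf.finrank_inf_perp hF, ← hf'.finrank_inf_perp hF', h f hfJ, h.perp hg]

/-- The spaces F f and perp g with f, g outside J are common to the whole residue, and the
dimensions of their intersections determine a position without inversions in J. -/
theorem Agree.position_eq [NeZero n] {J : Set (ZMod (2 * n))} (hJ : ∃ r, r ∉ J) (h : Agree J F F')
    (hF : X.Filt n F) (hF' : X.Filt n F') (hf : X.Frame n F a j) (hf' : X.Frame n F' a' j')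
    (hi : NoInv J j) (hi' : NoInv J j') : j = j' :=
  IsTwist.eq_of_counts hJ (hf.isTwist hF) (hf'.isTwist hF') hi hi' (h.counts hF hF' hf hf')

end TwistedForm

end AffineTwin

/-! ### Neighbours with a shorter position. -/

namespace AffineTwin

theorem intCast_add_mul {n : ℕ} (m z : ℤ) : ((m + 2 * n * z : ℤ) : ZMod (2 * n)) = m :=
  (intCast_eq_iff.2 ⟨z, rfl⟩).symm

theorem intCast_add_period {n : ℕ} (m : ℤ) : ((m + 2 * n : ℤ) : ZMod (2 * n)) = m :=
  (intCast_eq_iff.2 ⟨1, by ring⟩).symm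

theorem ne_of_sub_one {n : ℕ} [NeZero n] {r : ZMod (2 * n)} {l : ℤ}
    (h : ((l + 1 : ℤ) : ZMod (2 * n)) = r) : (l : ZMod (2 * n)) ≠ r := by
  intro h'
  rw [← h'] at h
  push_cast at h
  exact two_n_one (by simpa using h)

namespace TwistedForm

variable {k E : Type*} [Field k] [AddCommGroup E] [Module k E] {X : TwistedForm k E} {n : ℕ}
  {F F' : ℤ → Submodule k E} {a a' : ℤ → E} {j j' : ℤ → ℤ}

theorem Filt.congr_of_step [NeZero n] (hF : X.Filt n F)
    (per : ∀ l x, x ∈ F' l ↔ X.T x ∈ F' (l + 2 * n))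
    (step : ∀ l, ∃ ψ : E →ₗ[k] k, (∀ u, u ∈ F' (l + 1) ↔ u ∈ F' l ∧ ψ u = 0) ∧ ∃ u ∈ F' l, ψ u ≠ 0)
    (r : ℤ) (hr : ∀ z : ℤ, F' (r + 2 * n * z) = F (r + 2 * n * z)) : X.Filt n F' := by
  refine hF.congr (fun l u hu => ?_) per (fun l => ?_) (fun l x hx hx' y hy => ?_) r hr
  · obtain ⟨ψ, h1, -⟩ := step l
    exact ((h1 u).1 hu).1
  · obtain ⟨ψ, h1, u, hu, hu'⟩ := step l
    exact ⟨u, hu, fun h => hu' ((h1 u).1 h).2⟩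
  · obtain ⟨ψ, h1, -⟩ := step l
    have hx0 : ψ x ≠ 0 := fun h => hx' ((h1 x).2 ⟨hx, h⟩)
    refine ⟨ψ y / ψ x, (h1 _).2 ⟨sub_mem hy (Submodule.smul_mem _ _ hx), ?_⟩⟩
    rw [map_sub, map_smul, smul_eq_mul, div_mul_cancel₀ _ hx0, sub_self]

theorem Agree.perp_eq {g : ℤ} (h : F' g = F g) : X.perp F' g = X.perp F g := by
  ext x; rw [TwistedForm.mem_perp, TwistedForm.mem_perp, h]

namespace Frame

theorem b_zpow (z : ℤ) (u v : E) : X.b ((X.T ^ z) u) ((X.T ^ z) v) = X.b u v := by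
  induction z using Int.induction_on with
  | zero => simp
  | succ z ih =>
    rw [add_comm (z : ℤ) 1, zpow_one_add, LinearEquiv.mul_apply, LinearEquiv.mul_apply, b_T, ih]
  | pred z ih =>
    rw [← ih, ← b_T, ← LinearEquiv.mul_apply, ← LinearEquiv.mul_apply, ← zpow_one_add]
    congr 4 <;> ring

section

variable (hf : X.Frame n F a j)
include hf

theorem apply_add_mul (m z : ℤ) : a (m + 2 * n * z) = (X.T ^ z) (a m) := by
  induction z using Int.induction_on with
  | zero => simp
  | succ z ih =>
    rw [show m + 2 * n * ((z : ℤ) + 1) = m + 2 * n * z + 2 * n by ring, hf.aper, ih,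
      add_comm (z : ℤ) 1, zpow_one_add]; rfl
  | pred z ih =>
    apply X.T.injective
    rw [← hf.aper, show m + 2 * n * (-(z : ℤ) - 1) + 2 * n = m + 2 * n * (-z) by ring, ih,
      ← LinearEquiv.mul_apply, ← zpow_one_add]
    congr 2; ring

theorem b_add_mul (l m z : ℤ) : X.b (a (l + 2 * n * z)) (a (m + 2 * n * z)) = X.b (a l) (a m) := by
  rw [hf.apply_add_mul, hf.apply_add_mul, b_zpow]

end

variable (hf : X.Frame n F a j) (hF : X.Filt n F)
include hf hF

theorem coord_T (m : ℤ) (u : E) : hf.coord hF (m + 2 * n) (X.T u) = hf.coord hF m u := by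
  have h : (hf.coord hF (m + 2 * n)) ∘ₗ X.T.toLinearMap = hf.coord hF m := by
    refine (hf.basis hF).ext fun l => ?_
    rw [basis_apply, LinearMap.comp_apply, LinearEquiv.coe_coe, ← hf.aper]
    rcases eq_or_ne l m with rfl | hl
    · rw [coord_self, coord_self]
    · rw [coord_ne _ _ hl, coord_ne _ _ (by simpa using hl)]
  exact LinearMap.congr_fun h u

theorem step (l : ℤ) : (∀ u, u ∈ F (l + 1) ↔ u ∈ F l ∧ hf.coord hF l u = 0) := by
  intro u
  rw [hf.mem_iff hF, hf.mem_iff hF]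
  constructor
  · exact fun h => ⟨fun m hm => h m (by omega), h l (by omega)⟩
  · rintro ⟨h1, h2⟩ m hm
    rcases lt_or_eq_of_le (Int.lt_add_one_iff.1 hm) with h3 | rfl
    exacts [h1 m h3, h2]

/-- If the frame of `F` has an inversion at `i`, then `F` has a neighbour whose relative position is
shorter. -/
theorem descent [NeZero n] (i : ℤ) (hi : j i < j (i - 1)) :
    ∃ F' a', X.Filt n F' ∧ Agree (n := n) {(i : ZMod (2 * n))} F' F ∧
      X.Frame n F' a' (fun m => s n i (j (s n i m))) := by
  classical
  have htw := hf.isTwist hF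
  obtain ⟨r, hr⟩ : ∃ r, r = (i : ZMod (2 * n)) := ⟨_, rfl⟩
  have hdesc : ∀ m : ℤ, (m : ZMod (2 * n)) = r → j m < j (m - 1) := by
    intro m hm
    obtain ⟨z, rfl⟩ := intCast_eq_iff.1 (hm.trans hr).symm
    rw [hf.jper.add_mul, show i + 2 * n * z - 1 = i - 1 + 2 * n * z by ring, hf.jper.add_mul]
    linarith
  -- The neighbours of F at i correspond to lines in F (i - 1) modulo F (i + 1). The one wanted is
  -- spanned by a (i - 1) + c a i, with c such that this vector pairs to zero with the frame vector
  -- a v for which j v = i.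
  obtain ⟨c, hc⟩ : ∃ c : k, ∀ l v : ℤ, (l : ZMod (2 * n)) = r → j v = l →
      X.b (a (l - 1) + c • a l) (a v) = 0 := by
    obtain ⟨v0, hv0⟩ := hf.surjective hF i
    have hne := hf.b_ne_zero hF v0
    rw [hv0] at hne
    refine ⟨- (X.b (a (i - 1)) (a v0) / X.b (a i) (a v0)), fun l v hl hv => ?_⟩
    obtain ⟨z, rfl⟩ := intCast_eq_iff.1 (hl.trans hr).symm
    rw [← hv0, ← hf.jper.add_mul] at hv
    rw [hf.inj hv, map_add, map_smul, LinearMap.add_apply, LinearMap.smul_apply,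
      show i + 2 * n * z - 1 = i - 1 + 2 * n * z by ring, hf.b_add_mul, hf.b_add_mul, smul_eq_mul]
    field_simp
    ring
  -- The line is written as an equation between the coordinates l - 1 and l.
  let F' : ℤ → Submodule k E := fun l => if (l : ZMod (2 * n)) = r then
    F (l - 1) ⊓ LinearMap.ker (hf.coord hF l - c • hf.coord hF (l - 1)) else F l
  have hF1 : ∀ l : ℤ, (l : ZMod (2 * n)) = r → ∀ u, u ∈ F' l ↔
      u ∈ F (l - 1) ∧ hf.coord hF l u - c * hf.coord hF (l - 1) u = 0 := by
    intro l hl u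
    simp [F', hl]
  have hF2 : ∀ l : ℤ, (l : ZMod (2 * n)) ≠ r → F' l = F l := fun l hl => if_neg hl
  have hagree : Agree (n := n) {r} F' F := fun l hl => hF2 l hl
  have hFilt : X.Filt n F' := by
    refine hF.congr_of_step (fun l x => ?_) (fun l => ?_) (i + 1) (fun z => ?_)
    · by_cases hl : (l : ZMod (2 * n)) = r
      · rw [hF1 l hl, hF1 (l + 2 * n) (by rw [intCast_add_period, hl]), coord_T,
          show l + 2 * (n : ℤ) - 1 = l - 1 + 2 * n by ring, coord_T, ← hF.per]
      · rw [hF2 l hl, hF2 (l + 2 * n) (by rwa [intCast_add_period]), hF.per]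
    · by_cases hl : (l : ZMod (2 * n)) = r
      · have hl' : ((l + 1 : ℤ) : ZMod (2 * n)) ≠ r := fun h => ne_of_sub_one h hl
        refine ⟨hf.coord hF (l - 1), fun u => ?_, a (l - 1) + c • a l, ?_, ?_⟩
        · rw [hF2 _ hl', hF1 l hl, hf.step hF l]
          have h3 := hf.step hF (l - 1) u
          rw [sub_add_cancel] at h3
          rw [h3]
          constructor
          · rintro ⟨⟨h4, h5⟩, h6⟩
            exact ⟨⟨h4, by rw [h5, h6]; ring⟩, h5⟩
          · rintro ⟨⟨h4, h5⟩, h6⟩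
            exact ⟨⟨h4, h6⟩, by rw [h6] at h5; linear_combination h5⟩
        · rw [hF1 l hl]
          refine ⟨add_mem (hf.mem _) (Submodule.smul_mem _ _ (hF.antitone (by omega) (hf.mem l))), ?_⟩
          rw [map_add, map_add, map_smul, map_smul, coord_self, coord_self, coord_ne _ _ (by omega),
            coord_ne _ _ (by omega)]
          simp
        · rw [map_add, map_smul, coord_self, coord_ne _ _ (by omega)]
          simp
      · by_cases hl' : ((l + 1 : ℤ) : ZMod (2 * n)) = r
        · refine ⟨hf.coord hF (l + 1) - c • hf.coord hF l, fun u => ?_, a (l + 1), ?_, ?_⟩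
          · rw [hF1 _ hl', hF2 l hl, add_sub_cancel_right]
            simp
          · rw [hF2 l hl]; exact hF.anti _ (hf.mem _)
          · rw [LinearMap.sub_apply, LinearMap.smul_apply, coord_self, coord_ne _ _ (by omega)]
            simp
        · rw [hF2 l hl, hF2 _ hl']
          exact ⟨hf.coord hF l, hf.step hF l, a l, hf.mem l, by rw [coord_self]; exact one_ne_zero⟩
    · refine hF2 _ ?_
      rw [intCast_add_mul, hr]
      exact fun h => ne_of_sub_one (r := ((i + 1 : ℤ) : ZMod (2 * n))) rfl h.symm
  have hperp1 : ∀ l : ℤ, (l : ZMod (2 * n)) = r → ∀ x, x ∈ X.perp F' l ↔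
      x ∈ X.perp F (l + 1) ∧ X.b (a (l - 1) + c • a l) x = 0 := by
    intro l hl x
    have hl' : ((l + 1 : ℤ) : ZMod (2 * n)) ≠ r := fun h => ne_of_sub_one h hl
    have hmem : a (l - 1) + c • a l ∈ F' l := by
      rw [hF1 l hl]
      refine ⟨add_mem (hf.mem _) (Submodule.smul_mem _ _ (hF.antitone (by omega) (hf.mem l))), ?_⟩
      rw [map_add, map_add, map_smul, map_smul, coord_self, coord_self, coord_ne _ _ (by omega),
        coord_ne _ _ (by omega)]
      simp
    have hnm : a (l - 1) + c • a l ∉ F' (l + 1) := by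
      rw [hF2 _ hl']
      intro h
      have := (hf.mem_iff hF).1 h (l - 1) (by omega)
      rw [map_add, map_smul, coord_self, coord_ne _ _ (by omega)] at this
      simp at this
    constructor
    · intro h
      refine ⟨?_, h _ hmem⟩
      rw [← Agree.perp_eq (hF2 _ hl')]
      exact hFilt.perp_mono (by omega) h
    · rintro ⟨h1, h2⟩ u hu
      obtain ⟨d, hd⟩ := hFilt.codim l _ hmem hnm u hu
      rw [hF2 _ hl'] at hd
      have h3 := h1 _ hd
      rwa [map_sub, map_smul, LinearMap.sub_apply, LinearMap.smul_apply, h2, smul_zero, sub_zero] at h3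
  have hperp2 : ∀ l : ℤ, (l : ZMod (2 * n)) ≠ r → X.perp F' l = X.perp F l := fun l hl =>
    Agree.perp_eq (hF2 l hl)
  -- The frame vectors at m - 1 and m are interchanged, up to the multiple by c, so the position is
  -- conjugated by the reflection.
  let a' : ℤ → E := fun m => if (m : ZMod (2 * n)) = r then a (m - 1) + c • a m else a (s n r m)
  have ha1 : ∀ m : ℤ, (m : ZMod (2 * n)) = r → a' m = a (m - 1) + c • a m := fun m hm => if_pos hm
  have ha2 : ∀ m : ℤ, (m : ZMod (2 * n)) ≠ r → a' m = a (s n r m) := fun m hm => if_neg hm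
  have ha3 : ∀ m : ℤ, ((m + 1 : ℤ) : ZMod (2 * n)) = r → a' m = a (m + 1) := fun m hm => by
    rw [ha2 m (ne_of_sub_one hm), s_of_add_one_eq hm]
  -- a uniform description of the new vectors
  have hw : ∀ m, ∃ (l q : ℤ) (d : k), l = s n r m ∧ a' m = a l + d • a q ∧
      (d = 0 ∨ (j q < j l ∧ q = l + 1 ∧ (q : ZMod (2 * n)) = r)) := by
    intro m
    by_cases hm : (m : ZMod (2 * n)) = r
    · exact ⟨m - 1, m, c, (s_of_eq hm).symm, ha1 m hm, .inr ⟨hdesc m hm, by ring, hm⟩⟩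
    · exact ⟨s n r m, m, 0, rfl, by rw [ha2 m hm]; simp, .inl rfl⟩
  have hwmem : ∀ m, a' m ∈ X.perp F (j (s n r m) + 1) ∧ a' m ∉ X.perp F (j (s n r m)) := by
    intro m
    obtain ⟨l, q, d, rfl, h2, h3⟩ := hw m
    have h4 : d • a q ∈ X.perp F (j (s n r m)) := by
      rcases h3 with rfl | ⟨h3, -⟩
      · rw [zero_smul]; exact zero_mem _
      · exact Submodule.smul_mem _ _ (hF.perp_mono (by omega) (hf.mem_perp q))
    rw [h2]
    refine ⟨add_mem (hf.mem_perp _) (hF.perp_mono (by omega) h4), fun h => ?_⟩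
    exact hf.notMem_perp _ ((Submodule.add_mem_iff_left _ h4).1 h)
  have hnew : ∀ m, a' m ∈ X.perp F' (s n r (j (s n r m)) + 1) ∧
      a' m ∉ X.perp F' (s n r (j (s n r m))) := by
    intro m
    obtain ⟨h1, h2⟩ := hwmem m
    obtain ⟨l, q, d, hl, h3, h4⟩ := hw m
    rw [← hl] at h1 h2 ⊢
    by_cases hp : (j l : ZMod (2 * n)) = r
    · rw [s_of_eq hp, sub_add_cancel]
      have hp' : ((j l - 1 : ℤ) : ZMod (2 * n)) ≠ r := by
        apply ne_of_sub_one; rwa [sub_add_cancel]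
      rw [hperp1 _ hp, hperp2 _ hp']
      refine ⟨⟨h1, ?_⟩, fun h => h2 (hF.perp_mono (by omega) h)⟩
      rw [h3, map_add, hc _ l hp rfl, zero_add, map_smul]
      rcases h4 with rfl | ⟨h4, h5, h6⟩
      · rw [zero_smul]
      -- Equality would mean that the reflection interchanges j l and j (l + 1); then j (j l) = l +
      -- 4nz for some z, which is not l - 2n.
      · have hne : j q ≠ j l - 1 := by
          intro h7
          obtain ⟨z, hz⟩ := intCast_eq_iff.1 (h6.trans hp.symm)
          have h8 := htw.twist l
          rw [hz, hf.jper.add_mul, h7, hz, h5] at h8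
          have hn : (n : ℤ) ≠ 0 := by exact_mod_cast NeZero.ne n
          have : (2 * (n : ℤ)) * (2 * z) = 2 * n * (-1) := by linarith
          have := mul_left_cancel₀ (by positivity) this
          omega
        have h9 : X.b (a (j l - 1) + c • a (j l)) (a q) = 0 := by
          rw [map_add, map_smul, LinearMap.add_apply, LinearMap.smul_apply,
            hf.b_eq_zero hF (by omega), hf.b_eq_zero hF h4]
          simp
        rw [h9, smul_zero]
    · by_cases hp' : ((j l + 1 : ℤ) : ZMod (2 * n)) = r
      · rw [s_of_add_one_eq hp', hperp1 _ hp', hperp2 _ (fun h => ne_of_sub_one h hp')]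
        refine ⟨hF.perp_mono (by omega) h1, fun ⟨_, h⟩ => ?_⟩
        rw [add_sub_cancel_right, map_add, map_smul, LinearMap.add_apply, LinearMap.smul_apply,
          h1 _ (hf.mem _), smul_zero, add_zero, h3, map_add, map_smul] at h
        rcases h4 with rfl | ⟨h4, -⟩
        · rw [zero_smul, add_zero] at h
          exact hf.b_ne_zero hF l h
        · rw [hf.b_eq_zero hF h4, smul_zero, add_zero] at h
          exact hf.b_ne_zero hF l h
      · rw [s_of_ne hp hp', hperp2 _ hp, hperp2 _ hp']
        exact ⟨h1, h2⟩
  rw [← hr]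
  refine ⟨F', a', hFilt, hagree, ?_, ?_, ?_, ?_, ?_, fun m => (hnew m).1, fun m => (hnew m).2, ?_⟩
  · intro m
    by_cases hm : (m : ZMod (2 * n)) = r
    · rw [ha1 m hm, ha1 _ (by rwa [intCast_add_period]), map_add, map_smul, ← hf.aper, ← hf.aper]
      congr 2; ring
    · rw [ha2 m hm, ha2 _ (by rwa [intCast_add_period]), periodic_s, hf.aper]
  · exact (periodic_s _).comp (hf.jper.comp (periodic_s _))
  · exact (s n r).injective.comp (hf.inj.comp (s n r).injective)
  · intro m
    by_cases hm : (m : ZMod (2 * n)) = r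
    · rw [ha1 m hm, hF1 m hm]
      refine ⟨add_mem (hf.mem _) (Submodule.smul_mem _ _ (hF.antitone (by omega) (hf.mem m))), ?_⟩
      rw [map_add, map_add, map_smul, map_smul, coord_self, coord_self, coord_ne _ _ (by omega),
        coord_ne _ _ (by omega)]
      simp
    · rw [hF2 m hm]
      by_cases hm' : ((m + 1 : ℤ) : ZMod (2 * n)) = r
      · rw [ha3 m hm']; exact hF.anti _ (hf.mem _)
      · rw [ha2 m hm, s_of_ne hm hm']; exact hf.mem m
  · intro m h
    by_cases hm : (m : ZMod (2 * n)) = r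
    · rw [ha1 m hm, hF2 _ (fun h => ne_of_sub_one h hm), hf.mem_iff hF] at h
      have := h (m - 1) (by omega)
      rw [map_add, map_smul, coord_self, coord_ne _ _ (by omega)] at this
      simp at this
    · by_cases hm' : ((m + 1 : ℤ) : ZMod (2 * n)) = r
      · rw [ha3 m hm', hF1 _ hm', add_sub_cancel_right, coord_self, coord_ne _ _ (by omega)] at h
        simp at h
      · rw [ha2 m hm, s_of_ne hm hm', hF2 _ hm'] at h
        exact hf.notMem m h
  · refine eq_top_iff.2 ?_
    rw [← hf.span, Submodule.span_le]
    rintro _ ⟨l, rfl⟩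
    have hsub : ∀ m, a' m ∈ Submodule.span k (Set.range a') := fun m => Submodule.subset_span ⟨m, rfl⟩
    by_cases hl : (l : ZMod (2 * n)) = r
    · have := hsub (l - 1)
      rwa [ha3 _ (by simpa using hl), sub_add_cancel] at this
    · by_cases hl' : ((l + 1 : ℤ) : ZMod (2 * n)) = r
      · have h1 := hsub (l + 1)
        have h2 := hsub l
        rw [ha1 _ hl', add_sub_cancel_right] at h1
        rw [ha3 _ hl'] at h2
        exact (Submodule.add_mem_iff_left _ (Submodule.smul_mem _ _ h2)).1 h1
      · have := hsub l
        rwa [ha2 l hl, s_of_ne hl hl'] at this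

end Frame

end TwistedForm

end AffineTwin

/-! ### Minimal positions in a residue. -/

namespace AffineTwin

namespace TwistedForm

variable {k E : Type*} [Field k] [AddCommGroup E] [Module k E] {X : TwistedForm k E} {n : ℕ}
  {F F' F'' : ℤ → Submodule k E} {a a' : ℤ → E} {j j' : ℤ → ℤ} {J K : Set (ZMod (2 * n))}

theorem Agree.symm (h : Agree J F F') : Agree J F' F := fun l hl => (h l hl).symm

theorem Agree.trans (h : Agree J F F') (h' : Agree J F' F'') : Agree J F F'' := fun l hl =>
  (h l hl).trans (h' l hl)

theorem Agree.mono (hK : K ⊆ J) (h : Agree K F F') : Agree J F F' := fun l hl =>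
  h l fun h' => hl (hK h')

/-- Descents in J are removed one by one; each step stays in the residue and lowers the number of
inversions. -/
theorem Frame.exists_noInv [NeZero n] (J : Set (ZMod (2 * n))) (hF : X.Filt n F)
    (hf : X.Frame n F a j) : ∃ F' a' j', X.Filt n F' ∧ Agree J F' F ∧ X.Frame n F' a' j' ∧
      NoInv J j' ∧ inv n j' ≤ inv n j ∧ (¬ NoInv J j → inv n j' < inv n j) := by
  generalize hr : inv n j = r
  induction r using Nat.strong_induction_on generalizing F a j with
  | _ r ih =>
    by_cases hJ : NoInv J j
    · exact ⟨F, a, j, hF, fun _ _ => rfl, hf, hJ, hr.le, fun h => absurd hJ h⟩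
    · have : ∃ i : ℤ, (i : ZMod (2 * n)) ∈ J ∧ j i ≤ j (i - 1) := by
        unfold NoInv at hJ; push Not at hJ; exact hJ
      obtain ⟨i, hi, hle⟩ := this
      have hlt : j i < j (i - 1) := lt_of_le_of_ne hle (hf.inj.ne (by omega))
      obtain ⟨F₁, a₁, h1, h2, h3⟩ := hf.descent hF i hlt
      have h4 := (hf.isTwist hF).inv_conj_lt hlt
      rw [hr] at h4
      obtain ⟨F', a', j', b1, b2, b3, b4, b5, -⟩ := ih _ h4 h1 h3 rfl
      exact ⟨F', a', j', b1, b2.trans (h2.mono (by simpa using hi)), b3, b4, by omega,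
        fun _ => by omega⟩

/-- The relative position of a filtration has minimal length among the filtrations that agree with it
outside `J` if and only if it has no inversions inside the blocks of type `J`. -/
theorem Frame.minimal_iff [NeZero n] (hJ : ∃ r, r ∉ J) (hF : X.Filt n F) (hf : X.Frame n F a j) :
    (∀ F' a' j', X.Filt n F' → Agree J F' F → X.Frame n F' a' j' → inv n j ≤ inv n j') ↔
      NoInv J j := by
  constructor
  · intro h
    by_contra hcon
    obtain ⟨F', a', j', b1, b2, b3, b4, -, b6⟩ := hf.exists_noInv J hF
    have := h F' a' j' b1 b2 b3
    have := b6 hcon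
    omega
  · intro h F' a' j' h1 h2 h3
    obtain ⟨F₁, a₁, j₁, b1, b2, b3, b4, b5, -⟩ := h3.exists_noInv J h1
    -- Descent from j' ends in a position without inversions in J, which by uniqueness is j.
    rw [Agree.position_eq hJ (h2.symm.trans b2.symm) hF b1 hf b3 h b4]
    exact b5

end TwistedForm

end AffineTwin

namespace AffineTwin

/-! ### Unipotent changes of a frame -/

section Shear

variable {k E : Type*} [Field k] [AddCommGroup E] [Module k E] {n : ℕ} {α β : ℕ}

/-- The vectors `a l`, with multiples of `a (l')`, `h - α ≤ l' < h`, added to those with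
`h ≤ l < h + β`, and periodically. -/
def shear (n : ℕ) (a : ℤ → E) (h : ℤ) (S : Matrix (Fin α) (Fin β) k) (l : ℤ) : E :=
  a l + if hr : ((l - h) % (2 * n)).toNat < β then
    ∑ s : Fin α, S s ⟨_, hr⟩ • a (l - ((l - h) % (2 * n)).toNat - α + s) else 0

/-- The coordinates dual to `shear`. -/
def shearDual (n : ℕ) (c : ℤ → E →ₗ[k] k) (h : ℤ) (S : Matrix (Fin α) (Fin β) k) (m : ℤ) :
    E →ₗ[k] k :=
  c m - if hr : ((m - (h - α)) % (2 * n)).toNat < α then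
    ∑ t : Fin β, S ⟨_, hr⟩ t • c (m - ((m - (h - α)) % (2 * n)).toNat + α + t) else 0

variable {a : ℤ → E} {c : ℤ → E →ₗ[k] k} {h : ℤ} {S : Matrix (Fin α) (Fin β) k}

theorem emod_toNat {n : ℕ} {p : ℕ} (hp : p < 2 * n) (z : ℤ) :
    (((p : ℤ) + 2 * n * z) % (2 * n)).toNat = p := by
  rw [Int.add_mul_emod_self_left, Int.emod_eq_of_lt (by omega) (by exact_mod_cast hp)]
  simp

theorem shear_of_eq (hβ : β < 2 * n) (t : Fin β) (z : ℤ) {l : ℤ} (hl : l = h + t + 2 * n * z) :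
    shear n a h S l = a l + ∑ s : Fin α, S s t • a (h - α + s + 2 * n * z) := by
  have e : ((l - h) % (2 * n)).toNat = t := by
    rw [hl, show h + (t : ℤ) + 2 * n * z - h = ((t : ℕ) : ℤ) + 2 * n * z by ring]
    exact emod_toNat (by omega) z
  rw [shear, dif_pos (by rw [e]; exact t.2)]
  congr 1
  refine Finset.sum_congr rfl fun s _ => ?_
  congr 2
  · exact Fin.ext e
  · rw [e, hl]; ring

theorem shear_of_ne (hn : 0 < n) {l : ℤ} (hl : ∀ (t : Fin β) (z : ℤ), l ≠ h + t + 2 * n * z) :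
    shear n a h S l = a l := by
  rw [shear, dif_neg, add_zero]
  intro hr
  refine hl ⟨_, hr⟩ ((l - h) / (2 * n)) ?_
  have h1 : 0 ≤ (l - h) % (2 * (n : ℤ)) := Int.emod_nonneg _ (by positivity)
  have h2 := Int.emod_add_mul_ediv (l - h) (2 * n)
  simp only [Int.toNat_of_nonneg h1]
  linarith

theorem shearDual_of_eq (hα : α < 2 * n) (s : Fin α) (z : ℤ) {m : ℤ}
    (hm : m = h - α + s + 2 * n * z) :
    shearDual n c h S m = c m - ∑ t : Fin β, S s t • c (h + t + 2 * n * z) := by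
  have e : ((m - (h - α)) % (2 * n)).toNat = s := by
    rw [hm, show h - α + (s : ℤ) + 2 * n * z - (h - α) = ((s : ℕ) : ℤ) + 2 * n * z by ring]
    exact emod_toNat (by omega) z
  rw [shearDual, dif_pos (by rw [e]; exact s.2)]
  congr 1
  refine Finset.sum_congr rfl fun t _ => ?_
  congr 2
  · exact Fin.ext e
  · rw [e, hm]; ring

theorem shearDual_of_ne (hn : 0 < n) {m : ℤ}
    (hm : ∀ (s : Fin α) (z : ℤ), m ≠ h - α + s + 2 * n * z) : shearDual n c h S m = c m := by
  rw [shearDual, dif_neg, sub_zero]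
  intro hr
  refine hm ⟨_, hr⟩ ((m - (h - α)) / (2 * n)) ?_
  have h1 : 0 ≤ (m - (h - α)) % (2 * (n : ℤ)) := Int.emod_nonneg _ (by positivity)
  have h2 := Int.emod_add_mul_ediv (m - (h - α)) (2 * n)
  simp only [Int.toNat_of_nonneg h1]
  linarith

/-- Indices less than a period apart have a common translate only under the same translation. -/
theorem shift_inj {p q : ℤ} {z z' : ℤ} (h0 : |p - q| < 2 * n)
    (h : p + 2 * n * z = q + 2 * n * z') : z = z' := by
  have h1 : p - q = 2 * n * (z' - z) := by linarith
  by_contra hne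
  have h2 : 1 ≤ |z' - z| := Int.one_le_abs (sub_ne_zero.2 (Ne.symm hne))
  rw [h1, abs_mul] at h0
  have : |(2 * n : ℤ)| = 2 * n := abs_of_nonneg (by positivity)
  rw [this] at h0
  nlinarith

/-- As α + β < 2n, the indices that receive multiples and those that supply them are disjoint modulo
2n. So the shear is 1 + N with N² = 0, and the dual vectors change by the transpose of 1 - N. -/
theorem shearDual_shear (hn : α + β < 2 * n) (hc : ∀ m l, c m (a l) = if l = m then 1 else 0)
    (m l : ℤ) : shearDual n c h S m (shear n a h S l) = if l = m then 1 else 0 := by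
  have hn0 : 0 < n := by omega
  have tb : ∀ (s : Fin α) (t : Fin β) (z z' : ℤ),
      h - α + (s : ℤ) + 2 * n * z ≠ h + t + 2 * n * z' := by
    intro s t z z' he
    have hs := s.2
    have ht := t.2
    have h2 := shift_inj (n := n) (p := h - α + s) (q := h + t) (by rw [abs_lt]; omega) he
    rw [h2] at he
    omega
  by_cases hm : ∃ (s : Fin α) (z : ℤ), m = h - α + s + 2 * n * z
  · obtain ⟨s, z, hm⟩ := hm
    rw [shearDual_of_eq (by omega) s z hm]
    by_cases hl : ∃ (t : Fin β) (z : ℤ), l = h + t + 2 * n * z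
    · obtain ⟨t, z', hl⟩ := hl
      rw [shear_of_eq (by omega) t z' hl]
      have hml : l ≠ m := by rw [hl, hm]; exact (tb _ _ _ _).symm
      simp only [LinearMap.sub_apply, LinearMap.sum_apply, LinearMap.smul_apply, map_add, map_sum,
        map_smul, hc, smul_eq_mul]
      simp only [if_neg hml, (tb _ _ _ _), if_false, mul_zero, Finset.sum_const_zero, sub_zero]
      by_cases hz : z' = z
      · subst hz
        rw [Finset.sum_eq_single s, Finset.sum_eq_single t]
        · simp [hl, hm]
        · intro t' _ ht'
          rw [if_neg, mul_zero]
          rw [hl]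
          intro h0
          exact ht' (Fin.ext (by omega))
        · simp
        · intro t' _ ht'
          rw [if_neg, mul_zero]
          rw [hm]
          intro h0
          exact ht' (Fin.ext (by omega))
        · simp
      · have e1 : ∀ x : Fin β, (S s x * if l = h + x + 2 * n * z then (1 : k) else 0) = 0 := by
          intro t'
          rw [if_neg, mul_zero]
          rw [hl]
          intro h0
          have := t.2
          have := t'.2
          exact hz (shift_inj (n := n) (p := h + t) (q := h + t') (by rw [abs_lt]; omega) h0)
        have e2 : ∀ x : Fin α, (S x t * if h - α + x + 2 * n * z' = m then (1 : k) else 0) = 0 := by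
          intro t'
          rw [if_neg, mul_zero]
          rw [hm]
          intro h0
          have := s.2
          have := t'.2
          exact hz (shift_inj (n := n) (p := h - α + t') (q := h - α + s) (by rw [abs_lt]; omega) h0)
        simp only [e1, e2, Finset.sum_const_zero, add_zero, sub_zero]
    · push Not at hl
      rw [shear_of_ne hn0 hl]
      simp only [LinearMap.sub_apply, LinearMap.sum_apply, LinearMap.smul_apply, hc, smul_eq_mul]
      rw [Finset.sum_eq_zero, sub_zero]
      intro t _
      rw [if_neg (hl _ _), mul_zero]
  · push Not at hm
    rw [shearDual_of_ne hn0 hm]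
    by_cases hl : ∃ (t : Fin β) (z : ℤ), l = h + t + 2 * n * z
    · obtain ⟨t, z, hl⟩ := hl
      rw [shear_of_eq (by omega) t z hl]
      simp only [map_add, map_sum, map_smul, hc, smul_eq_mul]
      rw [Finset.sum_eq_zero, add_zero]
      intro s _
      rw [if_neg (hm _ _).symm, mul_zero]
    · push Not at hl
      rw [shear_of_ne hn0 hl, hc]

theorem shearDual_period {T : E →ₗ[k] E} (hn : α < 2 * n) (hT : ∀ m u, c (m + 2 * n) (T u) = c m u)
    (m : ℤ) (u : E) : shearDual n c h S (m + 2 * n) (T u) = shearDual n c h S m u := by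
  by_cases hm : ∃ (s : Fin α) (z : ℤ), m = h - α + s + 2 * n * z
  · obtain ⟨s, z, hm⟩ := hm
    rw [shearDual_of_eq hn s z hm, shearDual_of_eq hn s (z + 1) (by rw [hm]; ring)]
    simp only [LinearMap.sub_apply, LinearMap.sum_apply, LinearMap.smul_apply, hT]
    congr 1
    refine Finset.sum_congr rfl fun t _ => ?_
    rw [show h + (t : ℤ) + 2 * n * (z + 1) = h + t + 2 * n * z + 2 * n by ring, hT]
  · push Not at hm
    rw [shearDual_of_ne (by omega) hm, shearDual_of_ne (by omega), hT]
    intro s z hz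
    exact hm s (z - 1) (by linarith)

end Shear

end AffineTwin

/-! ### Sets of three types. -/

namespace AffineTwin

/-- The possible shapes of a set of three types: `h` is distinguished, `i` is its predecessor or not
adjacent to it, `i'` is its successor or not adjacent to it, and `i` and `i'` are not adjacent. -/
structure Config (n : ℕ) (J : Set (ZMod (2 * n))) (h i i' : ℤ) (α β : ℕ) : Prop where
  eq : J = {(h : ZMod (2 * n)), (i : ZMod (2 * n)), (i' : ZMod (2 * n))}
  h_ne_i : (h : ZMod (2 * n)) ≠ i
  h_ne_i' : (h : ZMod (2 * n)) ≠ i'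
  i_ne_i' : (i : ZMod (2 * n)) ≠ i'
  top : α = 1 ∨ α = 2 ∧ i = h - 1
  bot : β = 1 ∨ β = 2 ∧ i' = h + 1
  low : ((h - α : ℤ) : ZMod (2 * n)) ∉ J
  high : ((h + β : ℤ) : ZMod (2 * n)) ∉ J
  left : ((i - 1 : ℤ) : ZMod (2 * n)) ∉ J
  right : ((i' + 1 : ℤ) : ZMod (2 * n)) ∉ J
  succ_i : α = 1 → ((i + 1 : ℤ) : ZMod (2 * n)) ∉ J
  pred_i' : β = 1 → ((i' - 1 : ℤ) : ZMod (2 * n)) ∉ J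

/-- Congruence of integers modulo `2n`. -/
theorem intCast_eq_shift {n : ℕ} {a b : ℤ} (h : (a : ZMod (2 * n)) = b) (d : ℤ) :
    ((a + d : ℤ) : ZMod (2 * n)) = ((b + d : ℤ) : ZMod (2 * n)) := by
  push_cast; rw [h]

theorem intCast_eq_shift_sub {n : ℕ} {a b : ℤ} (h : (a : ZMod (2 * n)) = b) (d : ℤ) :
    ((a - d : ℤ) : ZMod (2 * n)) = ((b - d : ℤ) : ZMod (2 * n)) := by
  push_cast; rw [h]

namespace Config

variable {n : ℕ} {J : Set (ZMod (2 * n))} {h i i' : ℤ} {α β : ℕ} (C : Config n J h i i' α β)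
include C

theorem mem_iff {r : ZMod (2 * n)} : r ∈ J ↔ r = h ∨ r = i ∨ r = i' := by
  rw [C.eq]; simp

theorem h_mem : (h : ZMod (2 * n)) ∈ J := C.mem_iff.2 (.inl rfl)
theorem i_mem : (i : ZMod (2 * n)) ∈ J := C.mem_iff.2 (.inr (.inl rfl))
theorem i'_mem : (i' : ZMod (2 * n)) ∈ J := C.mem_iff.2 (.inr (.inr rfl))

theorem top_le : α ≤ 2 := by rcases C.top with h | h <;> omega
theorem bot_le : β ≤ 2 := by rcases C.bot with h | h <;> omega
theorem top_pos : 0 < α := by rcases C.top with h | h <;> omega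
theorem bot_pos : 0 < β := by rcases C.bot with h | h <;> omega

/-- The integers strictly inside the block of `h` have types in `J`. -/
theorem mem_of_between {l z : ℤ} (h1 : h - α + 2 * n * z < l) (h2 : l < h + β + 2 * n * z) :
    (l : ZMod (2 * n)) ∈ J := by
  obtain ⟨m, rfl⟩ : ∃ m, l = m + 2 * n * z := ⟨l - 2 * n * z, by ring⟩
  rw [intCast_add_mul]
  rcases C.top with ht | ⟨ht, hi⟩ <;> rcases C.bot with hb | ⟨hb, hi'⟩ <;> subst ht hb <;>
    push_cast at h1 h2
  · have : m = h := by omega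
    rw [this]; exact C.h_mem
  · have : m = h ∨ m = i' := by omega
    rcases this with rfl | rfl
    exacts [C.h_mem, C.i'_mem]
  · have : m = h ∨ m = i := by omega
    rcases this with rfl | rfl
    exacts [C.h_mem, C.i_mem]
  · have : m = h ∨ m = i' ∨ m = i := by omega
    rcases this with rfl | rfl | rfl
    exacts [C.h_mem, C.i'_mem, C.i_mem]

/-- The types of the integers in the upper half of the block of `h`. -/
theorem top_cases (s : Fin α) (z : ℤ) :
    ((h - α + s + 2 * n * z : ℤ) : ZMod (2 * n)) ∉ J ∧ (s : ℕ) = 0 ∨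
    ((h - α + s + 2 * n * z : ℤ) : ZMod (2 * n)) = i ∧ (s : ℕ) = 1 ∧ α = 2 ∧ i = h - 1 := by
  rw [intCast_add_mul]
  by_cases hs : (s : ℕ) = 0
  · left
    rw [hs]
    exact ⟨by simpa using C.low, rfl⟩
  · right
    have := s.2
    rcases C.top with ht | ⟨ht, hi⟩
    · omega
    · refine ⟨?_, by omega, ht, hi⟩
      have hs' : (s : ℕ) = 1 := by omega
      rw [hs', ht, hi]
      congr 1
      push_cast; ring

/-- The types of the integers in the lower half of the block of `h`. -/
theorem bot_cases (t : Fin β) (z : ℤ) :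
    ((h + t + 2 * n * z : ℤ) : ZMod (2 * n)) = h ∧ (t : ℕ) = 0 ∨
    ((h + t + 2 * n * z : ℤ) : ZMod (2 * n)) = i' ∧ (t : ℕ) = 1 ∧ β = 2 ∧ i' = h + 1 := by
  rw [intCast_add_mul]
  by_cases hs : (t : ℕ) = 0
  · left
    rw [hs]
    exact ⟨by simp, rfl⟩
  · right
    have := t.2
    rcases C.bot with ht | ⟨ht, hi⟩
    · omega
    · have hs' : (t : ℕ) = 1 := by omega
      refine ⟨?_, hs', ht, hi⟩
      rw [hs', hi]
      simp

theorem ne_top_of_eq_h {m : ℤ} (hm : (m : ZMod (2 * n)) = h) (s : Fin α) (z : ℤ) :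
    m ≠ h - α + s + 2 * n * z := by
  rintro rfl
  rcases C.top_cases s z with ⟨h1, -⟩ | ⟨h1, -⟩
  · exact h1 (hm ▸ C.h_mem)
  · exact C.h_ne_i (hm.symm.trans h1)

theorem ne_top_of_eq_i' {m : ℤ} (hm : (m : ZMod (2 * n)) = i') (s : Fin α) (z : ℤ) :
    m ≠ h - α + s + 2 * n * z := by
  rintro rfl
  rcases C.top_cases s z with ⟨h1, -⟩ | ⟨h1, -⟩
  · exact h1 (hm ▸ C.i'_mem)
  · exact C.i_ne_i' (h1.symm.trans hm)

/-- With `ne_top_of_eq_i'` this shows that the two coordinates defining the line of type i' are not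
affected by the shear. -/
theorem pred_i'_ne_top {m : ℤ} (hm : (m : ZMod (2 * n)) = i') (s : Fin α) (z : ℤ) :
    m - 1 ≠ h - α + s + 2 * n * z := by
  intro h0
  have hm' : ((m - 1 : ℤ) : ZMod (2 * n)) = ((i' - 1 : ℤ) : ZMod (2 * n)) := by push_cast; rw [hm]
  rcases C.top_cases s z with ⟨h1, h2⟩ | ⟨h1, h2, h3, h4⟩
  · rcases C.top with ht | ⟨ht, hi⟩
    · apply C.h_ne_i'
      rw [← hm, show m = h + 2 * n * z by rw [h2, ht] at h0; push_cast at h0; linarith,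
        intCast_add_mul]
    · apply C.i_ne_i'
      rw [← hm, show m = i + 2 * n * z by rw [h2, ht] at h0; push_cast at h0; linarith,
        intCast_add_mul]
  · apply C.h_ne_i'
    rw [← hm, show m = h + 2 * n * z by rw [h2, h3] at h0; push_cast at h0; linarith,
      intCast_add_mul]

theorem ne_bot_of_eq_i {m : ℤ} (hm : (m : ZMod (2 * n)) = i) (t : Fin β) (z : ℤ) :
    m ≠ h + t + 2 * n * z := by
  rintro rfl
  rcases C.bot_cases t z with ⟨h1, -⟩ | ⟨h1, -⟩
  · exact C.h_ne_i (h1.symm.trans hm)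
  · exact C.i_ne_i' (hm.symm.trans h1)

theorem ne_bot_of_notMem {m : ℤ} (hm : (m : ZMod (2 * n)) ∉ J) (t : Fin β) (z : ℤ) :
    m ≠ h + t + 2 * n * z := by
  rintro rfl
  rcases C.bot_cases t z with ⟨h1, -⟩ | ⟨h1, -⟩
  · exact hm (h1 ▸ C.h_mem)
  · exact hm (h1 ▸ C.i'_mem)

theorem pred_i_notMem {l : ℤ} (hl : (l : ZMod (2 * n)) = i) : ((l - 1 : ℤ) : ZMod (2 * n)) ∉ J := by
  have := C.left
  rwa [intCast_eq_shift_sub hl]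

theorem succ_i'_notMem {l : ℤ} (hl : (l : ZMod (2 * n)) = i') :
    ((l + 1 : ℤ) : ZMod (2 * n)) ∉ J := by
  have := C.right
  rwa [intCast_eq_shift hl]

theorem succ_i_ne_i' {l : ℤ} (hl : (l : ZMod (2 * n)) = i) :
    ((l + 1 : ℤ) : ZMod (2 * n)) ≠ i' := by
  rw [intCast_eq_shift hl]
  rcases C.top with ht | ⟨-, ht⟩
  · exact fun h0 => C.succ_i ht (h0 ▸ C.i'_mem)
  · rw [ht, sub_add_cancel]; exact C.h_ne_i'

end Config

/-! ### Filtrations with prescribed coordinates -/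

section Modify

variable {k E : Type*} [Field k] [AddCommGroup E] [Module k E] {n : ℕ}

/-- The vectors whose coordinates of index less than `l` vanish. -/
def vanish (c : ℤ → E →ₗ[k] k) (l : ℤ) : Submodule k E where
  carrier := {u | ∀ m < l, c m u = 0}
  zero_mem' := fun m _ => map_zero _
  add_mem' := fun {u v} hu hv m hm => by rw [map_add, hu m hm, hv m hm, add_zero]
  smul_mem' := fun r u hu m hm => by rw [map_smul, hu m hm, smul_zero]

theorem vanish_succ {c : ℤ → E →ₗ[k] k} {l : ℤ} {u : E} :
    u ∈ vanish c (l + 1) ↔ u ∈ vanish c l ∧ c l u = 0 := by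
  constructor
  · exact fun h => ⟨fun m hm => h m (by omega), h l (by omega)⟩
  · rintro ⟨h1, h2⟩ m hm
    rcases lt_or_eq_of_le (Int.lt_add_one_iff.1 hm) with h3 | rfl
    exacts [h1 m h3, h2]

theorem vanish_eq {c : ℤ → E →ₗ[k] k} {l : ℤ} {u : E} :
    u ∈ vanish c l ↔ u ∈ vanish c (l - 1) ∧ c (l - 1) u = 0 := by
  have := vanish_succ (c := c) (l := l - 1) (u := u)
  rwa [sub_add_cancel] at this

/-- The vectors of `vanish c (l - 1)` with coordinates of index `l - 1` and `l` proportional to `x`. -/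
def onLine (c : ℤ → E →ₗ[k] k) (x : k × k) (l : ℤ) : Submodule k E :=
  vanish c (l - 1) ⊓ LinearMap.ker (x.2 • c (l - 1) - x.1 • c l)

theorem mem_onLine {c : ℤ → E →ₗ[k] k} {x : k × k} {l : ℤ} {u : E} :
    u ∈ onLine c x l ↔ u ∈ vanish c (l - 1) ∧ x.2 * c (l - 1) u = x.1 * c l u := by
  rw [onLine, Submodule.mem_inf, LinearMap.mem_ker]
  simp [sub_eq_zero]

/-- The filtration by vanishing of coordinates, modified at the types `i` and `i'`. -/
def modify (n : ℕ) (c : ℤ → E →ₗ[k] k) (i i' : ℤ) (x y : k × k) (l : ℤ) : Submodule k E :=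
  if (l : ZMod (2 * n)) = i then onLine c x l
  else if (l : ZMod (2 * n)) = i' then onLine c y l else vanish c l

variable {c : ℤ → E →ₗ[k] k} {i i' : ℤ} {x y : k × k}

theorem modify_i {l : ℤ} (hl : (l : ZMod (2 * n)) = i) : modify n c i i' x y l = onLine c x l :=
  if_pos hl

theorem modify_i' {l : ℤ} (hii : (i : ZMod (2 * n)) ≠ i') (hl : (l : ZMod (2 * n)) = i') :
    modify n c i i' x y l = onLine c y l := by
  rw [modify, if_neg (by rw [hl]; exact hii.symm), if_pos hl]

theorem modify_of_ne {l : ℤ} (hl : (l : ZMod (2 * n)) ≠ i) (hl' : (l : ZMod (2 * n)) ≠ i') :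
    modify n c i i' x y l = vanish c l := by
  rw [modify, if_neg hl, if_neg hl']

theorem vanish_le_onLine {l : ℤ} {u : E} (hu : u ∈ vanish c (l + 1)) : u ∈ onLine c x l := by
  rw [mem_onLine]
  exact ⟨fun m hm => hu m (by omega), by rw [hu _ (by omega), hu l (by omega)]; ring⟩

theorem onLine_par {x' : k × k} (h : Par x x') (hx : x ≠ 0) (hx' : x' ≠ 0) (l : ℤ) :
    onLine c x l = onLine c x' l := by
  obtain ⟨r, hr, rfl⟩ := h.exists_smul hx hx'
  ext u
  rw [mem_onLine, mem_onLine]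
  refine and_congr_right fun _ => ?_
  simp only [Prod.smul_fst, Prod.smul_snd, smul_eq_mul, mul_assoc]
  exact (mul_right_inj' hr).symm

variable {X : TwistedForm k E} {F : ℤ → Submodule k E} {a : ℤ → E}

theorem exists_mem_onLine (hac : ∀ m l, c m (a l) = if l = m then 1 else 0) (x : k × k) (l : ℤ) :
    x.1 • a (l - 1) + x.2 • a l ∈ onLine c x l := by
  rw [mem_onLine]
  refine ⟨fun m hm => ?_, ?_⟩
  · rw [map_add, map_smul, map_smul, hac, hac, if_neg (by omega), if_neg (by omega)]; simp
  · simp only [map_add, map_smul, hac]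
    rw [if_neg (show l ≠ l - 1 by omega), if_neg (show l - 1 ≠ l by omega)]
    simp [mul_comm]

/-- On the line of x the coordinate l - 1 is nonzero unless x.1 = 0, and then the coordinate l is.
-/
theorem line_step (hac : ∀ m l, c m (a l) = if l = m then 1 else 0) (hx : x ≠ 0) (l : ℤ) :
    ∃ ψ : E →ₗ[k] k, (∀ u, u ∈ vanish c (l + 1) ↔ u ∈ onLine c x l ∧ ψ u = 0) ∧
      ∃ u ∈ onLine c x l, ψ u ≠ 0 := by
  have hv : c (l - 1) (x.1 • a (l - 1) + x.2 • a l) = x.1 := by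
    simp only [map_add, map_smul, hac]
    rw [if_neg (show l ≠ l - 1 by omega)]; simp
  have hv' : c l (x.1 • a (l - 1) + x.2 • a l) = x.2 := by
    simp only [map_add, map_smul, hac]
    rw [if_neg (show l - 1 ≠ l by omega)]; simp
  by_cases h1 : x.1 = 0
  · have h2 : x.2 ≠ 0 := fun h2 => hx (Prod.ext h1 h2)
    refine ⟨c l, fun u => ?_, _, exists_mem_onLine hac x l, by rwa [hv']⟩
    rw [vanish_succ, vanish_eq, mem_onLine, h1]
    simp [h2]
  · refine ⟨c (l - 1), fun u => ?_, _, exists_mem_onLine hac x l, by rwa [hv]⟩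
    rw [vanish_succ, vanish_eq, mem_onLine]
    constructor
    · rintro ⟨⟨h3, h4⟩, h5⟩
      exact ⟨⟨h3, by rw [h4, h5]; ring⟩, h4⟩
    · rintro ⟨⟨h3, h4⟩, h5⟩
      rw [h5, mul_zero] at h4
      exact ⟨⟨h3, h5⟩, (mul_eq_zero.1 h4.symm).resolve_left h1⟩

theorem step_line (hac : ∀ m l, c m (a l) = if l = m then 1 else 0) (hx : x ≠ 0) (l : ℤ) :
    ∃ ψ : E →ₗ[k] k, (∀ u, u ∈ onLine c x (l + 1) ↔ u ∈ vanish c l ∧ ψ u = 0) ∧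
      ∃ u ∈ vanish c l, ψ u ≠ 0 := by
  refine ⟨x.2 • c l - x.1 • c (l + 1), fun u => ?_, ?_⟩
  · rw [mem_onLine, add_sub_cancel_right]
    simp [sub_eq_zero]
  · by_cases h1 : x.1 = 0
    · have h2 : x.2 ≠ 0 := fun h2 => hx (Prod.ext h1 h2)
      refine ⟨a l, fun m hm => by rw [hac, if_neg (by omega)], ?_⟩
      simp [hac, h1, h2]
    · refine ⟨a (l + 1), fun m hm => by rw [hac, if_neg (by omega)], ?_⟩
      simp [hac, h1]

/-- As i and i' are neither equal nor adjacent, the neighbours of a modified space are unmodified,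
so `vanish_succ`, `line_step` and `step_line` cover all steps. The class of r ties the new
filtration to F. -/
theorem TwistedForm.Filt.modify [NeZero n] (hF : X.Filt n F)
    (hac : ∀ m l, c m (a l) = if l = m then 1 else 0)
    (hT : ∀ m u, c (m + 2 * n) (X.T u) = c m u) (hx : x ≠ 0) (hy : y ≠ 0)
    (hii : (i : ZMod (2 * n)) ≠ i')
    (h1 : ∀ l : ℤ, (l : ZMod (2 * n)) = i → ((l + 1 : ℤ) : ZMod (2 * n)) ≠ i')
    (h2 : ∀ l : ℤ, (l : ZMod (2 * n)) = i' → ((l + 1 : ℤ) : ZMod (2 * n)) ≠ i)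
    (r : ℤ) (hr1 : (r : ZMod (2 * n)) ≠ i) (hr2 : (r : ZMod (2 * n)) ≠ i')
    (hr : ∀ z : ℤ, vanish c (r + 2 * n * z) = F (r + 2 * n * z)) :
    X.Filt n (modify n c i i' x y) := by
  have hvT : ∀ l u, u ∈ vanish c l ↔ X.T u ∈ vanish c (l + 2 * n) := by
    intro l u
    constructor
    · intro h m hm
      have := hT (m - 2 * n) u
      rw [sub_add_cancel] at this
      rw [this]; exact h _ (by linarith)
    · intro h m hm
      rw [← hT]; exact h _ (by linarith)
  have hlT : ∀ x l u, u ∈ onLine c x l ↔ X.T u ∈ onLine c x (l + 2 * n) := by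
    intro x l u
    rw [mem_onLine, mem_onLine, hT, show l + 2 * (n : ℤ) - 1 = l - 1 + 2 * n by ring, hT, ← hvT]
  refine hF.congr_of_step (fun l u => ?_) (fun l => ?_) r (fun z => ?_)
  · unfold AffineTwin.modify
    rw [intCast_add_period]
    split_ifs
    exacts [hlT _ _ _, hlT _ _ _, hvT _ _]
  · by_cases e1 : (l : ZMod (2 * n)) = i
    · rw [modify_of_ne (l := l + 1) (fun h => ne_of_sub_one h e1) (h1 l e1), modify_i e1]
      exact line_step hac hx l
    · by_cases e2 : (l : ZMod (2 * n)) = i'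
      · rw [modify_of_ne (l := l + 1) (h2 l e2) (fun h => ne_of_sub_one h e2), modify_i' hii e2]
        exact line_step hac hy l
      · rw [modify_of_ne e1 e2]
        by_cases e3 : ((l + 1 : ℤ) : ZMod (2 * n)) = i
        · rw [modify_i e3]; exact step_line hac hx l
        · by_cases e4 : ((l + 1 : ℤ) : ZMod (2 * n)) = i'
          · rw [modify_i' hii e4]; exact step_line hac hy l
          · rw [modify_of_ne e3 e4]
            exact ⟨c l, fun u => vanish_succ, a l, fun m hm => by rw [hac, if_neg (by omega)],
              by simp [hac]⟩
  · rw [modify_of_ne (by rwa [intCast_add_mul]) (by rwa [intCast_add_mul]), hr]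

end Modify

end AffineTwin

/-! ### Adjacency in the coordinates (S, x, y). -/

namespace AffineTwin

section Adjacency

variable {k E : Type*} [Field k] [AddCommGroup E] [Module k E] {n : ℕ}
  {J : Set (ZMod (2 * n))} {h i i' : ℤ} {α β : ℕ} {F : ℤ → Submodule k E}
  {c : ℤ → E →ₗ[k] k} {a : ℤ → E} {S S' : Matrix (Fin α) (Fin β) k} {x y x' y' : k × k}

/-- The filtration with coordinates `(S, x, y)`. -/
def coordFilt (n : ℕ) (c : ℤ → E →ₗ[k] k) (h i i' : ℤ) (S : Matrix (Fin α) (Fin β) k)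
    (x y : k × k) : ℤ → Submodule k E :=
  modify n (shearDual n c h S) i i' x y

theorem Config.lt_two_mul (C : Config n J h i i' α β) (hn : 4 ≤ n) : α + β < 2 * n := by
  have := C.top_le
  have := C.bot_le
  omega

/-- The lower coordinates do not depend on S, so shears compose additively in S. -/
theorem shearDual_sub (hα : α < 2 * n)
    (htb : ∀ (t : Fin β) (z : ℤ) (s : Fin α) (z' : ℤ), h + t + 2 * n * z ≠ h - α + s + 2 * n * z')
    (s : Fin α) (z : ℤ) {m : ℤ} (hm : m = h - α + s + 2 * n * z) (u : E) :
    shearDual n c h S' m u = shearDual n c h S m u -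
      ∑ t : Fin β, (S' - S) s t * shearDual n c h S (h + t + 2 * n * z) u := by
  have hn0 : 0 < n := by omega
  rw [shearDual_of_eq hα s z hm, shearDual_of_eq hα s z hm]
  have e : ∀ t : Fin β, shearDual n c h S (h + t + 2 * n * z) = c (h + t + 2 * n * z) := fun t =>
    shearDual_of_ne hn0 (htb t z)
  simp only [e, LinearMap.sub_apply, LinearMap.sum_apply, LinearMap.smul_apply, smul_eq_mul,
    Matrix.sub_apply, sub_mul, Finset.sum_sub_distrib]
  ring

variable (C : Config n J h i i' α β) (hn : 4 ≤ n)
include C hn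

theorem Config.bot_ne_top (t : Fin β) (z : ℤ) (s : Fin α) (z' : ℤ) :
    h + t + 2 * n * z ≠ h - α + s + 2 * n * z' := by
  have _ := hn
  rcases C.bot_cases t z with ⟨h1, -⟩ | ⟨h1, -⟩
  · exact C.ne_top_of_eq_h h1 s z'
  · exact C.ne_top_of_eq_i' h1 s z'

theorem Config.shearDual_eq {m : ℤ} (hm : ∀ (s : Fin α) (z : ℤ), m ≠ h - α + s + 2 * n * z) :
    shearDual n c h S m = shearDual n c h S' m := by
  have _ := C
  rw [shearDual_of_ne (by omega) hm, shearDual_of_ne (by omega) hm]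

theorem Config.shearDual_apply_sub (s : Fin α) (z : ℤ) {m : ℤ} (hm : m = h - α + s + 2 * n * z)
    (u : E) : shearDual n c h S' m u = shearDual n c h S m u -
      ∑ t : Fin β, (S' - S) s t * shearDual n c h S (h + t + 2 * n * z) u :=
  shearDual_sub (by have := C.lt_two_mul hn; omega) (C.bot_ne_top hn) s z hm u

/-- Away from the block of `h` the coordinates vanish simultaneously. -/
theorem Config.vanish_shearDual {l : ℤ} (hl : (l : ZMod (2 * n)) ∉ J) :
    vanish (shearDual n c h S) l = vanish c l := by
  have hn0 : 0 < n := by omega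
  have hαβ := C.lt_two_mul hn
  have hlt : ∀ (s : Fin α) (z : ℤ) (t : Fin β), h - α + s + 2 * n * z < l →
      h + t + 2 * n * z < l := by
    intro s z t hs
    by_contra hcon
    apply hl
    refine C.mem_of_between (z := z) ?_ ?_
    · have := s.2; omega
    · have := t.2; omega
  ext u
  constructor
  · intro hu m hm
    by_cases hm' : ∃ (s : Fin α) (z : ℤ), m = h - α + s + 2 * n * z
    · obtain ⟨s, z, hmz⟩ := hm'
      have h1 := hu m hm
      rw [shearDual_of_eq (by omega) s z hmz] at h1
      simp only [LinearMap.sub_apply, LinearMap.sum_apply, LinearMap.smul_apply, smul_eq_mul] at h1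
      rw [Finset.sum_eq_zero, sub_zero] at h1
      · exact h1
      · intro t _
        have h2 := hu _ (hlt s z t (hmz ▸ hm))
        rw [shearDual_of_ne hn0 (C.bot_ne_top hn t z)] at h2
        rw [h2, mul_zero]
    · push Not at hm'
      have h1 := hu m hm
      rwa [shearDual_of_ne hn0 hm'] at h1
  · intro hu m hm
    by_cases hm' : ∃ (s : Fin α) (z : ℤ), m = h - α + s + 2 * n * z
    · obtain ⟨s, z, hmz⟩ := hm'
      rw [shearDual_of_eq (by omega) s z hmz]
      simp only [LinearMap.sub_apply, LinearMap.sum_apply, LinearMap.smul_apply, smul_eq_mul]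
      rw [hu m hm, Finset.sum_eq_zero, sub_zero]
      intro t _
      rw [hu _ (hlt s z t (hmz ▸ hm)), mul_zero]
    · push Not at hm'
      rw [shearDual_of_ne hn0 hm']
      exact hu m hm

theorem Config.coordFilt_of_notMem {l : ℤ} (hl : (l : ZMod (2 * n)) ∉ J) :
    coordFilt n c h i i' S x y l = vanish c l := by
  rw [coordFilt, modify_of_ne, C.vanish_shearDual hn hl]
  · exact fun h0 => hl (h0 ▸ C.i_mem)
  · exact fun h0 => hl (h0 ▸ C.i'_mem)

theorem Config.coordFilt_h {l : ℤ} (hl : (l : ZMod (2 * n)) = h) :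
    coordFilt n c h i i' S x y l = vanish (shearDual n c h S) l := by
  have _ := hn
  rw [coordFilt, modify_of_ne (by rw [hl]; exact C.h_ne_i) (by rw [hl]; exact C.h_ne_i')]

theorem Config.coordFilt_i {l : ℤ} (hl : (l : ZMod (2 * n)) = i) :
    coordFilt n c h i i' S x y l = onLine (shearDual n c h S) x l := by
  have _ := hn
  have _ := C
  rw [coordFilt, modify_i hl]

theorem Config.coordFilt_i' {l : ℤ} (hl : (l : ZMod (2 * n)) = i') :
    coordFilt n c h i i' S x y l = onLine (shearDual n c h S) y l := by
  have _ := hn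
  rw [coordFilt, modify_i' C.i_ne_i' hl]

variable (hac : ∀ m l, c m (a l) = if l = m then 1 else 0)
include hac

theorem Config.dual_apply (m l : ℤ) :
    shearDual n c h S m (shear n a h S l) = if l = m then 1 else 0 :=
  shearDual_shear (C.lt_two_mul hn) hac m l

/-- The spanning vector of the line for x has to satisfy the equation for x'. To evaluate the
coordinates for S' on it, either these or the vectors must be unchanged from S; the first happens at
type i', the second at type i. -/
theorem Config.par_of_onLine {l : ℤ} (hl : ∀ m, m = l - 1 ∨ m = l →
      shearDual n c h S' m = shearDual n c h S m ∨ shear n a h S m = shear n a h S' m ∧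
        shear n a h S (l - 1) = shear n a h S' (l - 1) ∧ shear n a h S l = shear n a h S' l)
    (heq : onLine (shearDual n c h S) x l ≤ onLine (shearDual n c h S') x' l) : Par x x' := by
  have h1 := heq (exists_mem_onLine (C.dual_apply hn hac) x l)
  have key : ∀ m, m = l - 1 ∨ m = l → shearDual n c h S' m
      (x.1 • shear n a h S (l - 1) + x.2 • shear n a h S l) = shearDual n c h S m
      (x.1 • shear n a h S (l - 1) + x.2 • shear n a h S l) := by
    intro m hm
    rcases hl m hm with h2 | ⟨-, h3, h4⟩
    · rw [h2]
    · simp only [map_add, map_smul, C.dual_apply hn hac (S := S)]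
      rw [h3, h4, C.dual_apply hn hac, C.dual_apply hn hac]
  obtain ⟨-, h2⟩ := mem_onLine.1 h1
  rw [key _ (.inl rfl), key _ (.inr rfl)] at h2
  simp only [map_add, map_smul, C.dual_apply hn hac (S := S)] at h2
  rw [if_neg (show l ≠ l - 1 by omega), if_neg (show l - 1 ≠ l by omega)] at h2
  simp only [if_true, smul_eq_mul, mul_one, mul_zero, add_zero, zero_add] at h2
  unfold Par
  linear_combination h2

theorem Config.shear_top (s : Fin α) (t : Fin β) :
    shearDual n c h S' (h - α + s) (shear n a h S (h + t)) = -(S' - S) s t := by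
  have h1 := C.shearDual_apply_sub hn (c := c) (S := S) (S' := S') s 0 (m := h - α + s) (by ring)
    (shear n a h S (h + t))
  have hne : ∀ t' : Fin β, ((h + (t : ℤ) = h + t' + 2 * n * 0) ↔ t' = t) := by
    intro t'
    constructor
    · intro h0; exact Fin.ext (by omega)
    · rintro rfl; ring
  have hne2 : h + (t : ℤ) ≠ h - α + s := by
    have := C.bot_ne_top hn t 0 s 0
    simpa using this
  simp only [C.dual_apply hn hac, hne, if_neg hne2] at h1
  rw [h1]
  simp

/-- The vectors a (h + t) sheared by S lie in the space of type h, and their upper coordinates for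
S' are the entries of S - S'. -/
theorem Config.eq_of_vanish_le
    (heq : vanish (shearDual n c h S) h ≤ vanish (shearDual n c h S') h) : S = S' := by
  ext s t
  have h1 : shear n a h S (h + t) ∈ vanish (shearDual n c h S) h := fun m hm => by
    rw [C.dual_apply hn hac, if_neg (by omega)]
  have h2 := heq h1 (h - α + s) (by have := s.2; omega)
  rw [C.shear_top hn hac] at h2
  simp only [Matrix.sub_apply] at h2
  linear_combination h2

omit hac

theorem Config.shear_eq_i (l : ℤ) (hl : (l : ZMod (2 * n)) = i) :
    shear n a h S (l - 1) = shear n a h S' (l - 1) ∧ shear n a h S l = shear n a h S' l := by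
  have hn0 : 0 < n := by omega
  constructor
  · rw [shear_of_ne hn0 (C.ne_bot_of_notMem (C.pred_i_notMem hl)),
      shear_of_ne hn0 (C.ne_bot_of_notMem (C.pred_i_notMem hl))]
  · rw [shear_of_ne hn0 (C.ne_bot_of_eq_i hl), shear_of_ne hn0 (C.ne_bot_of_eq_i hl)]

/-- For a change of `S` by a matrix whose columns are proportional to `x`. -/
theorem Config.onLine_i_le (hS : S' - S ∈ colSub α β x) {l : ℤ} (hl : (l : ZMod (2 * n)) = i) :
    onLine (shearDual n c h S) x l = onLine (shearDual n c h S') x l := by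
  have hpre := C.pred_i_notMem hl
  ext u
  rw [mem_onLine, mem_onLine, C.vanish_shearDual hn hpre, C.vanish_shearDual hn hpre]
  refine and_congr_right fun _ => ?_
  rcases C.top with ht | ⟨ht, hi⟩
  · have h1 : ∀ m : ℤ, m = l - 1 ∨ m = l → ∀ (s : Fin α) (z : ℤ), m ≠ h - α + s + 2 * n * z := by
      intro m hm s z h0
      have hs : (s : ℕ) = 0 := by have := s.2; omega
      rcases C.top_cases s z with ⟨h2, -⟩ | ⟨-, h2, -⟩
      · rcases hm with rfl | rfl
        · apply C.h_ne_i
          rw [← hl, show l = h + 2 * n * z by rw [hs, ht] at h0; push_cast at h0; linarith,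
            intCast_add_mul]
        · apply h2; rw [← h0, hl]; exact C.i_mem
      · omega
    rw [C.shearDual_eq hn (S := S) (S' := S') (h1 _ (.inl rfl)),
      C.shearDual_eq hn (S := S) (S' := S') (h1 _ (.inr rfl))]
  · subst ht
    obtain ⟨z, rfl⟩ := intCast_eq_iff.1 hl.symm
    have e0 := C.shearDual_apply_sub hn (c := c) (S := S) (S' := S') 0 z
      (m := i + 2 * n * z - 1) (by rw [hi]; simp; ring) u
    have e1 := C.shearDual_apply_sub hn (c := c) (S := S) (S' := S') 1 z
      (m := i + 2 * n * z) (by rw [hi]; simp; ring) u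
    have e2 : x.2 * ∑ t : Fin β, (S' - S) 0 t * shearDual n c h S (h + t + 2 * n * z) u =
        x.1 * ∑ t : Fin β, (S' - S) 1 t * shearDual n c h S (h + t + 2 * n * z) u := by
      rw [Finset.mul_sum, Finset.mul_sum]
      refine Finset.sum_congr rfl fun t _ => ?_
      have := hS 0 1 t
      simp only [co_zero, co_one] at this
      linear_combination shearDual n c h S (h + t + 2 * n * z) u * this
    rw [e0, e1]
    constructor
    · intro h0; linear_combination h0 - e2
    · intro h0; linear_combination h0 + e2

/-- For a change of `S` by a matrix whose rows are orthogonal to `y`. -/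
theorem Config.onLine_i'_le (hy : y ≠ 0) (hS : S' - S ∈ rowSub α β y) {l : ℤ}
    (hl : (l : ZMod (2 * n)) = i') :
    onLine (shearDual n c h S) y l ≤ onLine (shearDual n c h S') y l := by
  intro u hu
  rw [mem_onLine] at hu ⊢
  obtain ⟨h1, h2⟩ := hu
  rw [C.shearDual_eq hn (S := S') (S' := S) (C.pred_i'_ne_top hl),
    C.shearDual_eq hn (S := S') (S' := S) (C.ne_top_of_eq_i' hl)]
  refine ⟨?_, h2⟩
  rcases C.bot with hb | ⟨hb, hi⟩
  · have hpre : ((l - 1 : ℤ) : ZMod (2 * n)) ∉ J := by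
      rw [intCast_eq_shift_sub hl]; exact C.pred_i' hb
    rwa [C.vanish_shearDual hn hpre] at h1 ⊢
  · subst hb
    obtain ⟨z, rfl⟩ := intCast_eq_iff.1 hl.symm
    intro m hm
    by_cases hm' : ∃ (s : Fin α) (z : ℤ), m = h - α + s + 2 * n * z
    · obtain ⟨s, z', hmz⟩ := hm'
      rw [C.shearDual_apply_sub hn (S := S) s z' hmz, h1 m hm, zero_sub, neg_eq_zero]
      have hα := C.top_le
      -- In earlier translates of the block all lower coordinates vanish, and later ones are out of
      -- reach. In the translate containing l the lower coordinates of u are proportional to y, to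
      -- which the rows of S' - S are orthogonal.
      rcases lt_trichotomy z' z with hz | rfl | hz
      · refine Finset.sum_eq_zero fun t _ => ?_
        rw [h1 _ (by have := t.2; nlinarith), mul_zero]
      · have h3 := hS s 0 1
        rw [hi, show h + 1 + 2 * (n : ℤ) * z' - 1 = h + 2 * n * z' by ring] at h2
        simp only [rot, co_zero, co_one] at h3
        rw [Fin.sum_univ_two]
        simp only [Fin.val_zero, Fin.val_one, Nat.cast_zero, Nat.cast_one, add_zero]
        by_cases h4 : y.1 = 0
        · have h5 : y.2 ≠ 0 := fun h5 => hy (Prod.ext h4 h5)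
          apply mul_left_cancel₀ h5
          rw [h4] at h2 h3
          linear_combination (S' - S) s 0 * h2 + shearDual n c h S (h + 1 + 2 * n * z') u * h3
        · apply mul_left_cancel₀ h4
          linear_combination shearDual n c h S (h + 2 * n * z') u * h3 - (S' - S) s 1 * h2
      · exfalso
        have h5 : 2 * (n : ℤ) * (z + 1) ≤ 2 * n * z' := by
          apply mul_le_mul_of_nonneg_left (by omega) (by positivity)
        rw [hi] at hm
        nlinarith
    · push Not at hm'
      rw [C.shearDual_eq hn (S := S') (S' := S) hm']
      exact h1 m hm

include hac
variable (hx : x ≠ 0) (hy : y ≠ 0) (hx' : x' ≠ 0) (hy' : y' ≠ 0)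
include hx hy hx' hy'

/-- The objects of types h and i' recover S and y. -/
theorem Config.agree_i : TwistedForm.Agree {(i : ZMod (2 * n))}
    (coordFilt n c h i i' S x y) (coordFilt n c h i i' S' x' y') ↔ S = S' ∧ Par y y' := by
  have _ := hx
  have _ := hx'
  constructor
  · intro hag
    have h1 := hag h (by simpa using C.h_ne_i)
    rw [C.coordFilt_h hn rfl, C.coordFilt_h hn rfl] at h1
    have hS := C.eq_of_vanish_le hn hac h1.le
    subst hS
    have h2 := hag i' (by simpa using C.i_ne_i'.symm)
    rw [C.coordFilt_i' hn rfl, C.coordFilt_i' hn rfl] at h2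
    exact ⟨rfl, C.par_of_onLine hn hac (fun m _ => .inl rfl) h2.le⟩
  · rintro ⟨rfl, h1⟩ l hl
    rw [Set.mem_singleton_iff] at hl
    unfold coordFilt modify
    rw [if_neg hl, if_neg hl, onLine_par h1 hy hy']

theorem Config.agree_i' : TwistedForm.Agree {(i' : ZMod (2 * n))}
    (coordFilt n c h i i' S x y) (coordFilt n c h i i' S' x' y') ↔ S = S' ∧ Par x x' := by
  have _ := hy
  have _ := hy'
  constructor
  · intro hag
    have h1 := hag h (by simpa using C.h_ne_i')
    rw [C.coordFilt_h hn rfl, C.coordFilt_h hn rfl] at h1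
    have hS := C.eq_of_vanish_le hn hac h1.le
    subst hS
    have h2 := hag i (by simpa using C.i_ne_i')
    rw [C.coordFilt_i hn rfl, C.coordFilt_i hn rfl] at h2
    exact ⟨rfl, C.par_of_onLine hn hac (fun m _ => .inl rfl) h2.le⟩
  · rintro ⟨rfl, h1⟩ l hl
    rw [Set.mem_singleton_iff] at hl
    unfold coordFilt modify
    rw [if_neg hl, if_neg hl, onLine_par h1 hx hx']

/-- The objects of types i and i' give x and y up to scalars. If α = 2, the sheared a (h + t) lie in
the space of type i; their upper coordinates for S' show that the columns of S' - S are proportional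
to x. If β = 2, the spanning vector of the line of type i' must have no upper coordinates for S',
which makes the rows orthogonal to y. -/
theorem Config.agree_h : TwistedForm.Agree {(h : ZMod (2 * n))}
    (coordFilt n c h i i' S x y) (coordFilt n c h i i' S' x' y') ↔
    Par x x' ∧ Par y y' ∧ S' - S ∈ colSub α β x ∧ S' - S ∈ rowSub α β y := by
  constructor
  · intro hag
    have h1 := hag i (by simpa using C.h_ne_i.symm)
    rw [C.coordFilt_i hn rfl, C.coordFilt_i hn rfl] at h1
    have h2 := hag i' (by simpa using C.h_ne_i'.symm)
    rw [C.coordFilt_i' hn rfl, C.coordFilt_i' hn rfl] at h2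
    have px : Par x x' := by
      have e := C.shear_eq_i hn (a := a) (S := S) (S' := S') i rfl
      refine C.par_of_onLine hn hac (fun m hm => .inr ⟨?_, e⟩) h1.le
      rcases hm with rfl | rfl
      exacts [e.1, e.2]
    have py : Par y y' := by
      refine C.par_of_onLine hn hac (fun m hm => .inl ?_) h2.le
      rcases hm with rfl | rfl
      · exact C.shearDual_eq hn (C.pred_i'_ne_top rfl)
      · exact C.shearDual_eq hn (C.ne_top_of_eq_i' rfl)
    refine ⟨px, py, ?_, ?_⟩
    · rw [← onLine_par px hx hx'] at h1
      rcases C.top with ht | ⟨ht, hi⟩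
      · subst ht; rw [colSub_one]; trivial
      · subst ht
        have key : ∀ t, x.2 * (S' - S) 0 t = x.1 * (S' - S) 1 t := by
          intro t
          have h3 : shear n a h S (h + t) ∈ onLine (shearDual n c h S) x i := by
            refine vanish_le_onLine fun m hm => ?_
            rw [C.dual_apply hn hac, if_neg (by omega)]
          rw [h1, mem_onLine] at h3
          have e0 := C.shear_top hn hac (S := S) (S' := S') 0 t
          have e1 := C.shear_top hn hac (S := S) (S' := S') 1 t
          rw [show h - ((2 : ℕ) : ℤ) + ((0 : Fin 2) : ℕ) = i - 1 by rw [hi]; simp; ring] at e0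
          rw [show h - ((2 : ℕ) : ℤ) + ((1 : Fin 2) : ℕ) = i by rw [hi]; simp; ring] at e1
          rw [e0, e1] at h3
          linear_combination -h3.2
        intro s s' t
        have := key t
        fin_cases s <;> fin_cases s' <;> simp only [Fin.zero_eta, Fin.mk_one, co_zero, co_one] <;>
          first | ring1 | linear_combination this | linear_combination -this
    · rcases C.bot with hb | ⟨hb, hi⟩
      · subst hb; rw [rowSub_one]; trivial
      · subst hb
        have key : ∀ s, (S' - S) s 0 * y.1 + (S' - S) s 1 * y.2 = 0 := by
          intro s
          have h3 := exists_mem_onLine (C.dual_apply hn hac (S := S)) y i'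
          rw [h2, mem_onLine] at h3
          have h4 := h3.1 (h - α + s) (by have := s.2; omega)
          have e0 := C.shear_top hn hac (S := S) (S' := S') s 0
          have e1 := C.shear_top hn hac (S := S) (S' := S') s 1
          rw [show h + (((0 : Fin 2) : ℕ) : ℤ) = i' - 1 by rw [hi]; simp] at e0
          rw [show h + (((1 : Fin 2) : ℕ) : ℤ) = i' by rw [hi]; simp] at e1
          rw [map_add, map_smul, map_smul, e0, e1, smul_eq_mul, smul_eq_mul] at h4
          linear_combination -h4
        intro s t t'
        have := key s
        fin_cases t <;> fin_cases t' <;>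
          simp only [Fin.zero_eta, Fin.mk_one, co_zero, co_one, rot] <;>
          first | ring1 | linear_combination this | linear_combination -this
  · rintro ⟨px, py, h1, h2⟩ l hl
    rw [Set.mem_singleton_iff] at hl
    by_cases e1 : (l : ZMod (2 * n)) = i
    · rw [C.coordFilt_i hn e1, C.coordFilt_i hn e1, ← onLine_par px hx hx', C.onLine_i_le hn h1 e1]
    · by_cases e2 : (l : ZMod (2 * n)) = i'
      · rw [C.coordFilt_i' hn e2, C.coordFilt_i' hn e2, ← onLine_par py hy hy']
        refine le_antisymm (C.onLine_i'_le hn hy h2 e2) (C.onLine_i'_le hn hy ?_ e2)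
        rw [← neg_sub]; exact neg_mem h2
      · have e3 : (l : ZMod (2 * n)) ∉ J := fun h0 => by
          rcases C.mem_iff.1 h0 with h0 | h0 | h0
          exacts [hl h0, e1 h0, e2 h0]
        rw [C.coordFilt_of_notMem hn e3, C.coordFilt_of_notMem hn e3]

end Adjacency

end AffineTwin

/-! ### Coordinates of the filtrations of minimal position. -/

namespace AffineTwin

namespace TwistedForm

set_option linter.unusedSectionVars false

variable {k E : Type*} [Field k] [AddCommGroup E] [Module k E] {X : TwistedForm k E} {n : ℕ}
  {F F' : ℤ → Submodule k E} {a a' : ℤ → E} {j j' : ℤ → ℤ} {J : Set (ZMod (2 * n))}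
  {h i i' : ℤ} {α β : ℕ}

/-- The reflections `s_t` and `s_{j t}`, both of type in `J`, are interchanged by `j`. -/
def Linked (J : Set (ZMod (2 * n))) (j : ℤ → ℤ) (t : ℤ) : Prop :=
  j t = j (t - 1) + 1 ∧ (j t : ZMod (2 * n)) ∈ J

/-- Suppose all indices from j (t - 1) + 1 to j t have types in J. If there is one such index, t is
linked. Otherwise j, increasing on this block, sends some index strictly between j (j (t - 1)) and j
(j t), which are the consecutive integers t - 1 - 2n and t - 2n. -/
theorem exists_separator [NeZero n] (htw : IsTwist n j) (hj : NoInv J j) {t : ℤ}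
    (ht : (t : ZMod (2 * n)) ∈ J) (hK : ¬ Linked J j t) :
    ∃ g : ℤ, (g : ZMod (2 * n)) ∉ J ∧ j (t - 1) < g ∧ g ≤ j t := by
  by_contra! hcon
  have h1 := hj t ht
  have hin : ∀ g : ℤ, j (t - 1) < g → g ≤ j t → (g : ZMod (2 * n)) ∈ J := by
    intro g h2 h3
    by_contra h4
    exact absurd (hcon g h4 h2) (not_lt.2 h3)
  by_cases h2 : j t = j (t - 1) + 1
  · exact hK ⟨h2, hin _ h1 le_rfl⟩
  · have h3 := hj.lt (f := j (t - 1)) (x := j (t - 1)) (y := j (t - 1) + 1)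
      (fun m hm hm' => hin m hm (by omega)) le_rfl (by omega)
    have h4 := hj.lt (f := j (t - 1)) (x := j (t - 1) + 1) (y := j t)
      (fun m hm hm' => hin m hm hm') (by omega) (by omega)
    rw [htw.twist] at h3 h4
    omega

theorem NoInv.block_iff [NeZero n] (hj : NoInv J j) {f f' t g : ℤ}
    (hJ : ∀ m : ℤ, f < m → m < f' → (m : ZMod (2 * n)) ∈ J) (h1 : f < t) (h2 : t < f')
    (hg : j (t - 1) < g) (hg' : g ≤ j t) (m : ℤ) (hm : f ≤ m) (hm' : m < f') : j m < g ↔ m < t := by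
  constructor
  · intro h3
    by_contra hcon
    rcases lt_or_eq_of_le (not_lt.1 hcon) with h4 | rfl
    · have := hj.lt (f := f) (fun i hi hi' => hJ i hi (by omega)) h1.le h4
      omega
    · omega
  · intro h3
    rcases lt_or_eq_of_le (Int.le_sub_one_of_lt h3) with h4 | rfl
    · have := hj.lt (f := f) (y := t - 1) (fun i hi hi' => hJ i hi (by omega)) hm h4
      omega
    · exact hg

theorem Frame.inf_perp_le (hF' : X.Filt n F') (hf' : X.Frame n F' a' j) (hag : Agree J F' F)
    {t f' g : ℤ} (hg : (g : ZMod (2 * n)) ∉ J) (hf'J : (f' : ZMod (2 * n)) ∉ J)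
    (hj : ∀ m, t ≤ m → m < f' → g ≤ j m) : ∀ u ∈ F' t, u ∈ X.perp F g → u ∈ F f' := by
  intro u hu hu'
  rw [← hag f' hf'J, hf'.mem_iff hF']
  rw [← hag.perp hg] at hu'
  intro m hm
  rcases lt_or_ge m t with h1 | h1
  · exact (hf'.mem_iff hF').1 hu m h1
  · exact (hf'.mem_perp_iff hF').1 hu' m (hj m h1 hm)

/-- By `hQ` no index of the block from t on is sent below g. Since the number of indices of the
block sent below g is fixed in the residue, all those before t are. -/
theorem Frame.separates_of_inf_perp_le [NeZero n] (hF : X.Filt n F) (hf : X.Frame n F a j)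
    (hF' : X.Filt n F') (hf' : X.Frame n F' a' j') (hag : Agree J F' F) {f t f' g : ℤ}
    (hfJ : (f : ZMod (2 * n)) ∉ J) (hf'J : (f' : ZMod (2 * n)) ∉ J) (hg : (g : ZMod (2 * n)) ∉ J)
    (hft : f ≤ t) (htf : t ≤ f') (hj : ∀ m, f ≤ m → m < f' → (j m < g ↔ m < t))
    (hQ : ∀ u ∈ F' t, u ∈ X.perp F g → u ∈ F f') :
    ∀ m, f ≤ m → m < f' → (j' m < g ↔ m < t) := by
  have hno : ∀ m, t ≤ m → m < f' → g ≤ j' m := by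
    intro m h1 h2
    by_contra hcon
    have h3 := hQ (a' m) (hF'.antitone h1 (hf'.mem m)) (by
      rw [← hag.perp hg]
      exact hF'.perp_mono (by omega) (hf'.mem_perp m))
    rw [← hag f' hf'J] at h3
    exact hf'.notMem m (hF'.antitone (by omega) h3)
  have hsplit : ∀ j, Periodic n j → {m | f ≤ m ∧ j m < g}.ncard =
      {m | (f ≤ m ∧ m < f') ∧ j m < g}.ncard + {m | f' ≤ m ∧ j m < g}.ncard := by
    intro j hj
    rw [← Set.ncard_union_eq ?_ ?_ ?_]
    · congr 1
      ext m
      simp only [Set.mem_ofPred_eq, Set.mem_union]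
      constructor
      · rintro ⟨h1, h2⟩
        rcases lt_or_ge m f' with h3 | h3
        · exact .inl ⟨⟨h1, h3⟩, h2⟩
        · exact .inr ⟨h3, h2⟩
      · rintro (⟨⟨h1, -⟩, h2⟩ | ⟨h1, h2⟩)
        · exact ⟨h1, h2⟩
        · exact ⟨by omega, h2⟩
    · rw [Set.disjoint_left]
      rintro m ⟨⟨-, h1⟩, -⟩ ⟨h2, -⟩
      omega
    · exact (finite_counts hj f g).subset fun m hm => ⟨hm.1.1, hm.2⟩
    · exact finite_counts hj f' g
  have hcard : {m | (f ≤ m ∧ m < f') ∧ j' m < g}.ncard =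
      {m | (f ≤ m ∧ m < f') ∧ j m < g}.ncard := by
    have h1 := hsplit j hf.jper
    have h2 := hsplit j' hf'.jper
    rw [hag.counts hF' hF hf' hf f g hfJ hg, hag.counts hF' hF hf' hf f' g hf'J hg] at h2
    omega
  have heq : {m | (f ≤ m ∧ m < f') ∧ j' m < g} = {m | (f ≤ m ∧ m < f') ∧ j m < g} := by
    refine Set.eq_of_subset_of_ncard_le ?_ hcard.ge
      ((finite_counts hf.jper f g).subset fun m hm => ⟨hm.1.1, hm.2⟩)
    rintro m ⟨h1, h2⟩
    refine ⟨h1, (hj m h1.1 h1.2).2 ?_⟩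
    by_contra hcon
    exact absurd h2 (not_lt.2 (hno m (not_lt.1 hcon) h1.2))
  intro m h1 h2
  rw [← hj m h1 h2]
  have := Set.ext_iff.1 heq m
  simpa [h1, h2] using this

theorem Frame.coord_apply (hF : X.Filt n F) (hf : X.Frame n F a j) (m l : ℤ) :
    hf.coord hF m (a l) = if l = m then 1 else 0 := by
  split_ifs with h1
  · rw [h1, hf.coord_self]
  · exact hf.coord_ne hF h1

theorem Frame.vanish_coord (hF : X.Filt n F) (hf : X.Frame n F a j) (l : ℤ) :
    vanish (hf.coord hF) l = F l := by
  ext u; rw [hf.mem_iff hF]; rfl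

section

variable (C : Config n J h i i' α β) (hn : 4 ≤ n) (hF : X.Filt n F) (hf : X.Frame n F a j)
include C hn

theorem filt_coordFilt [NeZero n] (S : Matrix (Fin α) (Fin β) k) {x y : k × k} (hx : x ≠ 0)
    (hy : y ≠ 0) : X.Filt n (coordFilt n (hf.coord hF) h i i' S x y) := by
  refine hF.modify (C.dual_apply hn (hf.coord_apply hF)) (fun m u => ?_) hx hy C.i_ne_i'
    (fun l => C.succ_i_ne_i') (fun l hl h0 => C.succ_i'_notMem hl (h0 ▸ C.i_mem)) (i - 1)
    (fun h0 => C.left (h0 ▸ C.i_mem)) (fun h0 => C.left (h0 ▸ C.i'_mem)) (fun z => ?_)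
  · exact shearDual_period (T := X.T.toLinearMap) (by have := C.lt_two_mul hn; omega)
      (hf.coord_T hF) m u
  · rw [C.vanish_shearDual hn, hf.vanish_coord hF]
    rw [intCast_add_mul]; exact C.left

theorem agree_coordFilt (S : Matrix (Fin α) (Fin β) k) (x y : k × k) :
    Agree J (coordFilt n (hf.coord hF) h i i' S x y) F := fun l hl => by
  rw [C.coordFilt_of_notMem hn hl, hf.vanish_coord hF]

/-- A line between two consecutive spaces of a filtration defined by coordinates. -/
theorem Filt.eq_onLine (hF' : X.Filt n F') {c : ℤ → E →ₗ[k] k} (l : ℤ)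
    (h1 : F' (l - 1) = vanish c (l - 1)) (h2 : F' (l + 1) = vanish c (l + 1)) :
    ∃ x : k × k, x ≠ 0 ∧ F' l = onLine c x l := by
  obtain ⟨w, hw, hw'⟩ := hF'.ne l
  have hv : ∀ u, u ∈ vanish c (l + 1) ↔ u ∈ vanish c (l - 1) ∧ c (l - 1) u = 0 ∧ c l u = 0 := by
    intro u
    rw [vanish_succ, vanish_eq, and_assoc]
  have hw1 : w ∈ vanish c (l - 1) := h1 ▸ hF'.antitone (by omega) hw
  refine ⟨(c (l - 1) w, c l w), fun h0 => ?_, ?_⟩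
  · rw [Prod.mk_eq_zero] at h0
    apply hw'
    rw [h2, hv]
    exact ⟨hw1, h0⟩
  · ext u
    rw [mem_onLine]
    constructor
    · intro hu
      obtain ⟨r, hr⟩ := hF'.codim l w hw hw' u hu
      rw [h2, hv, map_sub, map_sub, map_smul, map_smul, smul_eq_mul, smul_eq_mul] at hr
      refine ⟨h1 ▸ hF'.antitone (by omega) hu, ?_⟩
      linear_combination c l w * hr.2.1 - c (l - 1) w * hr.2.2
    · rintro ⟨hu, hu'⟩
      simp only at hu'
      obtain ⟨r, hr1, hr2⟩ : ∃ r, c (l - 1) u = r * c (l - 1) w ∧ c l u = r * c l w := by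
        by_cases h3 : c (l - 1) w = 0
        · have h4 : c l w ≠ 0 := by
            intro h4
            apply hw'
            rw [h2, hv]
            exact ⟨hw1, h3, h4⟩
          refine ⟨c l u / c l w, ?_, by field_simp⟩
          rw [h3, zero_mul] at hu'
          rw [h3, mul_zero]
          exact (mul_eq_zero.1 hu').resolve_left h4
        · refine ⟨c (l - 1) u / c (l - 1) w, by field_simp, ?_⟩
          field_simp
          linear_combination -hu'
      have h5 : u - r • w ∈ F' (l + 1) := by
        rw [h2, hv]
        refine ⟨sub_mem hu (Submodule.smul_mem _ _ hw1), ?_, ?_⟩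
        · rw [map_sub, map_smul, hr1, smul_eq_mul, sub_self]
        · rw [map_sub, map_smul, hr2, smul_eq_mul, sub_self]
      have := add_mem (hF'.anti l h5) (Submodule.smul_mem _ r hw)
      simpa using this

/-- Modulo F (h + β) the space F' h meets the span of the upper frame vectors, which are orthogonal
to F g, trivially. So it is the graph of a map from the span of the lower frame vectors to that of
the upper ones, and S is its matrix. The objects of types i and i' are then lines between known
spaces. -/
theorem Frame.exists_coords [NeZero n] (hF' : X.Filt n F') (hf' : X.Frame n F' a' j)
    (hag : Agree J F' F) {g : ℤ} (hg : (g : ZMod (2 * n)) ∉ J)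
    (hj : ∀ m, h - α ≤ m → m < h + β → (j m < g ↔ m < h)) :
    ∃ (S : Matrix (Fin α) (Fin β) k) (x y : k × k), x ≠ 0 ∧ y ≠ 0 ∧
      F' = coordFilt n (hf.coord hF) h i i' S x y := by
  have hαβ := C.lt_two_mul hn
  have hQ := hf'.inf_perp_le hF' hag (t := h) hg C.high (fun m h1 h2 => by
    by_contra hcon
    have := (hj m (by omega) h2).1 (by omega)
    omega)
  have hlow : F' (h - α) = F (h - α) := hag _ C.low
  have hhigh : F' (h + β) = F (h + β) := hag _ C.high
  have hac := hf.coord_apply hF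
  -- the adapted vectors of `F' h`
  have hw : ∀ t : Fin β, ∃ w ∈ F' h, ∀ t' : Fin β,
      hf.coord hF (h + t') w = if t' = t then 1 else 0 := by
    intro t
    -- Removing the components along the a' of index below h moves a (h + t) into F' h. These a' are
    -- orthogonal to F g, hence have no lower coordinates with respect to a.
    refine ⟨a (h + t) - ∑ s : Fin α, hf'.coord hF' (h - α + s) (a (h + t)) • a' (h - α + s), ?_, ?_⟩
    · rw [hf'.mem_iff hF']
      intro m hm
      rw [map_sub, map_sum]
      by_cases h1 : m < h - α
      · have h2 : a (h + t) ∈ F' (h - α) := by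
          rw [hlow]; exact hF.antitone (by omega) (hf.mem _)
        rw [(hf'.mem_iff hF').1 h2 m h1, Finset.sum_eq_zero, sub_zero]
        intro s _
        rw [map_smul, hf'.coord_ne hF' (by omega), smul_zero]
      · rw [Finset.sum_eq_single ⟨(m - (h - α)).toNat, by omega⟩]
        · have e : h - α + ((m - (h - α)).toNat : ℤ) = m := by omega
          simp only [e]
          rw [map_smul, hf'.coord_self, smul_eq_mul, mul_one, sub_self]
        · intro s _ hs
          rw [map_smul, hf'.coord_ne hF', smul_zero]
          intro h3
          exact hs (Fin.ext (by simp only; omega))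
        · simp
    · intro t'
      rw [map_sub, map_sum, hac, Finset.sum_eq_zero, sub_zero]
      · by_cases h1 : t' = t
        · rw [h1]; simp
        · rw [if_neg h1, if_neg]
          intro h2; exact h1 (Fin.ext (by omega))
      · intro s _
        rw [map_smul]
        have h1 : a' (h - α + s) ∈ X.perp F g := by
          rw [← hag.perp hg]
          refine hF'.perp_mono ?_ (hf'.mem_perp _)
          have := (hj (h - α + s) (by omega) (by have := s.2; omega)).2 (by have := s.2; omega)
          omega
        rw [(hf.mem_perp_iff hF).1 h1 (h + t'), smul_zero]
        by_contra hcon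
        have := (hj (h + t') (by omega) (by have := t'.2; omega)).1 (by omega)
        omega
  choose w hwm hwc using hw
  let S : Matrix (Fin α) (Fin β) k := Matrix.of fun s t => hf.coord hF (h - α + s) (w t)
  have hSw : ∀ (u : E) (t' : Fin β), hf.coord hF (h + t')
      (u - ∑ t : Fin β, hf.coord hF (h + t) u • w t) = 0 := by
    intro u t'
    rw [map_sub, map_sum, Finset.sum_eq_single t']
    · rw [map_smul, hwc, if_pos rfl, smul_eq_mul, mul_one, sub_self]
    · intro t _ ht
      rw [map_smul, hwc, if_neg ht.symm, smul_zero]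
    · simp
  have hSs : ∀ (u : E) (s : Fin α), hf.coord hF (h - α + s)
      (u - ∑ t : Fin β, hf.coord hF (h + t) u • w t) =
      shearDual n (hf.coord hF) h S (h - α + s) u := by
    intro u s
    rw [shearDual_of_eq (by omega) s 0 (by ring), map_sub, map_sum, LinearMap.sub_apply,
      LinearMap.sum_apply]
    congr 1
    refine Finset.sum_congr rfl fun t _ => ?_
    rw [map_smul, LinearMap.smul_apply, smul_eq_mul, smul_eq_mul, mul_comm]
    simp [S]
  have hFh : F' h = vanish (shearDual n (hf.coord hF) h S) h := by
    have hlv : ∀ u, u ∈ vanish (shearDual n (hf.coord hF) h S) (h - α) ↔ u ∈ F' (h - α) := by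
      intro u
      rw [C.vanish_shearDual hn C.low, hf.vanish_coord hF, hlow]
    have hsplit : ∀ m : ℤ, h - α ≤ m → m < h → ∃ s : Fin α, m = h - α + s := by
      intro m h1 h2
      exact ⟨⟨(m - (h - α)).toNat, by omega⟩, by simp only; omega⟩
    have hsplit' : ∀ m : ℤ, h ≤ m → m < h + β → ∃ s : Fin β, m = h + s := by
      intro m h1 h2
      exact ⟨⟨(m - h).toNat, by omega⟩, by simp only; omega⟩
    ext u
    constructor
    · intro hu m hm
      have hua : u ∈ F' (h - α) := hF'.antitone (by omega) hu
      by_cases h1 : m < h - α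
      · exact (hlv u).2 hua m h1
      · obtain ⟨s, rfl⟩ := hsplit m (not_lt.1 h1) hm
        rw [← hSs]
        -- v has no lower coordinates, so modulo F (h + β) it is a combination v' of upper frame
        -- vectors. As v' lies in F' h and is orthogonal to F g, it lies in F (h + β) by `hQ`, and
        -- its upper coordinates vanish.
        obtain ⟨v, hv⟩ : ∃ v, v = u - ∑ t : Fin β, hf.coord hF (h + t) u • w t := ⟨_, rfl⟩
        have hv0 : ∀ t' : Fin β, hf.coord hF (h + t') v = 0 := fun t' => hv ▸ hSw u t'
        have hvF : v ∈ F' h := hv ▸ sub_mem hu (sum_mem fun t _ => Submodule.smul_mem _ _ (hwm t))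
        rw [← hv]
        have hvl : v ∈ F (h - α) := hlow ▸ hF'.antitone (by omega) hvF
        obtain ⟨v', hv'⟩ : ∃ v', v' = ∑ s : Fin α, hf.coord hF (h - α + s) v • a (h - α + s) :=
          ⟨_, rfl⟩
        have hc' : ∀ s : Fin α, hf.coord hF (h - α + s) v' = hf.coord hF (h - α + s) v := by
          intro s
          rw [hv', map_sum, Finset.sum_eq_single s]
          · rw [map_smul, hf.coord_self, smul_eq_mul, mul_one]
          · intro s' _ hs'
            rw [map_smul, hf.coord_ne hF, smul_zero]
            intro h3; exact hs' (Fin.ext (by omega))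
          · simp
        have hd : v - v' ∈ F (h + β) := by
          rw [hf.mem_iff hF]
          intro m hm
          rw [map_sub]
          by_cases h2 : m < h - α
          · rw [(hf.mem_iff hF).1 hvl m h2, hv', map_sum, Finset.sum_eq_zero, sub_zero]
            intro s' _
            rw [map_smul, hf.coord_ne hF (by omega), smul_zero]
          · by_cases h3 : m < h
            · obtain ⟨s', rfl⟩ := hsplit m (not_lt.1 h2) h3
              rw [hc', sub_self]
            · obtain ⟨t', rfl⟩ := hsplit' m (not_lt.1 h3) hm
              rw [hv0, hv', map_sum, Finset.sum_eq_zero, sub_zero]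
              intro s' _
              rw [map_smul, hf.coord_ne hF (by have := s'.2; omega), smul_zero]
        have hv'F : v' ∈ F' h := by
          have h4 : v - v' ∈ F' h := hF'.antitone (show h ≤ h + β by omega) (hhigh ▸ hd)
          have := sub_mem hvF h4
          simpa using this
        have hv'p : v' ∈ X.perp F g := by
          rw [hv']
          refine sum_mem fun s' _ => Submodule.smul_mem _ _ (hF.perp_mono ?_ (hf.mem_perp _))
          have := (hj (h - α + s') (by omega) (by have := s'.2; omega)).2 (by have := s'.2; omega)
          omega
        have h5 := (hf.mem_iff hF).1 (hQ v' hv'F hv'p) (h - α + s) (by have := s.2; omega)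
        rwa [hc'] at h5
    · intro hu
      have h1 : u - ∑ t : Fin β, hf.coord hF (h + t) u • w t ∈ F' h := by
        refine hF'.antitone (show h ≤ h + β by omega) ?_
        rw [hhigh, hf.mem_iff hF]
        intro m hm
        by_cases h2 : m < h - α
        · have h3 : u - ∑ t : Fin β, hf.coord hF (h + t) u • w t ∈ F (h - α) := by
            rw [← hlow]
            refine sub_mem ((hlv u).1 fun m hm => hu m (by omega))
              (sum_mem fun t _ => Submodule.smul_mem _ _ (hF'.antitone (by omega) (hwm t)))
          exact (hf.mem_iff hF).1 h3 m h2
        · by_cases h3 : m < h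
          · obtain ⟨s, rfl⟩ := hsplit m (not_lt.1 h2) h3
            rw [hSs]
            exact hu _ h3
          · obtain ⟨t', rfl⟩ := hsplit' m (not_lt.1 h3) hm
            exact hSw u t'
      have := add_mem h1 (sum_mem (t := (Finset.univ : Finset (Fin β))) fun t _ =>
        Submodule.smul_mem _ (hf.coord hF (h + t) u) (hwm t))
      simpa using this
  have hnotJ : ∀ l : ℤ, (l : ZMod (2 * n)) ∉ J →
      F' l = vanish (shearDual n (hf.coord hF) h S) l := fun l hl => by
    rw [C.vanish_shearDual hn hl, hf.vanish_coord hF, hag l hl]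
  obtain ⟨x, hx, hFi⟩ := Filt.eq_onLine C hn hF' (c := shearDual n (hf.coord hF) h S) i
    (hnotJ _ C.left) (by
      rcases C.top with ht | ⟨-, ht⟩
      · exact hnotJ _ (C.succ_i ht)
      · rw [ht, sub_add_cancel]; exact hFh)
  obtain ⟨y, hy, hFi'⟩ := Filt.eq_onLine C hn hF' (c := shearDual n (hf.coord hF) h S) i' (by
      rcases C.bot with ht | ⟨-, ht⟩
      · exact hnotJ _ (C.pred_i' ht)
      · rw [ht, add_sub_cancel_right]; exact hFh) (hnotJ _ C.right)
  refine ⟨S, x, y, hx, hy, ?_⟩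
  have hG := filt_coordFilt C hn hF hf S hx hy
  have hper : ∀ l0 : ℤ, F' l0 = coordFilt n (hf.coord hF) h i i' S x y l0 →
      ∀ l : ℤ, (l : ZMod (2 * n)) = l0 → F' l = coordFilt n (hf.coord hF) h i i' S x y l := by
    intro l0 hl0 l hl
    obtain ⟨z, rfl⟩ := intCast_eq_iff.1 hl.symm
    ext u
    obtain ⟨v, rfl⟩ := (X.T ^ z).surjective u
    rw [← hF'.per_zpow, ← hG.per_zpow, hl0]
  funext l
  by_cases hl : (l : ZMod (2 * n)) ∈ J
  · rcases C.mem_iff.1 hl with h0 | h0 | h0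
    · exact hper h (by rw [C.coordFilt_h hn rfl, hFh]) l h0
    · exact hper i (by rw [C.coordFilt_i hn rfl, hFi]) l h0
    · exact hper i' (by rw [C.coordFilt_i' hn rfl, hFi']) l h0
  · rw [C.coordFilt_of_notMem hn hl, hf.vanish_coord hF, hag l hl]

end

end TwistedForm

end AffineTwin

/-! ### The coordinates that occur if no type is linked. -/

namespace AffineTwin

namespace TwistedForm

set_option linter.unusedSectionVars false

variable {k E : Type*} [Field k] [AddCommGroup E] [Module k E] {X : TwistedForm k E} {n : ℕ}
  {F F' : ℤ → Submodule k E} {a a' : ℤ → E} {j j' : ℤ → ℤ} {J : Set (ZMod (2 * n))}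
  {h i i' : ℤ} {α β : ℕ}

variable (X) in
/-- The filtrations in the `J`-residue of `F` whose relative position to the orthogonal filtration
has no inversions in `J`. -/
def geometry (J : Set (ZMod (2 * n))) (F : ℤ → Submodule k E) : Set (ℤ → Submodule k E) :=
  {G | X.Filt n G ∧ Agree J G F ∧ ∃ a j, X.Frame n G a j ∧ NoInv J j}

theorem lt_of_intCast_eq (hj : Periodic n j) {t l : ℤ} (h : (t : ZMod (2 * n)) = l)
    (hlt : j (t - 1) < j t) : j (l - 1) < j l := by
  obtain ⟨z, rfl⟩ := intCast_eq_iff.1 h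
  rw [show t + 2 * n * z - 1 = t - 1 + 2 * n * z by ring, hj.add_mul, hj.add_mul]
  omega

section

variable [NeZero n] (C : Config n J h i i' α β) (hn : 4 ≤ n) (hF : X.Filt n F)
  (hf : X.Frame n F a j) (hj : NoInv J j)
include C hn

omit [NeZero n] in
theorem _root_.AffineTwin.Config.block_h {m : ℤ} (h1 : h - α < m) (h2 : m < h + β) : (m : ZMod (2 * n)) ∈ J :=
  C.mem_of_between (z := 0) (by linarith) (by linarith)

omit [NeZero n] in
/-- Where the coordinates in the lower half of the block of `h` vanish, `S` plays no role. -/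
theorem _root_.AffineTwin.Config.shearDual_apply_of_eq_zero {S : Matrix (Fin α) (Fin β) k} {c : ℤ → E →ₗ[k] k} {u : E}
    (hu : ∀ t : Fin β, c (h + t) u = 0) {m : ℤ} (h1 : h - α ≤ m) (h2 : m < h + β) :
    shearDual n c h S m u = c m u := by
  have hαβ := C.lt_two_mul hn
  by_cases h3 : m < h
  · rw [shearDual_of_eq (by omega) ⟨(m - (h - α)).toNat, by omega⟩ 0 (by simp only; omega),
      LinearMap.sub_apply, LinearMap.sum_apply, Finset.sum_eq_zero, sub_zero]
    intro t _
    rw [LinearMap.smul_apply, show h + (t : ℤ) + 2 * n * 0 = h + t by ring, hu, smul_zero]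
  · rw [shearDual_of_ne (by omega)]
    intro s z
    have := C.bot_ne_top hn ⟨(m - h).toNat, by omega⟩ 0 s z
    intro h0
    apply this
    rw [← h0]
    simp only
    omega

omit [NeZero n] in
theorem _root_.AffineTwin.Config.mem_of_vanish {S : Matrix (Fin α) (Fin β) k} {u : E} {l : ℤ}
    (hl : h - α ≤ l)
    (h0 : u ∈ vanish (shearDual n (hf.coord hF) h S) l) (hu : ∀ t : Fin β, hf.coord hF (h + t) u = 0)
    (h1 : ∀ m, l ≤ m → m < h → shearDual n (hf.coord hF) h S m u = 0) : u ∈ F (h + β) := by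
  rw [hf.mem_iff hF]
  intro m hm
  by_cases h2 : m < h - α
  · have h3 : u ∈ vanish (shearDual n (hf.coord hF) h S) (h - α) := fun m hm => h0 m (by omega)
    rw [C.vanish_shearDual hn C.low] at h3
    exact h3 m h2
  · by_cases h3 : h ≤ m
    · have := hu ⟨(m - h).toNat, by omega⟩
      rwa [show h + (((⟨(m - h).toNat, by omega⟩ : Fin β) : ℕ) : ℤ) = m by simp only; omega] at this
    · rw [← C.shearDual_apply_of_eq_zero hn hu (S := S) (by omega) hm]
      by_cases h4 : m < l
      · exact h0 m h4
      · exact h1 m (by omega) (by omega)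

omit [NeZero n] in
/-- The coordinates at the types `i - 1` and `i`, and `i' - 1` and `i'`, if these do not belong to the
block of `h`. -/
theorem _root_.AffineTwin.Config.shearDual_i {S : Matrix (Fin α) (Fin β) k} {c : ℤ → E →ₗ[k] k} (hα : α = 1) {l : ℤ}
    (hl : (l : ZMod (2 * n)) = i) :
    shearDual n c h S l = c l ∧ shearDual n c h S (l - 1) = c (l - 1) := by
  have hn0 : 0 < n := by omega
  constructor
  · refine shearDual_of_ne hn0 fun s z h0 => ?_
    rcases C.top_cases s z with ⟨h1, -⟩ | ⟨-, -, h1, -⟩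
    · exact h1 (h0 ▸ hl ▸ C.i_mem)
    · omega
  · refine shearDual_of_ne hn0 fun s z h0 => C.h_ne_i ?_
    rw [← hl]
    have := s.2
    exact intCast_eq_iff.2 ⟨z, by linarith [show (s : ℤ) = 0 by omega, show (α : ℤ) = 1 by omega]⟩

omit [NeZero n] in
theorem _root_.AffineTwin.Config.shearDual_i' {S : Matrix (Fin α) (Fin β) k} {c : ℤ → E →ₗ[k] k} {l : ℤ}
    (hl : (l : ZMod (2 * n)) = i') :
    shearDual n c h S l = c l ∧ shearDual n c h S (l - 1) = c (l - 1) :=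
  ⟨shearDual_of_ne (by omega) (C.ne_top_of_eq_i' hl),
    shearDual_of_ne (by omega) (C.pred_i'_ne_top hl)⟩

omit [NeZero n] in
theorem _root_.AffineTwin.Config.inf_perp_le_h {S : Matrix (Fin α) (Fin β) k} {x y : k × k} {g : ℤ}
    (hg : ∀ m, h ≤ m → m < h + β → g ≤ j m) :
    ∀ u ∈ coordFilt n (hf.coord hF) h i i' S x y h, u ∈ X.perp F g → u ∈ F (h + β) := by
  intro u hu hu'
  rw [C.coordFilt_h hn rfl] at hu
  refine C.mem_of_vanish hn hF hf (l := h) (by omega) hu (fun t => ?_)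
    (fun m h1 h2 => absurd h1 (not_le.2 h2))
  exact (hf.mem_perp_iff hF).1 hu' _ (hg _ (by omega) (by have := t.2; omega))

include hF hf hj in
/-- `j` increases at `h` in the strong sense that is inherited by the filtrations of the residue. -/
theorem _root_.AffineTwin.Config.separates_h (hhK : ¬ Linked J j h) : ∃ g : ℤ, (g : ZMod (2 * n)) ∉ J ∧
    j (h - 1) < g ∧ g ≤ j h ∧ ∀ m, h - α ≤ m → m < h + β → (j m < g ↔ m < h) := by
  obtain ⟨g, hg, h1, h2⟩ := exists_separator (hf.isTwist hF) hj C.h_mem hhK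
  have := C.top_pos
  have := C.bot_pos
  exact ⟨g, hg, h1, h2, NoInv.block_iff hj (fun m => C.block_h hn) (by omega) (by omega) h1 h2⟩

-- If h is not linked, the order at h survives for all coordinates: within the orthogonal space of F
-- g, the sheared space of type h is contained in F (h + β).
include hF hf hj in
theorem _root_.AffineTwin.Config.lt_h {G : ℤ → Submodule k E} (hhK : ¬ Linked J j h) {S : Matrix (Fin α) (Fin β) k}
    {x y : k × k} (hG : G = coordFilt n (hf.coord hF) h i i' S x y) (hFG : X.Filt n G)
    (hf' : X.Frame n G a' j') : j' (h - 1) < j' h ∧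
    ∀ m, h ≤ m → m < h + β → j (h - 1) < j' m := by
  obtain ⟨g, hg, h1, h2, h3⟩ := C.separates_h hn hF hf hj hhK
  have hag : Agree J G F := hG ▸ agree_coordFilt C hn hF hf S x y
  have := C.top_pos
  have := C.bot_pos
  have key := hf.separates_of_inf_perp_le hF hFG hf' hag (f := h - α) (t := h) (f' := h + β)
    C.low C.high hg (by omega) (by omega) h3 (by
      rw [hG]
      exact C.inf_perp_le_h hn hF hf fun m h4 h5 => by
        by_contra hcon
        have := (h3 m (by omega) h5).1 (by omega)
        omega)
  have key' : ∀ m, h ≤ m → m < h + β → g ≤ j' m := fun m h4 h5 => by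
    by_contra hcon
    have := (key m (by omega) h5).1 (by omega)
    omega
  refine ⟨?_, fun m h4 h5 => h1.trans_le (key' m h4 h5)⟩
  exact ((key (h - 1) (by omega) (by omega)).2 (by omega)).trans_le (key' h le_rfl (by omega))

omit [NeZero n] in
/-- The end of the block of `i`. -/
theorem _root_.AffineTwin.Config.exists_end_i : ∃ f' : ℤ, i < f' ∧ (f' : ZMod (2 * n)) ∉ J ∧
    (∀ m : ℤ, i - 1 < m → m < f' → (m : ZMod (2 * n)) ∈ J) ∧
    (α = 1 ∧ f' = i + 1 ∨ α = 2 ∧ i = h - 1 ∧ f' = h + β) := by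
  rcases C.top with hα | ⟨hα, hi⟩
  · refine ⟨i + 1, by omega, C.succ_i hα, fun m h1 h2 => ?_, .inl ⟨hα, rfl⟩⟩
    rw [show m = i by omega]; exact C.i_mem
  · exact ⟨h + β, by omega, C.high, fun m h1 h2 => C.block_h hn (by omega) h2,
      .inr ⟨hα, hi, rfl⟩⟩

omit [NeZero n] in
/-- The beginning of the block of `i'`. -/
theorem _root_.AffineTwin.Config.exists_begin_i' : ∃ f : ℤ, f < i' ∧ (f : ZMod (2 * n)) ∉ J ∧
    (∀ m : ℤ, f < m → m < i' + 1 → (m : ZMod (2 * n)) ∈ J) ∧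
    (β = 1 ∧ f = i' - 1 ∨ β = 2 ∧ i' = h + 1 ∧ f = h - α) := by
  rcases C.bot with hβ | ⟨hβ, hi⟩
  · refine ⟨i' - 1, by omega, C.pred_i' hβ, fun m h1 h2 => ?_, .inl ⟨hβ, rfl⟩⟩
    rw [show m = i' by omega]; exact C.i'_mem
  · exact ⟨h - α, by omega, C.low, fun m h1 h2 => C.block_h hn h1 (by omega),
      .inr ⟨hβ, hi, rfl⟩⟩

include hF hf hj in
/-- The criterion for membership in the geometry if `j` interchanges no reflections of types in `J`. -/
theorem coordFilt_mem_iff_of_not_linked (hhK : ¬ Linked J j h) (hiK : ¬ Linked J j i)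
    (hi'K : ¬ Linked J j i') (S : Matrix (Fin α) (Fin β) k) {x y : k × k} (hx : x ≠ 0) (hy : y ≠ 0) :
    coordFilt n (hf.coord hF) h i i' S x y ∈ X.geometry J F ↔ x.2 * y.2 ≠ 0 := by
  have hFG := filt_coordFilt C hn hF hf S hx hy
  have hag := agree_coordFilt C hn hF hf S x y
  have hac := hf.coord_apply hF
  have hdual := C.dual_apply hn hac (S := S)
  have hn0 : 0 < n := by omega
  obtain ⟨gi, hgi, hgi1, hgi2⟩ := exists_separator (hf.isTwist hF) hj C.i_mem hiK
  obtain ⟨fi, hfi1, hfi2, hfi3, hfi4⟩ := C.exists_end_i hn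
  have hbi := NoInv.block_iff hj hfi3 (by omega) hfi1 hgi1 hgi2
  obtain ⟨gi', hgi', hgi1', hgi2'⟩ := exists_separator (hf.isTwist hF) hj C.i'_mem hi'K
  obtain ⟨fi', hfi1', hfi2', hfi3', hfi4'⟩ := C.exists_begin_i' hn
  have hbi' := NoInv.block_iff hj hfi3' hfi1' (by omega) hgi1' hgi2'
  constructor
  · rintro ⟨-, -, a', j', hf', hj'⟩
    have hjj : j' = j := hag.position_eq ⟨_, C.left⟩ hFG hF hf' hf hj' hj
    subst hjj
    -- If x.2 = 0, then a (i - 1) lies in the space of type i and is orthogonal to F gi; for a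
    -- filtration of position j such vectors lie in F fi, which a (i - 1) does not. If y.2 = 0, the
    -- sheared a (i' - 1) plays this role.
    refine mul_ne_zero (fun h0 => ?_) (fun h0 => ?_)
    · have h1 : a (i - 1) ∈ coordFilt n (hf.coord hF) h i i' S x y i := by
        rw [C.coordFilt_i hn rfl]
        have h2 := exists_mem_onLine hdual x i
        have hx1 : x.1 ≠ 0 := fun h1 => hx (Prod.ext h1 h0)
        rw [h0, zero_smul, add_zero, shear_of_ne hn0 (C.ne_bot_of_notMem C.left)] at h2
        have := Submodule.smul_mem _ x.1⁻¹ h2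
        rwa [smul_smul, inv_mul_cancel₀ hx1, one_smul] at this
      have h2 := hf'.inf_perp_le hFG hag hgi hfi2 (t := i) (fun m h3 h4 => by
        by_contra hcon
        have := (hbi m (by omega) h4).1 (by omega)
        omega) _ h1 (hF.perp_mono (by omega) (hf.mem_perp _))
      exact hf.notMem _ (hF.antitone (by omega) h2)
    · have hy1 : y.1 ≠ 0 := fun h1 => hy (Prod.ext h1 h0)
      have h1 : shear n a h S (i' - 1) ∈ coordFilt n (hf.coord hF) h i i' S x y i' := by
        rw [C.coordFilt_i' hn rfl]
        have h2 := exists_mem_onLine hdual y i'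
        rw [h0, zero_smul, add_zero] at h2
        have := Submodule.smul_mem _ y.1⁻¹ h2
        rwa [smul_smul, inv_mul_cancel₀ hy1, one_smul] at this
      have hperp : ∀ m, fi' ≤ m → m < i' → a m ∈ X.perp F gi' := fun m h3 h4 =>
        hF.perp_mono (by have := (hbi' m h3 (by omega)).2 h4; omega) (hf.mem_perp m)
      have h2 : shear n a h S (i' - 1) ∈ X.perp F gi' := by
        rcases hfi4' with ⟨hβ, hf0⟩ | ⟨hβ, hi, hf0⟩
        · rw [shear_of_ne hn0 (C.ne_bot_of_notMem (C.pred_i' hβ))]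
          exact hperp _ (by omega) (by omega)
        · rw [shear_of_eq (by have := C.lt_two_mul hn; omega) ⟨0, by omega⟩ 0 (by simp; omega)]
          refine add_mem (hperp _ (by omega) (by omega)) (sum_mem fun s _ =>
            Submodule.smul_mem _ _ (hperp _ (by rw [hf0]; linarith [s.1.zero_le]) ?_))
          have := s.2
          rw [hi]; linarith
      have h3 := hf'.inf_perp_le hFG hag hgi' C.right (t := i') (fun m h3 h4 => by
        by_contra hcon
        have := (hbi' m (by omega) h4).1 (by omega)
        omega) _ h1 h2
      have h4 := (hf.mem_iff hF).1 h3 (i' - 1) (by omega)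
      rw [← (C.shearDual_i' hn (S := S) (c := hf.coord hF) rfl).2, hdual, if_pos rfl] at h4
      exact one_ne_zero h4
  · intro hxy
    have hx2 := left_ne_zero_of_mul hxy
    have hy2 := right_ne_zero_of_mul hxy
    obtain ⟨a', j', hf'⟩ := hFG.exists_frame
    refine ⟨hFG, hag, a', j', hf', ?_⟩
    have hlt_h := (C.lt_h hn hF hf hj hhK rfl hFG hf').1
    have hlt_i : j' (i - 1) < j' i := by
      -- A vector of the space of type i orthogonal to F gi has vanishing coordinates from i to the
      -- end of the block, and x.2 ≠ 0 then kills the coordinate i - 1.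
      have key := hf.separates_of_inf_perp_le hF hFG hf' hag (f := i - 1) (t := i) (f' := fi)
        C.left hfi2 hgi (by omega) (by omega) hbi (by
          intro u hu hu'
          rw [C.coordFilt_i hn rfl, mem_onLine] at hu
          have hu0 : ∀ m, i ≤ m → m < fi → hf.coord hF m u = 0 := fun m h3 h4 =>
            (hf.mem_perp_iff hF).1 hu' m (by
              by_contra hcon
              have := (hbi m (by omega) h4).1 (by omega)
              omega)
          rcases hfi4 with ⟨hα, hf0⟩ | ⟨hα, hi, hf0⟩
          · obtain ⟨e1, e2⟩ := C.shearDual_i hn (S := S) (c := hf.coord hF) hα (l := i) rfl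
            rw [C.vanish_shearDual hn C.left, e1, e2, hu0 i le_rfl hfi1, mul_zero] at hu
            rw [hf0, hf.mem_iff hF]
            intro m hm
            rcases lt_or_ge m (i - 1) with h1 | h1
            · exact hu.1 m h1
            · rcases lt_or_eq_of_le h1 with h2 | rfl
              · rw [show m = i by omega]; exact hu0 i le_rfl hfi1
              · exact (mul_eq_zero.1 hu.2).resolve_left hx2
          · have hut : ∀ t : Fin β, hf.coord hF (h + t) u = 0 := fun t =>
              hu0 _ (by omega) (by have := t.2; omega)
            have h5 := C.bot_pos
            have e1 : shearDual n (hf.coord hF) h S i u = 0 := by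
              rw [C.shearDual_apply_of_eq_zero hn hut (by omega) (by omega)]
              exact hu0 i le_rfl hfi1
            rw [hf0]
            refine C.mem_of_vanish hn hF hf (l := i - 1) (by omega) hu.1 hut fun m h3 h4 => ?_
            rcases lt_or_eq_of_le h3 with h2 | rfl
            · rw [show m = i by omega]; exact e1
            · have := hu.2
              rw [e1, mul_zero] at this
              exact (mul_eq_zero.1 this).resolve_left hx2)
      have h1 := (key (i - 1) le_rfl (by omega)).2 (by omega)
      have h2 := mt (key i (by omega) hfi1).1 (by omega)
      omega
    have hlt_i' : j' (i' - 1) < j' i' := by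
      have key := hf.separates_of_inf_perp_le hF hFG hf' hag (f := fi') (t := i') (f' := i' + 1)
        hfi2' C.right hgi' (by omega) (by omega) hbi' (by
          intro u hu hu'
          rw [C.coordFilt_i' hn rfl, mem_onLine] at hu
          have hu0 : hf.coord hF i' u = 0 := (hf.mem_perp_iff hF).1 hu' i' hgi2'
          obtain ⟨e1, e2⟩ := C.shearDual_i' hn (S := S) (c := hf.coord hF) (l := i') rfl
          rw [e1, e2, hu0, mul_zero] at hu
          have hu1 := (mul_eq_zero.1 hu.2).resolve_left hy2
          rcases hfi4' with ⟨hβ, hf0⟩ | ⟨hβ, hi, hf0⟩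
          · have hu2 := hu.1
            rw [C.vanish_shearDual hn (C.pred_i' hβ)] at hu2
            rw [hf.mem_iff hF]
            intro m hm
            rcases lt_or_ge m (i' - 1) with h1 | h1
            · exact hu2 m h1
            · rcases lt_or_eq_of_le h1 with h2 | rfl
              · rw [show m = i' by omega]; exact hu0
              · exact hu1
          · have := C.mem_of_vanish hn hF hf (u := u) (S := S) (l := h) (by omega)
              (by have := hu.1; rwa [hi, add_sub_cancel_right] at this) (fun t => by
                have := t.2
                rcases (show (t : ℕ) = 0 ∨ (t : ℕ) = 1 by omega) with h1 | h1
                · rw [h1]; rw [hi, add_sub_cancel_right] at hu1; simpa using hu1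
                · rw [h1]; rw [hi] at hu0; simpa using hu0) (by omega)
            rwa [hβ, show h + ((2 : ℕ) : ℤ) = i' + 1 by omega] at this)
      have h1 := (key (i' - 1) (by omega) (by omega)).2 (by omega)
      have h2 := mt (key i' (by omega) (by omega)).1 (by omega)
      omega
    intro l hl
    rcases C.mem_iff.1 hl with h0 | h0 | h0
    · exact lt_of_intCast_eq hf'.jper h0.symm hlt_h
    · exact lt_of_intCast_eq hf'.jper h0.symm hlt_i
    · exact lt_of_intCast_eq hf'.jper h0.symm hlt_i'

end

end TwistedForm

end AffineTwin

/-! ### The coordinates that occur if i and i' are linked. -/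

namespace AffineTwin

namespace TwistedForm

set_option linter.unusedSectionVars false

variable {k E : Type*} [Field k] [AddCommGroup E] [Module k E] {X : TwistedForm k E} {n : ℕ}
  {F F' : ℤ → Submodule k E} {a a' : ℤ → E} {j j' : ℤ → ℤ} {J : Set (ZMod (2 * n))}
  {h i i' : ℤ} {α β : ℕ}

/-- The form on `k²` given by two pairs of vectors. -/
def pairForm (X : TwistedForm k E) (u₁ u₂ v₁ v₂ : E) : (k × k) →ₗ[k] (k × k) →ₗ[k] k :=
  LinearMap.mk₂ k (fun x y => X.b (y.1 • v₁ + y.2 • v₂) (x.1 • u₁ + x.2 • u₂))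
    (fun x x' y => by simp only [map_add, map_smul, Prod.fst_add, Prod.snd_add, add_smul]; abel)
    (fun r x y => by
      simp only [map_add, map_smul, Prod.smul_fst, Prod.smul_snd, smul_eq_mul]; ring)
    (fun x y y' => by
      simp only [map_add, map_smul, Prod.fst_add, Prod.snd_add, LinearMap.add_apply,
        LinearMap.smul_apply, smul_eq_mul]; ring)
    (fun r x y => by
      simp only [map_add, map_smul, Prod.smul_fst, Prod.smul_snd, smul_eq_mul,
        LinearMap.add_apply, LinearMap.smul_apply]; ring)

theorem pairForm_apply (u₁ u₂ v₁ v₂ : E) (x y : k × k) : pairForm X u₁ u₂ v₁ v₂ x y =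
    X.b (y.1 • v₁ + y.2 • v₂) (x.1 • u₁ + x.2 • u₂) := rfl

section

variable [NeZero n] (C : Config n J h i i' α β) (hn : 4 ≤ n) (hF : X.Filt n F)
  (hf : X.Frame n F a j) (hj : NoInv J j) (hhK : ¬ Linked J j h) {g : ℤ}
  (hgi : j i = g) (hgi1 : j (i - 1) = g - 1) (hg : (g : ZMod (2 * n)) = i')
include C hn

omit [NeZero n] in
/-- The beginning of the block of a translate of `i'`. -/
theorem _root_.AffineTwin.Config.exists_begin {g : ℤ} (hg : (g : ZMod (2 * n)) = i') :
    ∃ e : ℤ, e < g ∧ (e : ZMod (2 * n)) ∉ J ∧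
    (∀ m : ℤ, e < m → m < g + 1 → (m : ZMod (2 * n)) ∈ J) ∧
    ∀ (a : ℤ → E) (S : Matrix (Fin α) (Fin β) k) (P : E → Prop), P 0 →
      (∀ u v, P u → P v → P (u + v)) → (∀ (r : k) u, P u → P (r • u)) →
      (∀ m, e ≤ m → m < g - 1 → P (a m)) →
      P (shear n a h S (g - 1) - a (g - 1)) ∧ P (shear n a h S g - a g) := by
  obtain ⟨z, rfl⟩ := intCast_eq_iff.1 hg.symm
  have hn0 : 0 < n := by omega
  have hαβ := C.lt_two_mul hn
  rcases C.bot with hβ | ⟨hβ, hi⟩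
  · refine ⟨i' + 2 * n * z - 1, by omega, ?_, fun m h1 h2 => ?_, fun a S P h0 _ _ _ => ?_⟩
    · rw [show i' + 2 * n * z - 1 = i' - 1 + 2 * n * z by ring, intCast_add_mul]
      exact C.pred_i' hβ
    · rw [show m = i' + 2 * n * z by omega, intCast_add_mul]
      exact C.i'_mem
    · rw [shear_of_ne hn0, shear_of_ne hn0, sub_self, sub_self]
      · exact ⟨h0, h0⟩
      · rintro t z' h1
        rcases C.bot_cases t z' with ⟨h2, -⟩ | ⟨-, h2, -⟩
        · rw [← h1, intCast_add_mul] at h2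
          exact C.h_ne_i' h2.symm
        · have := t.2; omega
      · refine C.ne_bot_of_notMem ?_
        rw [show i' + 2 * n * z - 1 = i' - 1 + 2 * n * z by ring, intCast_add_mul]
        exact C.pred_i' hβ
  · refine ⟨h - α + 2 * n * z, by linarith [show (0 : ℤ) ≤ α by positivity], ?_, fun m h1 h2 => ?_,
      fun a S P h0 hadd hsmul hP => ?_⟩
    · rw [intCast_add_mul]; exact C.low
    · refine C.mem_of_between h1 ?_
      rw [hβ]; push_cast; linarith
    · have hsum : ∀ t : Fin β, P (∑ s : Fin α, S s t • a (h - α + s + 2 * n * z)) := by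
        intro t
        refine Finset.sum_induction _ P hadd h0 fun s _ => hsmul _ _ (hP _ ?_ ?_)
        · linarith [show (0 : ℤ) ≤ (s : ℕ) by positivity]
        · have : (s : ℤ) < α := by exact_mod_cast s.2
          linarith
      rw [shear_of_eq (by omega) ⟨0, by omega⟩ z (by simp only; push_cast; linarith),
        shear_of_eq (by omega) ⟨1, by omega⟩ z (by simp only; push_cast; linarith),
        add_sub_cancel_left, add_sub_cancel_left]
      exact ⟨hsum _, hsum _⟩

include hF hf hj hgi hgi1 hg in
/-- The criterion for membership in the geometry if `j` interchanges the types `i` and `i'`. -/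
theorem coordFilt_mem_iff_of_linked (hhK : ¬ Linked J j h)
    (S : Matrix (Fin α) (Fin β) k) {x y : k × k} (hx : x ≠ 0) (hy : y ≠ 0) :
    coordFilt n (hf.coord hF) h i i' S x y ∈ X.geometry J F ↔
      pairForm X (a (i - 1)) (a i) (a (g - 1)) (a g) x y ≠ 0 := by
  have hFG := filt_coordFilt C hn hF hf S hx hy
  have hag := agree_coordFilt C hn hF hf S x y
  have hac := hf.coord_apply hF
  have hdual := C.dual_apply hn hac (S := S)
  have hn0 : 0 < n := by omega
  have htw := hf.isTwist hF
  have hjg : j g = i - 2 * n := by rw [← hgi, htw.twist]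
  have hjg1 : j (g - 1) = i - 1 - 2 * n := by rw [← hgi1, htw.twist]
  obtain ⟨G, hG⟩ : ∃ G, G = coordFilt n (hf.coord hF) h i i' S x y := ⟨_, rfl⟩
  obtain ⟨e, he1, he2, he3, he4⟩ := C.exists_begin hn (k := k) (E := E) hg
  obtain ⟨fi, hfi1, hfi2, hfi3, hfi4⟩ := C.exists_end_i hn
  have hjlt : ∀ m, e ≤ m → m < g - 1 → j m < i - 1 - 2 * n := fun m h1 h2 => by
    rw [← hjg1]
    exact hj.lt (fun l h3 h4 => he3 l h3 (by omega)) h1 h2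
  have hgJ : ((g + 1 : ℤ) : ZMod (2 * n)) ∉ J := C.succ_i'_notMem hg
  -- the distinguished vectors
  obtain ⟨v, hv⟩ : ∃ v, v = x.1 • a (i - 1) + x.2 • a i := ⟨_, rfl⟩
  obtain ⟨w, hw⟩ : ∃ w, w = y.1 • shear n a h S (g - 1) + y.2 • shear n a h S g := ⟨_, rfl⟩
  have hvG : v ∈ G i := by
    have h1 := exists_mem_onLine hdual x i
    rw [shear_of_ne hn0 (C.ne_bot_of_notMem C.left),
      shear_of_ne hn0 (C.ne_bot_of_eq_i rfl), ← hv] at h1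
    rw [hG, C.coordFilt_i hn rfl]
    exact h1
  have hwG : w ∈ G g := by
    rw [hG, C.coordFilt_i' hn hg, hw]
    exact exists_mem_onLine hdual y g
  have hvp : v ∈ X.perp G (g + 1) := by
    rw [hG, hag.perp hgJ, hv]
    exact add_mem (Submodule.smul_mem _ _ (hF.perp_mono (by omega) (hf.mem_perp _)))
      (Submodule.smul_mem _ _ (hF.perp_mono (by omega) (hf.mem_perp _)))
  -- The shear adds combinations of a m with m < g - 1 in the block of g; their positions are too
  -- small for a nonzero pairing with a (i - 1) or a i.
  have hb : X.b w v = pairForm X (a (i - 1)) (a i) (a (g - 1)) (a g) x y := by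
    obtain ⟨h1, h2⟩ := he4 a S (fun u => X.b u (a (i - 1)) = 0 ∧ X.b u (a i) = 0) (by simp)
      (fun u v hu hv => by
        rw [map_add, LinearMap.add_apply, LinearMap.add_apply, hu.1, hu.2, hv.1, hv.2]; simp)
      (fun r u hu => by rw [map_smul, LinearMap.smul_apply, LinearMap.smul_apply, hu.1, hu.2]; simp)
      (fun m h1 h2 => by
        have := hjlt m h1 h2
        exact ⟨hf.b_eq_zero_of_add_lt hF (by omega), hf.b_eq_zero_of_add_lt hF (by omega)⟩)
    simp only [map_sub, LinearMap.sub_apply, sub_eq_zero] at h1 h2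
    rw [pairForm_apply, hv, hw]
    simp only [map_add, map_smul, LinearMap.add_apply, LinearMap.smul_apply, h1.1, h1.2, h2.1, h2.2]
  have hxi : ∀ u ∈ G (i + 1), shearDual n (hf.coord hF) h S (i - 1) u = 0 ∧
      shearDual n (hf.coord hF) h S i u = 0 := by
    intro u hu
    have h1 : G (i + 1) = vanish (shearDual n (hf.coord hF) h S) (i + 1) := by
      rcases C.top with hα | ⟨hα, hi⟩
      · rw [hG, C.coordFilt_of_notMem hn (C.succ_i hα), C.vanish_shearDual hn (C.succ_i hα)]
      · rw [hG, C.coordFilt_h hn]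
        rw [hi, sub_add_cancel]
    rw [h1] at hu
    exact ⟨hu _ (by omega), hu _ (by omega)⟩
  have hvG' : v ∉ G (i + 1) := by
    intro h0
    obtain ⟨h1, h2⟩ := hxi v h0
    rw [hv, ← shear_of_ne (α := α) (a := a) (h := h) (S := S) hn0 (C.ne_bot_of_notMem C.left),
      ← shear_of_ne (α := α) (a := a) (l := i) (h := h) (S := S) hn0 (C.ne_bot_of_eq_i rfl), map_add,
      map_smul, map_smul, hdual, hdual] at h1 h2
    rw [if_pos rfl, if_neg (by omega)] at h1
    rw [if_pos rfl, if_neg (by omega)] at h2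
    exact hx (Prod.ext (by simpa using h1) (by simpa using h2))
  have hwG' : w ∉ G (g + 1) := by
    intro h0
    rw [hG, C.coordFilt_of_notMem hn hgJ, ← C.vanish_shearDual hn (S := S) hgJ] at h0
    have h1 := h0 (g - 1) (by omega)
    have h2 := h0 g (by omega)
    rw [hw, map_add, map_smul, map_smul, hdual, hdual] at h1 h2
    rw [if_pos rfl, if_neg (by omega)] at h1
    rw [if_pos rfl, if_neg (by omega)] at h2
    exact hy (Prod.ext (by simpa using h1) (by simpa using h2))
  rw [← hG] at hFG hag ⊢
  have hperp : ∀ u ∈ X.perp G (g + 1), X.b w u = 0 → u ∈ X.perp G g := by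
    intro u hu h0 w' hw'
    obtain ⟨r, hr⟩ := hFG.codim g w hwG hwG' w' hw'
    have := hu _ hr
    rwa [map_sub, map_smul, LinearMap.sub_apply, LinearMap.smul_apply, h0, smul_zero, sub_zero]
      at this
  rw [← hb]
  constructor
  -- w spans G g modulo G (g + 1), and v is orthogonal to G (g + 1). So b w v = 0 makes v orthogonal
  -- to G g; as v is in G i but not in G (i + 1), the position sends i below g, whereas j i = g.
  · rintro ⟨-, -, a', j', hf', hj'⟩ h0
    have hjj : j' = j := hag.position_eq ⟨_, C.left⟩ hFG hF hf' hf hj' hj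
    subst hjj
    have := (hf'.lt_iff hFG).2 ⟨v, hvG, hperp v hvp h0, hvG'⟩
    omega
  · intro hne
    obtain ⟨a', j', hf'⟩ := hFG.exists_frame
    refine ⟨hFG, hag, a', j', hf', ?_⟩
    have htw' := hf'.isTwist hFG
    obtain ⟨hlt_h, hlt_h'⟩ := C.lt_h hn hF hf hj hhK hG hFG hf'
    -- no index above `i` is mapped into the block of `g`
    have hno : ∀ m, i + 1 ≤ m → e ≤ j' m → ¬ j' m ≤ g := by
      intro m h1 h2 h3
      by_cases h4 : m < fi
      · rcases hfi4 with ⟨hα, hf0⟩ | ⟨hα, hi, hf0⟩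
        · omega
        · have := hlt_h' m (by omega) (by omega)
          rw [← hi, hgi] at this
          omega
      -- For j itself no index beyond the block of i lands between e and g: j increases there, and
      -- applying it again would give l ≤ i. Equality of counts carries this over to j'.
      · have hz : ∀ l, fi ≤ l → e ≤ j l → g < j l := by
          intro l h5 h6
          by_contra hcon
          have h7 : j (j l) ≤ i - 2 * n := by
            rcases lt_or_eq_of_le (not_lt.1 hcon) with h8 | h8
            · rw [← hjg]
              exact (hj.lt (fun l h9 h10 => he3 l h9 (by omega)) h6 h8).le
            · rw [h8, hjg]
          rw [htw.twist] at h7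
          omega
        have hc1 := hag.counts hFG hF hf' hf fi e hfi2 he2
        have hc2 := hag.counts hFG hF hf' hf fi (g + 1) hfi2 hgJ
        have hss : {l | fi ≤ l ∧ j l < g + 1} = {l | fi ≤ l ∧ j l < e} := by
          ext l
          simp only [Set.mem_ofPred_eq]
          refine and_congr_right fun h5 => ⟨fun h6 => ?_, fun h6 => by omega⟩
          by_contra hcon
          have := hz l h5 (not_lt.1 hcon)
          omega
        have hlt : {l | fi ≤ l ∧ j' l < e}.ncard < {l | fi ≤ l ∧ j' l < g + 1}.ncard := by
          refine Set.ncard_lt_ncard ⟨fun l hl => ⟨hl.1, by have := hl.2; omega⟩, fun hl => ?_⟩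
            (finite_counts hf'.jper _ _)
          have := (hl (a := m) ⟨not_lt.1 h4, by omega⟩).2
          omega
        rw [hc1, hc2, hss] at hlt
        omega
    -- The vector v shows j' i ≤ g. If the position were smaller, subtracting from v a multiple of a
    -- vector u responsible for this would leave a component of index above i in position exactly g,
    -- against `hno`.
    have hji : j' i = g := by
      have h1 := (hf'.lt_iff hFG).2 ⟨v, hvG, hvp, hvG'⟩
      by_contra hcon
      obtain ⟨u, h2, h3, h4⟩ := (hf'.lt_iff hFG (f := i) (g := g)).1 (by omega)
      obtain ⟨r, hr⟩ := hFG.codim i u h2 h4 v hvG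
      have h5 : v - r • u ∉ X.perp G g := by
        intro h5
        apply hne
        have := add_mem h5 (Submodule.smul_mem _ r h3)
        rw [sub_add_cancel] at this
        exact this w hwG
      have h6 : v - r • u ∈ X.perp G (g + 1) :=
        sub_mem hvp (Submodule.smul_mem _ _ (hFG.perp_mono (by omega) h3))
      rw [hf'.mem_perp_iff hFG] at h5
      push Not at h5
      obtain ⟨m, h7, h8⟩ := h5
      have h9 : j' m ≤ g := by
        by_contra h9
        exact h8 ((hf'.mem_perp_iff hFG).1 h6 m (by omega))
      refine hno m ?_ (by omega) h9
      by_contra h10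
      exact h8 ((hf'.mem_iff hFG).1 hr m (by omega))
    have hlt_i : j' (i - 1) < j' i := by
      have h1 : j' (i - 1) < g + 1 := by
        have h2 : ∃ u, (u = a (i - 1) ∨ u = a i) ∧ u ∉ G i := by
          by_contra! hcon
          have h3 := hcon _ (.inl rfl)
          have h4 := hcon _ (.inr rfl)
          rw [hG, C.coordFilt_i hn rfl, mem_onLine] at h3 h4
          rw [← shear_of_ne (α := α) (a := a) (h := h) (S := S) hn0 (C.ne_bot_of_notMem C.left), hdual,
            hdual, if_pos rfl, if_neg (by omega)] at h3
          rw [← shear_of_ne (α := α) (a := a) (l := i) (h := h) (S := S) hn0 (C.ne_bot_of_eq_i rfl), hdual,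
            hdual, if_pos rfl, if_neg (by omega)] at h4
          exact hx (Prod.ext (by simpa using h4.2.symm) (by simpa using h3.2))
        obtain ⟨u, h2, h3⟩ := h2
        refine (hf'.lt_iff hFG).2 ⟨u, ?_, ?_, by rwa [sub_add_cancel]⟩
        · rw [hag _ C.left]
          rcases h2 with rfl | rfl
          exacts [hf.mem _, hF.antitone (by omega) (hf.mem _)]
        · rw [hag.perp hgJ]
          rcases h2 with rfl | rfl
          exacts [hF.perp_mono (by omega) (hf.mem_perp _), hF.perp_mono (by omega) (hf.mem_perp _)]
      have h2 : j' (i - 1) ≠ j' i := fun h0 => by have := hf'.inj h0; omega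
      omega
    have hlt_g : j' (g - 1) < j' g := by
      have h1 : j' g = i - 2 * n := by rw [← hji, htw'.twist]
      have h2 : j' (g - 1) ≠ j' g := fun h0 => by have := hf'.inj h0; omega
      by_contra hcon
      -- The index sent to g - 1 is j' (g - 1) + 2n; without an increase at g it would exceed i.
      have h3 : j' (j' (g - 1) + 2 * n) = g - 1 := by rw [hf'.jper, htw'.twist]; ring
      exact hno (j' (g - 1) + 2 * n) (by omega) (by omega) (by omega)
    intro l hl
    rcases C.mem_iff.1 hl with h0 | h0 | h0
    · exact lt_of_intCast_eq hf'.jper h0.symm hlt_h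
    · exact lt_of_intCast_eq hf'.jper h0.symm hlt_i
    · exact lt_of_intCast_eq hf'.jper (hg.trans h0.symm) hlt_g

end

end TwistedForm

end AffineTwin

namespace AffineTwin

/-! ### The choice of coordinates -/

section Shapes

variable {n : ℕ} {J : Set (ZMod (2 * n))}

theorem natCast_ne_zero_of_lt {m : ℕ} (hm : 0 < m) (hmn : m < 2 * n) : (m : ZMod (2 * n)) ≠ 0 := by
  intro h
  exact absurd (Nat.le_of_dvd hm ((ZMod.natCast_eq_zero_iff _ _).1 h)) (by omega)

theorem exists_config_aux (hn : 4 ≤ n) {p q r : ZMod (2 * n)} (hJ : J = {p, q, r}) (hpq : p ≠ q)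
    (hpr : p ≠ r) (hqr : q ≠ r) (h1 : q ≠ r + 1) (h2 : r ≠ q + 1) (h3 : q ≠ p + 1)
    (h4 : r ≠ p - 1) : ∃ (h i i' : ℤ) (α β : ℕ), Config n J h i i' α β ∧ (h : ZMod (2 * n)) = p ∧
      (i : ZMod (2 * n)) = q ∧ (i' : ZMod (2 * n)) = r := by
  have e1 : (1 : ZMod (2 * n)) ≠ 0 := by exact_mod_cast natCast_ne_zero_of_lt one_pos (by omega)
  have e2 : (2 : ZMod (2 * n)) ≠ 0 := by exact_mod_cast natCast_ne_zero_of_lt two_pos (by omega)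
  obtain ⟨h, rfl⟩ := ZMod.intCast_surjective p
  have hq : ∃ (i : ℤ) (α : ℕ), (i : ZMod (2 * n)) = q ∧
      (α = 1 ∧ q ≠ h - 1 ∨ α = 2 ∧ i = h - 1) := by
    by_cases h5 : q = h - 1
    · exact ⟨h - 1, 2, by push_cast; exact h5.symm, .inr ⟨rfl, rfl⟩⟩
    · obtain ⟨i, rfl⟩ := ZMod.intCast_surjective q
      exact ⟨i, 1, rfl, .inl ⟨rfl, h5⟩⟩
  have hr : ∃ (i : ℤ) (β : ℕ), (i : ZMod (2 * n)) = r ∧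
      (β = 1 ∧ r ≠ h + 1 ∨ β = 2 ∧ i = h + 1) := by
    by_cases h5 : r = h + 1
    · exact ⟨h + 1, 2, by push_cast; exact h5.symm, .inr ⟨rfl, rfl⟩⟩
    · obtain ⟨i, rfl⟩ := ZMod.intCast_surjective r
      exact ⟨i, 1, rfl, .inl ⟨rfl, h5⟩⟩
  obtain ⟨i, α, rfl, hα⟩ := hq
  obtain ⟨i', β, rfl, hβ⟩ := hr
  have hα' : α = 1 ∧ (i : ZMod (2 * n)) ≠ h - 1 ∨ α = 2 ∧ (i : ZMod (2 * n)) = h - 1 := by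
    rcases hα with h5 | ⟨h5, rfl⟩
    exacts [.inl h5, .inr ⟨h5, by push_cast; rfl⟩]
  have hβ' : β = 1 ∧ (i' : ZMod (2 * n)) ≠ h + 1 ∨ β = 2 ∧ (i' : ZMod (2 * n)) = h + 1 := by
    rcases hβ with h5 | ⟨h5, rfl⟩
    exacts [.inl h5, .inr ⟨h5, by push_cast; rfl⟩]
  refine ⟨h, i, i', α, β, ⟨hJ, hpq, hpr, hqr, ?_, ?_, ?_, ?_, ?_, ?_, ?_, ?_⟩, rfl, rfl, rfl⟩
  · rcases hα with h5 | h5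
    exacts [.inl h5.1, .inr h5]
  · rcases hβ with h5 | h5
    exacts [.inl h5.1, .inr h5]
  · rw [hJ]
    push_cast
    simp only [Set.mem_insert_iff, Set.mem_singleton_iff]
    rcases hα' with ⟨rfl, h5⟩ | ⟨rfl, h5⟩ <;> push_cast <;> grind
  · rw [hJ]
    push_cast
    simp only [Set.mem_insert_iff, Set.mem_singleton_iff]
    rcases hβ' with ⟨rfl, h5⟩ | ⟨rfl, h5⟩ <;> push_cast <;> grind
  · rw [hJ]
    push_cast
    simp only [Set.mem_insert_iff, Set.mem_singleton_iff]
    grind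
  · rw [hJ]
    push_cast
    simp only [Set.mem_insert_iff, Set.mem_singleton_iff]
    grind
  · rintro rfl
    rw [hJ]
    push_cast
    simp only [Set.mem_insert_iff, Set.mem_singleton_iff]
    grind
  · rintro rfl
    rw [hJ]
    push_cast
    simp only [Set.mem_insert_iff, Set.mem_singleton_iff]
    grind

/-- The types q and r may be interchanged, so that q is not the successor and r not the predecessor
of p. -/
theorem exists_config (hn : 4 ≤ n) {p q r : ZMod (2 * n)} (hJ : J = {p, q, r}) (hpq : p ≠ q)
    (hpr : p ≠ r) (hqr : q ≠ r) (h1 : q ≠ r + 1) (h2 : r ≠ q + 1) :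
    ∃ (h i i' : ℤ) (α β : ℕ), Config n J h i i' α β ∧ (h : ZMod (2 * n)) = p ∧
      ((i : ZMod (2 * n)) = q ∧ (i' : ZMod (2 * n)) = r ∨
        (i : ZMod (2 * n)) = r ∧ (i' : ZMod (2 * n)) = q) := by
  have e2 : (2 : ZMod (2 * n)) ≠ 0 := by exact_mod_cast natCast_ne_zero_of_lt two_pos (by omega)
  by_cases h3 : q ≠ p + 1 ∧ r ≠ p - 1
  · obtain ⟨h, i, i', α, β, C, rfl, rfl, rfl⟩ := exists_config_aux hn hJ hpq hpr hqr h1 h2 h3.1 h3.2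
    exact ⟨h, i, i', α, β, C, rfl, .inl ⟨rfl, rfl⟩⟩
  · have hJ' : J = {p, r, q} := by rw [hJ, Set.pair_comm]
    obtain ⟨h, i, i', α, β, C, rfl, rfl, rfl⟩ := exists_config_aux hn hJ' hpr hpq hqr.symm h2 h1
      (by grind) (by grind)
    exact ⟨h, i, i', α, β, C, rfl, .inr ⟨rfl, rfl⟩⟩

/-- A cycle with at least eight vertices contains no triangle. -/
theorem exists_nonadjacent (hn : 4 ≤ n) {p q r : ZMod (2 * n)} (hpq : p ≠ q)
    (hpr : p ≠ r) (hqr : q ≠ r) : ∃ p' q' r' : ZMod (2 * n), ({p', q', r'} : Set (ZMod (2 * n))) =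
      {p, q, r} ∧ p' ≠ q' ∧ p' ≠ r' ∧ q' ≠ r' ∧ q' ≠ r' + 1 ∧ r' ≠ q' + 1 := by
  have e1 : (1 : ZMod (2 * n)) ≠ 0 := by exact_mod_cast natCast_ne_zero_of_lt one_pos (by omega)
  have e3 : (3 : ZMod (2 * n)) ≠ 0 := by
    exact_mod_cast natCast_ne_zero_of_lt (show 0 < 3 by omega) (by omega)
  by_cases h1 : p ≠ q + 1 ∧ q ≠ p + 1
  · exact ⟨r, p, q, by ext; simp; tauto, hpr.symm, hqr.symm, hpq, h1.1, h1.2⟩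
  by_cases h2 : q ≠ r + 1 ∧ r ≠ q + 1
  · exact ⟨p, q, r, rfl, hpq, hpr, hqr, h2.1, h2.2⟩
  exact ⟨q, p, r, by ext; simp; tauto, hpq.symm, hqr, hpr, by grind, by grind⟩

end Shapes

namespace TwistedForm

section Linked

variable {n : ℕ} [NeZero n] {J : Set (ZMod (2 * n))} {j : ℤ → ℤ}

omit [NeZero n] in
theorem Linked.congr (hj : Periodic n j) {t l : ℤ} (h : (t : ZMod (2 * n)) = l)
    (ht : Linked J j t) : Linked J j l ∧ ((j l : ℤ) : ZMod (2 * n)) = j t := by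
  obtain ⟨z, rfl⟩ := intCast_eq_iff.1 h
  have e : j (t + 2 * n * z) = j t + 2 * n * z := hj.add_mul _ _
  rw [Linked, show t + 2 * n * z - 1 = t - 1 + 2 * n * z by ring, e, hj.add_mul, ht.1,
    intCast_add_mul]
  refine ⟨⟨by ring, ?_⟩, ?_⟩
  · rw [← ht.1]; exact ht.2
  · rfl

-- Linked types come in pairs, since j applied twice is the translation by a period.
omit [NeZero n] in
theorem Linked.position (hj : IsTwist n j) {t : ℤ} (ht : Linked J j t)
    (htJ : (t : ZMod (2 * n)) ∈ J) : Linked J j (j t) := by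
  rw [Linked, show j t - 1 = j (t - 1) by rw [ht.1]; ring, hj.twist, hj.twist]
  refine ⟨by ring, ?_⟩
  have := intCast_add_mul (n := n) t (-1)
  rw [show t + 2 * (n : ℤ) * -1 = t - 2 * n by ring] at this
  rwa [this]

-- If j t were congruent to t or t ± 1, applying j twice would give n (2z + 1) = 0 or ± 1 for an
-- integer z.
omit [NeZero n] in
theorem Linked.nonadjacent (hn : 4 ≤ n) (hj : IsTwist n j) {t : ℤ} (ht : Linked J j t) :
    (t : ZMod (2 * n)) ≠ j t ∧ (t : ZMod (2 * n)) ≠ j t + 1 ∧ (j t : ZMod (2 * n)) ≠ t + 1 := by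
  have h0 : j (t - 1) = j t - 1 := by rw [ht.1]; ring
  have h1 := hj.twist t
  have h1' := hj.twist (t - 1)
  refine ⟨fun h2 => ?_, fun h2 => ?_, fun h2 => ?_⟩
  · obtain ⟨z, hz⟩ := intCast_eq_iff.1 h2
    rw [hz, hj.per.add_mul, hz] at h1
    have h3 : (n : ℤ) * (2 * z + 1) = 0 := by linarith
    rcases mul_eq_zero.1 h3 with h4 | h4 <;> omega
  · obtain ⟨z, hz⟩ := intCast_eq_iff.1 (show ((t - 1 : ℤ) : ZMod (2 * n)) = j t by
      push_cast; rw [h2]; ring)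
    rw [hz, hj.per.add_mul, h0, hz] at h1
    have h3 : (n : ℤ) * (2 * z + 1) = 1 := by linarith
    have := Int.le_of_dvd one_pos (Dvd.intro _ h3)
    omega
  · obtain ⟨z, hz⟩ := intCast_eq_iff.1 (show ((t + 1 : ℤ) : ZMod (2 * n)) = j t by
      push_cast; rw [h2])
    rw [h0, hz, show t + 1 + 2 * n * z - 1 = t + 2 * n * z by ring, hj.per.add_mul, hz] at h1'
    have h3 : (n : ℤ) * (-(2 * z + 1)) = 1 := by linarith
    have := Int.le_of_dvd one_pos (Dvd.intro _ h3)
    omega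

/-- A linked type t and its partner j t are two nonadjacent elements of J. The third is not linked:
its partner cannot be itself, and the other two are already partners of each other. It serves as h.
If nothing is linked, any two nonadjacent types serve as i and i'. -/
theorem exists_config_position (hn : 4 ≤ n) {J : Finset (ZMod (2 * n))} (hJ : J.card = 3)
    (htw : IsTwist n j) : ∃ (h i i' : ℤ) (α β : ℕ), Config n (J : Set (ZMod (2 * n))) h i i' α β ∧
      ¬ Linked (J : Set (ZMod (2 * n))) j h ∧
      (¬ Linked (J : Set (ZMod (2 * n))) j i ∧ ¬ Linked (J : Set (ZMod (2 * n))) j i' ∨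
        j (i - 1) = j i - 1 ∧ (j i : ZMod (2 * n)) = i') := by
  by_cases hK : ∃ t : ℤ, (t : ZMod (2 * n)) ∈ (J : Set (ZMod (2 * n))) ∧
      Linked (J : Set (ZMod (2 * n))) j t
  · obtain ⟨t, htJ, ht⟩ := hK
    obtain ⟨h1, h2, h3⟩ := ht.nonadjacent hn htw
    obtain ⟨p, hp⟩ : ∃ p, (J.erase (t : ZMod (2 * n))).erase (j t : ZMod (2 * n)) = {p} := by
      rw [← Finset.card_eq_one, Finset.card_erase_of_mem, Finset.card_erase_of_mem, hJ]
      · exact_mod_cast htJ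
      · exact Finset.mem_erase.2 ⟨h1.symm, by exact_mod_cast ht.2⟩
    have hp' : p ∈ (J.erase (t : ZMod (2 * n))).erase (j t : ZMod (2 * n)) := by simp [hp]
    simp only [Finset.mem_erase] at hp'
    have hJ' : (J : Set (ZMod (2 * n))) = {p, (t : ZMod (2 * n)), (j t : ZMod (2 * n))} := by
      ext r
      have h4 := Finset.ext_iff.1 hp r
      simp only [Finset.mem_erase, Finset.mem_singleton] at h4
      simp only [Set.mem_insert_iff, Set.mem_singleton_iff, Finset.mem_coe]
      constructor
      · intro h5; tauto
      · rintro (rfl | rfl | rfl)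
        exacts [hp'.2.2, by exact_mod_cast htJ, by exact_mod_cast ht.2]
    obtain ⟨h, i, i', α, β, C, rfl, h4⟩ := exists_config hn hJ' hp'.2.1 hp'.1 h1 h2 h3
    refine ⟨h, i, i', α, β, C, fun h5 => ?_, .inr ?_⟩
    · have h6 := h5.2
      rw [hJ'] at h6
      rcases h6 with h6 | h6 | h6
      · exact (h5.nonadjacent hn htw).1 h6.symm
      · obtain ⟨-, h7⟩ := ht.congr htw.per h6.symm
        rw [htw.twist] at h7
        apply hp'.1
        rw [← h7]
        have := intCast_add_mul (n := n) h (-1)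
        rw [← this]
        congr 1
        ring
      · obtain ⟨z, hz⟩ := intCast_eq_iff.1 h6.symm
        rw [← htw.per.add_mul] at hz
        rw [htw.injective hz, intCast_add_mul] at hp'
        exact hp'.2.1 rfl
    · rcases h4 with ⟨h5, h6⟩ | ⟨h5, h6⟩
      · obtain ⟨h7, h8⟩ := ht.congr htw.per h5.symm
        exact ⟨by rw [h7.1]; ring, by rw [h8, h6]⟩
      · obtain ⟨h7, h8⟩ := (ht.position htw htJ).congr htw.per h5.symm
        refine ⟨by rw [h7.1]; ring, ?_⟩
        rw [h8, h6, htw.twist, ← intCast_add_mul t (-1)]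
        congr 1
        ring
  · push Not at hK
    obtain ⟨p, q, r, hpq, hpr, hqr, rfl⟩ := Finset.card_eq_three.1 hJ
    obtain ⟨p', q', r', h1, h2, h3, h4, h5, h6⟩ := exists_nonadjacent hn hpq hpr hqr
    obtain ⟨h, i, i', α, β, C, -, -⟩ := exists_config (J := (({p, q, r} : Finset (ZMod (2 * n))) :
      Set (ZMod (2 * n)))) hn (by simpa using h1.symm) h2 h3 h4 h5 h6
    exact ⟨h, i, i', α, β, C, hK _ C.h_mem, .inl ⟨hK _ C.i_mem, hK _ C.i'_mem⟩⟩

end Linked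

universe u

variable {k E : Type u} [Field k] [AddCommGroup E] [Module k E] {X : TwistedForm k E} {n : ℕ}
  [NeZero n] {F : ℤ → Submodule k E} {a : ℤ → E} {j : ℤ → ℤ}

/-- Both cases are expressed by one nonzero form: the product of the second coordinates, or the form
induced by b, whose value at the second basis vectors is b (a (j i)) (a i). -/
theorem coordFilt_mem_iff (hn : 4 ≤ n) {J : Set (ZMod (2 * n))} {h i i' : ℤ} {α β : ℕ}
    (C : Config n J h i i' α β) (hF : X.Filt n F)
    (hf : X.Frame n F a j) (hj : NoInv J j) (hhK : ¬ Linked J j h)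
    (hK : ¬ Linked J j i ∧ ¬ Linked J j i' ∨ j (i - 1) = j i - 1 ∧ (j i : ZMod (2 * n)) = i') :
    ∃ B : Form k, B ≠ 0 ∧ ∀ (S : Matrix (Fin α) (Fin β) k) (x y : k × k), x ≠ 0 → y ≠ 0 →
      (coordFilt n (hf.coord hF) h i i' S x y ∈ X.geometry J F ↔ B x y ≠ 0) := by
  rcases hK with ⟨h1, h2⟩ | ⟨h1, h2⟩
  · refine ⟨(LinearMap.mul k k).compl₁₂ (LinearMap.snd k k k) (LinearMap.snd k k k), fun h0 => ?_,
      fun S x y hx hy => ?_⟩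
    · have := LinearMap.congr_fun₂ h0 (0, 1) (0, 1)
      simp at this
    · rw [coordFilt_mem_iff_of_not_linked C hn hF hf hj hhK h1 h2 S hx hy]
      rfl
  · refine ⟨pairForm X (a (i - 1)) (a i) (a (j i - 1)) (a (j i)), fun h0 => ?_, fun S x y hx hy =>
      coordFilt_mem_iff_of_linked C hn hF hf hj rfl h1 h2 hhK S hx hy⟩
    have := LinearMap.congr_fun₂ h0 (0, 1) (0, 1)
    rw [pairForm_apply] at this
    simp only [zero_smul, one_smul, zero_add] at this
    exact hf.b_ne_zero hF i this

/-- The geometry of filtrations of position without inversions has coordinates. -/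
theorem exists_isCoord (hn : 4 ≤ n) {J : Finset (ZMod (2 * n))} (hJ : J.card = 3)
    (hF : X.Filt n F) : ∃ (h i i' : ZMod (2 * n)) (α β : ℕ) (B : Form k)
      (pu : (ℤ → Submodule k E) → Matrix (Fin α) (Fin β) k) (px py : (ℤ → Submodule k E) → k × k),
      (J : Set (ZMod (2 * n))) = {h, i, i'} ∧ h ≠ i ∧ h ≠ i' ∧ i ≠ i' ∧ (α = 1 ∨ α = 2) ∧
      (β = 1 ∨ β = 2) ∧ IsCoord (fun (r : ZMod (2 * n)) G G' => Agree {r} G G')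
        (X.geometry (J : Set (ZMod (2 * n))) F) h i i' B (colSub α β)
        (rowSub α β) pu px py := by
  obtain ⟨a0, j0, hf0⟩ := hF.exists_frame
  -- The coordinates refer to a frame of a member of the geometry, obtained by descent.
  obtain ⟨F', a, j, hF', hag', hf, hj, -⟩ := hf0.exists_noInv (J : Set (ZMod (2 * n))) hF
  have hgeo : X.geometry (J : Set (ZMod (2 * n))) F = X.geometry (J : Set (ZMod (2 * n))) F' := by
    ext G
    exact ⟨fun h => ⟨h.1, h.2.1.trans hag'.symm, h.2.2⟩, fun h => ⟨h.1, h.2.1.trans hag', h.2.2⟩⟩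
  rw [hgeo]
  obtain ⟨h, i, i', α, β, C, hhK, hK⟩ := exists_config_position hn hJ (hf.isTwist hF')
  obtain ⟨B, hB, hcrit⟩ := coordFilt_mem_iff hn C hF' hf hj hhK hK
  have hex : ∀ G, ∃ (S : Matrix (Fin α) (Fin β) k) (x y : k × k), G ∈ X.geometry (J : Set (ZMod (2 * n))) F' →
      x ≠ 0 ∧ y ≠ 0 ∧ G = coordFilt n (hf.coord hF') h i i' S x y := by
    intro G
    by_cases hG : G ∈ X.geometry (J : Set (ZMod (2 * n))) F'
    · obtain ⟨hFG, hag, a', j', hf', hj'⟩ := hG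
      have hjj : j' = j := hag.position_eq ⟨_, C.left⟩ hFG hF' hf' hf hj' hj
      subst hjj
      obtain ⟨g, hg, -, -, h3⟩ := C.separates_h hn hF' hf hj hhK
      obtain ⟨S, x, y, hx, hy, hG⟩ := hf.exists_coords C hn hF' hFG hf' hag hg h3
      exact ⟨S, x, y, fun _ => ⟨hx, hy, hG⟩⟩
    · exact ⟨0, 0, 0, fun h' => absurd h' hG⟩
  choose pu px py hp using hex
  have hac := hf.coord_apply hF'
  refine ⟨h, i, i', α, β, B, pu, px, py, C.eq, C.h_ne_i, C.h_ne_i', C.i_ne_i',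
    C.top.imp_right And.left, C.bot.imp_right And.left, ⟨hB, ?_, ?_, ?_, ?_, ?_, ?_, ?_⟩⟩
  · intro G hG
    obtain ⟨hx, hy, h1⟩ := hp G hG
    rw [← hcrit (pu G) _ _ hx hy, ← h1]
    exact hG
  · intro S x y hxy
    have hx := ne_zero_of_left hxy
    have hy := ne_zero_of_right hxy
    have hG := (hcrit S x y hx hy).2 hxy
    obtain ⟨hx', hy', h1⟩ := hp _ hG
    refine ⟨_, hG, ?_, ?_, ?_⟩
    · exact ((C.agree_i hn hac hx' hy' hx hy).1 (fun l _ => congrFun h1.symm l)).1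
    · exact ((C.agree_i' hn hac hx' hy' hx hy).1 (fun l _ => congrFun h1.symm l)).2
    · exact ((C.agree_i hn hac hx' hy' hx hy).1 (fun l _ => congrFun h1.symm l)).2
  · intro G hG G' hG'
    obtain ⟨hx, hy, h1⟩ := hp G hG
    obtain ⟨hx', hy', h1'⟩ := hp G' hG'
    conv_lhs => rw [h1, h1']
    exact C.agree_h hn hac hx hy hx' hy'
  · intro G hG G' hG'
    obtain ⟨hx, hy, h1⟩ := hp G hG
    obtain ⟨hx', hy', h1'⟩ := hp G' hG'
    conv_lhs => rw [h1, h1']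
    exact C.agree_i hn hac hx hy hx' hy'
  · intro G hG G' hG'
    obtain ⟨hx, hy, h1⟩ := hp G hG
    obtain ⟨hx', hy', h1'⟩ := hp G' hG'
    conv_lhs => rw [h1, h1']
    exact C.agree_i' hn hac hx hy hx' hy'
  · exact fun x x' => colSub_par
  · exact fun x x' => rowSub_par

end TwistedForm

end AffineTwin

namespace AffineTwin

open LaurentPolynomial WithZero

/-! ### Laurent polynomials as rational functions -/

/-- The sign of a half of the twin building. -/
def Side.sign : Side → ℤ
  | .plus => 1
  | .minus => -1

@[simp] theorem Side.sign_flip (ε : Side) : ε.flip.sign = -ε.sign := by cases ε <;> simp [sign, flip]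

@[simp] theorem Side.sign_mul_sign (ε : Side) : ε.sign * ε.sign = 1 := by cases ε <;> rfl

variable {k : Type*} [Field k] {n : ℕ}

theorem t_ne_zero : t k ≠ 0 := RatFunc.X_ne_zero

/-- The indeterminate `t` as a unit. -/
noncomputable def tUnit : (RatFunc k)ˣ := Units.mk0 (t k) t_ne_zero

/-- The inclusion of the Laurent polynomials in the rational functions. -/
noncomputable def toRat : k[T;T⁻¹] →ₐ[k] RatFunc k :=
  { LaurentPolynomial.eval₂ (algebraMap k (RatFunc k)) (tUnit (k := k)) with
    commutes' := fun r => by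
      rw [← LaurentPolynomial.C_eq_algebraMap]
      exact LaurentPolynomial.eval₂_C _ _ r }

theorem toRat_T (z : ℤ) : toRat (T z : k[T;T⁻¹]) = t k ^ z := by
  have : toRat (T z : k[T;T⁻¹]) = ((tUnit (k := k) ^ z : (RatFunc k)ˣ) : RatFunc k) :=
    LaurentPolynomial.eval₂_T _ _ z
  rw [this]; simp [tUnit]

theorem toRat_C (r : k) : toRat (LaurentPolynomial.C r) = algebraMap k (RatFunc k) r :=
  LaurentPolynomial.eval₂_C _ _ r

theorem toRat_toLaurent (p : Polynomial k) :
    toRat (Polynomial.toLaurent p) = algebraMap (Polynomial k) (RatFunc k) p := by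
  have h : (toRat (k := k)).comp Polynomial.toLaurentAlg =
      IsScalarTower.toAlgHom k (Polynomial k) (RatFunc k) := by
    apply Polynomial.algHom_ext
    simp [toRat_T]
  exact DFunLike.congr_fun h p

theorem toRat_injective : Function.Injective (toRat (k := k)) := by
  rw [injective_iff_map_eq_zero]
  intro f hf
  obtain ⟨m, p, hp⟩ := exists_T_pow f
  have h1 : algebraMap (Polynomial k) (RatFunc k) p = 0 := by
    rw [← toRat_toLaurent, hp, map_mul, hf, zero_mul]
  have h2 : p = 0 := (map_eq_zero_iff _ (RatFunc.algebraMap_injective k)).1 h1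
  rw [h2, map_zero] at hp
  exact (isUnit_T (m : ℤ)).mul_left_eq_zero.1 hp.symm

theorem sigma_toRat (f : k[T;T⁻¹]) : sigma k (toRat f) = toRat (invert f) := by
  induction f using LaurentPolynomial.induction_on' with
  | add p q hp hq => rw [map_add, map_add, map_add, map_add, hp, hq]
  | C_mul_T z r =>
    rw [map_mul, map_mul, map_mul, map_mul, invert_C, invert_T, toRat_C, toRat_T, toRat_T,
      AlgHom.commutes, map_zpow₀, sigma_X, inv_zpow']

theorem toRat_mem_laurent (f : k[T;T⁻¹]) : toRat f ∈ Laurent k := by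
  have h1 : ∀ z : ℤ, t k ^ z ∈ Laurent k := by
    intro z
    rcases Int.eq_nat_or_neg z with ⟨m, rfl | rfl⟩
    · rw [zpow_natCast]
      exact pow_mem (Algebra.subset_adjoin (by simp)) m
    · rw [zpow_neg, zpow_natCast, ← inv_pow]
      exact pow_mem (Algebra.subset_adjoin (by simp)) m
  induction f using LaurentPolynomial.induction_on' with
  | add p q hp hq => rw [map_add]; exact add_mem hp hq
  | C_mul_T z r =>
    rw [map_mul, toRat_C, toRat_T]
    exact mul_mem (Subalgebra.algebraMap_mem _ r) (h1 z)

theorem exists_toRat {x : RatFunc k} (hx : x ∈ Laurent k) : ∃ f, toRat f = x := by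
  have h1 : Laurent k ≤ (toRat (k := k)).range := by
    refine Algebra.adjoin_le ?_
    rintro x (rfl | rfl)
    · exact ⟨T 1, by simp [toRat_T]⟩
    · exact ⟨T (-1), by simp [toRat_T]⟩
  exact h1 hx

/-! ### Valuations -/

theorem val_t (ε : Side) : val k ε (t k) = exp (-ε.sign) := by
  cases ε
  · exact Polynomial.valuation_X_eq_neg_one k
  · change (Polynomial.idealX k).valuation (RatFunc k) (sigma k (RatFunc.X)) = _
    rw [sigma_X, map_inv₀, Polynomial.valuation_X_eq_neg_one]
    simp [Side.sign, exp]

theorem val_t_zpow (ε : Side) (z : ℤ) : val k ε (t k ^ z) = exp (-(ε.sign * z)) := by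
  rw [map_zpow₀, val_t, ← exp_zsmul]
  congr 1
  simp [mul_comm]

theorem algebraMap_mem_O (ε : Side) (r : k) : algebraMap k (RatFunc k) r ∈ O k ε := by
  have h : ∀ r : k, val k .plus (algebraMap k (RatFunc k) r) ≤ 1 := fun r => by
    rw [IsScalarTower.algebraMap_apply k (Polynomial k) (RatFunc k)]
    exact (Polynomial.idealX k).valuation_le_one _
  cases ε
  · exact h r
  · rw [Valuation.mem_integer_iff]
    change val k Side.plus.flip _ ≤ 1
    rw [← val_sigma, AlgHom.commutes]
    exact h r

theorem coeff_mul_T (f : k[T;T⁻¹]) (z l : ℤ) : (f * T z).coeff l = f.coeff (l - z) := by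
  have := AddMonoidAlgebra.coeff_mul_single_eq_coeff_mul (x := f) (m := z) (r := 1) (m₁ := l)
    (l - z) (fun m' _ => by constructor <;> intro h <;> omega)
  rw [mul_one] at this
  exact this

theorem coeff_toLaurent_natCast (p : Polynomial k) (i : ℕ) :
    (Polynomial.toLaurent p).coeff (i : ℤ) = p.coeff i := by
  rw [LaurentPolynomial.coeff_toLaurent]
  exact Finsupp.mapDomain_apply Nat.castEmbedding.injective _ i

/-- A power T ^ s turns f into a polynomial p, and integrality of f becomes divisibility of p by X ^
s. -/
theorem toRat_mem_O_plus {f : k[T;T⁻¹]} :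
    toRat f ∈ O k .plus ↔ ∀ l, f.coeff l ≠ 0 → 0 ≤ l := by
  obtain ⟨s, p, hp⟩ := exists_T_pow f
  have hpc : ∀ i : ℕ, p.coeff i = f.coeff (i - s) := fun i => by
    rw [← coeff_toLaurent_natCast, hp, coeff_mul_T]
  have hlow : ∀ l : ℤ, f.coeff l ≠ 0 → 0 ≤ l + s := fun l hl => by
    have h1 : (l + s) ∈ (Polynomial.toLaurent p).coeff.support := by
      rw [Finsupp.mem_support_iff, hp, coeff_mul_T]; simpa using hl
    rw [LaurentPolynomial.support_coeff_toLaurent, Finset.mem_map] at h1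
    obtain ⟨i, -, hi⟩ := h1
    rw [← hi]
    exact Int.natCast_nonneg i
  have h1 : toRat f ∈ O k .plus ↔ val k .plus (algebraMap (Polynomial k) (RatFunc k) p) ≤
      exp (-(s : ℤ)) := by
    rw [Valuation.mem_integer_iff, ← toRat_toLaurent, hp, map_mul, map_mul, toRat_T, val_t_zpow]
    simp only [Side.sign, one_mul]
    rw [mul_comm, mul_le_iff_le_one_right exp_pos]
  rw [h1]
  have h2 : val k .plus (algebraMap (Polynomial k) (RatFunc k) p) ≤ exp (-(s : ℤ)) ↔
      Polynomial.X ^ s ∣ p := by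
    change (Polynomial.idealX k).valuation (RatFunc k) _ ≤ _ ↔ _
    rw [IsDedekindDomain.HeightOneSpectrum.valuation_of_algebraMap,
      IsDedekindDomain.HeightOneSpectrum.intValuation_le_pow_iff_mem, Polynomial.idealX_span,
      Ideal.span_singleton_pow, Ideal.mem_span_singleton]
  rw [h2, Polynomial.X_pow_dvd_iff]
  constructor
  · intro h l hl
    by_contra hneg
    have h3 := hlow l hl
    have h4 := h (l + s).toNat (by omega)
    rw [hpc, Int.toNat_of_nonneg h3, add_sub_cancel_right] at h4
    exact hl h4
  · intro h i hi
    rw [hpc]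
    by_contra hne
    have := h _ hne
    omega

theorem toRat_mem_O {ε : Side} {f : k[T;T⁻¹]} :
    toRat f ∈ O k ε ↔ ∀ l, f.coeff l ≠ 0 → 0 ≤ ε.sign * l := by
  cases ε
  · simp only [toRat_mem_O_plus, Side.sign, one_mul]
  · have h : toRat f ∈ O k .minus ↔ toRat (invert f) ∈ O k .plus := by
      rw [← sigma_toRat]; rfl
    rw [h, toRat_mem_O_plus]
    simp only [invert_apply, Side.sign]
    constructor
    · intro h l hl
      have := h (-l) (by rwa [neg_neg])
      omega
    · intro h l hl
      have := h _ hl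
      omega

theorem exists_val_le (ε : Side) (x : RatFunc k) : ∃ s : ℕ, val k ε x ≤ exp (s : ℤ) := by
  by_cases hx : x = 0
  · exact ⟨0, by rw [hx, map_zero]; exact zero_le⟩
  · refine ⟨(log (val k ε x)).toNat, ?_⟩
    rw [← log_le_iff_le_exp ((Valuation.ne_zero_iff _).2 hx)]
    omega

theorem zpow_mul_mem_O {ε : Side} {x : RatFunc k} {s : ℤ} :
    t k ^ (ε.sign * s) * x ∈ O k ε ↔ val k ε x ≤ exp s := by
  rw [Valuation.mem_integer_iff, map_mul, val_t_zpow, ← mul_assoc, Side.sign_mul_sign, one_mul]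
  conv_rhs => rw [← mul_one (exp s)]
  rw [exp_neg, inv_mul_le_iff₀ exp_pos]

/-- The Laurent polynomials are dense in `k(t)`. -/
theorem exists_toRat_approx (ε : Side) (s : ℤ) (x : RatFunc k) :
    ∃ f : k[T;T⁻¹], val k ε (x - toRat f) ≤ exp (-s) := by
  -- Clear the pole by t ^ d, approximate by a polynomial and divide again. The case ε = - is
  -- transported by σ.
  have hplus : ∀ x : RatFunc k, ∃ f : k[T;T⁻¹], val k .plus (x - toRat f) ≤ exp (-s) := by
    intro x
    obtain ⟨d, hd⟩ := exists_val_le .plus x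
    have h1 : val k .plus (t k ^ (d : ℤ) * x) ≤ 1 := by
      have := (zpow_mul_mem_O (ε := .plus) (s := d)).2 hd
      simp only [Side.sign, one_mul] at this
      exact this
    obtain ⟨p, hp⟩ := (Polynomial.idealX k).exists_valuation_sub_lt_of_integer (K := RatFunc k) h1
      (Units.mk0 (exp (-(s + d))) exp_ne_zero)
    refine ⟨T (-d) * Polynomial.toLaurent p, ?_⟩
    have h2 : x - toRat (T (-d) * Polynomial.toLaurent p) =
        -(t k ^ (-(d : ℤ)) * (algebraMap _ _ p - t k ^ (d : ℤ) * x)) := by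
      rw [map_mul, toRat_T, toRat_toLaurent, mul_sub, ← mul_assoc, ← zpow_add₀ t_ne_zero]
      simp
    rw [h2, Valuation.map_neg, map_mul, val_t_zpow]
    have h3 := mul_le_mul_right hp.le (exp (-(Side.plus.sign * -(d : ℤ))))
    refine h3.trans (le_of_eq ?_)
    rw [Units.val_mk0, ← exp_add]
    congr 1
    simp [Side.sign]
  cases ε
  · exact hplus x
  · obtain ⟨f, hf⟩ := hplus (sigma k x)
    refine ⟨invert f, ?_⟩
    have : val k .minus (x - toRat (invert f)) = val k .plus (sigma k x - toRat f) := by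
      rw [show val k .minus (x - toRat (invert f)) =
        val k .plus (sigma k (x - toRat (invert f))) from rfl, map_sub, sigma_toRat,
        involutive_invert]
    rw [this]; exact hf

/-- The residue field of `O_ε` is `k`. -/
theorem exists_residue {ε : Side} {x : RatFunc k} (hx : x ∈ O k ε) :
    ∃ r : k, val k ε (x - algebraMap k (RatFunc k) r) ≤ exp (-1) := by
  obtain ⟨f, hf⟩ := exists_toRat_approx ε 1 x
  have h1 : toRat f ∈ O k ε := by
    have h2 : x - toRat f ∈ O k ε := hf.trans (by rw [← exp_zero, exp_le_exp]; omega)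
    have := sub_mem hx h2
    simpa using this
  rw [toRat_mem_O] at h1
  -- The residue is the constant term of an approximating Laurent polynomial; its other terms have
  -- positive valuation.
  refine ⟨f.coeff 0, ?_⟩
  have h3 : x - algebraMap k (RatFunc k) (f.coeff 0) =
      (x - toRat f) + toRat (f - LaurentPolynomial.C (f.coeff 0)) := by
    rw [map_sub, toRat_C]; ring
  rw [h3]
  refine Valuation.map_add_le _ hf ?_
  rw [← zpow_mul_mem_O, ← toRat_T, ← map_mul, toRat_mem_O, mul_comm]
  intro l hl
  rw [coeff_mul_T, AddMonoidAlgebra.coeff_sub, Finsupp.sub_apply, LaurentPolynomial.C_apply] at hl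
  split_ifs at hl with h4
  · rw [h4, sub_self] at hl; exact absurd rfl hl
  · rw [sub_zero] at hl
    have h5 := h1 _ hl
    cases ε <;> simp only [Side.sign] at h4 h5 ⊢ <;> omega

end AffineTwin

namespace AffineTwin

open LaurentPolynomial WithZero

variable {k : Type*} [Field k] {n : ℕ}

/-! ### The module of Laurent polynomial vectors and its twisted form -/

variable (k n) in
/-- Vectors of Laurent polynomials. -/
abbrev LaurentVec : Type _ := Fin n ⊕ Fin n → k[T;T⁻¹]

/-- The inclusion of the vectors of Laurent polynomials in `V`. -/
noncomputable def incl : LaurentVec k n →ₗ[k] V k n where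
  toFun x i := toRat (x i)
  map_add' _ _ := by funext i; simp
  map_smul' _ _ := by funext i; simp

@[simp] theorem incl_apply (x : LaurentVec k n) (i : Fin n ⊕ Fin n) : incl x i = toRat (x i) := rfl

theorem incl_injective : Function.Injective (incl (k := k) (n := n)) := fun x y h =>
  funext fun i => toRat_injective (congrFun h i)

theorem incl_smul (f : k[T;T⁻¹]) (x : LaurentVec k n) : incl (f • x) = toRat f • incl x := by
  funext i; simp

/-- Multiplication by `t ^ z`. -/
noncomputable def shiftEquiv (k : Type*) [Field k] (n : ℕ) (z : ℤ) :
    LaurentVec k n ≃ₗ[k] LaurentVec k n where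
  toFun x := (T z : k[T;T⁻¹]) • x
  map_add' _ _ := smul_add _ _ _
  map_smul' _ _ := smul_comm _ _ _
  invFun x := (T (-z) : k[T;T⁻¹]) • x
  left_inv x := by
    change (T (-z) : k[T;T⁻¹]) • ((T z : k[T;T⁻¹]) • x) = x
    rw [smul_smul, ← T_add]; simp
  right_inv x := by
    change (T z : k[T;T⁻¹]) • ((T (-z) : k[T;T⁻¹]) • x) = x
    rw [smul_smul, ← T_add]; simp

theorem shiftEquiv_apply (z : ℤ) (x : LaurentVec k n) :
    shiftEquiv k n z x = (T z : k[T;T⁻¹]) • x := rfl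

theorem incl_shiftEquiv (z : ℤ) (x : LaurentVec k n) :
    incl (shiftEquiv k n z x) = t k ^ z • incl x := by
  rw [shiftEquiv_apply, incl_smul, toRat_T]

/-- The sesquilinear form on vectors of Laurent polynomials. -/
noncomputable def betaL (u v : LaurentVec k n) : k[T;T⁻¹] :=
  ∑ i : Fin n, (u (.inl i) * invert (v (.inr i)) + T 1 * u (.inr i) * invert (v (.inl i)))

theorem beta_eq (u v : V k n) : beta u v = ∑ i : Fin n, (u (.inl i) * sigma k (v (.inr i)) +
    t k * u (.inr i) * sigma k (v (.inl i))) := by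
  rw [beta, gram, Matrix.fromBlocks_mulVec]
  simp only [dotProduct, Fintype.sum_sum_type, Sum.elim_inl, Sum.elim_inr, Matrix.zero_mulVec,
    Matrix.one_mulVec, zero_add, add_zero, Matrix.smul_mulVec, Pi.smul_apply, Function.comp_apply,
    smul_eq_mul]
  rw [← Finset.sum_add_distrib]
  refine Finset.sum_congr rfl fun i _ => ?_
  ring

theorem toRat_betaL (u v : LaurentVec k n) : toRat (betaL u v) = beta (incl u) (incl v) := by
  rw [beta_eq, betaL, map_sum]
  refine Finset.sum_congr rfl fun i _ => ?_
  rw [map_add, map_mul, map_mul, map_mul, toRat_T, zpow_one, incl_apply, incl_apply, incl_apply,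
    incl_apply, sigma_toRat, sigma_toRat]

/-- The Gram matrix is t times its σ-conjugate transpose. This is the source of the twist, and so of
j (j m) = m - 2n. -/
theorem betaL_symm (u v : LaurentVec k n) : betaL u v = T 1 * invert (betaL v u) := by
  rw [betaL, betaL, map_sum, Finset.mul_sum]
  refine Finset.sum_congr rfl fun i _ => ?_
  simp only [map_add, map_mul, involutive_invert (u (.inr i)),
    involutive_invert (u (.inl i)), invert_T]
  have : (T 1 : k[T;T⁻¹]) * T (-1) = 1 := by rw [← T_add]; simp
  linear_combination (-(invert (v (Sum.inr i)) * u (Sum.inl i))) * this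

theorem betaL_add_left (u u' v : LaurentVec k n) : betaL (u + u') v = betaL u v + betaL u' v := by
  simp only [betaL, ← Finset.sum_add_distrib]
  refine Finset.sum_congr rfl fun i _ => ?_
  simp only [Pi.add_apply]; ring

theorem betaL_smul_left (f : k[T;T⁻¹]) (u v : LaurentVec k n) :
    betaL (f • u) v = f * betaL u v := by
  simp only [betaL, Finset.mul_sum]
  refine Finset.sum_congr rfl fun i _ => ?_
  simp only [Pi.smul_apply, smul_eq_mul]; ring

theorem betaL_add_right (u v v' : LaurentVec k n) : betaL u (v + v') = betaL u v + betaL u v' := by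
  simp only [betaL, ← Finset.sum_add_distrib]
  refine Finset.sum_congr rfl fun i _ => ?_
  simp only [Pi.add_apply, map_add]; ring

theorem betaL_smul_right (f : k[T;T⁻¹]) (u v : LaurentVec k n) :
    betaL u (f • v) = invert f * betaL u v := by
  simp only [betaL, Finset.mul_sum]
  refine Finset.sum_congr rfl fun i _ => ?_
  simp only [Pi.smul_apply, smul_eq_mul, map_mul]; ring

/-- The coefficient of the sesquilinear form that is relevant for `Δ_ε`. -/
def Side.exponent : Side → ℤ
  | .plus => 0
  | .minus => 1

variable (k n) in
/-- The twisted symmetric form over `k`. -/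
noncomputable def twistedForm (ε : Side) : TwistedForm k (LaurentVec k n) where
  T := shiftEquiv k n ε.sign
  b := LinearMap.mk₂ k (fun u v => (betaL u v).coeff ε.exponent)
    (fun u u' v => by rw [betaL_add_left]; rfl)
    (fun r u v => by
      rw [← algebraMap_smul k[T;T⁻¹] r u, betaL_smul_left, ← Algebra.smul_def]; rfl)
    (fun u v v' => by rw [betaL_add_right]; rfl)
    (fun r u v => by
      rw [← algebraMap_smul k[T;T⁻¹] r v, betaL_smul_right, ← LaurentPolynomial.C_eq_algebraMap,
        invert_C, LaurentPolynomial.C_eq_algebraMap, ← Algebra.smul_def]; rfl)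
  -- Both sides are one coefficient of `betaL v u`: for the exponent e, the factor T and the
  -- inversion lead to 1 - e, the shift of u leads to e plus the sign of ε, and these agree for both
  -- values of ε.
  twist u v := by
    simp only [LinearMap.mk₂_apply]
    rw [shiftEquiv_apply, betaL_smul_right, invert_T, betaL_symm u v, mul_comm, coeff_mul_T,
      invert_apply, mul_comm, coeff_mul_T]
    cases ε <;> rfl

theorem twistedForm_b (ε : Side) (u v : LaurentVec k n) :
    (twistedForm k n ε).b u v = (betaL u v).coeff ε.exponent := rfl

theorem twistedForm_T (ε : Side) (u : LaurentVec k n) :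
    (twistedForm k n ε).T u = shiftEquiv k n ε.sign u := rfl

/-! ### The lattice `M` -/

theorem mem_M {v : V k n} : v ∈ M k n ↔ ∃ x : LaurentVec k n, incl x = v := by
  constructor
  · intro h
    refine Submodule.span_induction (p := fun v _ => ∃ x : LaurentVec k n, incl x = v)
      ?_ ?_ ?_ ?_ h
    · rintro _ ⟨i, rfl⟩
      refine ⟨Pi.single i 1, ?_⟩
      funext l
      rw [incl_apply]
      by_cases hl : l = i
      · subst hl; simp
      · simp [hl]
    · exact ⟨0, map_zero _⟩
    · rintro _ _ - - ⟨x, rfl⟩ ⟨y, rfl⟩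
      exact ⟨x + y, map_add _ _ _⟩
    · rintro ⟨r, hr⟩ _ - ⟨x, rfl⟩
      obtain ⟨f, rfl⟩ := exists_toRat hr
      exact ⟨f • x, incl_smul f x⟩
  · rintro ⟨x, rfl⟩
    have h1 : incl x = ∑ i, (⟨toRat (x i), toRat_mem_laurent _⟩ : Laurent k) •
        (Pi.single i 1 : V k n) := by
      funext l
      rw [Finset.sum_apply, Finset.sum_eq_single l]
      · rw [Pi.smul_apply, Pi.single_eq_same, Subalgebra.smul_def]; simp
      · intro i _ hi
        rw [Pi.smul_apply, Pi.single_eq_of_ne hi.symm, smul_zero]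
      · simp
    rw [h1]
    exact sum_mem fun i _ => Submodule.smul_mem _ _ (Submodule.subset_span ⟨i, rfl⟩)

/-- The vectors of Laurent polynomials in an `O_ε`-module. -/
noncomputable def trace {ε : Side} (Λ : Submodule (O k ε) (V k n)) :
    Submodule k (LaurentVec k n) where
  carrier := {x | incl x ∈ Λ}
  zero_mem' := by rw [Set.mem_ofPred_eq, map_zero]; exact zero_mem _
  add_mem' := fun hx hy => by rw [Set.mem_ofPred_eq, map_add]; exact add_mem hx hy
  smul_mem' := fun r x hx => by
    rw [Set.mem_ofPred_eq, map_smul, ← algebraMap_smul (RatFunc k) r (incl x)]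
    exact Λ.smul_mem (⟨algebraMap k (RatFunc k) r, algebraMap_mem_O ε r⟩ : O k ε) hx

theorem mem_trace {ε : Side} {Λ : Submodule (O k ε) (V k n)} {x : LaurentVec k n} :
    x ∈ trace Λ ↔ incl x ∈ Λ := Iff.rfl

/-- An `O_ε`-module that contains a lattice. -/
def IsLarge {ε : Side} (Λ : Submodule (O k ε) (V k n)) : Prop :=
  ∃ s : ℤ, ∀ (v : V k n), (∀ i, val k ε (v i) ≤ exp (-s)) → v ∈ Λ

theorem exists_incl_approx (ε : Side) (s : ℤ) (v : V k n) :
    ∃ x : LaurentVec k n, ∀ i, val k ε ((v - incl x) i) ≤ exp (-s) := by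
  choose x hx using fun i => exists_toRat_approx ε s (v i)
  exact ⟨x, hx⟩

/-- By density a vector of Λ differs from a vector of Laurent polynomials by a small vector, and the
small vectors form a lattice inside Λ that is generated by monomials. -/
theorem IsLarge.eq_span {ε : Side} {Λ : Submodule (O k ε) (V k n)} (h : IsLarge Λ) :
    Λ = Submodule.span (O k ε) (incl '' (trace Λ : Set (LaurentVec k n))) := by
  refine le_antisymm (fun v hv => ?_) (Submodule.span_le.2 ?_)
  · obtain ⟨s, hs⟩ := h
    obtain ⟨x, hx⟩ := exists_incl_approx ε s v
    have h1 := hs _ hx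
    have h2 : incl x ∈ Λ := by have := sub_mem hv h1; simpa using this
    have h3 : ∀ i, (t k ^ (ε.sign * s) • (Pi.single i 1 : V k n)) ∈
        Submodule.span (O k ε) (incl '' (trace Λ : Set (LaurentVec k n))) := by
      intro i
      have e : incl (shiftEquiv k n (ε.sign * s) (Pi.single i 1)) =
          t k ^ (ε.sign * s) • (Pi.single i 1 : V k n) := by
        rw [incl_shiftEquiv]
        congr 1
        funext l
        rw [incl_apply]
        by_cases hl : l = i
        · subst hl; simp
        · simp [hl]
      rw [← e]
      refine Submodule.subset_span ⟨_, ?_, rfl⟩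
      change incl _ ∈ Λ
      rw [e]
      refine hs _ fun l => ?_
      rw [Pi.smul_apply, smul_eq_mul, map_mul, val_t_zpow, ← mul_assoc, Side.sign_mul_sign, one_mul]
      by_cases hl : l = i
      · subst hl; simp
      · simp [hl]
    have h4 : v - incl x = ∑ i, (⟨t k ^ (ε.sign * -s) * (v - incl x) i,
        zpow_mul_mem_O.2 (hx i)⟩ : O k ε) • (t k ^ (ε.sign * s) • (Pi.single i 1 : V k n)) := by
      funext l
      rw [Finset.sum_apply, Finset.sum_eq_single l]
      · rw [Pi.smul_apply, Pi.smul_apply, Pi.single_eq_same, Subring.smul_def, smul_eq_mul,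
          smul_eq_mul, mul_one, mul_right_comm, ← zpow_add₀ t_ne_zero]
        simp
      · intro i _ hi
        rw [Pi.smul_apply, Pi.smul_apply, Pi.single_eq_of_ne hi.symm, smul_zero, smul_zero]
      · simp
    have h5 := add_mem (Submodule.subset_span ⟨x, h2, rfl⟩ : incl x ∈
      Submodule.span (O k ε) (incl '' (trace Λ : Set (LaurentVec k n))))
      (sum_mem fun i (_ : i ∈ Finset.univ) => Submodule.smul_mem _
        (⟨t k ^ (ε.sign * -s) * (v - incl x) i, zpow_mul_mem_O.2 (hx i)⟩ : O k ε) (h3 i))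
    rw [← h4, add_sub_cancel] at h5
    exact h5
  · rintro _ ⟨x, hx, rfl⟩
    exact hx

/-- Modules that are generated by vectors of Laurent polynomials are determined by these. -/
theorem eq_of_trace_eq {ε : Side} {Λ Λ' : Submodule (O k ε) (V k n)}
    (h : Λ = Submodule.span (O k ε) (incl '' (trace Λ : Set (LaurentVec k n))))
    (h' : Λ' = Submodule.span (O k ε) (incl '' (trace Λ' : Set (LaurentVec k n))))
    (heq : trace Λ = trace Λ') : Λ = Λ' := by
  rw [h, h', heq]

end AffineTwin

namespace AffineTwin

open WithZero

variable {k : Type*} [Field k] {n : ℕ} {ε : Side}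

/-! ### Lattices and determinants -/

theorem exists_val_le_of_finite {ι : Type*} [Finite ι] (ε : Side) (x : ι → RatFunc k) :
    ∃ s : ℕ, ∀ i, val k ε (x i) ≤ exp (s : ℤ) := by
  choose s hs using fun i => exists_val_le ε (x i)
  obtain ⟨m, hm⟩ := (Set.finite_range s).bddAbove
  refine ⟨m, fun i => (hs i).trans (exp_le_exp.2 ?_)⟩
  exact_mod_cast hm ⟨i, rfl⟩

section Det

variable {b b' : Fin n ⊕ Fin n → V k n}

theorem exists_coeffs (hb : (Matrix.of b).det ≠ 0) (v : V k n) :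
    v = ∑ i, (v ᵥ* (Matrix.of b)⁻¹) i • b i := by
  have h1 : (v ᵥ* (Matrix.of b)⁻¹) ᵥ* Matrix.of b = v := by
    rw [Matrix.vecMul_vecMul, Matrix.nonsing_inv_mul _ (Ne.isUnit hb), Matrix.vecMul_one]
  conv_lhs => rw [← h1]
  funext l
  simp [Matrix.vecMul, dotProduct, Finset.sum_apply]

theorem coeffs_unique (hb : (Matrix.of b).det ≠ 0) (c : Fin n ⊕ Fin n → RatFunc k) :
    (∑ i, c i • b i) ᵥ* (Matrix.of b)⁻¹ = c := by
  have h1 : ∑ i, c i • b i = c ᵥ* Matrix.of b := by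
    funext l
    simp [Matrix.vecMul, dotProduct, Finset.sum_apply]
  rw [h1, Matrix.vecMul_vecMul, Matrix.mul_nonsing_inv _ (Ne.isUnit hb), Matrix.vecMul_one]

theorem mem_span_iff_coeffs (hb : (Matrix.of b).det ≠ 0) (v : V k n) :
    v ∈ Submodule.span (O k ε) (Set.range b) ↔ ∀ i, (v ᵥ* (Matrix.of b)⁻¹) i ∈ O k ε := by
  constructor
  · intro h i
    obtain ⟨c, rfl⟩ := (Submodule.mem_span_range_iff_exists_fun _).1 h
    have := coeffs_unique hb (fun i => (c i : RatFunc k))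
    simp only [Subring.smul_def]
    rw [this]
    exact (c i).2
  · intro h
    rw [exists_coeffs hb v]
    exact sum_mem fun i _ => Submodule.smul_mem _ (⟨_, h i⟩ : O k ε) (Submodule.subset_span ⟨i, rfl⟩)

theorem exists_matrix (h : ∀ i, b' i ∈ Submodule.span (O k ε) (Set.range b)) :
    ∃ P : Matrix (Fin n ⊕ Fin n) (Fin n ⊕ Fin n) (O k ε),
      Matrix.of b' = P.map (O k ε).subtype * Matrix.of b := by
  choose P hP using fun i => (Submodule.mem_span_range_iff_exists_fun _).1 (h i)
  refine ⟨Matrix.of P, ?_⟩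
  ext i l
  have := congrFun (hP i) l
  rw [Matrix.of_apply, ← this, Matrix.mul_apply, Finset.sum_apply]
  rfl

theorem val_det_le (h : ∀ i, b' i ∈ Submodule.span (O k ε) (Set.range b)) :
    val k ε (Matrix.of b').det ≤ val k ε (Matrix.of b).det := by
  obtain ⟨P, hP⟩ := exists_matrix h
  rw [hP, Matrix.det_mul, map_mul]
  have h1 : (P.map (O k ε).subtype).det = (P.det : RatFunc k) :=
    ((O k ε).subtype.map_det P).symm
  rw [h1]
  exact mul_le_of_le_one_left' P.det.2

/-- The transition matrix is integral and its determinant is a unit. -/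
theorem span_eq_of_val_det_eq (hb : (Matrix.of b).det ≠ 0)
    (h : ∀ i, b' i ∈ Submodule.span (O k ε) (Set.range b))
    (hdet : val k ε (Matrix.of b').det = val k ε (Matrix.of b).det) :
    Submodule.span (O k ε) (Set.range b') = Submodule.span (O k ε) (Set.range b) := by
  refine le_antisymm (Submodule.span_le.2 (by rintro _ ⟨i, rfl⟩; exact h i)) ?_
  obtain ⟨P, hP⟩ := exists_matrix h
  have h1 : (P.map (O k ε).subtype).det = (P.det : RatFunc k) :=
    ((O k ε).subtype.map_det P).symm
  have h2 : val k ε (P.det : RatFunc k) = 1 := by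
    rw [hP, Matrix.det_mul, map_mul, h1] at hdet
    exact (mul_eq_right₀ ((Valuation.ne_zero_iff _).2 hb)).1 hdet
  have h3 : IsUnit P.det := by
    have h4 : (P.det : RatFunc k) ≠ 0 := fun h0 => by rw [h0, map_zero] at h2; exact zero_ne_one h2
    refine IsUnit.of_mul_eq_one (⟨(P.det : RatFunc k)⁻¹, ?_⟩ : O k ε) (Subtype.ext ?_)
    · rw [Valuation.mem_integer_iff, map_inv₀, h2, inv_one]
    · exact mul_inv_cancel₀ h4
  have h5 : Matrix.of b = P⁻¹.map (O k ε).subtype * Matrix.of b' := by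
    rw [hP, ← Matrix.mul_assoc, ← Matrix.map_mul, Matrix.nonsing_inv_mul _ h3]
    simp
  refine Submodule.span_le.2 ?_
  rintro _ ⟨i, rfl⟩
  have h6 : b i = ∑ l, P⁻¹ i l • b' l := by
    funext m
    have := congrFun (congrFun h5 i) m
    rw [Matrix.of_apply, Matrix.mul_apply] at this
    rw [this, Finset.sum_apply]
    rfl
  rw [SetLike.mem_coe, h6]
  exact sum_mem fun l _ => Submodule.smul_mem _ _ (Submodule.subset_span ⟨l, rfl⟩)

theorem det_update (i : Fin n ⊕ Fin n) (c : Fin n ⊕ Fin n → RatFunc k) :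
    (Matrix.of (Function.update b i (∑ l, c l • b l))).det = c i * (Matrix.of b).det := by
  have := Matrix.det_updateRow_sum (Matrix.of b) i c
  rw [smul_eq_mul] at this
  rw [← this]
  rfl

end Det

variable {Λ Λ' : Submodule (O k ε) (V k n)} {l l' : ℤ}

theorem det_ne_zero_of_val_eq {b : Fin n ⊕ Fin n → V k n}
    (h : val k ε (Matrix.of b).det = val k ε (t k ^ l)) : (Matrix.of b).det ≠ 0 := by
  rw [← Valuation.ne_zero_iff (val k ε), h]
  exact (Valuation.ne_zero_iff _).2 (zpow_ne_zero _ t_ne_zero)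

theorem HasDegree.sign_le (h : HasDegree ε Λ l) (h' : HasDegree ε Λ' l') (hle : Λ' ≤ Λ) :
    ε.sign * l ≤ ε.sign * l' := by
  obtain ⟨b, rfl, hb⟩ := h
  obtain ⟨b', rfl, hb'⟩ := h'
  have h1 := val_det_le (ε := ε) (b := b) (b' := b')
    fun i => hle (Submodule.subset_span ⟨i, rfl⟩)
  rw [hb, hb', val_t_zpow, val_t_zpow, exp_le_exp] at h1
  omega

/-- A lattice of colength one. -/
theorem HasDegree.step (h : HasDegree ε Λ l) (h' : HasDegree ε Λ' l') (hle : Λ' ≤ Λ)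
    (hl : ε.sign * l' = ε.sign * l + 1) {x y : V k n} (hx : x ∈ Λ) (hx' : x ∉ Λ') (hy : y ∈ Λ) :
    ∃ r : k, y - algebraMap k (RatFunc k) r • x ∈ Λ' := by
  obtain ⟨b, rfl, hb⟩ := h
  obtain ⟨b', rfl, hb'⟩ := h'
  have hd := det_ne_zero_of_val_eq hb
  have hd' := det_ne_zero_of_val_eq hb'
  obtain ⟨ξ, hξ⟩ : ∃ ξ, ξ = x ᵥ* (Matrix.of b')⁻¹ := ⟨_, rfl⟩
  have hxξ : x = ∑ i, ξ i • b' i := hξ ▸ exists_coeffs hd' x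
  rw [mem_span_iff_coeffs hd', ← hξ] at hx'
  push Not at hx'
  obtain ⟨i1, hi1⟩ := hx'
  -- The coefficient with the worst pole. Exchanging its basis vector for x multiplies the
  -- determinant by it; as the two lattices differ by one uniformizer, the pole is simple and the
  -- exchange gives a basis of the larger lattice.
  obtain ⟨i, -, hmax⟩ := Finset.exists_max_image Finset.univ (fun i => val k ε (ξ i))
    ⟨i1, Finset.mem_univ _⟩
  have hgt : 1 < val k ε (ξ i) := (not_le.1 hi1).trans_le (hmax i1 (Finset.mem_univ _))
  -- exchange `b' i` for `x`
  have hmem : ∀ m, Function.update b' i x m ∈ Submodule.span (O k ε) (Set.range b) := by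
    intro m
    by_cases hm : m = i
    · subst hm; simpa using hx
    · rw [Function.update_of_ne hm]; exact hle (Submodule.subset_span ⟨m, rfl⟩)
  have hdet : (Matrix.of (Function.update b' i x)).det = ξ i * (Matrix.of b').det := by
    rw [hxξ]; exact det_update i ξ
  have h1 := val_det_le hmem
  have hval : val k ε (ξ i) = exp 1 := by
    refine le_antisymm ?_ ?_
    · rw [hdet, map_mul, hb, hb', val_t_zpow, val_t_zpow, hl] at h1
      rw [show exp (-(ε.sign * l)) = exp (1 : ℤ) * exp (-(ε.sign * l + 1)) by
        rw [← exp_add]; congr 1; ring] at h1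
      exact (mul_le_mul_iff_left₀ exp_pos).1 h1
    · have h2 : val k ε (ξ i) ≠ 0 := (zero_lt_one.trans hgt).ne'
      rw [← le_log_iff_exp_le h2]
      rw [← exp_zero, ← lt_log_iff_exp_lt h2] at hgt
      omega
  have hspan := span_eq_of_val_det_eq hd hmem (by
    rw [hdet, map_mul, hval, hb, hb', val_t_zpow, val_t_zpow, hl, ← exp_add]
    congr 1; ring)
  rw [← hspan] at hy
  obtain ⟨c, hc⟩ := (Submodule.mem_span_range_iff_exists_fun _).1 hy
  -- Modulo Λ' only the coefficient at x counts, and of this only the residue, since x has at most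
  -- simple poles.
  obtain ⟨r, hr⟩ := exists_residue (c i).2
  refine ⟨r, ?_⟩
  have hd'' : (Matrix.of (Function.update b' i x)).det ≠ 0 := by
    rw [hdet]
    exact mul_ne_zero (fun h0 => by rw [h0, map_zero] at hval; exact exp_ne_zero hval.symm) hd'
  have h3 : y - algebraMap k (RatFunc k) r • x =
      ((c i : RatFunc k) - algebraMap k (RatFunc k) r) • x +
        ∑ m ∈ Finset.univ.erase i, c m • b' m := by
    rw [← hc, ← Finset.add_sum_erase _ _ (Finset.mem_univ i), Function.update_self,
      Finset.sum_congr rfl fun m hm => by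
        rw [Function.update_of_ne (Finset.ne_of_mem_erase hm)], sub_smul, Subring.smul_def]
    abel
  rw [h3]
  refine add_mem ?_ (sum_mem fun m _ => Submodule.smul_mem _ _ (Submodule.subset_span ⟨m, rfl⟩))
  rw [hxξ, Finset.smul_sum]
  refine sum_mem fun m _ => ?_
  rw [smul_smul]
  refine Submodule.smul_mem _ (⟨_, ?_⟩ : O k ε) (Submodule.subset_span ⟨m, rfl⟩)
  rw [Valuation.mem_integer_iff, map_mul]
  refine (mul_le_mul' hr (hmax m (Finset.mem_univ _))).trans ?_
  rw [hval, ← exp_add]; simp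

theorem HasDegree.isLarge (h : HasDegree ε Λ l) : IsLarge Λ := by
  obtain ⟨b, rfl, hb⟩ := h
  have hd := det_ne_zero_of_val_eq hb
  obtain ⟨s, hs⟩ := exists_val_le_of_finite ε
    (fun p : (Fin n ⊕ Fin n) × (Fin n ⊕ Fin n) => (Matrix.of b)⁻¹ p.1 p.2)
  refine ⟨s, fun v hv => ?_⟩
  rw [mem_span_iff_coeffs hd]
  intro i
  rw [Matrix.vecMul, dotProduct]
  refine Subring.sum_mem (O k ε) fun m _ => ?_
  rw [Valuation.mem_integer_iff, map_mul]
  refine (mul_le_mul' (hv m) (hs (m, i))).trans ?_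
  rw [← exp_add]; simp

/-- Lattices are bounded. -/
theorem HasDegree.exists_bound (h : HasDegree ε Λ l) :
    ∃ s : ℕ, ∀ v ∈ Λ, ∀ i, val k ε (v i) ≤ exp (s : ℤ) := by
  obtain ⟨b, rfl, hb⟩ := h
  obtain ⟨s, hs⟩ := exists_val_le_of_finite ε
    (fun p : (Fin n ⊕ Fin n) × (Fin n ⊕ Fin n) => b p.1 p.2)
  refine ⟨s, fun v hv i => ?_⟩
  obtain ⟨c, rfl⟩ := (Submodule.mem_span_range_iff_exists_fun _).1 hv
  rw [Finset.sum_apply]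
  refine Valuation.map_sum_le _ fun m _ => ?_
  rw [Pi.smul_apply, Subring.smul_def, smul_eq_mul, map_mul]
  exact (mul_le_of_le_one_left' (c m).2).trans (hs (m, i))

end AffineTwin

namespace AffineTwin

open LaurentPolynomial WithZero

variable {k : Type*} [Field k] {n : ℕ} {ε : Side}

/-! ### The filtration of a chamber -/

/-- The filtration of the vectors of Laurent polynomials defined by a chain of lattices. -/
noncomputable def chamberFilt (c : Chain k n ε) (l : ℤ) : Submodule k (LaurentVec k n) :=
  trace (c (ε.sign * l))

theorem mem_chamberFilt {c : Chain k n ε} {l : ℤ} {x : LaurentVec k n} :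
    x ∈ chamberFilt c l ↔ incl x ∈ c (ε.sign * l) := Iff.rfl

theorem beta_add_left (u u' v : V k n) : beta (u + u') v = beta u v + beta u' v :=
  add_dotProduct _ _ _

theorem beta_smul_left (x : RatFunc k) (u v : V k n) : beta (x • u) v = x * beta u v :=
  smul_dotProduct _ _ _

theorem mem_zpow_of_period {c : Chain k n ε} (h : ∀ l v, v ∈ c l ↔ t k • v ∈ c (l + 2 * n))
    (z l : ℤ) (v : V k n) : v ∈ c l ↔ t k ^ z • v ∈ c (l + 2 * n * z) := by
  induction z using Int.induction_on with
  | zero => simp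
  | succ z ih =>
    rw [ih, h, show l + 2 * n * ((z : ℤ) + 1) = l + 2 * n * z + 2 * n by ring, smul_smul,
      ← zpow_one_add₀ t_ne_zero, add_comm 1]
  | pred z ih =>
    rw [ih, h (l + 2 * n * (-(z : ℤ) - 1)), smul_smul, ← zpow_one_add₀ t_ne_zero]
    rw [show l + 2 * n * (-(z : ℤ) - 1) + 2 * n = l + 2 * n * (-z) by ring,
      show 1 + (-(z : ℤ) - 1) = -z by ring]

section Chamber

variable {c : Chain k n ε} (hc : IsChamber c)
include hc

theorem IsChamber.anti (l : ℤ) : c (ε.sign * (l + 1)) ≤ c (ε.sign * l) := by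
  obtain ⟨-, -, h⟩ := hc
  cases ε
  · simpa [Side.sign] using h l
  · have := h (-(l + 1))
    simpa [Side.sign, show -(l + 1) + 1 = -l by ring] using this

theorem IsChamber.antitone : Antitone fun l => c (ε.sign * l) := antitone_int_of_succ_le hc.anti

theorem IsChamber.mem_zpow (z l : ℤ) (v : V k n) :
    v ∈ c l ↔ t k ^ z • v ∈ c (l + 2 * n * z) := mem_zpow_of_period hc.2.1 z l v

theorem IsChamber.isLarge (l : ℤ) : IsLarge (c l) := (hc.1 l).isLarge

theorem theta_period (l : ℤ) (v : V k n) : v ∈ theta c l ↔ t k • v ∈ theta c (l + 2 * n) := by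
  have key : ∀ u, beta (t k • u) (t k • v) = beta u v := fun u => by
    rw [beta_smul, beta_smul_left, ← mul_assoc, sigma_X, inv_mul_cancel₀ t_ne_zero, one_mul]
  have e : l + 2 * (n : ℤ) - n = l - n + 2 * n := by ring
  constructor
  · intro h u hu
    have h1 : t k • ((t k)⁻¹ • u) = u := smul_inv_smul₀ t_ne_zero u
    rw [← h1, key]
    refine h _ ((hc.2.1 _ _).2 ?_)
    rw [h1, ← e]; exact hu
  · intro h u hu
    rw [← key]
    refine h _ ?_
    rw [e]
    exact (hc.2.1 _ _).1 hu

end Chamber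

/-! ### Dual lattices -/

section Dual

variable {Λ : Submodule (O k ε) (V k n)}

theorem val_flip_eq (ε : Side) (x : RatFunc k) : val k ε.flip x = val k ε (sigma k x) :=
  (val_sigma k ε x).symm

theorem isLarge_dual {s : ℕ} (h : ∀ v ∈ Λ, ∀ i, val k ε (v i) ≤ exp (s : ℤ)) :
    IsLarge (dual Λ) := by
  -- One more than s, because the factor t in the form has a simple pole if ε = -.
  refine ⟨s + 1, fun v hv u hu => ?_⟩
  rw [beta_eq]
  have h1 : ∀ i i', val k ε (u i * sigma k (v i')) ≤ exp (-1) := fun i i' => by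
    rw [map_mul, ← val_flip_eq]
    refine (mul_le_mul' (h u hu i) (hv i')).trans (le_of_eq ?_)
    rw [← exp_add]; congr 1; ring
  refine Subring.sum_mem (O k ε) fun i _ => add_mem ?_ ?_
  · exact (h1 _ _).trans (by rw [← exp_zero, exp_le_exp]; omega)
  · rw [mul_assoc, Valuation.mem_integer_iff, map_mul, val_t]
    refine (mul_le_mul' le_rfl (h1 _ _)).trans ?_
    rw [← exp_add, ← exp_zero, exp_le_exp]
    cases ε <;> simp [Side.sign]

theorem exists_bound_dual (h : IsLarge Λ) :
    ∃ s : ℤ, ∀ v ∈ dual Λ, ∀ i, val k ε.flip (v i) ≤ exp s := by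
  obtain ⟨s, hs⟩ := h
  have h1 : ∀ i, t k ^ (ε.sign * s) • (Pi.single i 1 : V k n) ∈ Λ := fun i => hs _ fun l => by
    rw [Pi.smul_apply, smul_eq_mul, map_mul, val_t_zpow, ← mul_assoc, Side.sign_mul_sign, one_mul]
    by_cases hl : l = i
    · subst hl; simp
    · simp [hl]
  have h2 : ∀ v : V k n, ∀ i, beta (Pi.single (.inl i) 1) v = sigma k (v (.inr i)) ∧
      beta (Pi.single (.inr i) 1) v = t k * sigma k (v (.inl i)) := by
    intro v i
    rw [beta_eq, beta_eq, Finset.sum_eq_single i, Finset.sum_eq_single i]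
    · simp
    · intro l _ hl; simp [hl]
    · simp
    · intro l _ hl; simp [hl]
    · simp
  refine ⟨s + 1, fun v hv i => ?_⟩
  rw [val_flip_eq]
  rcases i with i | i
  · have h3 := hv _ (h1 (.inr i))
    rw [beta_smul_left, (h2 v i).2, Valuation.mem_integer_iff, map_mul, map_mul, val_t_zpow,
      ← mul_assoc ε.sign, Side.sign_mul_sign, one_mul, val_t, ← mul_assoc, ← exp_add] at h3
    have h4 := mul_le_mul_right h3 (exp (s + ε.sign))
    rw [← mul_assoc, ← exp_add, show s + ε.sign + (-s + -ε.sign) = 0 by ring, exp_zero, one_mul,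
      mul_one] at h4
    refine h4.trans (exp_le_exp.2 ?_)
    cases ε <;> simp [Side.sign]
  · have h3 := hv _ (h1 (.inl i))
    rw [beta_smul_left, (h2 v i).1, Valuation.mem_integer_iff, map_mul, val_t_zpow,
      ← mul_assoc ε.sign, Side.sign_mul_sign, one_mul] at h3
    have h4 := mul_le_mul_right h3 (exp s)
    rw [← mul_assoc, ← exp_add, show s + -s = 0 by ring, exp_zero, one_mul, mul_one] at h4
    exact h4.trans (exp_le_exp.2 (by omega))

/-- Membership in the dual lattice is decided by one coefficient. -/
theorem mem_trace_dual (h : IsLarge Λ) (x : LaurentVec k n) :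
    x ∈ trace (dual Λ) ↔ ∀ u ∈ trace Λ, (betaL u x).coeff (-ε.sign) = 0 := by
  constructor
  · intro hx u hu
    have h1 := hx _ hu
    rw [← toRat_betaL, toRat_mem_O] at h1
    by_contra h2
    have := h1 _ h2
    rw [mul_neg, Side.sign_mul_sign] at this
    omega
  · intro hx u hu
    rw [h.eq_span] at hu
    refine Submodule.span_induction (p := fun u _ => beta u (incl x) ∈ O k ε) ?_ ?_ ?_ ?_ hu
    · rintro _ ⟨u, hu, rfl⟩
      rw [← toRat_betaL, toRat_mem_O]
      intro l hl
      by_contra hneg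
      -- A shift moves the offending coefficient to the tested exponent; it keeps u in Λ because the
      -- offending exponent has negative valuation.
      have h1 : shiftEquiv k n (-ε.sign - l) u ∈ trace Λ := by
        rw [mem_trace, incl_shiftEquiv]
        refine Λ.smul_mem (⟨_, ?_⟩ : O k ε) hu
        rw [Valuation.mem_integer_iff, val_t_zpow, ← exp_zero, exp_le_exp, mul_sub, mul_neg,
          Side.sign_mul_sign]
        omega
      have h2 := hx _ h1
      rw [shiftEquiv_apply, betaL_smul_left, mul_comm, coeff_mul_T] at h2
      rw [show -ε.sign - (-ε.sign - l) = l by ring] at h2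
      exact hl h2
    · rw [show beta (0 : V k n) (incl x) = 0 from zero_dotProduct _]; exact zero_mem _
    · intro u u' _ _ h1 h2
      rw [beta_add_left]; exact add_mem h1 h2
    · rintro r u _ h1
      rw [Subring.smul_def, beta_smul_left]
      exact mul_mem r.2 h1

end Dual

section Chamber

variable {c : Chain k n ε} (hc : IsChamber c)
include hc

theorem IsChamber.isLarge_theta (l : ℤ) : IsLarge (theta c l) := by
  obtain ⟨s, hs⟩ := (hc.1 (l - n)).exists_bound
  exact isLarge_dual hs

/-- The orthogonal filtration is given by `c^θ`. -/
theorem IsChamber.mem_perp {g l : ℤ} (hg : g = ε.sign * l + n) {x : LaurentVec k n} :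
    x ∈ (twistedForm k n ε).perp (chamberFilt c) g ↔ incl x ∈ theta c l := by
  have h1 : incl x ∈ theta c l ↔ x ∈ trace (dual (c (l - n))) := Iff.rfl
  rw [h1, mem_trace_dual (hc.isLarge _), TwistedForm.mem_perp]
  simp only [twistedForm_b]
  subst hg
  cases ε
  -- For ε = + the form uses the exponent 0 and the dual lattice the exponent -1, so vectors are
  -- shifted by t, in accordance with c (l + n) = t c (l - n). For ε = - the exponents coincide.
  · constructor
    · intro h u hu
      have h2 := h (shiftEquiv k n 1 u) (by
        rw [mem_chamberFilt, incl_shiftEquiv, zpow_one]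
        have := (hc.2.1 _ _).1 hu
        simp only [Side.sign, one_mul]
        rwa [show l - (n : ℤ) + 2 * n = l + n by ring] at this)
      rw [shiftEquiv_apply, betaL_smul_left, mul_comm, coeff_mul_T] at h2
      exact h2
    · intro h u hu
      have h2 := h (shiftEquiv k n (-1) u) (by
        rw [mem_trace, hc.2.1, incl_shiftEquiv, smul_smul]
        rw [mem_chamberFilt] at hu
        simp only [Side.sign, one_mul] at hu
        rw [show l - (n : ℤ) + 2 * n = l + n by ring]
        simpa [t_ne_zero] using hu)
      rw [shiftEquiv_apply, betaL_smul_left, mul_comm, coeff_mul_T] at h2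
      exact h2
  · refine forall_congr' fun u => ?_
    rw [mem_chamberFilt, mem_trace, show Side.minus.sign * (Side.minus.sign * l + n) = l - n by
      simp only [Side.sign]; ring]
    rfl

theorem IsChamber.exists_mem (x : V k n) : ∃ l, x ∈ c (ε.sign * l) := by
  obtain ⟨s, hs⟩ := hc.isLarge 0
  obtain ⟨d, hd⟩ := exists_val_le_of_finite ε x
  refine ⟨-(2 * n * (s + d)), (hc.mem_zpow (ε.sign * (s + d)) _ _).2 ?_⟩
  rw [show ε.sign * -(2 * n * (s + d)) + 2 * n * (ε.sign * (s + d)) = 0 by ring]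
  refine hs _ fun i => ?_
  rw [Pi.smul_apply, smul_eq_mul, map_mul, val_t_zpow, ← mul_assoc, Side.sign_mul_sign, one_mul]
  refine (mul_le_mul' le_rfl (hd i)).trans (le_of_eq ?_)
  rw [← exp_add]; congr 1; ring

theorem IsChamber.exists_mem_theta (x : V k n) : ∃ l, x ∈ theta c l := by
  obtain ⟨s, hs⟩ := hc.isLarge_theta 0
  obtain ⟨d, hd⟩ := exists_val_le_of_finite ε.flip x
  refine ⟨-(2 * n * (ε.flip.sign * (s + d))),
    (mem_zpow_of_period (theta_period hc) (ε.flip.sign * (s + d)) _ _).2 ?_⟩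
  rw [neg_add_cancel]
  refine hs _ fun i => ?_
  rw [Pi.smul_apply, smul_eq_mul, map_mul, val_t_zpow, ← mul_assoc, Side.sign_mul_sign, one_mul]
  refine (mul_le_mul' le_rfl (hd i)).trans (le_of_eq ?_)
  rw [← exp_add]; congr 1; ring

end Chamber

end AffineTwin

namespace AffineTwin

open LaurentPolynomial WithZero

variable {k : Type*} [Field k] {n : ℕ} {ε : Side}

/-! ### The filtration of a chamber is complete -/

/-- The monomial vectors. -/
noncomputable def mono (k : Type*) [Field k] {n : ℕ} (i : Fin n ⊕ Fin n) (m : ℤ) : LaurentVec k n :=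
  Pi.single i (T m)

theorem linearMap_ext_mono {W : Type*} [AddCommGroup W] [Module k W]
    {φ ψ : LaurentVec k n →ₗ[k] W} (h : ∀ i m, φ (mono k i m) = ψ (mono k i m)) : φ = ψ := by
  refine LinearMap.pi_ext fun i f => ?_
  induction f using LaurentPolynomial.induction_on' with
  | add p q hp hq => rw [Pi.single_add, map_add, map_add, hp, hq]
  | C_mul_T z r =>
    have : (Pi.single i (C r * T z) : LaurentVec k n) = r • mono k i z := by
      rw [mono, ← Pi.single_smul, LaurentPolynomial.smul_eq_C_mul]
    rw [this, map_smul, map_smul, h]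

theorem incl_mono (i : Fin n ⊕ Fin n) (m : ℤ) :
    incl (mono k i m) = t k ^ m • (Pi.single i 1 : V k n) := by
  funext l
  rw [incl_apply, mono]
  by_cases hl : l = i
  · subst hl; simp [toRat_T]
  · simp [hl]

theorem IsLarge.exists_mono {Λ : Submodule (O k ε) (V k n)} (h : IsLarge Λ) :
    ∃ s : ℤ, ∀ i m, s ≤ ε.sign * m → incl (mono k i m) ∈ Λ := by
  obtain ⟨s, hs⟩ := h
  refine ⟨s, fun i m hm => hs _ fun l => ?_⟩
  rw [incl_mono, Pi.smul_apply, smul_eq_mul, map_mul, val_t_zpow]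
  by_cases hl : l = i
  · subst hl
    rw [Pi.single_eq_same, map_one, mul_one, exp_le_exp]
    omega
  · simp [hl]

theorem betaL_mono (i : Fin n) (m : ℤ) (y : LaurentVec k n) :
    betaL (mono k (.inl i) m) y = T m * invert (y (.inr i)) ∧
    betaL (mono k (.inr i) m) y = T (m + 1) * invert (y (.inl i)) := by
  rw [betaL, betaL, Finset.sum_eq_single i, Finset.sum_eq_single i]
  · rw [add_comm m, T_add]
    simp only [mono, Pi.single_eq_same, Pi.single_eq_of_ne, ne_eq, reduceCtorEq,
      not_false_eq_true, zero_mul, mul_zero, add_zero, zero_add, and_self]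
  · intro l _ hl; simp [mono, hl]
  · simp
  · intro l _ hl; simp [mono, hl]
  · simp

theorem exists_laurent {g : ℤ → k} (hg : ∃ a b : ℤ, ∀ m, g m ≠ 0 → a ≤ m ∧ m ≤ b) :
    ∃ f : k[T;T⁻¹], ∀ m, f.coeff m = g m := by
  obtain ⟨a, b, h⟩ := hg
  refine ⟨∑ m ∈ Finset.Icc a b, C (g m) * T m, fun m => ?_⟩
  rw [AddMonoidAlgebra.coeff_sum, Finsupp.finsetSum_apply]
  have h1 : ∀ l : ℤ, (C (g l) * T l : k[T;T⁻¹]).coeff m = if m = l then g m else 0 := by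
    intro l
    rw [coeff_mul_T, C_apply]
    by_cases h : m = l
    · subst h; simp
    · rw [if_neg h, if_neg (by omega)]
  simp only [h1]
  rw [Finset.sum_ite_eq]
  split_ifs with h2
  · rfl
  · by_contra h3
    exact h2 (Finset.mem_Icc.2 (h m (Ne.symm h3)))

section Chamber

variable {c : Chain k n ε} (hc : IsChamber c)
include hc

/-- Lattices of different degrees differ, and they are generated by their vectors of Laurent
polynomials. -/
theorem IsChamber.exists_notMem (l : ℤ) :
    ∃ x ∈ chamberFilt c l, x ∉ chamberFilt c (l + 1) := by
  by_contra! hcon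
  have h1 : c (ε.sign * (l + 1)) = c (ε.sign * l) := by
    refine le_antisymm (hc.anti l) ?_
    rw [(hc.isLarge (ε.sign * l)).eq_span, Submodule.span_le]
    rintro _ ⟨x, hx, rfl⟩
    exact hcon x hx
  have h2 := hc.1 (ε.sign * l)
  rw [← h1] at h2
  have := h2.sign_le (hc.1 (ε.sign * (l + 1))) le_rfl
  have := (hc.1 (ε.sign * (l + 1))).sign_le h2 le_rfl
  rw [← mul_assoc, ← mul_assoc, Side.sign_mul_sign] at *
  omega

/-- For a vector deep in the lattices at one place and bounded at the other, no exponent is left for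
the entries. Periodicity makes the depth independent of l. -/
theorem IsChamber.separated [NeZero n] : ∃ D : ℤ, ∀ l, ∀ x ∈ chamberFilt c (l + D),
    x ∈ (twistedForm k n ε).perp (chamberFilt c) l → x = 0 := by
  obtain ⟨s, hs⟩ := (hc.1 0).exists_bound
  obtain ⟨s', hs'⟩ := exists_bound_dual (hc.isLarge (-(ε.sign * n) - n))
  obtain ⟨d, hd⟩ : ∃ d : ℤ, d = s + s' + 1 := ⟨_, rfl⟩
  have hn : (0 : ℤ) < 2 * n := by have := NeZero.pos n; positivity
  -- the case of a fixed index
  have key : ∀ x : LaurentVec k n, incl x ∈ c (ε.sign * (2 * n * d)) →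
      incl x ∈ theta c (-(ε.sign * n)) → x = 0 := by
    intro x hx hx'
    funext i
    refine LaurentPolynomial.ext fun m => ?_
    by_contra hm
    have hm : (x i).coeff m ≠ 0 := hm
    have h1 : val k ε (toRat (x i)) ≤ exp (s - d) := by
      have h2 := (hc.mem_zpow (-(ε.sign * d)) _ _).1 hx
      rw [show ε.sign * (2 * n * d) + 2 * n * -(ε.sign * d) = 0 by ring] at h2
      have h3 := hs _ h2 i
      rw [Pi.smul_apply, smul_eq_mul, map_mul, val_t_zpow, mul_neg, ← mul_assoc,
        Side.sign_mul_sign, one_mul, neg_neg, incl_apply] at h3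
      have h4 := mul_le_mul_right h3 (exp (-d))
      rw [← mul_assoc, ← exp_add, neg_add_cancel, exp_zero, one_mul, ← exp_add] at h4
      rwa [sub_eq_neg_add]
    have h2 : val k ε.flip (toRat (x i)) ≤ exp s' := hs' _ hx' i
    rw [← zpow_mul_mem_O, ← toRat_T, ← map_mul, toRat_mem_O, mul_comm] at h1 h2
    have h3 := h1 (m + ε.sign * (s - d)) (by rw [coeff_mul_T]; simpa using hm)
    have h4 := h2 (m + ε.flip.sign * s') (by rw [coeff_mul_T]; simpa using hm)
    rw [mul_add, ← mul_assoc, Side.sign_mul_sign] at h3 h4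
    rw [Side.sign_flip] at h4
    have h5 : -ε.sign * m = -(ε.sign * m) := by ring
    rw [h5] at h4
    omega
  refine ⟨2 * n * (d + 1), fun l x hx hx' => ?_⟩
  obtain ⟨z, hz⟩ : ∃ z, z = l / (2 * n) := ⟨_, rfl⟩
  have hz1 : 2 * n * z ≤ l := by rw [hz]; exact Int.mul_ediv_self_le hn.ne'
  have hz2 : l < 2 * n * z + 2 * n := by rw [hz]; exact Int.lt_mul_ediv_self_add hn
  have hx1 : incl x ∈ c (ε.sign * (2 * n * (z + 1 + d))) := by
    refine hc.antitone (show 2 * (n : ℤ) * (z + 1 + d) ≤ l + 2 * n * (d + 1) by linarith) hx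
  have hx2 : incl x ∈ theta c (ε.sign * (2 * n * (z + 1)) + -(ε.sign * n)) := by
    rw [← hc.mem_perp (g := 2 * n * (z + 1))]
    · intro u hu
      exact hx' u (hc.antitone (show l ≤ 2 * n * (z + 1) by linarith) hu)
    · linear_combination (-(2 * n * (z + 1) - n : ℤ)) * ε.sign_mul_sign
  have h0 : shiftEquiv k n (-(ε.sign * (z + 1))) x = 0 := by
    refine key _ ?_ ?_
    · rw [incl_shiftEquiv]
      have := (hc.mem_zpow (-(ε.sign * (z + 1))) _ _).1 hx1
      rwa [show ε.sign * (2 * n * (z + 1 + d)) + 2 * n * -(ε.sign * (z + 1)) =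
        ε.sign * (2 * n * d) by ring] at this
    · rw [incl_shiftEquiv]
      have := (mem_zpow_of_period (theta_period hc) (-(ε.sign * (z + 1))) _ _).1 hx2
      rwa [show ε.sign * (2 * n * (z + 1)) + -(ε.sign * n) + 2 * n * -(ε.sign * (z + 1)) =
        -(ε.sign * n) by ring] at this
  simpa using h0

/-- Monomials of high order at either place lie in F f or in the orthogonal space of F g, so φ is
nonzero on finitely many of them. Its values on monomials can thus serve as coefficients of y. -/
theorem IsChamber.represent (φ : LaurentVec k n →ₗ[k] k) (f g : ℤ)
    (hf : ∀ x ∈ chamberFilt c f, φ x = 0)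
    (hg : ∀ x ∈ (twistedForm k n ε).perp (chamberFilt c) g, φ x = 0) :
    ∃ y, ∀ x, φ x = (twistedForm k n ε).b x y := by
  obtain ⟨s, hs⟩ := (hc.isLarge (ε.sign * f)).exists_mono
  obtain ⟨s', hs'⟩ := (hc.isLarge_theta (ε.sign * (g - n))).exists_mono
  have hfin : ∀ i, ∃ a b : ℤ, ∀ m, φ (mono k i m) ≠ 0 → a ≤ m ∧ m ≤ b := by
    intro i
    have h1 : ∀ m, φ (mono k i m) ≠ 0 → ε.sign * m < s ∧ ε.flip.sign * m < s' := by
      intro m hm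
      constructor
      · by_contra h1
        exact hm (hf _ (hs i m (not_lt.1 h1)))
      · by_contra h1
        refine hm (hg _ ((hc.mem_perp (l := ε.sign * (g - n)) ?_).2 (hs' i m (not_lt.1 h1))))
        rw [← mul_assoc, Side.sign_mul_sign]; ring
    refine ⟨-(|s| + |s'|), |s| + |s'|, fun m hm => ?_⟩
    have := h1 m hm
    have h2 := le_abs_self s
    have h3 := le_abs_self s'
    have h4 := abs_nonneg s
    have h5 := abs_nonneg s'
    cases ε <;> simp only [Side.sign, Side.flip] at this <;> omega
  have hshift : ∀ i (d : ℤ), ∃ p : k[T;T⁻¹], ∀ m, p.coeff m = φ (mono k i (m + d)) := by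
    intro i d
    obtain ⟨a, b, hab⟩ := hfin i
    exact exists_laurent ⟨a - d, b - d, fun m hm => by have := hab _ hm; omega⟩
  choose y hy using fun i => hshift i
  obtain ⟨y0, hy0⟩ : ∃ y0 : LaurentVec k n, y0 =
    Sum.elim (fun i => y (.inr i) (ε.exponent - 1)) (fun i => y (.inl i) ε.exponent) := ⟨_, rfl⟩
  refine ⟨y0, fun x => ?_⟩
  have h1 : φ = (twistedForm k n ε).b.flip y0 := by
    refine linearMap_ext_mono fun i m => ?_
    rw [LinearMap.flip_apply, twistedForm_b]
    rcases i with i | i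
    · rw [(betaL_mono i m y0).1, mul_comm, coeff_mul_T, invert_apply, hy0, Sum.elim_inr, hy]
      congr 2; ring
    · rw [(betaL_mono i m y0).2, mul_comm, coeff_mul_T, invert_apply, hy0, Sum.elim_inl, hy]
      congr 2; ring
  exact DFunLike.congr_fun h1 x

theorem IsChamber.filt [NeZero n] : (twistedForm k n ε).Filt n (chamberFilt c) where
  anti l x hx := hc.anti l hx
  per l x := by
    rw [mem_chamberFilt, mem_chamberFilt, twistedForm_T, incl_shiftEquiv, hc.mem_zpow ε.sign]
    rw [show ε.sign * (l + 2 * n) = ε.sign * l + 2 * n * ε.sign by ring]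
  ne := hc.exists_notMem
  codim l x hx hx' y hy := by
    obtain ⟨r, hr⟩ := (hc.1 (ε.sign * l)).step (hc.1 (ε.sign * (l + 1))) (hc.anti l)
      (by rw [← mul_assoc, ← mul_assoc, Side.sign_mul_sign]; ring) hx hx' hy
    refine ⟨r, ?_⟩
    rw [mem_chamberFilt, map_sub, map_smul, ← algebraMap_smul (RatFunc k) r (incl x)]
    exact hr
  exhaust x := hc.exists_mem (incl x)
  exhaust_perp x := by
    obtain ⟨l, hl⟩ := hc.exists_mem_theta (incl x)
    exact ⟨_, (hc.mem_perp rfl).2 hl⟩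
  separated := hc.separated
  represent := hc.represent

end Chamber

end AffineTwin

namespace AffineTwin

open LaurentPolynomial WithZero

variable {k : Type*} [Field k] {n : ℕ} {ε : Side}

/-! ### Frames over the Laurent polynomials -/

/-- The bases over `k[t, t⁻¹]` of the vectors of Laurent polynomials, extended to all integers. -/
structure IsLaurentFrame (a : ℤ → LaurentVec k n) : Prop where
  period : ∀ m, a (m + 2 * n) = (T 1 : k[T;T⁻¹]) • a m
  linearIndependent : LinearIndependent k a
  span : Submodule.span k (Set.range a) = ⊤

theorem period_zpow {a : ℤ → LaurentVec k n}
    (h : ∀ m, a (m + 2 * n) = (T 1 : k[T;T⁻¹]) • a m) (m z : ℤ) :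
    a (m + 2 * n * z) = (T z : k[T;T⁻¹]) • a m := by
  induction z using Int.induction_on with
  | zero => simp
  | succ z ih =>
    rw [show m + 2 * n * ((z : ℤ) + 1) = m + 2 * n * z + 2 * n by ring, h, ih, smul_smul, ← T_add,
      add_comm]
  | pred z ih =>
    have h1 := h (m + 2 * n * (-(z : ℤ) - 1))
    rw [show m + 2 * n * (-(z : ℤ) - 1) + 2 * n = m + 2 * n * (-z) by ring, ih] at h1
    have h2 := congrArg (fun x => (T (-1) : k[T;T⁻¹]) • x) h1
    simp only [smul_smul, ← T_add] at h2
    rw [neg_add_cancel, T_zero, one_smul] at h2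
    rw [← h2]
    congr 2; ring

theorem linearIndependent_T : LinearIndependent k (fun z : ℤ => (T z : k[T;T⁻¹])) := by
  rw [linearIndependent_iff']
  intro s g hg i hi
  have h1 := congrArg (fun f : k[T;T⁻¹] => f.coeff i) hg
  have h2 : ∀ z : ℤ, (g z • T z : k[T;T⁻¹]).coeff i = if i = z then g i else 0 := fun z => by
    rw [LaurentPolynomial.smul_eq_C_mul, coeff_mul_T, C_apply]
    by_cases h : i = z
    · subst h; simp
    · rw [if_neg h, if_neg (by omega)]
  simp only [AddMonoidAlgebra.coeff_sum, Finsupp.finsetSum_apply, h2] at h1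
  rw [Finset.sum_ite_eq, if_pos hi] at h1
  exact h1

theorem span_T : Submodule.span k (Set.range fun z : ℤ => (T z : k[T;T⁻¹])) = ⊤ := by
  rw [eq_top_iff]
  rintro f -
  induction f using LaurentPolynomial.induction_on' with
  | add p q hp hq => exact add_mem hp hq
  | C_mul_T z r =>
    rw [← LaurentPolynomial.smul_eq_C_mul]
    exact Submodule.smul_mem _ _ (Submodule.subset_span ⟨z, rfl⟩)

section Window

variable [NeZero n] {a : ℤ → LaurentVec k n}

theorem eq_smul_window (h : ∀ m, a (m + 2 * n) = (T 1 : k[T;T⁻¹]) • a m) :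
    a = (fun p : ℤ × Fin (2 * n) => (T p.1 : k[T;T⁻¹]) • a p.2) ∘ Int.divModEquiv (2 * n) := by
  funext m
  rw [Function.comp_apply, ← period_zpow h]
  congr 1
  have h1 := (Int.divModEquiv (2 * n)).symm_apply_apply m
  rw [Int.divModEquiv_symm_apply] at h1
  push_cast at h1
  linarith

/-- The products of the powers T ^ z with a basis over k[T;T⁻¹] form a basis over k; division with
remainder by 2n enumerates them by ℤ. -/
theorem isLaurentFrame_of_window (h : ∀ m, a (m + 2 * n) = (T 1 : k[T;T⁻¹]) • a m)
    (hli : LinearIndependent k[T;T⁻¹] fun i : Fin (2 * n) => a i)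
    (hspan : Submodule.span k[T;T⁻¹] (Set.range fun i : Fin (2 * n) => a i) = ⊤) :
    IsLaurentFrame a := by
  refine ⟨h, ?_, ?_⟩
  · rw [eq_smul_window h]
    have h1 := linearIndependent_smul (linearIndependent_T (k := k)) hli
    exact h1.comp _ (Int.divModEquiv (2 * n)).injective
  · rw [eq_smul_window h, (Int.divModEquiv (2 * n)).surjective.range_comp]
    have h1 := Submodule.span_smul_of_span_eq_top (R := k) (A := LaurentVec k n) span_T
      (Set.range fun i : Fin (2 * n) => a i)
    rw [hspan, Submodule.restrictScalars_top] at h1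
    rw [← h1]
    congr 1
    ext x
    simp only [Set.mem_range, Set.mem_smul, Prod.exists, exists_exists_eq_and]

omit [NeZero n] in
theorem IsLaurentFrame.shift (ha : IsLaurentFrame a) (l : ℤ) :
    IsLaurentFrame fun m => a (l + m) := by
  refine ⟨fun m => by rw [← ha.period, add_assoc], ?_, ?_⟩
  · exact ha.linearIndependent.comp _ (add_right_injective l)
  · rw [← ha.span]
    exact congrArg _ ((Equiv.addLeft l).surjective.range_comp a)

theorem IsLaurentFrame.span_window (ha : IsLaurentFrame a) :
    Submodule.span k[T;T⁻¹] (Set.range fun i : Fin (2 * n) => a i) = ⊤ := by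
  rw [eq_top_iff]
  rintro x -
  have hx : x ∈ Submodule.span k (Set.range a) := ha.span ▸ Submodule.mem_top
  refine Submodule.span_induction (p := fun x _ => x ∈ Submodule.span k[T;T⁻¹]
    (Set.range fun i : Fin (2 * n) => a i)) ?_ (zero_mem _) (fun _ _ _ _ => add_mem) ?_ hx
  · rintro _ ⟨m, rfl⟩
    rw [congrFun (eq_smul_window ha.period) m]
    exact Submodule.smul_mem _ _ (Submodule.subset_span ⟨_, rfl⟩)
  · intro r x _ h
    rw [← algebraMap_smul k[T;T⁻¹] r x]
    exact Submodule.smul_mem _ _ h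

theorem IsLaurentFrame.exists_sum_window (ha : IsLaurentFrame a) (x : LaurentVec k n) :
    ∃ f : Fin (2 * n) → k[T;T⁻¹], ∑ i, f i • a i = x :=
  (Submodule.mem_span_range_iff_exists_fun _).1 (ha.span_window ▸ Submodule.mem_top)

/-- The vectors span V over k(t), and their number is its dimension. -/
theorem IsLaurentFrame.linearIndependent_window (ha : IsLaurentFrame a) :
    LinearIndependent (RatFunc k) fun i : Fin (2 * n) => incl (a i) := by
  refine linearIndependent_of_top_le_span_of_card_eq_finrank ?_ (by simp; ring)
  rintro v -
  have h1 : ∀ i, (Pi.single i 1 : V k n) ∈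
      Submodule.span (RatFunc k) (Set.range fun i : Fin (2 * n) => incl (a i)) := by
    intro i
    obtain ⟨f, hf⟩ := ha.exists_sum_window (mono k i 0)
    have h2 := incl_mono (k := k) i 0
    rw [zpow_zero, one_smul] at h2
    rw [← h2, ← hf, map_sum]
    refine sum_mem fun r _ => ?_
    rw [incl_smul]
    exact Submodule.smul_mem _ _ (Submodule.subset_span ⟨r, rfl⟩)
  rw [pi_eq_sum_univ' v]
  refine sum_mem fun i _ => ?_
  exact Submodule.smul_mem _ _ (h1 i)

/-- This turns bases of M over k[t, t⁻¹] into bases over k indexed by ℤ, the form in which frames of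
filtrations arise. -/
theorem isFrame_iff {b : ℤ → V k n} :
    IsFrame b ↔ ∃ a : ℤ → LaurentVec k n, IsLaurentFrame a ∧ b = fun m => incl (a m) := by
  constructor
  · rintro ⟨h1, h2, h3⟩
    have h4 : ∀ m, ∃ x : LaurentVec k n, incl x = b m := by
      have h5 : ∀ m z : ℤ, (∃ x : LaurentVec k n, incl x = b m) →
          ∃ x : LaurentVec k n, incl x = b (m + 2 * n * z) := by
        intro m z h
        induction z using Int.induction_on with
        | zero => simpa using h
        | succ z ih =>
          obtain ⟨x, hx⟩ := ih
          refine ⟨shiftEquiv k n 1 x, ?_⟩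
          rw [incl_shiftEquiv, zpow_one, hx, ← h1]
          congr 1; ring
        | pred z ih =>
          obtain ⟨x, hx⟩ := ih
          refine ⟨shiftEquiv k n (-1) x, ?_⟩
          rw [incl_shiftEquiv, hx, zpow_neg_one, inv_smul_eq_iff₀ t_ne_zero, ← h1]
          congr 1; ring
      intro m
      have h6 := (Int.divModEquiv (2 * n)).symm_apply_apply m
      rw [Int.divModEquiv_symm_apply] at h6
      have h7 : b ((Int.divModEquiv (2 * n) m).2 : ℕ) ∈ M k n := by
        rw [← h3]
        exact Submodule.subset_span ⟨(Int.divModEquiv (2 * n) m).2, rfl⟩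
      push_cast at h6
      rw [show m = _ from (by linarith :
        m = ((Int.divModEquiv (2 * n) m).2 : ℕ) + 2 * n * (Int.divModEquiv (2 * n) m).1)]
      exact h5 _ _ (mem_M.1 h7)
    choose a ha using h4
    refine ⟨a, isLaurentFrame_of_window ?_ ?_ ?_, funext fun m => (ha m).symm⟩
    · intro m
      apply incl_injective
      rw [incl_smul, ha, ha, h1, toRat_T, zpow_one]
    · rw [Fintype.linearIndependent_iff] at h2 ⊢
      intro g hg i
      have h5 := h2 (fun i => ⟨toRat (g i), toRat_mem_laurent _⟩) (by
        rw [← map_zero (incl (k := k) (n := n)), ← hg, map_sum]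
        refine Finset.sum_congr rfl fun i _ => ?_
        rw [incl_smul, ha]; rfl) i
      exact toRat_injective ((Subtype.ext_iff.1 h5).trans (map_zero _).symm)
    · rw [eq_top_iff]
      rintro x -
      have h5 : incl x ∈ Submodule.span (Laurent k) (Set.range fun i : Fin (2 * n) => b i) :=
        h3 ▸ mem_M.2 ⟨x, rfl⟩
      obtain ⟨c, hc⟩ := (Submodule.mem_span_range_iff_exists_fun _).1 h5
      choose f hf using fun i => exists_toRat (c i).2
      have h6 : x = ∑ i, f i • a i := by
        apply incl_injective
        rw [← hc, map_sum]
        refine Finset.sum_congr rfl fun i _ => ?_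
        rw [incl_smul, ha, hf]; rfl
      rw [h6]
      exact sum_mem fun i _ => Submodule.smul_mem _ _ (Submodule.subset_span ⟨i, rfl⟩)
  · rintro ⟨a, ha, rfl⟩
    refine ⟨fun m => ?_, ?_, ?_⟩
    · simp only
      rw [ha.period, incl_smul, toRat_T, zpow_one]
    · exact ha.linearIndependent_window.restrict_scalars (R := Laurent k) (by
        intro x y hxy
        simpa [Subalgebra.smul_def] using hxy)
    · refine le_antisymm (Submodule.span_le.2 ?_) ?_
      · rintro _ ⟨i, rfl⟩
        exact mem_M.2 ⟨_, rfl⟩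
      · intro v hv
        obtain ⟨x, rfl⟩ := mem_M.1 hv
        obtain ⟨f, rfl⟩ := ha.exists_sum_window x
        rw [map_sum]
        refine sum_mem fun i _ => ?_
        rw [incl_smul]
        exact Submodule.smul_mem _ (⟨toRat (f i), toRat_mem_laurent _⟩ : Laurent k)
          (Submodule.subset_span ⟨i, rfl⟩)

end Window

end AffineTwin

namespace AffineTwin

open LaurentPolynomial WithZero

variable {k : Type*} [Field k] {n : ℕ} {ε : Side}

/-! ### The chambers of a frame -/

/-- The indices of the vectors of a frame that belong to the lattice of degree `l`. -/
def Side.indices (n : ℕ) (l : ℤ) : Side → Set ℤ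
  | .plus => {m | l ≤ m}
  | .minus => {m | m < l + 2 * n}

theorem Side.add_mem_indices {l m z : ℤ} (hm : m ∈ Set.Ico l (l + 2 * n)) (hn : 0 < n) :
    m + 2 * n * z ∈ ε.indices n l ↔ 0 ≤ ε.sign * z := by
  obtain ⟨h1, h2⟩ := hm
  have hn' : (0 : ℤ) < 2 * n := by positivity
  cases ε
  · simp only [indices, sign, one_mul, Set.mem_ofPred_eq]
    constructor
    · intro h
      by_contra! h0
      have : 2 * (n : ℤ) * z ≤ 2 * n * (-1) := mul_le_mul_of_nonneg_left (by omega) hn'.le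
      linarith
    · intro h
      have := mul_nonneg hn'.le h
      linarith
  · simp only [indices, sign, Set.mem_ofPred_eq]
    constructor
    · intro h
      by_contra! h0
      have : 2 * (n : ℤ) * 1 ≤ 2 * n * z := mul_le_mul_of_nonneg_left (by omega) hn'.le
      linarith
    · intro h
      have := mul_nonneg hn'.le h
      linarith

theorem exists_add_mul (hn : 0 < n) (l q : ℤ) : ∃ m z : ℤ, m ∈ Set.Ico l (l + 2 * n) ∧ q = m + 2 * n * z := by
  have hn' : (0 : ℤ) < 2 * n := by positivity
  refine ⟨l + (q - l) % (2 * n), (q - l) / (2 * n), ⟨?_, ?_⟩, ?_⟩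
  · linarith [Int.emod_nonneg (q - l) hn'.ne']
  · linarith [Int.emod_lt_of_pos (q - l) hn']
  · linarith [Int.emod_add_mul_ediv (q - l) (2 * n)]

theorem range_window {α : Type*} (n : ℕ) (b : ℤ → α) (l : ℤ) :
    Set.range (fun i : Fin (2 * n) => b (l + i)) = b '' Set.Ico l (l + 2 * n) := by
  ext v
  constructor
  · rintro ⟨i, rfl⟩
    exact ⟨_, ⟨by linarith, by have := i.2; omega⟩, rfl⟩
  · rintro ⟨m, ⟨h1, h2⟩, rfl⟩
    exact ⟨⟨(m - l).toNat, by omega⟩, by simp only; congr 1; omega⟩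

theorem eq_sum_T (f : k[T;T⁻¹]) :
    f = ∑ z ∈ f.coeff.support, f.coeff z • (T z : k[T;T⁻¹]) := by
  ext l
  simp only [AddMonoidAlgebra.coeff_sum, Finsupp.finsetSum_apply]
  have h1 : ∀ z : ℤ, (f.coeff z • (T z : k[T;T⁻¹])).coeff l = if l = z then f.coeff l else 0 := by
    intro z
    rw [LaurentPolynomial.smul_eq_C_mul, coeff_mul_T, C_apply]
    by_cases h : l = z
    · subst h; simp
    · rw [if_neg h, if_neg (by omega)]
  simp only [h1]
  rw [Finset.sum_ite_eq]
  split_ifs with h2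
  · rfl
  · exact Finsupp.notMem_support_iff.1 h2

section Trace

variable [NeZero n] {a : ℤ → LaurentVec k n} (ha : IsLaurentFrame a)
include ha

/-- The vectors of Laurent polynomials in the lattices of a frame chamber. -/
theorem IsLaurentFrame.trace_frameChamber (ε : Side) (l : ℤ) :
    trace (frameChamber ε (fun m => incl (a m)) l) = Submodule.span k (a '' ε.indices n l) := by
  apply le_antisymm
  · intro x hx
    rw [mem_trace, frameChamber, ← range_window] at hx
    obtain ⟨g, hg⟩ := (Submodule.mem_span_range_iff_exists_fun _).1 hx
    obtain ⟨f, rfl⟩ := (ha.shift l).exists_sum_window x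
    have h1 := (ha.shift l).linearIndependent_window
    rw [Fintype.linearIndependent_iff] at h1
    have h2 := h1 (fun i => (g i : RatFunc k) - toRat (f i)) (by
      simp only [sub_smul, Finset.sum_sub_distrib]
      rw [sub_eq_zero]
      rw [map_sum] at hg
      simp only [incl_smul] at hg
      exact hg)
    refine sum_mem fun i _ => ?_
    have h3 : toRat (f i) ∈ O k ε := by
      rw [← sub_eq_zero.1 (h2 i)]; exact (g i).2
    rw [toRat_mem_O] at h3
    have h4 : f i = ∑ z ∈ (f i).coeff.support, (f i).coeff z • (T z : k[T;T⁻¹]) :=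
      eq_sum_T _
    rw [h4, Finset.sum_smul]
    refine sum_mem fun z hz => ?_
    rw [smul_assoc, ← period_zpow ha.period]
    refine Submodule.smul_mem _ _ (Submodule.subset_span ⟨_, ?_, rfl⟩)
    rw [Side.add_mem_indices ⟨by linarith, by have := i.2; omega⟩ (NeZero.pos n)]
    exact h3 z (Finsupp.mem_support_iff.1 hz)
  · rw [Submodule.span_le]
    rintro _ ⟨q, hq, rfl⟩
    obtain ⟨m, z, hm, rfl⟩ := exists_add_mul (NeZero.pos n) l q
    rw [Side.add_mem_indices hm (NeZero.pos n)] at hq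
    rw [SetLike.mem_coe, mem_trace, period_zpow ha.period, incl_smul, toRat_T]
    refine Submodule.smul_mem _ (⟨t k ^ z, ?_⟩ : O k ε) (Submodule.subset_span ⟨m, hm, rfl⟩)
    rw [Valuation.mem_integer_iff, val_t_zpow, ← exp_zero, exp_le_exp]
    omega

theorem IsLaurentFrame.mem_frameChamber (ε : Side) {l q : ℤ} :
    incl (a q) ∈ frameChamber ε (fun m => incl (a m)) l ↔ q ∈ ε.indices n l := by
  rw [← mem_trace, ha.trace_frameChamber]
  constructor
  · intro h
    by_contra hq
    exact ha.linearIndependent.notMem_span_image hq h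
  · intro h
    exact Submodule.subset_span ⟨q, h, rfl⟩

omit [NeZero n] ha in
theorem frameChamber_eq_span (a : ℤ → LaurentVec k n) (ε : Side) (l : ℤ) :
    frameChamber ε (fun m => incl (a m)) l = Submodule.span (O k ε)
      (incl '' (trace (frameChamber ε (fun m => incl (a m)) l) : Set (LaurentVec k n))) := by
  apply le_antisymm
  · refine Submodule.span_le.2 ?_
    rintro _ ⟨m, hm, rfl⟩
    refine Submodule.subset_span ⟨a m, ?_, rfl⟩
    rw [SetLike.mem_coe, mem_trace]
    exact Submodule.subset_span ⟨m, hm, rfl⟩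
  · refine Submodule.span_le.2 ?_
    rintro _ ⟨x, hx, rfl⟩
    exact hx

end Trace

/-! ### Degrees of the lattices of a frame -/

section Degree

variable {b : ℤ → V k n}

theorem frameChamber_period (hb : ∀ m, b (m + 2 * n) = t k • b m) (l : ℤ) (v : V k n) :
    v ∈ frameChamber ε b l ↔ t k • v ∈ frameChamber ε b (l + 2 * n) := by
  have h1 : b '' Set.Ico (l + 2 * n) (l + 2 * n + 2 * n) =
      (fun v => t k • v) '' (b '' Set.Ico l (l + 2 * n)) := by
    have h2 : Set.Ico (l + 2 * (n : ℤ)) (l + 2 * n + 2 * n) =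
        (fun m => m + 2 * (n : ℤ)) '' Set.Ico l (l + 2 * n) := by
      rw [Set.image_add_const_Ico]
    rw [h2, Set.image_image, Set.image_image]
    simp only [hb]
  have h3 : frameChamber ε b (l + 2 * n) =
      (frameChamber ε b l).map (DistribSMul.toLinearMap (O k ε) (V k n) (t k)) := by
    rw [frameChamber, frameChamber, h1, Submodule.map_span]; rfl
  rw [h3, Submodule.mem_map]
  constructor
  · intro h; exact ⟨v, h, rfl⟩
  · rintro ⟨w, hw, h⟩
    rwa [← smul_right_injective (V k n) (t_ne_zero (k := k)) h]

theorem frameChamber_plus_anti (hb : ∀ m, b (m + 2 * n) = t k • b m) (l : ℤ) :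
    frameChamber (n := n) .plus b (l + 1) ≤ frameChamber .plus b l := by
  refine Submodule.span_le.2 ?_
  rintro _ ⟨m, ⟨h1, h2⟩, rfl⟩
  by_cases hm : m < l + 2 * n
  · exact Submodule.subset_span ⟨m, ⟨by omega, hm⟩, rfl⟩
  · have hm' : m = l + 2 * n := by omega
    subst hm'
    rw [hb]
    refine Submodule.smul_mem _ (⟨t k, ?_⟩ : O k .plus) (Submodule.subset_span ⟨l, ⟨le_rfl, by omega⟩, rfl⟩)
    rw [Valuation.mem_integer_iff, val_t, ← exp_zero, exp_le_exp]
    simp [Side.sign]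

theorem frameChamber_minus_mono (hb : ∀ m, b (m + 2 * n) = t k • b m) (l : ℤ) :
    frameChamber (n := n) .minus b l ≤ frameChamber .minus b (l + 1) := by
  refine Submodule.span_le.2 ?_
  rintro _ ⟨m, ⟨h1, h2⟩, rfl⟩
  by_cases hm : l + 1 ≤ m
  · exact Submodule.subset_span ⟨m, ⟨hm, by omega⟩, rfl⟩
  · have hm' : m = l := by omega
    subst hm'
    rw [show b m = (t k)⁻¹ • b (m + 2 * n) by rw [hb, inv_smul_smul₀ t_ne_zero]]
    refine Submodule.smul_mem _ (⟨(t k)⁻¹, ?_⟩ : O k .minus)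
      (Submodule.subset_span ⟨_, ⟨by omega, by omega⟩, rfl⟩)
    rw [Valuation.mem_integer_iff, map_inv₀, val_t, ← exp_neg, ← exp_zero, exp_le_exp]
    simp [Side.sign]

variable (n) in
/-- An enumeration of the coordinates. -/
def coordEquiv : Fin n ⊕ Fin n ≃ Fin (2 * n) := finSumFinEquiv.trans (finCongr (two_mul n).symm)

variable (b) in
/-- The basis of the lattice of degree `l`, arranged such that a single vector changes in each step. -/
def windowBasis (l : ℤ) (i : Fin n ⊕ Fin n) : V k n := b (l + ((coordEquiv n i : ℕ) - l) % (2 * n))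

theorem range_windowBasis [NeZero n] (b : ℤ → V k n) (l : ℤ) :
    Set.range (windowBasis b l) = b '' Set.Ico l (l + 2 * n) := by
  have hn' : (0 : ℤ) < 2 * n := by have := NeZero.pos n; positivity
  ext v
  constructor
  · rintro ⟨i, rfl⟩
    exact ⟨_, ⟨by linarith [Int.emod_nonneg ((coordEquiv n i : ℕ) - l) hn'.ne'],
      by linarith [Int.emod_lt_of_pos ((coordEquiv n i : ℕ) - l) hn']⟩, rfl⟩
  · rintro ⟨m, ⟨h1, h2⟩, rfl⟩
    have h3 := Int.emod_nonneg m hn'.ne'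
    have h4 := Int.emod_lt_of_pos m hn'
    refine ⟨(coordEquiv n).symm ⟨(m % (2 * n)).toNat, by omega⟩, ?_⟩
    rw [windowBasis, Equiv.apply_symm_apply]
    simp only [Int.toNat_of_nonneg h3]
    rw [← Int.sub_emod_emod, Int.emod_sub_emod, Int.sub_emod_emod, Int.emod_eq_of_lt (by linarith) (by linarith)]
    congr 1; ring

/-- From l to l + 1 only b l is replaced, by b (l + 2n) = t b l; the arrangement by residues keeps
all other vectors in their rows. -/
theorem det_windowBasis_succ [NeZero n] (hb : ∀ m, b (m + 2 * n) = t k • b m) (l : ℤ) :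
    (Matrix.of (windowBasis b (l + 1))).det = t k * (Matrix.of (windowBasis b l)).det := by
  have hn' : (0 : ℤ) < 2 * n := by have := NeZero.pos n; positivity
  have h3 := Int.emod_nonneg l hn'.ne'
  have h4 := Int.emod_lt_of_pos l hn'
  obtain ⟨r, hr⟩ : ∃ r, coordEquiv n r = ⟨(l % (2 * n)).toNat, by omega⟩ := (coordEquiv n).surjective _
  have h1 : ∀ i, windowBasis b (l + 1) i =
      Function.update (windowBasis b l) r (t k • windowBasis b l r) i := by
    intro i
    have h5 := Int.emod_nonneg ((coordEquiv n i : ℕ) - l : ℤ) hn'.ne'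
    have h6 := Int.emod_lt_of_pos ((coordEquiv n i : ℕ) - l : ℤ) hn'
    have h7 := Int.emod_add_mul_ediv ((coordEquiv n i : ℕ) - l : ℤ) (2 * n)
    have h8 : ((coordEquiv n r : ℕ) - l : ℤ) % (2 * n) = 0 := by
      rw [hr]
      simp [Int.toNat_of_nonneg h3]
    by_cases hi : i = r
    · subst hi
      rw [Function.update_self, windowBasis, windowBasis, ← hb, h8]
      congr 1
      rw [show ((coordEquiv n i : ℕ) - (l + 1) : ℤ) = ((coordEquiv n i : ℕ) - l : ℤ) - 1 by ring,
        ← Int.emod_sub_emod, h8]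
      rw [show (0 - 1 : ℤ) = (2 * n - 1) + 2 * n * (-1) by ring, Int.add_mul_emod_self_left,
        Int.emod_eq_of_lt (by linarith) (by linarith)]
      ring
    · rw [Function.update_of_ne hi, windowBasis, windowBasis]
      congr 1
      have h9 : ((coordEquiv n i : ℕ) - l : ℤ) % (2 * n) ≠ 0 := by
        intro h0
        apply hi
        apply (coordEquiv n).injective
        rw [hr]
        ext
        simp only
        have e2 : ((coordEquiv n i : ℕ) : ℤ) % (2 * n) = l % (2 * n) :=
          Int.emod_eq_emod_iff_emod_sub_eq_zero.2 h0
        rw [Int.emod_eq_of_lt (by omega) (by have := (coordEquiv n i).2; omega)] at e2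
        omega
      rw [show ((coordEquiv n i : ℕ) - (l + 1) : ℤ) = ((coordEquiv n i : ℕ) - l : ℤ) - 1 by ring,
        ← Int.emod_sub_emod, Int.emod_eq_of_lt (a := _ - 1) (by omega) (by omega)]
      ring
  rw [show windowBasis b (l + 1) = _ from funext h1]
  exact (Matrix.det_updateRow_smul (Matrix.of (windowBasis b l)) r _ _).trans
    (congrArg (fun M : Fin n ⊕ Fin n → V k n => t k * (Matrix.of M).det)
      (Function.update_eq_self r (windowBasis b l)))

/-- Each step multiplies the determinant by t, so the right degree at one index propagates. Hence
one lattice in common with a chamber suffices in `TwistedForm.Frame.exists_chamber`. -/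
theorem hasDegree_frameChamber [NeZero n] (hb : ∀ m, b (m + 2 * n) = t k • b m) {l₀ : ℤ}
    (h : HasDegree ε (frameChamber ε b l₀) l₀) (l : ℤ) : HasDegree ε (frameChamber ε b l) l := by
  refine ⟨windowBasis b l, ?_, ?_⟩
  · rw [range_windowBasis]; rfl
  · have h0 : val k ε (Matrix.of (windowBasis b l₀)).det = val k ε (t k ^ l₀) := by
      obtain ⟨b', h1, h2⟩ := h
      rw [frameChamber, ← range_windowBasis] at h1
      rw [← h2]
      refine le_antisymm (val_det_le fun i => ?_) (val_det_le fun i => ?_)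
      · rw [← h1]; exact Submodule.subset_span ⟨i, rfl⟩
      · rw [h1]; exact Submodule.subset_span ⟨i, rfl⟩
    have h1 : ∀ l, val k ε (Matrix.of (windowBasis b l)).det = val k ε (t k ^ l) ↔
        val k ε (Matrix.of (windowBasis b (l + 1))).det = val k ε (t k ^ (l + 1)) := by
      intro l
      rw [det_windowBasis_succ hb, zpow_add_one₀ t_ne_zero, mul_comm, map_mul, map_mul]
      exact (mul_left_inj' ((Valuation.ne_zero_iff _).2 t_ne_zero)).symm
    have h2 : ∀ z : ℤ, val k ε (Matrix.of (windowBasis b (l₀ + z))).det = val k ε (t k ^ (l₀ + z)) := by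
      intro z
      induction z using Int.induction_on with
      | zero => simpa using h0
      | succ z ih => rw [← add_assoc]; exact (h1 _).1 ih
      | pred z ih =>
        refine (h1 _).2 ?_
        rwa [show l₀ + (-(z : ℤ) - 1) + 1 = l₀ + -z by ring]
    have := h2 (l - l₀)
    rwa [add_sub_cancel] at this

theorem isChamber_frameChamber [NeZero n] (hb : ∀ m, b (m + 2 * n) = t k • b m) {l₀ : ℤ}
    (h : HasDegree ε (frameChamber ε b l₀) l₀) : IsChamber (frameChamber ε b) := by
  refine ⟨hasDegree_frameChamber hb h, frameChamber_period hb, ?_⟩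
  cases ε
  · exact frameChamber_plus_anti hb
  · exact frameChamber_minus_mono hb

end Degree

end AffineTwin

namespace AffineTwin

open LaurentPolynomial WithZero

variable {k : Type*} [Field k] {n : ℕ} {ε : Side}

/-! ### Frames of filtrations and frames of lattices -/

/-- The index set of a frame is traversed in opposite directions for the two halves. -/
def Side.index (n : ℕ) : Side → ℤ → ℤ
  | .plus, m => m
  | .minus, m => 2 * n - 1 - m

/-- The position of a vector of a frame with respect to the filtration of the dual lattices. -/
def Side.position (n : ℕ) : Side → ℤ → ℤ
  | .plus, m => m - n
  | .minus, m => n - 1 - m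

/-- The inverse of `Side.position`. -/
def Side.unposition (n : ℕ) : Side → ℤ → ℤ
  | .plus, m => m + n
  | .minus, m => n - 1 - m

theorem Side.index_index (ε : Side) (m : ℤ) : ε.index n (ε.index n m) = m := by
  cases ε <;> simp [index]

theorem Side.position_unposition (ε : Side) (m : ℤ) : ε.position n (ε.unposition n m) = m := by
  cases ε <;> simp [position, unposition]

theorem Side.unposition_position (ε : Side) (m : ℤ) : ε.unposition n (ε.position n m) = m := by
  cases ε <;> simp [position, unposition]

theorem Side.mem_indices {l m : ℤ} : m ∈ ε.indices n (ε.sign * l) ↔ l ≤ ε.index n m := by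
  cases ε <;> simp only [indices, sign, index, Set.mem_ofPred_eq] <;> omega

theorem Side.mem_indices_flip {l m : ℤ} :
    m ∈ ε.flip.indices n l ↔ ε.position n m < ε.sign * l + n := by
  cases ε <;> simp only [indices, sign, position, flip, Set.mem_ofPred_eq] <;> omega

theorem Side.index_bijective (ε : Side) : Function.Bijective (ε.index n) :=
  Function.Involutive.bijective ε.index_index

theorem Side.periodic_unposition (ε : Side) {j : ℤ → ℤ} (hj : Periodic n j) :
    Periodic n fun m => ε.unposition n (j (ε.index n m)) := by
  intro m
  cases ε
  · simp only [unposition, index, hj m]; ring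
  · have := hj (2 * n - 1 - (m + 2 * n))
    rw [show 2 * (n : ℤ) - 1 - (m + 2 * n) + 2 * n = 2 * n - 1 - m by ring] at this
    simp only [unposition, index, this]; ring

theorem Side.periodic_position (ε : Side) {u : ℤ → ℤ} (hu : Periodic n u) :
    Periodic n fun m => ε.position n (u (ε.index n m)) := by
  intro m
  cases ε
  · simp only [position, index, hu m]; ring
  · have := hu (2 * n - 1 - (m + 2 * n))
    rw [show 2 * (n : ℤ) - 1 - (m + 2 * n) + 2 * n = 2 * n - 1 - m by ring] at this
    simp only [position, index, this]; ring

theorem Side.inv_position [NeZero n] (ε : Side) {u : ℤ → ℤ} (hu : Periodic n u) :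
    inv n (fun m => ε.position n (u (ε.index n m))) = inv n u := by
  cases ε
  · exact inv_add_const u (-n)
  · exact inv_reflect hu _ _

theorem displacement_reflect [NeZero n] {f : ℤ → ℤ} (hf : Periodic n f) (b c : ℤ) :
    displacement n (fun m => b - f (c - m)) = 2 * n * (b - c) - displacement n f := by
  let e : ZMod (2 * n) → ZMod (2 * n) := fun r => c - r
  have he : Function.Bijective e := (Equiv.subLeft (c : ZMod (2 * n))).bijective
  have h1 : ∀ r : ZMod (2 * n), b - f (c - r.val) - r.val =
      (b - c) - (f ((e r).val : ℤ) - ((e r).val : ℤ)) := by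
    intro r
    have := hf.sub_eq (a := ((e r).val : ℤ)) (b := c - (r.val : ℤ)) (by
      rw [val_intCast]; push_cast; simp [e])
    linarith
  rw [displacement, Finset.sum_congr rfl fun r _ => h1 r, Finset.sum_sub_distrib,
    he.sum_comp (fun r => f (r.val : ℤ) - (r.val : ℤ))]
  simp [displacement, ZMod.card]
  ring

/-- The displacement -2n² of j is compensated by the reindexing, which contains the shift by n of
`theta`. So the codistance lies in W. -/
theorem Side.displacement_unposition [NeZero n] (ε : Side) {j : ℤ → ℤ} (hj : IsTwist n j) :
    displacement n (fun m => ε.unposition n (j (ε.index n m))) = 0 := by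
  cases ε
  · have h := displacement_comp (f := fun m => m + (n : ℤ)) (g := hj.perm) (periodic_add _) hj.per
    have h2 := hj.displacement_eq
    simp only [IsTwist.perm_apply] at h
    change displacement n (fun m => j m + n) = 0
    rw [h, displacement_add]
    change _ + displacement n j = 0
    rw [h2]; ring
  · change displacement n (fun m => (n - 1 : ℤ) - j (2 * n - 1 - m)) = 0
    rw [displacement_reflect hj.per, hj.displacement_eq]; ring

/-- The element of the Weyl group that corresponds to the position of a frame. -/
theorem IsTwist.exists_weyl [NeZero n] (ε : Side) {j : ℤ → ℤ} (hj : IsTwist n j) :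
    ∃ w : W n, (∀ m, (w : Equiv.Perm ℤ).symm m = ε.unposition n (j (ε.index n m))) ∧
      length w = inv n j := by
  have hbij : Function.Bijective fun m => ε.unposition n (j (ε.index n m)) := by
    have h1 : Function.Bijective (ε.unposition n) :=
      ⟨Function.LeftInverse.injective ε.position_unposition,
        Function.RightInverse.surjective ε.unposition_position⟩
    exact h1.comp (hj.perm.bijective.comp ε.index_bijective)
  have hper := ε.periodic_unposition hj.per
  let u : Equiv.Perm ℤ := Equiv.ofBijective _ hbij
  have hu : u ∈ W n := mem_W_iff.2 ⟨hper, ε.displacement_unposition hj⟩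
  refine ⟨⟨u.symm, inv_mem hu⟩, fun m => rfl, ?_⟩
  rw [length_eq]
  change inv n u.symm = _
  rw [inv_symm (f := u) hper]
  have := ε.inv_position hper
  simp only [Side.index_index, Side.position_unposition] at this
  exact this.symm

section Frames

variable [NeZero n] {G : ℤ → Submodule k (LaurentVec k n)} {a : ℤ → LaurentVec k n} {j : ℤ → ℤ}

omit [NeZero n] in
theorem TwistedForm.Frame.isLaurentFrame (hf : (twistedForm k n ε).Frame n G a j)
    (hG : (twistedForm k n ε).Filt n G) : IsLaurentFrame fun m => a (ε.index n m) := by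
  refine ⟨fun m => ?_, ?_, ?_⟩
  · cases ε
    · exact hf.aper m
    · have h := hf.aper (2 * n - 1 - (m + 2 * n))
      rw [show 2 * (n : ℤ) - 1 - (m + 2 * n) + 2 * n = 2 * n - 1 - m by ring, twistedForm_T,
        shiftEquiv_apply] at h
      simp only [Side.index]
      rw [h, smul_smul, ← T_add]
      simp [Side.sign]
  · exact (hf.linearIndependent hG).comp _ ε.index_bijective.injective
  · rw [← hf.span]
    exact congrArg _ (ε.index_bijective.surjective.range_comp a)

theorem TwistedForm.Frame.chamberFilt_frameChamber (hf : (twistedForm k n ε).Frame n G a j)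
    (hG : (twistedForm k n ε).Filt n G) :
    chamberFilt (frameChamber ε fun m => incl (a (ε.index n m))) = G := by
  funext l
  rw [chamberFilt, (hf.isLaurentFrame hG).trace_frameChamber]
  apply le_antisymm
  · rw [Submodule.span_le]
    rintro _ ⟨m, hm, rfl⟩
    exact hG.antitone (Side.mem_indices.1 hm) (hf.mem _)
  · intro x hx
    refine hf.mem_of_coord hG fun m hm => Submodule.subset_span ⟨ε.index n m, ?_, ?_⟩
    · rw [Side.mem_indices, Side.index_index]
      by_contra hlt
      exact hm ((hf.mem_iff hG).1 hx m (not_le.1 hlt))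
    · simp only [Side.index_index]

/-- A filtration with a frame that agrees somewhere with a chamber comes from a chamber. -/
theorem TwistedForm.Frame.exists_chamber {c : Chain k n ε} (hc : IsChamber c)
    (hf : (twistedForm k n ε).Frame n G a j) (hG : (twistedForm k n ε).Filt n G)
    {l₀ : ℤ} (h₀ : G l₀ = chamberFilt c l₀) :
    IsChamber (frameChamber ε fun m => incl (a (ε.index n m))) ∧
      ∀ l, G l = chamberFilt c l →
        frameChamber ε (fun m => incl (a (ε.index n m))) (ε.sign * l) = c (ε.sign * l) := by
  have hL := hf.isLaurentFrame hG
  have h1 : ∀ l, G l = chamberFilt c l →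
      frameChamber ε (fun m => incl (a (ε.index n m))) (ε.sign * l) = c (ε.sign * l) := by
    intro l hl
    refine eq_of_trace_eq (frameChamber_eq_span _ _ _) (hc.isLarge _).eq_span ?_
    exact (congrFun (hf.chamberFilt_frameChamber hG) l).trans hl
  refine ⟨isChamber_frameChamber (l₀ := ε.sign * l₀) (fun m => ?_) ?_, h1⟩
  · rw [hL.period, incl_smul, toRat_T, zpow_one]
  · rw [h1 _ h₀]; exact hc.1 _

end Frames

section Codistance

variable [NeZero n] {c : Chain k n ε} (hc : IsChamber c)
include hc

/-- The basis of a twin apartment is a frame: c describes its membership in F, the image of c its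
membership in the orthogonal filtration, and the position is w⁻¹ up to reindexing. -/
theorem IsChamber.exists_frame_of_codistance {w : W n} (h : Codistance c (theta c) w) :
    ∃ a j, (twistedForm k n ε).Frame n (chamberFilt c) a j ∧ inv n j = length w := by
  obtain ⟨b, hb, h1, h2⟩ := h
  obtain ⟨a, ha, rfl⟩ := isFrame_iff.1 hb
  obtain ⟨hw, -⟩ := mem_W_iff.1 w.2
  have haw : IsLaurentFrame fun m => a ((w : Equiv.Perm ℤ) m) := by
    refine ⟨fun m => ?_, ha.linearIndependent.comp _ (w : Equiv.Perm ℤ).injective, ?_⟩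
    · rw [hw, ha.period]
    · rw [← ha.span]
      exact congrArg _ ((w : Equiv.Perm ℤ).surjective.range_comp a)
  have hmem : ∀ m l, a (ε.index n m) ∈ chamberFilt c l ↔ l ≤ m := by
    intro m l
    rw [mem_chamberFilt, h1, ha.mem_frameChamber, Side.mem_indices, Side.index_index]
  have hperp : ∀ m g, a (ε.index n m) ∈ (twistedForm k n ε).perp (chamberFilt c) g ↔
      ε.position n ((w : Equiv.Perm ℤ).symm (ε.index n m)) < g := by
    intro m g
    have hg : g = ε.sign * (ε.sign * (g - n)) + n := by rw [← mul_assoc, Side.sign_mul_sign]; ring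
    rw [hc.mem_perp hg, h2]
    have h3 := haw.mem_frameChamber ε.flip (l := ε.sign * (g - n))
      (q := (w : Equiv.Perm ℤ).symm (ε.index n m))
    rw [Equiv.apply_symm_apply] at h3
    rw [h3, Side.mem_indices_flip, ← hg]
  refine ⟨fun m => a (ε.index n m), fun m => ε.position n ((w : Equiv.Perm ℤ).symm (ε.index n m)),
    ⟨fun m => ?_, ε.periodic_position hw.symm, ?_, fun m => (hmem _ _).2 le_rfl,
      fun m h => ?_, fun m => (hperp _ _).2 (by omega), fun m h => ?_, ?_⟩, ?_⟩
  · rw [twistedForm_T, shiftEquiv_apply]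
    cases ε
    · exact ha.period m
    · have h := ha.period (2 * n - 1 - (m + 2 * n))
      rw [show 2 * (n : ℤ) - 1 - (m + 2 * n) + 2 * n = 2 * n - 1 - m by ring] at h
      simp only [Side.index, h]
      rw [smul_smul, ← T_add]
      simp [Side.sign]
  · have h3 : Function.Injective (ε.position n) :=
      Function.LeftInverse.injective ε.unposition_position
    exact h3.comp ((w : Equiv.Perm ℤ).symm.injective.comp ε.index_bijective.injective)
  · have := (hmem _ _).1 h; omega
  · have := (hperp _ _).1 h; omega
  · rw [← ha.span]
    exact congrArg _ (ε.index_bijective.surjective.range_comp a)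
  · rw [ε.inv_position hw.symm, inv_symm hw, length_eq]

/-- Conversely a frame of the filtration is the basis of a twin apartment; reordering it by the
permutation attached to j produces the lattices of `theta c`. -/
theorem IsChamber.exists_codistance_of_frame {a : ℤ → LaurentVec k n} {j : ℤ → ℤ}
    (hf : (twistedForm k n ε).Frame n (chamberFilt c) a j) :
    ∃ w : W n, Codistance c (theta c) w ∧ length w = inv n j := by
  obtain ⟨w, h1, h2⟩ := (hf.isTwist hc.filt).exists_weyl ε
  refine ⟨w, ⟨fun m => incl (a (ε.index n m)),
    isFrame_iff.2 ⟨_, hf.isLaurentFrame hc.filt, rfl⟩, ?_, ?_⟩, h2⟩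
  · funext l
    have := (hf.exists_chamber hc hc.filt (l₀ := 0) rfl).2 (ε.sign * l) rfl
    rw [← mul_assoc, Side.sign_mul_sign, one_mul] at this
    exact this.symm
  · have hL := hf.isLaurentFrame hc.filt
    obtain ⟨hw, -⟩ := mem_W_iff.1 w.2
    have hLw : IsLaurentFrame fun m => a (ε.index n ((w : Equiv.Perm ℤ) m)) := by
      refine ⟨fun m => ?_, hL.linearIndependent.comp _ (w : Equiv.Perm ℤ).injective, ?_⟩
      · rw [hw]; exact hL.period _
      · rw [← hL.span]
        exact congrArg _ ((w : Equiv.Perm ℤ).surjective.range_comp fun m => a (ε.index n m))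
    funext l
    refine eq_of_trace_eq (hc.isLarge_theta l).eq_span
      (frameChamber_eq_span (fun m => a (ε.index n ((w : Equiv.Perm ℤ) m))) _ _) ?_
    rw [hLw.trace_frameChamber]
    have hkey : ∀ q, (w : Equiv.Perm ℤ).symm q ∈ ε.flip.indices n l ↔
        j (ε.index n q) < ε.sign * l + n := by
      intro q
      rw [Side.mem_indices_flip, h1, Side.position_unposition]
    ext x
    rw [mem_trace, ← hc.mem_perp rfl]
    constructor
    · intro hx
      refine hf.mem_of_coord hc.filt fun m hm => Submodule.subset_span
        ⟨(w : Equiv.Perm ℤ).symm (ε.index n m), ?_, ?_⟩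
      · rw [hkey, Side.index_index]
        by_contra hlt
        exact hm ((hf.mem_perp_iff hc.filt).1 hx m (not_lt.1 hlt))
      · simp only [Equiv.apply_symm_apply, Side.index_index]
    · intro hx
      have h3 : Submodule.span k ((fun m => a (ε.index n ((w : Equiv.Perm ℤ) m))) ''
          ε.flip.indices n l) ≤ (twistedForm k n ε).perp (chamberFilt c) (ε.sign * l + n) := by
        rw [Submodule.span_le]
        rintro _ ⟨m, hm, rfl⟩
        have h4 := (hkey ((w : Equiv.Perm ℤ) m)).1 (by rwa [Equiv.symm_apply_apply])
        exact hc.filt.perp_mono h4 (hf.mem_perp _)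
      exact h3 hx

end Codistance

end AffineTwin

namespace AffineTwin

universe u

variable {k : Type u} [Field k] {n : ℕ} {ε : Side}

/-! ### The chamber systems `A_θ(R)` in terms of filtrations -/

/-- The effect of the reindexing of chains by filtrations on types. -/
def Side.type (n : ℕ) (ε : Side) (i : ZMod (2 * n)) : ZMod (2 * n) := (ε.sign : ZMod (2 * n)) * i

theorem Side.type_type (ε : Side) (i : ZMod (2 * n)) : ε.type n (ε.type n i) = i := by
  rw [type, type, ← mul_assoc, ← Int.cast_mul, sign_mul_sign, Int.cast_one, one_mul]

theorem Side.type_intCast (ε : Side) (l : ℤ) : ε.type n l = ((ε.sign * l : ℤ) : ZMod (2 * n)) := by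
  rw [type, Int.cast_mul]

section

variable {c d : Chain k n ε}

theorem eq_iff_agree (hc : IsChamber c) (hd : IsChamber d) {J J' : Set (ZMod (2 * n))}
    (hJ : ∀ i, ε.type n i ∈ J' ↔ i ∈ J) :
    (∀ l : ℤ, (l : ZMod (2 * n)) ∉ J → d l = c l) ↔
      TwistedForm.Agree J' (chamberFilt d) (chamberFilt c) := by
  constructor
  · intro h l hl
    rw [chamberFilt, chamberFilt, h]
    rwa [← Side.type_intCast, ← hJ, Side.type_type]
  · intro h l hl
    refine eq_of_trace_eq (hd.isLarge l).eq_span (hc.isLarge l).eq_span ?_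
    have := h (ε.sign * l) (by rwa [← Side.type_intCast, hJ])
    rw [chamberFilt, chamberFilt, ← mul_assoc, Side.sign_mul_sign, one_mul] at this
    exact this

theorem adj_iff_agree (hc : IsChamber c) (hd : IsChamber d) (i : ZMod (2 * n)) :
    Adj (ε.type n i) c d ↔ TwistedForm.Agree {i} (chamberFilt c) (chamberFilt d) := by
  rw [← eq_iff_agree hd hc (J := {ε.type n i})]
  · rfl
  · intro r
    simp only [Set.mem_singleton_iff]
    constructor
    · rintro rfl; rw [Side.type_type]
    · rintro rfl; rw [Side.type_type]

variable [NeZero n] {J J' : Set (ZMod (2 * n))} {c₀ : Chain k n ε}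

theorem exists_chamber_of_filt (hc₀ : IsChamber c₀) (hJ : ∀ i, ε.type n i ∈ J' ↔ i ∈ J)
    (hJ' : ∃ r, r ∉ J') {G : ℤ → Submodule k (LaurentVec k n)} {a : ℤ → LaurentVec k n} {j : ℤ → ℤ}
    (hG : (twistedForm k n ε).Filt n G) (hag : TwistedForm.Agree J' G (chamberFilt c₀))
    (hf : (twistedForm k n ε).Frame n G a j) : ∃ c ∈ residue J c₀, chamberFilt c = G := by
  obtain ⟨r, hr⟩ := hJ'
  obtain ⟨h1, h2⟩ := hf.exists_chamber hc₀ hG (hag (r.val : ℤ) (by rwa [val_intCast]))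
  refine ⟨_, ⟨h1, fun l hl => ?_⟩, hf.chamberFilt_frameChamber hG⟩
  have := h2 (ε.sign * l) (hag _ (by rwa [← Side.type_intCast, hJ]))
  rwa [← mul_assoc, Side.sign_mul_sign, one_mul] at this

/-- Codistances of chambers and positions of frames correspond in both directions, with equal
lengths, so `TwistedForm.Frame.minimal_iff` applies. Filtrations with frames that agree outside `J'`
come from chambers because they share a lattice with `c₀`. -/
theorem mem_A_iff (hc₀ : IsChamber c₀) (hJ : ∀ i, ε.type n i ∈ J' ↔ i ∈ J)
    (hJ' : ∃ r, r ∉ J') : c ∈ A (residue J c₀) ↔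
      IsChamber c ∧ chamberFilt c ∈ (twistedForm k n ε).geometry J' (chamberFilt c₀) := by
  constructor
  · rintro ⟨⟨hc, hcr⟩, w, hw, hmin⟩
    have hag := (eq_iff_agree hc₀ hc hJ).1 hcr
    obtain ⟨a, j, hf, hl⟩ := hc.exists_frame_of_codistance hw
    refine ⟨hc, hc.filt, hag, a, j, hf, (hf.minimal_iff hJ' hc.filt).1 ?_⟩
    intro F' a' j' hF' hag' hf'
    obtain ⟨d, hd, rfl⟩ := exists_chamber_of_filt hc₀ hJ hJ' hF' (hag'.trans hag) hf'
    obtain ⟨w', hw', hl'⟩ := hd.1.exists_codistance_of_frame hf'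
    rw [hl, ← hl']
    exact hmin d hd w' hw'
  · rintro ⟨hc, -, hag, a, j, hf, hj⟩
    obtain ⟨w, hw, hl⟩ := hc.exists_codistance_of_frame hf
    refine ⟨⟨hc, (eq_iff_agree hc₀ hc hJ).2 hag⟩, w, hw, fun d hd w' hw' => ?_⟩
    obtain ⟨a', j', hf', hl'⟩ := hd.1.exists_frame_of_codistance hw'
    rw [hl, ← hl']
    exact (hf.minimal_iff hJ' hc.filt).2 hj _ a' j' hd.1.filt
      (((eq_iff_agree hc₀ hd.1 hJ).1 hd.2).trans hag.symm) hf'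

/-- Coordinates of a geometry of filtrations are coordinates of `A_θ(R)`. -/
theorem isCoord_A (hc₀ : IsChamber c₀) (hJ : ∀ i, ε.type n i ∈ J' ↔ i ∈ J) (hJ' : ∃ r, r ∉ J')
    {U : Type*} [AddCommGroup U] {h i i' : ZMod (2 * n)} {B : Form k} {L R : k × k → AddSubgroup U}
    {pu : (ℤ → Submodule k (LaurentVec k n)) → U}
    {px py : (ℤ → Submodule k (LaurentVec k n)) → k × k}
    (hco : IsCoord (fun (r : ZMod (2 * n)) G G' => TwistedForm.Agree {r} G G')
      ((twistedForm k n ε).geometry J' (chamberFilt c₀)) h i i' B L R pu px py) :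
    IsCoord Adj (A (residue J c₀)) (ε.type n h) (ε.type n i) (ε.type n i') B L R
      (fun c => pu (chamberFilt c)) (fun c => px (chamberFilt c)) (fun c => py (chamberFilt c)) where
  form_ne := hco.form_ne
  good c hc := hco.good _ ((mem_A_iff hc₀ hJ hJ').1 hc).2
  surj u x y hxy := by
    obtain ⟨G, hG, h1⟩ := hco.surj u x y hxy
    obtain ⟨hGf, hag, a, j, hf, -⟩ := id hG
    obtain ⟨c, hc, rfl⟩ := exists_chamber_of_filt hc₀ hJ hJ' hGf hag hf
    exact ⟨c, (mem_A_iff hc₀ hJ hJ').2 ⟨hc.1, hG⟩, h1⟩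
  adj_h c hc d hd := by
    rw [adj_iff_agree hc.1.1 hd.1.1]
    exact hco.adj_h _ ((mem_A_iff hc₀ hJ hJ').1 hc).2 _ ((mem_A_iff hc₀ hJ hJ').1 hd).2
  adj_i c hc d hd := by
    rw [adj_iff_agree hc.1.1 hd.1.1]
    exact hco.adj_i _ ((mem_A_iff hc₀ hJ hJ').1 hc).2 _ ((mem_A_iff hc₀ hJ hJ').1 hd).2
  adj_i' c hc d hd := by
    rw [adj_iff_agree hc.1.1 hd.1.1]
    exact hco.adj_i' _ ((mem_A_iff hc₀ hJ hJ').1 hc).2 _ ((mem_A_iff hc₀ hJ hJ').1 hd).2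
  left_par := hco.left_par
  right_par := hco.right_par

theorem nonempty_A (hc₀ : IsChamber c₀) (hJ : ∀ i, ε.type n i ∈ J' ↔ i ∈ J) (hJ' : ∃ r, r ∉ J') :
    (A (residue J c₀)).Nonempty := by
  obtain ⟨a, j, hf⟩ := hc₀.filt.exists_frame
  obtain ⟨G, a', j', hG, hag, hf', hj', -⟩ := hf.exists_noInv J' hc₀.filt
  obtain ⟨c, hc, rfl⟩ := exists_chamber_of_filt hc₀ hJ hJ' hG hag hf'
  exact ⟨c, (mem_A_iff hc₀ hJ hJ').2 ⟨hc.1, hG, hag, a', j', hf', hj'⟩⟩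

end

end AffineTwin

open AffineTwin in
theorem mainTheorem9 {k : Type*} [Field k] (hk : 5 ≤ ENat.card k) (n : ℕ) (hn : 4 ≤ n)
    (ε : AffineTwin.Side) (J : Finset (ZMod (2 * n))) (hJ : J.card = 3)
    (c : AffineTwin.Chain k n ε) (hc : AffineTwin.IsChamber c) :
    ChamberSystem.IsConnected AffineTwin.Adj
      (AffineTwin.A (AffineTwin.residue (J : Set (ZMod (2 * n))) c)) (J : Set (ZMod (2 * n))) ∧
    ChamberSystem.IsSimplyConnected AffineTwin.Adj
      (AffineTwin.A (AffineTwin.residue (J : Set (ZMod (2 * n))) c))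
      (J : Set (ZMod (2 * n))) := by
  classical
  have : NeZero n := ⟨by omega⟩
  have hinj : Function.Injective (ε.type n) := Function.LeftInverse.injective ε.type_type
  have hJJ' : ∀ i, ε.type n i ∈ ((J.image (ε.type n) : Finset _) : Set (ZMod (2 * n))) ↔
      i ∈ (J : Set (ZMod (2 * n))) := fun i => by
    rw [Finset.mem_coe, Finset.mem_coe, hinj.mem_finset_image]
  have hcard : (J.image (ε.type n)).card = 3 := by rw [Finset.card_image_of_injective _ hinj, hJ]
  -- Three types do not exhaust the 2n ≥ 8 types.
  have hout : ∃ r, r ∉ ((J.image (ε.type n) : Finset _) : Set (ZMod (2 * n))) := by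
    by_contra! hcon
    have h1 : J.image (ε.type n) = Finset.univ := Finset.eq_univ_iff_forall.2 hcon
    rw [h1, Finset.card_univ, ZMod.card] at hcard
    omega
  obtain ⟨h, i, i', α, β, B, pu, px, py, hset, hhi, hhi', hii', hα, hβ, hco⟩ :=
    (twistedForm k n ε).exists_isCoord hn hcard hc.filt
  have hcoA := isCoord_A hc hJJ' hout hco
  have hJset : (J : Set (ZMod (2 * n))) = {ε.type n h, ε.type n i, ε.type n i'} := by
    ext r
    rw [← hJJ', hset]
    have h1 : ∀ q, ε.type n r = q ↔ r = ε.type n q := fun q => by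
      rw [← hinj.eq_iff (b := ε.type n q), ε.type_type]
    simp only [Set.mem_insert_iff, Set.mem_singleton_iff, h1]
  have hG := generates_colSub_rowSub hk hcoA.form_ne hα hβ
  have hE := extends_colSub_rowSub hk hcoA.form_ne hα hβ
  have hne := nonempty_A hc hJJ' hout
  rw [hJset] at hcoA hne ⊢
  have hconn := ChamberSystem.isConnected_of_locallyConstant hne (hcoA.connected hG)
  refine ⟨hconn, ChamberSystem.isSimplyConnected_of_cocycles (fun _ _ _ _ => rfl)
    (fun _ _ _ h l hl => (h l hl).symm) ?_ ⟨_, Set.mem_insert _ _⟩ hconn fun Γ _ e he =>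
      hcoA.exists_potential (hinj.ne hhi) (hinj.ne hhi') (hinj.ne hii') hG hE e he⟩
  rw [← hJset]
  intro r hr
  obtain ⟨q, hq, hqr⟩ := Finset.exists_mem_ne (show 1 < J.card by omega) r
  exact ⟨q, hq, hqr.symm⟩
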